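/- **Conventions.** A graded category is an additive $\mathbb C$-linear category with an autoequivalence $\langle 1\rangle$; $\langle k\rangle$ is its $k$-th power, and a map of degree $k$ from $A$ to $B$ is a map $A\to B\langle k\rangle$. For $n\ge 0$ put $\bigoplus_{[n]}A=\bigoplus_{k=0}^{n-1}A\langle n-1-2k\rangle$. A graded additive $\mathbb C$-linear 2-category $\mathcal K$ has graded additive $\mathbb C$-linear Hom categories and bilinear composition, which commutes coherently with $\langle k\rangle$ in each variable (the two identifications of $f\langle m\rangle g\langle n\rangle$ with $(fg)\langle m+n\rangle$ agree up to $\varepsilon^{mn}$ for a fixed sign $\varepsilon$). A *categorical 2-representation of $\mathfrak{sl}_2$* is a graded additive $\mathbb C$-linear 2-category $\mathcal K$ whose Hom categories are idempotent complete, have finite dimensional spaces of 2-morphisms, and satisfy $A\cong A\langle k\rangle\Rightarrow k=0$ for $A\neq0$, together with objects $\mathcal D(\lambda)$ ($\lambda\in\mathbb Z$, with identity 1-morphisms $\mathbf 1_\lambda$), 1-morphisms $\mathsf E^{(r)}\mathbf 1_\lambda:\mathcal D(\lambda)\to\mathcal D(\lambda+2r)$ and $\mathbf 1_\lambda\mathsf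 F^{(r)}:\mathcal D(\lambda+2r)\to\mathcal D(\lambda)$ for $r\ge 0$ (with $\mathsf E^{(0)}\mathbf 1_\lambda\cong\mathbf 1_\lambda\cong\mathbf 1_\lambda\mathsf F^{(0)}$, $\mathsf E=\mathsf E^{(1)}$, $\mathsf F=\mathsf F^{(1)}$) and 2-morphisms $\theta:\mathbf 1_\lambda\to\mathbf 1_\lambda\langle 2\rangle$, such that 1. for each $\lambda$ the objects $\mathcal D(\lambda\pm 2r)$ are zero for $r\gg 0$; 2. if $\mathcal D(\lambda)\ne0$, then $\operatorname{Hom}(\mathbf 1_\lambda,\mathbf 1_\lambda\langle k\rangle)$ is $0$ for $k<0$ and one-dimensional for $k=0$; 3. $\mathsf E^{(r)}\mathbf 1_\lambda$ has right adjoint $\mathbf 1_\lambda\mathsf F^{(r)}\langle r(\lambda+r)\rangle$ and left adjoint $\mathbf 1_\lambda\mathsf F^{(r)}\langle -r(\lambda+r)\rangle$; 4. $\mathsf F\mathsf E\mathbf 1_\lambda\cong\mathsf E\mathsf F\mathbf 1_\lambda\oplus\bigoplus_{[-\lambda]}\mathbf 1_\lambda$ if $\lambda\le 0$, and $\mathsf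 E\mathsf F\mathbf 1_\lambda\cong\mathsf F\mathsf E\mathbf 1_\lambda\oplus\bigoplus_{[\lambda]}\mathbf 1_\lambda$ if $\lambda\ge 0$; 5. $\mathsf E\mathsf E^{(r)}\cong\bigoplus_{[r+1]}\mathsf E^{(r+1)}\cong\mathsf E^{(r)}\mathsf E$ and $\mathsf F\mathsf F^{(r)}\cong\bigoplus_{[r+1]}\mathsf F^{(r+1)}\cong\mathsf F^{(r)}\mathsf F$ on every weight; 6. $I\theta I:\mathsf E\mathbf 1_\lambda\mathsf E\to\mathsf E\mathbf 1_\lambda\mathsf E\langle 2\rangle$ induces an isomorphism between the summands $\mathsf E^{(2)}\langle 1\rangle$ on either side. **Rickard complexes.** Let $\lambda,r\in\mathbb Z$ with $n=\lambda+r\ge 0$. Define complexes of 1-morphisms in $\mathcal K$ whose term of index $s\ge 0$ sits in cohomological degree $-s$ (and which vanish in positive degrees) by - $\mathbf 1_\lambda\tau_{\lambda+r}\mathbf 1_{-\lambda-2r}$: terms $\mathsf E^{(n+s)}\mathsf F^{(s)}\langle -s(r+1)\rangle$ if $r\ge 0$, and $\mathsf F^{(s)}\mathsf E^{(n+s)}\langle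 s(r-1)\rangle$ if $r\le 0$; - $\mathbf 1_{-\lambda}\tau'_{\lambda+r}\mathbf 1_{\lambda+2r}$: terms $\mathsf F^{(n+s)}\mathsf E^{(s)}\langle -s(r+1)\rangle$ if $r\ge 0$, and $\mathsf E^{(s)}\mathsf F^{(n+s)}\langle s(r-1)\rangle$ if $r\le 0$. The differential is the composition $\mathsf E^{(a+1)}\mathsf F^{(b+1)}\to\mathsf E^{(a)}\mathsf E\mathsf F\mathsf F^{(b)}\langle -a-b\rangle\to\mathsf E^{(a)}\mathsf F^{(b)}\langle c\rangle$, respectively $\mathsf F^{(b+1)}\mathsf E^{(a+1)}\to\mathsf F^{(b)}\mathsf F\mathsf E\mathsf E^{(a)}\langle -a-b\rangle\to\mathsf F^{(b)}\mathsf E^{(a)}\langle c\rangle$, of the inclusions into the lowest degree summands in (5) and of the counit of an adjunction in (3), regarded as a map of nonzero degree on $\mathsf E\mathsf F$, respectively $\mathsf F\mathsf E$. At $r=0$ either form is allowed. Write $\mathsf T\mathbf 1_\lambda$ for the complex $\tau_{-\lambda}\mathbf 1_\lambda$ with terms $\mathsf E^{(-\lambda+s)}\mathsf F^{(s)}\langle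 -s\rangle$ if $\lambda\le 0$, and for $\tau'_\lambda\mathbf 1_\lambda$ with terms $\mathsf F^{(\lambda+s)}\mathsf E^{(s)}\langle -s\rangle$ if $\lambda\ge 0$. Let $[1]$ be the cohomological shift, and let $\cong$ denote homotopy equivalence of complexes in the Hom categories of $\mathcal K$. **Proposition.** Let $\mathcal K$ be a categorical 2-representation of $\mathfrak{sl}_2$. These complexes exist (the differentials above can be chosen to square to zero), and for all choices of them and all $p\ge 0$: - $\tau_\lambda\mathbf 1_{-\lambda}\mathsf E^{(p)}\cong\tau_{\lambda+p}\mathbf 1_{-\lambda-2p}\langle -p(\lambda+p+1)\rangle[p]$ if $\lambda\ge 0$; - $\tau_\lambda\mathbf 1_{-\lambda}\mathsf F^{(p)}\cong\tau_{\lambda-p}\mathbf 1_{-\lambda+2p}$ if $\lambda-p\ge 0$; - $\mathsf E^{(p)}\tau_\lambda\mathbf 1_{-\lambda}\cong\tau_{\lambda+p}\mathbf 1_{-\lambda}\langle -p(\lambda+p+1)\rangle[p]$ if $\lambda\ge 0$; - $\mathsf F^{(p)}\tau_\lambda\mathbf 1_{-\lambda}\cong\tau_{\lambda-p}\mathbf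 1_{-\lambda}$ if $\lambda-p\ge 0$; - $\tau'_\lambda\mathbf 1_\lambda\mathsf E^{(p)}\cong\tau'_{\lambda-p}\mathbf 1_{\lambda-2p}$ if $\lambda-p\ge 0$; - $\tau'_\lambda\mathbf 1_\lambda\mathsf F^{(p)}\cong\tau'_{\lambda+p}\mathbf 1_{\lambda+2p}\langle -p(\lambda+p+1)\rangle[p]$ if $\lambda\ge 0$; - $\mathsf E^{(p)}\tau'_\lambda\mathbf 1_\lambda\cong\tau'_{\lambda-p}\mathbf 1_\lambda$ if $\lambda-p\ge 0$; - $\mathsf F^{(p)}\tau'_\lambda\mathbf 1_\lambda\cong\tau'_{\lambda+p}\mathbf 1_\lambda\langle -p(\lambda+p+1)\rangle[p]$ if $\lambda\ge 0$. Consequently, for all $p\ge 0$: - $\mathsf T\mathbf 1_\lambda\mathsf F^{(p)}\cong\mathbf 1_{-\lambda}\mathsf E^{(p)}\mathsf T\langle -p(\lambda+p+1)\rangle[p]$ if $\lambda\ge 0$; - $\mathsf T\mathbf 1_\lambda\mathsf E^{(p)}\cong\mathbf 1_{-\lambda}\mathsf F^{(p)}\mathsf T\langle -p(-\lambda+p+1)\rangle[p]$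 if $\lambda\le 0$; - $\mathsf T\mathbf 1_\lambda\mathsf E^{(\lambda)}\cong\mathbf 1_{-\lambda}\mathsf F^{(\lambda)}\mathsf T$ if $\lambda\ge 0$; - $\mathsf T\mathbf 1_\lambda\mathsf F^{(-\lambda)}\cong\mathbf 1_{-\lambda}\mathsf E^{(-\lambda)}\mathsf T$ if $\lambda\le 0$. -/

import Mathlib

open CategoryTheory CategoryTheory.Limits
open scoped Bicategory

universe w v u

/-! ### Graded additive `ℂ`-linear bicategories -/

/-- An additive `ℂ`-linear bicategory: the Hom categories are additive and `ℂ`-linear, and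
horizontal composition is bilinear on 2-morphisms. -/
class AdditiveLinearBicategory (B : Type u) [Bicategory.{w, v} B] where
  preadditive (a b : B) : Preadditive (a ⟶ b)
  linear (a b : B) : Linear ℂ (a ⟶ b)
  hasFiniteBiproducts (a b : B) : HasFiniteBiproducts (a ⟶ b)
  whiskerLeft_add {a b c : B} (f : a ⟶ b) {g h : b ⟶ c} (η θ : g ⟶ h) :
    f ◁ (η + θ) = f ◁ η + f ◁ θ
  add_whiskerRight {a b c : B} {f g : a ⟶ b} (η θ : f ⟶ g) (h : b ⟶ c) :
    (η + θ) ▷ h = η ▷ h + θ ▷ h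
  whiskerLeft_smul {a b c : B} (f : a ⟶ b) {g h : b ⟶ c} (z : ℂ) (η : g ⟶ h) :
    f ◁ (z • η) = z • (f ◁ η)
  smul_whiskerRight {a b c : B} {f g : a ⟶ b} (z : ℂ) (η : f ⟶ g) (h : b ⟶ c) :
    (z • η) ▷ h = z • (η ▷ h)

attribute [reducible] AdditiveLinearBicategory.preadditive AdditiveLinearBicategory.linear

attribute [instance] AdditiveLinearBicategory.preadditive AdditiveLinearBicategory.linear
  AdditiveLinearBicategory.hasFiniteBiproducts

instance {B : Type u} [Bicategory.{w, v} B] [AdditiveLinearBicategory B] (a b : B) :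
    HasBinaryBiproducts (a ⟶ b) :=
  hasBinaryBiproducts_of_finite_biproducts _

instance {B : Type u} [Bicategory.{w, v} B] [AdditiveLinearBicategory B] {a b : B}
    (c : B) (f : a ⟶ b) : (Bicategory.precomp c f).Additive where
  map_add := AdditiveLinearBicategory.whiskerLeft_add f _ _

instance {B : Type u} [Bicategory.{w, v} B] [AdditiveLinearBicategory B] {b c : B}
    (a : B) (f : b ⟶ c) : (Bicategory.postcomp a f).Additive where
  map_add := AdditiveLinearBicategory.add_whiskerRight _ _ f

/-- A graded additive `ℂ`-linear bicategory: every Hom category carries a grading shift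
`f ↦ f⟦n⟧` (written `f⟨n⟩` on paper), and composition commutes with the shift in each variable,
coherently with the structure of a bicategory.

The two ways of moving `⟦m⟧` and `⟦n⟧` out of `f⟦m⟧ ≫ g⟦n⟧` agree up to `ε ^ (m * n)` for a fixed
sign `ε`. (`ε = 1` is the plain case; `ε = -1` occurs when the grading shift involves the
translation of a triangulated category, for instance for Fourier–Mukai kernels.) -/
class GradedLinearBicategory (B : Type u) [Bicategory.{w, v} B] extends
    AdditiveLinearBicategory B where
  hasShift (a b : B) : HasShift (a ⟶ b) ℤ
  shift_additive (a b : B) (n : ℤ) : (shiftFunctor (a ⟶ b) n).Additive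
  shift_linear (a b : B) (n : ℤ) : (shiftFunctor (a ⟶ b) n).Linear ℂ
  /-- `f ≫ g⟦n⟧ ≅ (f ≫ g)⟦n⟧`, natural in `g` and compatible with sums of shifts -/
  commShiftLeft {a b : B} (c : B) (f : a ⟶ b) : (Bicategory.precomp c f).CommShift ℤ
  /-- `f⟦n⟧ ≫ g ≅ (f ≫ g)⟦n⟧`, natural in `f` and compatible with sums of shifts -/
  commShiftRight (a : B) {b c : B} (g : b ⟶ c) : (Bicategory.postcomp a g).CommShift ℤ
  /-- naturality of `f ≫ g⟦n⟧ ≅ (f ≫ g)⟦n⟧` in `f` -/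
  left_naturality {a b c : B} {f f' : a ⟶ b} (η : f ⟶ f') (g : b ⟶ c) (n : ℤ) :
    η ▷ (g⟦n⟧) ≫ ((Bicategory.precomp c f').commShiftIso n).hom.app g =
      ((Bicategory.precomp c f).commShiftIso n).hom.app g ≫ (η ▷ g)⟦n⟧'
  /-- naturality of `f⟦n⟧ ≫ g ≅ (f ≫ g)⟦n⟧` in `g` -/
  right_naturality {a b c : B} (f : a ⟶ b) {g g' : b ⟶ c} (η : g ⟶ g') (n : ℤ) :
    (f⟦n⟧) ◁ η ≫ ((Bicategory.postcomp a g').commShiftIso n).hom.app f =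
      ((Bicategory.postcomp a g).commShiftIso n).hom.app f ≫ (f ◁ η)⟦n⟧'
  left_unitor {a b : B} (g : a ⟶ b) (n : ℤ) :
    ((Bicategory.precomp b (𝟙 a)).commShiftIso n).hom.app g ≫ (λ_ g).hom⟦n⟧' = (λ_ (g⟦n⟧)).hom
  right_unitor {a b : B} (f : a ⟶ b) (n : ℤ) :
    ((Bicategory.postcomp a (𝟙 b)).commShiftIso n).hom.app f ≫ (ρ_ f).hom⟦n⟧' = (ρ_ (f⟦n⟧)).hom
  associator_left {a b c d : B} (f : a ⟶ b) (g : b ⟶ c) (h : c ⟶ d) (n : ℤ) :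
    ((Bicategory.precomp d (f ≫ g)).commShiftIso n).hom.app h ≫ (α_ f g h).hom⟦n⟧' =
      (α_ f g (h⟦n⟧)).hom ≫ f ◁ ((Bicategory.precomp d g).commShiftIso n).hom.app h ≫
        ((Bicategory.precomp d f).commShiftIso n).hom.app (g ≫ h)
  associator_middle {a b c d : B} (f : a ⟶ b) (g : b ⟶ c) (h : c ⟶ d) (n : ℤ) :
    ((Bicategory.precomp c f).commShiftIso n).hom.app g ▷ h ≫
        ((Bicategory.postcomp a h).commShiftIso n).hom.app (f ≫ g) ≫ (α_ f g h).hom⟦n⟧' =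
      (α_ f (g⟦n⟧) h).hom ≫ f ◁ ((Bicategory.postcomp b h).commShiftIso n).hom.app g ≫
        ((Bicategory.precomp d f).commShiftIso n).hom.app (g ≫ h)
  associator_right {a b c d : B} (f : a ⟶ b) (g : b ⟶ c) (h : c ⟶ d) (n : ℤ) :
    ((Bicategory.postcomp a g).commShiftIso n).hom.app f ▷ h ≫
        ((Bicategory.postcomp a h).commShiftIso n).hom.app (f ≫ g) ≫ (α_ f g h).hom⟦n⟧' =
      (α_ (f⟦n⟧) g h).hom ≫ ((Bicategory.postcomp a (g ≫ h)).commShiftIso n).hom.app f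
  /-- the sign `ε` -/
  sign : ℤˣ
  interchange {a b c : B} (f : a ⟶ b) (g : b ⟶ c) (m n : ℤ) :
    ((Bicategory.precomp c (f⟦m⟧)).commShiftIso n).hom.app g ≫
        (((Bicategory.postcomp a g).commShiftIso m).hom.app f)⟦n⟧' =
      sign ^ (m * n) •
        (((Bicategory.postcomp a (g⟦n⟧)).commShiftIso m).hom.app f ≫
          (((Bicategory.precomp c f).commShiftIso n).hom.app g)⟦m⟧' ≫
            (shiftComm (f ≫ g) n m).hom)

attribute [reducible] GradedLinearBicategory.hasShift
  GradedLinearBicategory.commShiftLeft GradedLinearBicategory.commShiftRight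

attribute [instance] GradedLinearBicategory.hasShift GradedLinearBicategory.shift_additive
  GradedLinearBicategory.shift_linear GradedLinearBicategory.commShiftLeft
  GradedLinearBicategory.commShiftRight

/-! ### Degree `n` morphisms in a graded category

A morphism of degree `n` from `X` to `Y` is a morphism `X ⟶ Y⟦n⟧`, that is a
`ShiftedHom X Y n`. -/

section GradedCategory

variable {C : Type u} [Category.{v} C] [Preadditive C] [HasFiniteBiproducts C] [HasShift C ℤ]

/-- The direct sum of copies of `X` indexed by the quantum integer
`[n] = q^(n-1) + q^(n-3) + ⋯ + q^(1-n)`, namely `⨁_{k=0}^{n-1} X⟨n-1-2k⟩`. -/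
noncomputable def quantumSum (n : ℕ) (X : C) : C :=
  ⨁ fun k : Fin n => X⟦(n : ℤ) - 1 - 2 * ((k : ℕ) : ℤ)⟧

/-- `ι : X ⟶ Y⟨-m⟩` is an inclusion into the lowest degree summand: for some isomorphism
`Y ≅ ⨁_{[m+1]} X`, it is the `⟨-m⟩`-shift of the inclusion of the summand `X⟨m⟩` of `Y`. -/
def IsLowestInclusion (m : ℕ) {X Y : C} (ι : ShiftedHom X Y (-(m : ℤ))) : Prop :=
  ∃ φ : Y ≅ quantumSum (m + 1) X,
    ι = (shiftFunctorCompIsoId C (((m + 1 : ℕ) : ℤ) - 1 - 2 * (((0 : Fin (m + 1)) : ℕ) : ℤ))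
          (-(m : ℤ)) (by simp)).inv.app X ≫
        (biproduct.ι (fun k : Fin (m + 1) => X⟦((m + 1 : ℕ) : ℤ) - 1 - 2 * ((k : ℕ) : ℤ)⟧) 0 ≫
          φ.inv)⟦-(m : ℤ)⟧'

/-- The morphism `X⟨i⟩ ⟶ Y⟨j⟩` induced by a morphism of degree `n` from `X` to `Y`,
where `j = n + i`. -/
noncomputable def ShiftedHom.shiftedMap {X Y : C} {n : ℤ} (δ : ShiftedHom X Y n) (i j : ℤ)
    (h : n + i = j) : X⟦i⟧ ⟶ Y⟦j⟧ :=
  δ⟦i⟧' ≫ (shiftFunctorAdd' C n i j h).inv.app Y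

end GradedCategory

section GradedBicategory

variable {B : Type u} [Bicategory.{w, v} B] [GradedLinearBicategory B]

/-- Left whiskering of a 2-morphism of degree `n`. -/
noncomputable def gradedWhiskerLeft {a b c : B} (f : a ⟶ b) {g h : b ⟶ c} {n : ℤ}
    (η : ShiftedHom g h n) : ShiftedHom (f ≫ g) (f ≫ h) n :=
  f ◁ η ≫ ((Bicategory.precomp c f).commShiftIso n).hom.app h

/-- Right whiskering of a 2-morphism of degree `n`. -/
noncomputable def gradedWhiskerRight {a b c : B} {f g : a ⟶ b} {n : ℤ}
    (η : ShiftedHom f g n) (h : b ⟶ c) : ShiftedHom (f ≫ h) (g ≫ h) n :=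
  η ▷ h ≫ ((Bicategory.postcomp a h).commShiftIso n).hom.app g

/-- The counit of an adjunction `f ⊣ g⟨n⟩`, as a 2-morphism `f ∘ g ⟶ 𝟙` of degree `-n`. -/
noncomputable def counitOfRightShift {a b : B} {f : a ⟶ b} {g : b ⟶ a} {n : ℤ}
    (adj : f ⊣ g⟦n⟧) : ShiftedHom (g ≫ f) (𝟙 b) (-n) :=
  (shiftFunctorCompIsoId (b ⟶ b) n (-n) (add_neg_cancel n)).inv.app (g ≫ f) ≫
    (((Bicategory.postcomp b f).commShiftIso n).inv.app g ≫ adj.counit)⟦-n⟧'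

/-- The counit of an adjunction `f⟨n⟩ ⊣ g`, as a 2-morphism `f ∘ g ⟶ 𝟙` of degree `-n`. -/
noncomputable def counitOfLeftShift {a b : B} {f : a ⟶ b} {g : b ⟶ a} {n : ℤ}
    (adj : f⟦n⟧ ⊣ g) : ShiftedHom (g ≫ f) (𝟙 b) (-n) :=
  (shiftFunctorCompIsoId (b ⟶ b) n (-n) (add_neg_cancel n)).inv.app (g ≫ f) ≫
    (((Bicategory.precomp b g).commShiftIso n).inv.app f ≫ adj.counit)⟦-n⟧'

/-- The composition
`Y' ∘ X' ⟶ (Y ∘ y) ∘ (x ∘ X) ≅ Y ∘ (y ∘ x) ∘ X ⟶ Y ∘ X`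
of `ι₁ : X' ⟶ x ∘ X`, `ι₂ : Y' ⟶ Y ∘ y` and `κ : y ∘ x ⟶ 𝟙`, of degrees `i`, `j` and `k`. -/
noncomputable def splitAndContract {p q r : B} {m : B} {X' : p ⟶ q} {X : p ⟶ m} {x : m ⟶ q}
    {Y' : q ⟶ r} {y : q ⟶ m} {Y : m ⟶ r} {i j k n : ℤ}
    (ι₁ : ShiftedHom X' (X ≫ x) i) (ι₂ : ShiftedHom Y' (y ≫ Y) j)
    (κ : ShiftedHom (x ≫ y) (𝟙 m) k) (h : k + (j + i) = n) :
    ShiftedHom (X' ≫ Y') (X ≫ Y) n :=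
  ((gradedWhiskerRight ι₁ Y').comp (gradedWhiskerLeft (X ≫ x) ι₂) rfl).comp
    (((α_ X x (y ≫ Y)).hom ≫ X ◁ (α_ x y Y).inv) ≫
      gradedWhiskerLeft X (gradedWhiskerRight κ Y) ≫ (X ◁ (λ_ Y).hom)⟦k⟧') h

end GradedBicategory

/-! ### Categorical 2-representations of `sl₂` -/

/-- A categorical 2-representation of `sl₂` on a graded additive `ℂ`-linear bicategory `B`.
The weight lattice is `ℤ`, with simple root `2`. In `B`, `f ≫ g` is the composition `g ∘ f`. -/
structure CategoricalSl2Rep (B : Type u) [Bicategory.{w, v} B] [GradedLinearBicategory B] where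
  /-- the weight objects -/
  wt : ℤ → B
  /-- `E r h` is the divided power `E^(r) : wt l ⟶ wt (l + 2r)` -/
  E (r : ℕ) {l m : ℤ} (h : m = l + 2 * (r : ℤ)) : wt l ⟶ wt m
  /-- `F r h` is the divided power `F^(r) : wt (l + 2r) ⟶ wt l` -/
  F (r : ℕ) {l m : ℤ} (h : m = l + 2 * (r : ℤ)) : wt m ⟶ wt l
  /-- the 2-morphism `θ : 𝟙 ⟶ 𝟙⟨2⟩` -/
  θ (l : ℤ) : 𝟙 (wt l) ⟶ (𝟙 (wt l))⟦(2 : ℤ)⟧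
  idempotent_complete (a b : B) : IsIdempotentComplete (a ⟶ b)
  finite_dimensional {a b : B} (f g : a ⟶ b) : FiniteDimensional ℂ (f ⟶ g)
  /-- nonzero 1-morphisms are not isomorphic to proper shifts of themselves -/
  aperiodic {a b : B} (f : a ⟶ b) (hf : ¬ IsZero f) (k : ℤ) (e : Nonempty (f ≅ f⟦k⟧)) : k = 0
  /-- the object `wt (l ± 2r)` is zero for large `r` -/
  integrable (l : ℤ) : ∃ N : ℕ, ∀ r : ℕ, N ≤ r →
    IsZero (𝟙 (wt (l + 2 * (r : ℤ)))) ∧ IsZero (𝟙 (wt (l - 2 * (r : ℤ))))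
  end_neg (l : ℤ) (hl : ¬ IsZero (𝟙 (wt l))) (k : ℤ) (hk : k < 0)
    (η : 𝟙 (wt l) ⟶ (𝟙 (wt l))⟦k⟧) : η = 0
  end_zero (l : ℤ) (hl : ¬ IsZero (𝟙 (wt l))) : Module.finrank ℂ (𝟙 (wt l) ⟶ 𝟙 (wt l)) = 1
  E_zero (l : ℤ) (h : l = l + 2 * ((0 : ℕ) : ℤ)) : Nonempty (E 0 h ≅ 𝟙 (wt l))
  F_zero (l : ℤ) (h : l = l + 2 * ((0 : ℕ) : ℤ)) : Nonempty (F 0 h ≅ 𝟙 (wt l))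
  /-- the right adjoint of `E^(r) 1_l` is `1_l F^(r) ⟨r(l+r)⟩` -/
  adj_right (r : ℕ) {l m : ℤ} (h : m = l + 2 * (r : ℤ)) :
    Nonempty (E r h ⊣ (F r h)⟦(r : ℤ) * (l + (r : ℤ))⟧)
  /-- the left adjoint of `E^(r) 1_l` is `1_l F^(r) ⟨-r(l+r)⟩` -/
  adj_left (r : ℕ) {l m : ℤ} (h : m = l + 2 * (r : ℤ)) :
    Nonempty ((F r h)⟦-((r : ℤ) * (l + (r : ℤ)))⟧ ⊣ E r h)
  /-- `F E 1_l ≅ E F 1_l ⊕ ⨁_{[-l]} 1_l` for `l ≤ 0` -/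
  FE_iso {k l m : ℤ} (h : l = k + 2 * ((1 : ℕ) : ℤ)) (h' : m = l + 2 * ((1 : ℕ) : ℤ))
    (hl : l ≤ 0) :
    Nonempty (E 1 h' ≫ F 1 h' ≅ (F 1 h ≫ E 1 h) ⊞ quantumSum (-l).toNat (𝟙 (wt l)))
  /-- `E F 1_l ≅ F E 1_l ⊕ ⨁_{[l]} 1_l` for `l ≥ 0` -/
  EF_iso {k l m : ℤ} (h : l = k + 2 * ((1 : ℕ) : ℤ)) (h' : m = l + 2 * ((1 : ℕ) : ℤ))
    (hl : 0 ≤ l) :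
    Nonempty (F 1 h ≫ E 1 h ≅ (E 1 h' ≫ F 1 h') ⊞ quantumSum l.toNat (𝟙 (wt l)))
  /-- `E E^(r) ≅ ⨁_{[r+1]} E^(r+1)` -/
  E_E_pow (r : ℕ) {l m k : ℤ} (h : m = l + 2 * (r : ℤ)) (h' : k = m + 2 * ((1 : ℕ) : ℤ))
    (h'' : k = l + 2 * ((r + 1 : ℕ) : ℤ)) :
    Nonempty (E r h ≫ E 1 h' ≅ quantumSum (r + 1) (E (r + 1) h''))
  /-- `E^(r) E ≅ ⨁_{[r+1]} E^(r+1)` -/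
  E_pow_E (r : ℕ) {l m k : ℤ} (h : m = l + 2 * ((1 : ℕ) : ℤ)) (h' : k = m + 2 * (r : ℤ))
    (h'' : k = l + 2 * ((r + 1 : ℕ) : ℤ)) :
    Nonempty (E 1 h ≫ E r h' ≅ quantumSum (r + 1) (E (r + 1) h''))
  /-- `F F^(r) ≅ ⨁_{[r+1]} F^(r+1)` -/
  F_F_pow (r : ℕ) {l m k : ℤ} (h : m = l + 2 * ((1 : ℕ) : ℤ)) (h' : k = m + 2 * (r : ℤ))
    (h'' : k = l + 2 * ((r + 1 : ℕ) : ℤ)) :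
    Nonempty (F r h' ≫ F 1 h ≅ quantumSum (r + 1) (F (r + 1) h''))
  /-- `F^(r) F ≅ ⨁_{[r+1]} F^(r+1)` -/
  F_pow_F (r : ℕ) {l m k : ℤ} (h : m = l + 2 * (r : ℤ)) (h' : k = m + 2 * ((1 : ℕ) : ℤ))
    (h'' : k = l + 2 * ((r + 1 : ℕ) : ℤ)) :
    Nonempty (F 1 h' ≫ F r h ≅ quantumSum (r + 1) (F (r + 1) h''))
  /-- With respect to a decomposition `E E ≅ E^(2)⟨1⟩ ⊕ E^(2)⟨-1⟩`, the map
  `I θ I : E 1_l E ⟶ E 1_l E ⟨2⟩` induces an isomorphism from the summand `E^(2)⟨1⟩` of the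
  source to the summand `E^(2)⟨-1⟩⟨2⟩` of the target. -/
  θ_iso {k l m : ℤ} (h : l = k + 2 * ((1 : ℕ) : ℤ)) (h' : m = l + 2 * ((1 : ℕ) : ℤ))
    (h'' : m = k + 2 * ((2 : ℕ) : ℤ)) :
    ∃ φ : E 1 h ≫ E 1 h' ≅ quantumSum 2 (E 2 h''),
      IsIso
        (biproduct.ι (fun j : Fin 2 => (E 2 h'')⟦((2 : ℕ) : ℤ) - 1 - 2 * ((j : ℕ) : ℤ)⟧) 0 ≫
          φ.inv ≫
          E 1 h ◁ (λ_ (E 1 h')).inv ≫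
          gradedWhiskerLeft (E 1 h) (gradedWhiskerRight (θ l) (E 1 h')) ≫
          (E 1 h ◁ (λ_ (E 1 h')).hom)⟦(2 : ℤ)⟧' ≫
          (φ.hom ≫
            biproduct.π (fun j : Fin 2 => (E 2 h'')⟦((2 : ℕ) : ℤ) - 1 - 2 * ((j : ℕ) : ℤ)⟧)
              1)⟦(2 : ℤ)⟧')

/-! ### Rickard complexes -/

section Complexes

variable {B : Type u} [Bicategory.{w, v} B] [GradedLinearBicategory B]

/-- The complex `C ∘ f`. -/
noncomputable def compBefore {a b c : B} (C : CochainComplex (b ⟶ c) ℤ) (f : a ⟶ b) :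
    CochainComplex (a ⟶ c) ℤ :=
  ((Bicategory.precomp c f).mapHomologicalComplex _).obj C

/-- The complex `f ∘ C`. -/
noncomputable def compAfter {a b c : B} (f : b ⟶ c) (C : CochainComplex (a ⟶ b) ℤ) :
    CochainComplex (a ⟶ c) ℤ :=
  ((Bicategory.postcomp a f).mapHomologicalComplex _).obj C

/-- The complex `C⟨k⟩[p]`: internal grading shift by `k`, cohomological shift by `p`. -/
noncomputable def bishift {a b : B} (C : CochainComplex (a ⟶ b) ℤ) (k p : ℤ) :
    CochainComplex (a ⟶ b) ℤ :=
  (((shiftFunctor (a ⟶ b) k).mapHomologicalComplex _).obj C)⟦p⟧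

/-- Isomorphism of complexes in the homotopy category. -/
def HtpyIso {a b : B} (C C' : CochainComplex (a ⟶ b) ℤ) : Prop :=
  Nonempty (HomotopyEquiv C C')

namespace CategoricalSl2Rep

variable (R : CategoricalSl2Rep B)

/-- The 1-morphism `E^(a) F^(b)` from weight `x` to weight `y`. -/
def EF (a b : ℕ) {x y : ℤ} (hy : y = x + 2 * (a : ℤ) - 2 * (b : ℤ)) : R.wt x ⟶ R.wt y :=
  R.F b (l := x - 2 * (b : ℤ)) (by omega) ≫ R.E a (by omega)

/-- The 1-morphism `F^(b) E^(a)` from weight `x` to weight `y`. -/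
def FE (a b : ℕ) {x y : ℤ} (hy : y = x + 2 * (a : ℤ) - 2 * (b : ℤ)) : R.wt x ⟶ R.wt y :=
  R.E a (m := x + 2 * (a : ℤ)) (by omega) ≫ R.F b (by omega)

/-- `δ : E^(a+1) F^(b+1) ⟶ E^(a) F^(b) ⟨c⟩` is a composition
`E^(a+1) F^(b+1) ⟶ E^(a) E F F^(b) ⟨-a-b⟩ ⟶ E^(a) F^(b) ⟨c⟩` of inclusions into the lowest degree
summands and of the counit `E F = E E_R ⟨-(l+1)⟩ ⟶ 𝟙 ⟨-(l+1)⟩`, where `E` starts at weight `l`. -/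
def IsEFDifferential (a b : ℕ) {x y : ℤ} (hy : y = x + 2 * (a : ℤ) - 2 * (b : ℤ))
    (hy' : y = x + 2 * ((a + 1 : ℕ) : ℤ) - 2 * ((b + 1 : ℕ) : ℤ))
    {c : ℤ} (hc : c = 1 - (a : ℤ) + (b : ℤ) - x)
    (δ : ShiftedHom (R.EF (a + 1) (b + 1) hy') (R.EF a b hy) c) : Prop :=
  ∃ (ιF : ShiftedHom (R.F (b + 1) (l := x - 2 * ((b + 1 : ℕ) : ℤ)) (m := x) (by omega))
        (R.F b (l := x - 2 * (b : ℤ)) (by omega) ≫ R.F 1 (by omega)) (-(b : ℤ)))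
    (ιE : ShiftedHom (R.E (a + 1) (l := x - 2 * ((b + 1 : ℕ) : ℤ)) (m := y) (by omega))
        (R.E 1 (m := x - 2 * (b : ℤ)) (by omega) ≫ R.E a (by omega)) (-(a : ℤ)))
    (adj : R.E 1 (l := x - 2 * ((b + 1 : ℕ) : ℤ)) (m := x - 2 * (b : ℤ)) (by omega) ⊣
        (R.F 1 (by omega))⟦((1 : ℕ) : ℤ) * (x - 2 * ((b + 1 : ℕ) : ℤ) + ((1 : ℕ) : ℤ))⟧),
    IsLowestInclusion b ιF ∧ IsLowestInclusion a ιE ∧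
      δ = splitAndContract ιF ιE (counitOfRightShift adj) (by push_cast; omega)

/-- `δ : F^(b+1) E^(a+1) ⟶ F^(b) E^(a) ⟨c⟩` is a composition
`F^(b+1) E^(a+1) ⟶ F^(b) F E E^(a) ⟨-a-b⟩ ⟶ F^(b) E^(a) ⟨c⟩` of inclusions into the lowest degree
summands and of the counit `F E = E_L ⟨l+1⟩ E ⟶ 𝟙 ⟨l+1⟩`, where `E` starts at weight `l`. -/
def IsFEDifferential (a b : ℕ) {x y : ℤ} (hy : y = x + 2 * (a : ℤ) - 2 * (b : ℤ))
    (hy' : y = x + 2 * ((a + 1 : ℕ) : ℤ) - 2 * ((b + 1 : ℕ) : ℤ))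
    {c : ℤ} (hc : c = 1 + (a : ℤ) - (b : ℤ) + x)
    (δ : ShiftedHom (R.FE (a + 1) (b + 1) hy') (R.FE a b hy) c) : Prop :=
  ∃ (ιE : ShiftedHom (R.E (a + 1) (l := x) (m := x + 2 * ((a + 1 : ℕ) : ℤ)) (by omega))
        (R.E a (m := x + 2 * (a : ℤ)) (by omega) ≫ R.E 1 (by omega)) (-(a : ℤ)))
    (ιF : ShiftedHom (R.F (b + 1) (l := y) (m := x + 2 * ((a + 1 : ℕ) : ℤ)) (by omega))
        (R.F 1 (l := x + 2 * (a : ℤ)) (by omega) ≫ R.F b (by omega)) (-(b : ℤ)))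
    (adj : (R.F 1 (l := x + 2 * (a : ℤ)) (m := x + 2 * ((a + 1 : ℕ) : ℤ)) (by omega))⟦
          -(((1 : ℕ) : ℤ) * (x + 2 * (a : ℤ) + ((1 : ℕ) : ℤ)))⟧ ⊣ R.E 1 (by omega)),
    IsLowestInclusion a ιE ∧ IsLowestInclusion b ιF ∧
      δ = splitAndContract ιE ιF (counitOfLeftShift adj) (by push_cast; omega)

/-- `C` is a complex of the form
`⋯ ⟶ E^(a+s) F^(b+s) ⟨-sc⟩ ⟶ E^(a+s-1) F^(b+s-1) ⟨-(s-1)c⟩ ⟶ ⋯ ⟶ E^(a) F^(b)`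
of 1-morphisms from weight `x` to weight `y`, with the term of index `s` in cohomological degree
`-s` and with differentials the maps above. -/
def IsEFComplex (a b : ℕ) (c : ℤ) {x y : ℤ} (hy : y = x + 2 * (a : ℤ) - 2 * (b : ℤ))
    (hc : c = 1 - (a : ℤ) + (b : ℤ) - x) (C : CochainComplex (R.wt x ⟶ R.wt y) ℤ) : Prop :=
  (∀ i : ℤ, 0 < i → IsZero (C.X i)) ∧
  ∃ e : ∀ s : ℕ, C.X (-(s : ℤ)) ≅
      (R.EF (a + s) (b + s) (x := x) (y := y) (by omega))⟦-((s : ℤ) * c)⟧,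
    ∀ s : ℕ, ∃ δ : ShiftedHom (R.EF (a + s + 1) (b + s + 1) (x := x) (y := y) (by omega))
        (R.EF (a + s) (b + s) (by omega)) c,
      R.IsEFDifferential (a + s) (b + s) (by omega) (by omega) (by omega) δ ∧
      C.d (-((s + 1 : ℕ) : ℤ)) (-(s : ℤ)) ≫ (e s).hom =
        (e (s + 1)).hom ≫ ShiftedHom.shiftedMap δ (-(((s + 1 : ℕ) : ℤ) * c)) (-((s : ℤ) * c))
          (by push_cast; ring)

/-- `C` is a complex of the form
`⋯ ⟶ F^(b+s) E^(a+s) ⟨-sc⟩ ⟶ F^(b+s-1) E^(a+s-1) ⟨-(s-1)c⟩ ⟶ ⋯ ⟶ F^(b) E^(a)`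
of 1-morphisms from weight `x` to weight `y`, with the term of index `s` in cohomological degree
`-s` and with differentials the maps above. -/
def IsFEComplex (a b : ℕ) (c : ℤ) {x y : ℤ} (hy : y = x + 2 * (a : ℤ) - 2 * (b : ℤ))
    (hc : c = 1 + (a : ℤ) - (b : ℤ) + x) (C : CochainComplex (R.wt x ⟶ R.wt y) ℤ) : Prop :=
  (∀ i : ℤ, 0 < i → IsZero (C.X i)) ∧
  ∃ e : ∀ s : ℕ, C.X (-(s : ℤ)) ≅
      (R.FE (a + s) (b + s) (x := x) (y := y) (by omega))⟦-((s : ℤ) * c)⟧,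
    ∀ s : ℕ, ∃ δ : ShiftedHom (R.FE (a + s + 1) (b + s + 1) (x := x) (y := y) (by omega))
        (R.FE (a + s) (b + s) (by omega)) c,
      R.IsFEDifferential (a + s) (b + s) (by omega) (by omega) (by omega) δ ∧
      C.d (-((s + 1 : ℕ) : ℤ)) (-(s : ℤ)) ≫ (e s).hom =
        (e (s + 1)).hom ≫ ShiftedHom.shiftedMap δ (-(((s + 1 : ℕ) : ℤ) * c)) (-((s : ℤ) * c))
          (by push_cast; ring)

/-- `C` is a Rickard complex `1_l τ_{l+r} 1_{-l-2r}`, where `n = l + r ≥ 0`, `x = -l-2r`, `y = l`.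
It has terms `E^(n+s) F^(s) ⟨-s(r+1)⟩` if `r ≥ 0`, and `F^(s) E^(n+s) ⟨s(r-1)⟩` if `r ≤ 0`. -/
def IsTau (l r : ℤ) (n : ℕ) (hn : (n : ℤ) = l + r) {x y : ℤ} (hx : x = -l - 2 * r) (hy : y = l)
    (C : CochainComplex (R.wt x ⟶ R.wt y) ℤ) : Prop :=
  (0 ≤ r ∧ R.IsEFComplex n 0 (r + 1) (by omega) (by omega) C) ∨
  (r ≤ 0 ∧ R.IsFEComplex n 0 (1 - r) (by omega) (by omega) C)

/-- `C` is a Rickard complex `1_{-l} τ'_{l+r} 1_{l+2r}`, where `n = l + r ≥ 0`, `x = l+2r`,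
`y = -l`. It has terms `F^(n+s) E^(s) ⟨-s(r+1)⟩` if `r ≥ 0`, and `E^(s) F^(n+s) ⟨s(r-1)⟩` if
`r ≤ 0`. -/
def IsTau' (l r : ℤ) (n : ℕ) (hn : (n : ℤ) = l + r) {x y : ℤ} (hx : x = l + 2 * r) (hy : y = -l)
    (C : CochainComplex (R.wt x ⟶ R.wt y) ℤ) : Prop :=
  (0 ≤ r ∧ R.IsFEComplex 0 n (r + 1) (by omega) (by omega) C) ∨
  (r ≤ 0 ∧ R.IsEFComplex 0 n (1 - r) (by omega) (by omega) C)

/-- `C` is a complex `T 1_l`, from weight `l` to weight `-l`. It has terms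
`E^(-l+s) F^(s) ⟨-s⟩` if `l ≤ 0`, and `F^(l+s) E^(s) ⟨-s⟩` if `l ≥ 0`. -/
def IsT (l : ℤ) {x y : ℤ} (hx : x = l) (hy : y = -l)
    (C : CochainComplex (R.wt x ⟶ R.wt y) ℤ) : Prop :=
  (∃ _ : l ≤ 0, R.IsEFComplex l.natAbs 0 1 (by omega) (by omega) C) ∨
  (∃ _ : 0 ≤ l, R.IsFEComplex 0 l.natAbs 1 (by omega) (by omega) C)

end CategoricalSl2Rep

end Complexes

/-!
The complexes `T ∘ E^(p)`, `E^(p) ∘ T`, … are compared with Rickard complexes of other weights, and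
everything follows from one statement: composing a Rickard complex of the middle weight with `E^(p)`
gives a Rickard complex (`Sl2Data.IsRickard.exists_isIso_E_pow`). The other cases come from it by
exchanging `E` and `F` (`Sl2Data.chev`) and by reversing the order of composition (`Sl2Data.rev`).

**Working up to scalars.** All morphisms that matter are determined up to scalars by their degrees:
the morphisms of the relevant degrees between products of divided powers vanish below some degree
and are unique up to scalars in this degree (`ProjObj.Low`; for instance `Sl2Data.low_E` and
`Sl2Data.low_FE_FE`). This is proved by moving divided powers around by adjunction and by the
commutation relations, starting from the weights where all objects are zero. Therefore homogeneous
morphisms are considered up to nonzero scalars, as morphisms of the category `ProjObj C`, in which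
an object and its shifts are isomorphic. Horizontal composition descends to these classes, and the
signs in the coherence of composition and shift disappear: there is an honest bicategory `PB B`.
The classes of the differentials of the Rickard complexes are unique, so that neither the choices
in their construction nor the squares of the differentials cause any difficulty, and a family of
classes which commutes with the differentials can be rescaled to a morphism of complexes
(`exists_rescale`).

**One step.** Let `x` be the weight of the source of a Rickard complex `C`, with terms
`E^(α-i) F^(β-i)`, and let `r = β - α - x ≥ 0`. Then `C ∘ E` is homotopy equivalent to the direct
sum of the `r + 1` shifts of a Rickard complex `D` with terms `E^(α-i) F^(β-1-i)`
(`Sl2Data.IsRickard.exists_isIso`). By `θ`, the 1-morphism `E` has an endomorphism `X` of degree `2`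
(`Sl2Data.Dot`), whose `n`-th power maps the lowest summand of `E^(n) E` isomorphically to the
highest one (`Sl2Data.Dot.j_iter_p`). The adjunction gives a morphism of complexes
`Ψ : C ∘ E ⟶ D`, and the required equivalence has the components `X^t Ψ` for `0 ≤ t ≤ r`. Its
mapping cone is contractible: a term `E^(a) F^(b+1) E` of `C ∘ E` consists of `r + a + 1` copies of
`E^(a) F^(b)`, generated by one copy of lowest degree under the powers of `X`, and of copies of
`E^(a+1) F^(b+1)` generated by the differential of such a lowest copy in the preceding term. These
copies exhaust the term, which is seen by counting dimensions of spaces of morphisms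
(`Sl2Data.exists_decomp_E_F`, `Sl2Data.IsRickard.hdim_E_comp`), and they are independent, as a
triangular matrix of composites shows (`isIso_quotient_map_of_triangular`).

**Divided powers.** At the middle weight `x = β - α`, apply the step repeatedly: `C ∘ E^(p) ∘ E` is
a sum of shifts of both `C ∘ E^(p+1)` and of a Rickard complex `D`. The matrix of the equivalence is
zero above its antidiagonal for degree reasons, and all entries on the antidiagonal are shifts of
the same morphism `C ∘ E^(p+1) ⟶ D`, which therefore is a homotopy equivalence
(`isSplitMono_isSplitEpi_of_antitriangular`).

At the middle weight the terms `E^(a) F^(b)` and `F^(b) E^(a)` are isomorphic, and so are the two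
forms of a Rickard complex (`Sl2Data.isRickard_chev_iff`). The relations with `T` on both sides hold
because both sides are equivalent to the same Rickard complex.
-/

universe v' u'

set_option linter.unusedSectionVars false

/-! ### Homogeneous morphisms up to scalars -/

section ProjectiveClasses

variable {C : Type u} [Category.{v} C] [Preadditive C] [Linear ℂ C] [HasShift C ℤ]
  [∀ n : ℤ, (shiftFunctor C n).Additive] [∀ n : ℤ, (shiftFunctor C n).Linear ℂ]

/-- Two homogeneous morphisms are equivalent if they have the same degree and differ by an
invertible scalar. -/
def homogeneousSetoid (X Y : C) : Setoid (Σ k : ℤ, ShiftedHom X Y k) where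
  r p q := ∃ c : ℂˣ, q = ⟨p.1, (c : ℂ) • p.2⟩
  iseqv :=
    { refl := fun p => ⟨1, by simp⟩
      symm := by
        rintro ⟨k, α⟩ q ⟨c, rfl⟩
        exact ⟨c⁻¹, by simp [smul_smul]⟩
      trans := by
        rintro ⟨k, α⟩ q r ⟨c, rfl⟩ ⟨d, rfl⟩
        exact ⟨d * c, by simp [smul_smul]⟩ }

/-- An object of `C`, regarded as an object of the category whose morphisms are the homogeneous
morphisms of `C` of arbitrary degree, up to invertible scalars. -/
@[ext]
structure ProjObj (C : Type u) where
  /-- the underlying object -/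
  obj : C

/-- A homogeneous morphism up to an invertible scalar. The degree is part of the data, also for
the zero morphisms. -/
def ProjHom (X Y : C) : Type v := Quotient (homogeneousSetoid X Y)

/-- The class of a homogeneous morphism. -/
def cl {X Y : C} {k : ℤ} (α : ShiftedHom X Y k) : ProjHom X Y :=
  Quotient.mk (homogeneousSetoid X Y) ⟨k, α⟩

lemma cl_eq_of_smul {X Y : C} {k : ℤ} {α β : ShiftedHom X Y k} (c : ℂˣ)
    (h : β = (c : ℂ) • α) : cl α = cl β :=
  Quotient.sound ⟨c, by rw [h]⟩

lemma cl_eq_iff {X Y : C} {k : ℤ} {α β : ShiftedHom X Y k} :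
    cl α = cl β ↔ ∃ c : ℂˣ, β = (c : ℂ) • α := by
  refine ⟨fun h => ?_, fun ⟨c, h⟩ => cl_eq_of_smul c h⟩
  obtain ⟨c, hc⟩ := Quotient.exact h
  exact ⟨c, by simpa using hc⟩

noncomputable instance : Category (ProjObj C) where
  Hom X Y := ProjHom X.obj Y.obj
  id X := cl (ShiftedHom.mk₀ 0 rfl (𝟙 X.obj))
  comp {X Y Z} := Quotient.map₂
    (fun p q => ⟨q.1 + p.1, p.2.comp q.2 rfl⟩) (by
      rintro ⟨k, α⟩ _ ⟨c, rfl⟩ ⟨l, β⟩ _ ⟨d, rfl⟩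
      exact ⟨d * c, by simp [smul_smul, mul_comm]⟩)
  id_comp := by
    rintro X Y ⟨k, α⟩
    refine Quotient.sound ⟨1, ?_⟩
    refine Sigma.ext (by simp) ?_
    simp only [Units.val_one, one_smul]
    rw [← ShiftedHom.mk₀_id_comp 0 rfl α]
    congr 1 <;> simp
  comp_id := by
    rintro X Y ⟨k, α⟩
    refine Quotient.sound ⟨1, ?_⟩
    refine Sigma.ext (by simp) ?_
    simp only [Units.val_one, one_smul]
    rw [← ShiftedHom.comp_mk₀_id α 0 rfl]
    congr 1 <;> simp
  assoc := by
    rintro X Y Z T ⟨k, α⟩ ⟨l, β⟩ ⟨m, γ⟩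
    refine Quotient.sound ⟨1, ?_⟩
    refine Sigma.ext (by simp [add_assoc]) ?_
    simp only [Units.val_one, one_smul]
    rw [← ShiftedHom.comp_assoc α β γ rfl rfl rfl]
    congr 1
    · simp [add_assoc]
    · exact proof_irrel_heq _ _

/-- The object of the category of projective classes attached to an object of `C`. -/
abbrev toProj (X : C) : ProjObj C := ⟨X⟩

/-- The morphism of projective classes given by a homogeneous morphism. -/
def pcl {X Y : C} {k : ℤ} (α : ShiftedHom X Y k) : toProj X ⟶ toProj Y := cl α

lemma pcl_eq_iff {X Y : C} {k : ℤ} {α β : ShiftedHom X Y k} :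
    pcl α = pcl β ↔ ∃ c : ℂˣ, β = (c : ℂ) • α := cl_eq_iff

lemma pcl_smul {X Y : C} {k : ℤ} (c : ℂˣ) (α : ShiftedHom X Y k) :
    pcl ((c : ℂ) • α) = pcl α := (pcl_eq_iff.2 ⟨c, rfl⟩).symm

lemma pcl_comp {X Y Z : C} {a b c : ℤ} (α : ShiftedHom X Y a) (β : ShiftedHom Y Z b)
    (h : b + a = c) : pcl (α.comp β h) = pcl α ≫ pcl β := by
  subst h; rfl

/-- The projective class of a morphism of degree `0`. -/
noncomputable def pcl₀ {X Y : C} (f : X ⟶ Y) : toProj X ⟶ toProj Y :=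
  pcl (ShiftedHom.mk₀ 0 rfl f)

@[simp] lemma pcl₀_id (X : C) : pcl₀ (𝟙 X) = 𝟙 (toProj X) := rfl

lemma pcl₀_comp {X Y Z : C} (f : X ⟶ Y) (g : Y ⟶ Z) : pcl₀ (f ≫ g) = pcl₀ f ≫ pcl₀ g := by
  rw [pcl₀, pcl₀, pcl₀, ← pcl_comp _ _ (add_zero 0), ShiftedHom.mk₀_comp_mk₀]

lemma pcl₀_comp_pcl {X Y Z : C} (f : X ⟶ Y) {k : ℤ} (α : ShiftedHom Y Z k) :
    pcl (f ≫ α : ShiftedHom X Z k) = pcl₀ f ≫ pcl α := by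
  rw [pcl₀, ← pcl_comp _ _ (add_zero k), ShiftedHom.mk₀_comp]

lemma pcl_comp_pcl₀ {X Y Z : C} {k : ℤ} (α : ShiftedHom X Y k) (g : Y ⟶ Z) :
    pcl (α ≫ g⟦k⟧' : ShiftedHom X Z k) = pcl α ≫ pcl₀ g := by
  rw [pcl₀, ← pcl_comp _ _ (zero_add k), ShiftedHom.comp_mk₀]

/-- The isomorphism of projective classes given by an isomorphism of degree `0`. -/
@[simps]
noncomputable def pisoOfIso {X Y : C} (e : X ≅ Y) : toProj X ≅ toProj Y where
  hom := pcl₀ e.hom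
  inv := pcl₀ e.inv
  hom_inv_id := by rw [← pcl₀_comp, e.hom_inv_id, pcl₀_id]
  inv_hom_id := by rw [← pcl₀_comp, e.inv_hom_id, pcl₀_id]

namespace ProjObj

variable {X Y Z T : ProjObj C}

/-- The degree of a projective class. -/
def deg (φ : X ⟶ Y) : ℤ :=
  Quotient.lift (fun p : Σ k : ℤ, ShiftedHom X.obj Y.obj k => p.1)
    (by rintro ⟨k, α⟩ _ ⟨c, rfl⟩; rfl) φ

/-- The projective class of a zero morphism. -/
def IsNull (φ : X ⟶ Y) : Prop := ∃ k : ℤ, φ = pcl (0 : ShiftedHom X.obj Y.obj k)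

@[simp] lemma deg_pcl₀ {X Y : C} (f : X ⟶ Y) : deg (pcl₀ f) = 0 := rfl

@[simp] lemma deg_id (X : ProjObj C) : deg (𝟙 X) = 0 := rfl

@[simp] lemma deg_comp (φ : X ⟶ Y) (ψ : Y ⟶ Z) : deg (φ ≫ ψ) = deg φ + deg ψ := by
  obtain ⟨⟨k, α⟩, rfl⟩ := Quotient.exists_rep φ
  obtain ⟨⟨l, β⟩, rfl⟩ := Quotient.exists_rep ψ
  exact add_comm _ _

lemma exists_rep (φ : X ⟶ Y) {n : ℤ} (h : deg φ = n) :
    ∃ α : ShiftedHom X.obj Y.obj n, φ = pcl α := by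
  obtain ⟨⟨k, α⟩, rfl⟩ := Quotient.exists_rep φ
  obtain rfl : k = n := h
  exact ⟨α, rfl⟩

lemma exists_pcl (φ : X ⟶ Y) : ∃ (k : ℤ) (α : ShiftedHom X.obj Y.obj k), φ = pcl α :=
  ⟨_, exists_rep φ rfl⟩

lemma isNull_pcl {X Y : C} {k : ℤ} {α : ShiftedHom X Y k} : IsNull (pcl α) ↔ α = 0 := by
  refine ⟨fun ⟨l, h⟩ => ?_, fun h => ⟨k, by rw [h]⟩⟩
  obtain rfl : k = l := congrArg (deg (X := toProj X) (Y := toProj Y)) h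
  obtain ⟨c, hc⟩ := pcl_eq_iff.1 h
  exact ((smul_eq_zero_iff_eq c).1 hc.symm)

lemma isNull_pcl₀ {X Y : C} {f : X ⟶ Y} : IsNull (pcl₀ f) ↔ f = 0 := by
  rw [pcl₀, isNull_pcl, ShiftedHom.mk₀]
  exact ⟨fun h => by simpa using h, fun h => by simp [h]⟩

lemma IsNull.eq {φ ψ : X ⟶ Y} (hφ : IsNull φ) (hψ : IsNull ψ) (h : deg φ = deg ψ) : φ = ψ := by
  obtain ⟨k, rfl⟩ := hφ
  obtain ⟨l, rfl⟩ := hψ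
  obtain rfl : k = l := h
  rfl

lemma IsNull.comp {φ : X ⟶ Y} (h : IsNull φ) (ψ : Y ⟶ Z) : IsNull (φ ≫ ψ) := by
  obtain ⟨k, rfl⟩ := h
  obtain ⟨l, β, rfl⟩ := exists_pcl ψ
  exact ⟨_, by rw [← pcl_comp _ _ rfl, ShiftedHom.zero_comp]⟩

lemma IsNull.comp_left {ψ : Y ⟶ Z} (h : IsNull ψ) (φ : X ⟶ Y) : IsNull (φ ≫ ψ) := by
  obtain ⟨k, rfl⟩ := h
  obtain ⟨l, β, rfl⟩ := exists_pcl φ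
  exact ⟨_, by rw [← pcl_comp _ _ rfl, ShiftedHom.comp_zero]⟩

lemma exists_isNull (X Y : ProjObj C) (n : ℤ) : ∃ φ : X ⟶ Y, IsNull φ ∧ deg φ = n :=
  ⟨pcl (0 : ShiftedHom X.obj Y.obj n), ⟨n, rfl⟩, rfl⟩

lemma deg_inv_of_comp_eq_id {φ : X ⟶ Y} {ψ : Y ⟶ X} (h : φ ≫ ψ = 𝟙 X) : deg ψ = - deg φ := by
  have := congrArg deg h
  rw [deg_comp, deg_id] at this
  omega

@[simp] lemma deg_iso_inv (e : X ≅ Y) : deg e.inv = - deg e.hom :=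
  deg_inv_of_comp_eq_id e.hom_inv_id

lemma isNull_comp_iso (φ : X ⟶ Y) (e : Y ≅ Z) : IsNull (φ ≫ e.hom) ↔ IsNull φ :=
  ⟨fun h => by simpa using h.comp e.inv, fun h => h.comp _⟩

lemma isNull_iso_comp (e : X ≅ Y) (φ : Y ⟶ Z) : IsNull (e.hom ≫ φ) ↔ IsNull φ :=
  ⟨fun h => by simpa using h.comp_left e.inv, fun h => h.comp_left _⟩

lemma isNull_of_isNull_id (h : IsNull (𝟙 X)) (φ : X ⟶ Y) : IsNull φ := by
  simpa using h.comp φ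

lemma isNull_of_isNull_id' (h : IsNull (𝟙 Y)) (φ : X ⟶ Y) : IsNull φ := by
  simpa using h.comp_left φ

lemma isNull_id_iff {X : C} : IsNull (𝟙 (toProj X)) ↔ IsZero X := by
  rw [← pcl₀_id, isNull_pcl₀, IsZero.iff_id_eq_zero]

/-- The morphisms of degree less than `N` vanish. -/
def VanishBelow (X Y : ProjObj C) (N : ℤ) : Prop :=
  ∀ φ : X ⟶ Y, deg φ < N → IsNull φ

/-- The morphisms of degree less than `N` vanish, and those of degree `N` form a space of
dimension at most one. -/
def Low (X Y : ProjObj C) (N : ℤ) : Prop :=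
  VanishBelow X Y N ∧ ∀ φ ψ : X ⟶ Y, deg φ = N → deg ψ = N → ¬ IsNull φ → ¬ IsNull ψ → φ = ψ

lemma VanishBelow.mono {N M : ℤ} (h : VanishBelow X Y N) (hM : M ≤ N) : VanishBelow X Y M :=
  fun φ hφ => h φ (hφ.trans_le hM)

lemma VanishBelow.low {N M : ℤ} (h : VanishBelow X Y N) (hM : M < N) : Low X Y M :=
  ⟨h.mono hM.le, fun φ _ hφ _ h₀ => (h₀ (h φ (by omega))).elim⟩

lemma Low.mono {N M : ℤ} (h : Low X Y N) (hM : M ≤ N) : Low X Y M := by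
  rcases hM.eq_or_lt with rfl | hM
  exacts [h, h.1.low hM]

/-- Bounds are inherited along an injective map of Hom spaces which changes all degrees by `d`. -/
lemma VanishBelow.of_map {X' Y' : ProjObj C} {N : ℤ} (T : (X ⟶ Y) → (X' ⟶ Y')) (d : ℤ)
    (hd : ∀ φ, deg (T φ) = deg φ + d) (hn : ∀ φ, IsNull (T φ) → IsNull φ) {M : ℤ}
    (h : VanishBelow X' Y' M) (hM : M = N + d := by omega) : VanishBelow X Y N :=
  fun φ hφ => hn φ (h _ (by rw [hd]; omega))

lemma Low.of_map {C' : Type*} [Category C'] [Preadditive C'] [Linear ℂ C'] [HasShift C' ℤ]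
    [∀ n : ℤ, (shiftFunctor C' n).Additive] [∀ n : ℤ, (shiftFunctor C' n).Linear ℂ]
    {X' Y' : ProjObj C'} {N : ℤ} (T : (X ⟶ Y) → (X' ⟶ Y')) (d : ℤ)
    (hd : ∀ φ, deg (T φ) = deg φ + d) (hn : ∀ φ, IsNull (T φ) → IsNull φ)
    (hT : Function.Injective T) {M : ℤ}
    (h : Low X' Y' M) (hM : M = N + d := by omega) : Low X Y N :=
  ⟨fun φ hφ => hn φ (h.1 _ (by rw [hd]; omega)), fun φ ψ hφ hψ h₁ h₂ =>
    hT (h.2 _ _ (by rw [hd]; omega) (by rw [hd]; omega) (fun h' => h₁ (hn _ h'))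
      (fun h' => h₂ (hn _ h')))⟩

end ProjObj

end ProjectiveClasses

/-! ### Decompositions of objects of a graded category -/

section Decompositions

variable {C : Type u} [Category.{v} C] [Preadditive C] [Linear ℂ C] [HasShift C ℤ]
  [∀ n : ℤ, (shiftFunctor C n).Additive] [∀ n : ℤ, (shiftFunctor C n).Linear ℂ]

namespace CategoryTheory.ShiftedHom

variable {X Y Z : C}

lemma comp_sum {ι : Type*} (s : Finset ι) {a b c : ℤ} (α : ShiftedHom X Y a)
    (β : ι → ShiftedHom Y Z b) (h : b + a = c) :
    α.comp (∑ i ∈ s, β i) h = ∑ i ∈ s, α.comp (β i) h :=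
  map_sum (AddMonoidHom.mk' (fun β => α.comp β h) fun _ _ => comp_add _ _ _ _) _ _

lemma sum_comp {ι : Type*} (s : Finset ι) {a b c : ℤ} (α : ι → ShiftedHom X Y a)
    (β : ShiftedHom Y Z b) (h : b + a = c) :
    ShiftedHom.comp (∑ i ∈ s, α i) β h = ∑ i ∈ s, (α i).comp β h :=
  map_sum (AddMonoidHom.mk' (fun α => ShiftedHom.comp α β h) fun _ _ => add_comp _ _ _ _) _ _

lemma mk₀_injective {m₀ : ℤ} {hm₀ : m₀ = 0} :
    Function.Injective (mk₀ m₀ hm₀ : (X ⟶ Y) → ShiftedHom X Y m₀) :=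
  (homEquiv m₀ hm₀).injective

end CategoryTheory.ShiftedHom

open ShiftedHom ProjObj

/-- A factorization of the identity of `M` through the objects `Z i`: homogeneous morphisms
`M → Z i` of degree `d i` and `Z i → M` of degree `-d i` whose composites sum to the identity. -/
structure Fac (M : ProjObj C) {ι : Type} [Fintype ι] (Z : ι → ProjObj C) (d : ι → ℤ) where
  /-- the morphisms to the objects `Z i` -/
  proj (i : ι) : ShiftedHom M.obj (Z i).obj (d i)
  /-- the morphisms from the objects `Z i` -/
  inj (i : ι) : ShiftedHom (Z i).obj M.obj (-d i)
  sum_proj_inj : ∑ i, (proj i).comp (inj i) (neg_add_cancel (d i)) = mk₀ 0 rfl (𝟙 M.obj)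

/-- A direct sum decomposition `M ≅ ⨁ i, Z i⟨d i⟩`. -/
structure Decomp (M : ProjObj C) {ι : Type} [Fintype ι] (Z : ι → ProjObj C) (d : ι → ℤ) extends
    Fac M Z d where
  inj_proj_self (i : ι) : (inj i).comp (proj i) (add_neg_cancel (d i)) = mk₀ 0 rfl (𝟙 (Z i).obj)
  inj_proj_of_ne {i j : ι} (h : i ≠ j) : (inj i).comp (proj j) rfl = 0

namespace Fac

variable {M T W : ProjObj C} {ι : Type} [Fintype ι] {Z : ι → ProjObj C} {d : ι → ℤ}

/-- The projective class of a component `M → Z i`. -/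
def p (D : Fac M Z d) (i : ι) : M ⟶ Z i := pcl (D.proj i)

/-- The projective class of a component `Z i → M`. -/
def j (D : Fac M Z d) (i : ι) : Z i ⟶ M := pcl (D.inj i)

@[simp] lemma deg_p (D : Fac M Z d) (i : ι) : deg (D.p i) = d i := rfl
@[simp] lemma deg_j (D : Fac M Z d) (i : ι) : deg (D.j i) = -d i := rfl

lemma comp_eq_sum (D : Fac M Z d) {X Y : C} {a b c : ℤ} (α : ShiftedHom X M.obj a)
    (β : ShiftedHom M.obj Y b) (h : b + a = c) :
    α.comp β h = ∑ i, (α.comp (D.proj i) rfl).comp ((D.inj i).comp β rfl) (by omega) := by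
  have h₁ : β = (mk₀ 0 rfl (𝟙 M.obj)).comp β (add_zero b) := by simp
  conv_lhs => rw [h₁, ← D.sum_proj_inj, sum_comp, comp_sum]
  refine Finset.sum_congr rfl fun i _ => ?_
  rw [comp_assoc (D.proj i) (D.inj i) β (neg_add_cancel _) rfl (by omega),
    comp_assoc α (D.proj i) ((D.inj i).comp β rfl) rfl (show b + -d i + d i = b by omega)
      (by omega)]

lemma comp_eq_sum' (D : Fac M Z d) {X Y : C} {a b c : ℤ} (α : ShiftedHom X M.obj a)
    (β : ShiftedHom M.obj Y b) (h : b + a = c) (a' b' : ι → ℤ) (ha : ∀ i, d i + a = a' i)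
    (hb : ∀ i, b + -d i = b' i) :
    α.comp β h = ∑ i, (α.comp (D.proj i) (ha i)).comp ((D.inj i).comp β (hb i))
      (by have := ha i; have := hb i; omega) := by
  obtain rfl : (fun i => d i + a) = a' := funext ha
  obtain rfl : (fun i => b + -d i) = b' := funext hb
  exact D.comp_eq_sum α β h

/-- If all but one of the composites through the `Z i` vanish, the composite is the remaining
one. -/
lemma comp_eq (D : Fac M Z d) (φ : T ⟶ M) (ψ : M ⟶ W) (i₀ : ι)
    (h : ∀ i, i ≠ i₀ → IsNull (φ ≫ D.p i ≫ D.j i ≫ ψ)) :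
    φ ≫ ψ = φ ≫ D.p i₀ ≫ D.j i₀ ≫ ψ := by
  obtain ⟨a, α, rfl⟩ := exists_pcl φ
  obtain ⟨b, β, rfl⟩ := exists_pcl ψ
  have key (i : ι) : pcl α ≫ D.p i ≫ D.j i ≫ pcl β =
      pcl ((α.comp (D.proj i) rfl).comp ((D.inj i).comp β rfl)
        (show _ = b + a by omega)) := by
    rw [pcl_comp, pcl_comp, pcl_comp, Category.assoc]; rfl
  rw [key, ← pcl_comp _ _ rfl, D.comp_eq_sum, Finset.sum_eq_single i₀]
  · intro i _ hi
    have := h i hi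
    rwa [key, isNull_pcl] at this
  · simp

lemma isNull_comp (D : Fac M Z d) (φ : T ⟶ M) (ψ : M ⟶ W)
    (h : ∀ i, IsNull (φ ≫ D.p i ≫ D.j i ≫ ψ)) : IsNull (φ ≫ ψ) := by
  by_cases hι : Nonempty ι
  · obtain ⟨i₀⟩ := hι
    rw [D.comp_eq φ ψ i₀ fun i _ => h i]
    exact h i₀
  · obtain ⟨a, α, rfl⟩ := exists_pcl φ
    obtain ⟨b, β, rfl⟩ := exists_pcl ψ
    rw [not_nonempty_iff] at hι
    rw [← pcl_comp _ _ rfl, D.comp_eq_sum, isNull_pcl]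
    simp

lemma eq_p_j (D : Fac M Z d) (φ : T ⟶ M) (i₀ : ι)
    (h : ∀ i, i ≠ i₀ → IsNull (φ ≫ D.p i)) : φ = φ ≫ D.p i₀ ≫ D.j i₀ := by
  have := D.comp_eq φ (𝟙 M) i₀ fun i hi => by
    simpa using (h i hi).comp (D.j i ≫ 𝟙 M)
  simpa using this

lemma eq_p_j' (D : Fac M Z d) (ψ : M ⟶ W) (i₀ : ι)
    (h : ∀ i, i ≠ i₀ → IsNull (D.j i ≫ ψ)) : ψ = D.p i₀ ≫ D.j i₀ ≫ ψ := by
  have := D.comp_eq (𝟙 M) ψ i₀ fun i hi => by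
    simpa using (h i hi).comp_left (D.p i)
  simpa using this

lemma isNull_of_p (D : Fac M Z d) (φ : T ⟶ M) (h : ∀ i, IsNull (φ ≫ D.p i)) : IsNull φ := by
  simpa using D.isNull_comp φ (𝟙 M) fun i => by simpa using (h i).comp (D.j i)

lemma isNull_of_j (D : Fac M Z d) (ψ : M ⟶ W) (h : ∀ i, IsNull (D.j i ≫ ψ)) : IsNull ψ := by
  simpa using D.isNull_comp (𝟙 M) ψ fun i => by simpa using (h i).comp_left (D.p i)

lemma vanish_right (D : Fac M Z d) {N : ℤ} (h : ∀ i, VanishBelow T (Z i) (N + d i)) :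
    VanishBelow T M N := fun φ hφ => D.isNull_of_p φ fun i => h i _ (by simp; omega)

lemma vanish_left (D : Fac M Z d) {N : ℤ} (h : ∀ i, VanishBelow (Z i) W (N - d i)) :
    VanishBelow M W N := fun φ hφ => D.isNull_of_j φ fun i => h i _ (by simp; omega)

lemma low_right (D : Fac M Z d) {N : ℤ} (i₀ : ι) (h₀ : Low T (Z i₀) (N + d i₀))
    (h : ∀ i, i ≠ i₀ → VanishBelow T (Z i) (N + d i + 1)) : Low T M N := by
  refine ⟨D.vanish_right fun i => ?_, fun φ ψ hφ hψ h₁ h₂ => ?_⟩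
  · by_cases hi : i = i₀
    · subst hi; exact h₀.1
    · exact (h i hi).mono (by omega)
  · have e (φ : T ⟶ M) (hφ : deg φ = N) : φ = φ ≫ D.p i₀ ≫ D.j i₀ :=
      D.eq_p_j φ i₀ fun i hi => h i hi _ (by simp; omega)
    have : φ ≫ D.p i₀ = ψ ≫ D.p i₀ := by
      refine h₀.2 _ _ (by simp; omega) (by simp; omega) (fun h' => h₁ ?_) (fun h' => h₂ ?_)
      · rw [e φ hφ, ← Category.assoc]; exact h'.comp _
      · rw [e ψ hψ, ← Category.assoc]; exact h'.comp _
    rw [e φ hφ, e ψ hψ, ← Category.assoc, this, Category.assoc]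

lemma low_left (D : Fac M Z d) {N : ℤ} (i₀ : ι) (h₀ : Low (Z i₀) W (N - d i₀))
    (h : ∀ i, i ≠ i₀ → VanishBelow (Z i) W (N - d i + 1)) : Low M W N := by
  refine ⟨D.vanish_left fun i => ?_, fun φ ψ hφ hψ h₁ h₂ => ?_⟩
  · by_cases hi : i = i₀
    · subst hi; exact h₀.1
    · exact (h i hi).mono (by omega)
  · have e (φ : M ⟶ W) (hφ : deg φ = N) : φ = D.p i₀ ≫ D.j i₀ ≫ φ :=
      D.eq_p_j' φ i₀ fun i hi => h i hi _ (by simp; omega)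
    have : D.j i₀ ≫ φ = D.j i₀ ≫ ψ := by
      refine h₀.2 _ _ (by simp; omega) (by simp; omega) (fun h' => h₁ ?_) (fun h' => h₂ ?_)
      · rw [e φ hφ]; exact h'.comp_left _
      · rw [e ψ hψ]; exact h'.comp_left _
    rw [e φ hφ, e ψ hψ, this]

/-- Factorizations can be composed. -/
noncomputable def trans (D : Fac M Z d) {κ : ι → Type} [∀ i, Fintype (κ i)]
    {Y : ∀ i, κ i → ProjObj C} {e : ∀ i, κ i → ℤ} (D' : ∀ i, Fac (Z i) (Y i) (e i)) :
    Fac M (fun s : Σ i, κ i => Y s.1 s.2) (fun s => d s.1 + e s.1 s.2) where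
  proj s := (D.proj s.1).comp ((D' s.1).proj s.2) (add_comm _ _)
  inj s := ((D' s.1).inj s.2).comp (D.inj s.1) (by ring)
  sum_proj_inj := by
    rw [Fintype.sum_sigma, ← D.sum_proj_inj]
    exact Finset.sum_congr rfl fun i _ =>
      ((D' i).comp_eq_sum' (D.proj i) (D.inj i) (neg_add_cancel (d i)) _ _ _ _).symm

end Fac

namespace Decomp

variable {M T W : ProjObj C} {ι : Type} [Fintype ι] {Z : ι → ProjObj C} {d : ι → ℤ}

lemma j_p_self (D : Decomp M Z d) (i : ι) : D.j i ≫ D.p i = 𝟙 (Z i) := by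
  rw [Fac.j, Fac.p, ← pcl_comp _ _ (add_neg_cancel (d i)), D.inj_proj_self]; rfl

/-- The morphism `X⟨k⟩ → X` of degree `k`. -/
def _root_.CategoryTheory.ShiftedHom.ofShift (X : C) (k : ℤ) : ShiftedHom (X⟦k⟧) X k := 𝟙 (X⟦k⟧)

/-- The morphism `X → X⟨k⟩` of degree `-k`. -/
noncomputable def _root_.CategoryTheory.ShiftedHom.toShift (X : C) (k : ℤ) :
    ShiftedHom X (X⟦k⟧) (-k) :=
  (shiftFunctorCompIsoId C k (-k) (add_neg_cancel k)).inv.app X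

lemma _root_.CategoryTheory.ShiftedHom.ofShift_toShift (X : C) (k : ℤ) :
    (ofShift X k).comp (toShift X k) (neg_add_cancel k) = mk₀ 0 rfl (𝟙 _) := by
  have h := shift_shiftFunctorCompIsoId_inv_app (n := k) (m := -k) (add_neg_cancel k) X
  rw [ShiftedHom.comp, ofShift, toShift, h, shiftFunctorCompIsoId]
  simp [mk₀, shiftFunctorZero']

lemma _root_.CategoryTheory.ShiftedHom.toShift_ofShift (X : C) (k : ℤ) :
    (toShift X k).comp (ofShift X k) (add_neg_cancel k) = mk₀ 0 rfl (𝟙 _) := by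
  simp only [ShiftedHom.comp, mk₀, ofShift, toShift, shiftFunctorCompIsoId]
  simp [shiftFunctorZero']

lemma _root_.CategoryTheory.ShiftedHom.mk₀_comp_ofShift {X Y : C} {k : ℤ} (α : X ⟶ Y⟦k⟧) :
    (mk₀ 0 rfl α).comp (ofShift Y k) (add_zero k) = α := by
  rw [mk₀_comp]; exact Category.comp_id α

/-- The decomposition given by an isomorphism with a biproduct of shifted objects. -/
noncomputable def ofIso [DecidableEq ι] {M : C} {Z : ι → C} {d : ι → ℤ}
    [HasBiproduct fun i => (Z i)⟦d i⟧]
    (e : M ≅ ⨁ fun i => (Z i)⟦d i⟧) : Decomp (toProj M) (fun i => toProj (Z i)) d where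
  proj i := (mk₀ 0 rfl (e.hom ≫ biproduct.π (fun i => (Z i)⟦d i⟧) i)).comp
    (ofShift (Z i) (d i)) (add_zero _)
  inj i := (toShift (Z i) (d i)).comp
    (mk₀ 0 rfl (biproduct.ι (fun i => (Z i)⟦d i⟧) i ≫ e.inv)) (zero_add _)
  sum_proj_inj := by
    have (i : ι) : ((mk₀ 0 rfl (e.hom ≫ biproduct.π (fun i => (Z i)⟦d i⟧) i)).comp
        (ofShift (Z i) (d i)) (add_zero _)).comp ((toShift (Z i) (d i)).comp
        (mk₀ 0 rfl (biproduct.ι (fun i => (Z i)⟦d i⟧) i ≫ e.inv)) (zero_add _))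
        (neg_add_cancel (d i)) = mk₀ 0 rfl (e.hom ≫ (biproduct.π (fun i => (Z i)⟦d i⟧) i ≫
          biproduct.ι (fun i => (Z i)⟦d i⟧) i) ≫ e.inv) := by
      rw [comp_assoc _ _ _ (add_zero (d i)) (neg_add_cancel (d i)) (by omega),
        ← comp_assoc (ofShift (Z i) (d i)) _ _ (neg_add_cancel _) _ (by omega),
        ofShift_toShift, mk₀_comp_mk₀, mk₀_comp_mk₀]
      simp
    refine (Finset.sum_congr rfl fun i _ => this i).trans ?_
    refine (map_sum (AddMonoidHom.mk' (fun f : M ⟶ M => mk₀ (0 : ℤ) rfl f)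
      fun _ _ => mk₀_add _ _ _ _) _ _).symm.trans ?_
    simp only [AddMonoidHom.mk'_apply]
    rw [← Preadditive.comp_sum, ← Preadditive.sum_comp, biproduct.total]
    simp
  inj_proj_self i := by
    rw [comp_assoc _ _ _ (zero_add _) (show d i + 0 = d i by omega) (by omega),
        ← comp_assoc (mk₀ 0 rfl _) (mk₀ 0 rfl _) _ (add_zero _) _ (by omega)]
    simp [toShift_ofShift]
  inj_proj_of_ne {i k} h := by
    rw [comp_assoc _ _ _ (zero_add _) (show d k + 0 = d k by omega) (by omega),
        ← comp_assoc (mk₀ 0 rfl _) (mk₀ 0 rfl _) _ (add_zero _) _ (by omega)]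
    simp [biproduct.ι_π_ne _ h]

end Decomp
end Decompositions

/-! ### Bases, and dimension counts -/

section Bases

variable {C : Type u} [Category.{v} C] [Preadditive C] [Linear ℂ C] [HasShift C ℤ]
  [∀ n : ℤ, (shiftFunctor C n).Additive] [∀ n : ℤ, (shiftFunctor C n).Linear ℂ]
  {D : Type u'} [Category.{v'} D] [Preadditive D] [Linear ℂ D] [HasShift D ℤ]
  [∀ n : ℤ, (shiftFunctor D n).Additive] [∀ n : ℤ, (shiftFunctor D n).Linear ℂ]

open ShiftedHom ProjObj

lemma comp_eq_pcl {X Y Z : ProjObj C} {φ : X ⟶ Y} {ψ : Y ⟶ Z} {a b c : ℤ}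
    {α : ShiftedHom X.obj Y.obj a} {β : ShiftedHom Y.obj Z.obj b} (hφ : φ = pcl α)
    (hψ : ψ = pcl β) (h : b + a = c) : φ ≫ ψ = pcl (α.comp β h) := by
  subst hφ hψ; exact (pcl_comp α β h).symm

/-- The image of a factorization of the identity under a functor compatible with shifts. -/
def Fac.map {M : C} {ι : Type} [Fintype ι] {Z : ι → C} {d : ι → ℤ}
    (A : Fac (toProj M) (fun i => toProj (Z i)) d) (F : C ⥤ D) [F.Additive] [F.CommShift ℤ] :
    Fac (toProj (F.obj M)) (fun i => toProj (F.obj (Z i))) d where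
  proj i := (A.proj i).map F
  inj i := (A.inj i).map F
  sum_proj_inj := by
    have h := congrArg (fun f => ShiftedHom.map f F) A.sum_proj_inj
    simp only [ShiftedHom.map_mk₀, F.map_id] at h
    rw [← h]
    refine Eq.trans ?_ (map_sum (AddMonoidHom.mk' (fun f : ShiftedHom M M 0 => f.map F)
      fun _ _ => map_add _ _ _) _ _).symm
    exact Finset.sum_congr rfl fun i _ => (map_comp _ _ _ _).symm

/-- The image of a direct sum decomposition under a functor compatible with shifts. -/
def Decomp.map {M : C} {ι : Type} [Fintype ι] {Z : ι → C} {d : ι → ℤ}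
    (A : Decomp (toProj M) (fun i => toProj (Z i)) d) (F : C ⥤ D) [F.Additive] [F.CommShift ℤ] :
    Decomp (toProj (F.obj M)) (fun i => toProj (F.obj (Z i))) d where
  toFac := A.toFac.map F
  inj_proj_self i := by
    have h := congrArg (fun f => ShiftedHom.map f F) (A.inj_proj_self i)
    simp only [map_comp, map_mk₀, F.map_id] at h
    exact h
  inj_proj_of_ne {i j} hij := by
    have h := congrArg (fun f => ShiftedHom.map f F) (A.inj_proj_of_ne hij)
    simp only [map_comp, ShiftedHom.map_zero] at h
    exact h

/-- An isomorphism of projective classes, as a decomposition with one summand. -/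
lemma Decomp.exists_ofPIso {M N : ProjObj C} (e : M ≅ N) {k : ℤ} (hk : deg e.hom = k) :
    ∃ A : Decomp M (fun _ : Unit => N) (fun _ => k), A.p () = e.hom ∧ A.j () = e.inv := by
  obtain ⟨α, hα⟩ := exists_rep e.hom hk
  obtain ⟨β, hβ⟩ := exists_rep e.inv (show deg e.inv = -k by rw [deg_iso_inv, hk])
  have h₁ : pcl (α.comp β (neg_add_cancel _)) = pcl (mk₀ 0 rfl (𝟙 M.obj)) := by
    rw [pcl_comp, ← hα, ← hβ, e.hom_inv_id]; rfl
  have h₂ : pcl (β.comp α (add_neg_cancel _)) = pcl (mk₀ 0 rfl (𝟙 N.obj)) := by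
    rw [pcl_comp, ← hα, ← hβ, e.inv_hom_id]; rfl
  obtain ⟨c, hc⟩ := pcl_eq_iff.1 h₁
  obtain ⟨c', hc'⟩ := pcl_eq_iff.1 h₂
  have h₃ : (c' : ℂ) • β = (c : ℂ) • β := by
    have e₁ : β.comp (mk₀ 0 rfl (𝟙 M.obj)) (zero_add _) = β := by simp
    have e₂ : (mk₀ 0 rfl (𝟙 N.obj)).comp β (add_zero _) = β := by simp
    rw [hc, comp_smul, ← comp_assoc β α β (add_neg_cancel _) _ (by omega)] at e₁
    rw [hc', smul_comp] at e₂
    conv_lhs => rw [← e₁]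
    conv_rhs => rw [← e₂]
    rw [smul_smul, smul_smul, mul_comm]
  exact ⟨{ proj := fun _ => α
           inj := fun _ => (c : ℂ) • β
           sum_proj_inj := by simp [hc]
           inj_proj_self := fun _ => by rw [← h₃, smul_comp, ← hc']
           inj_proj_of_ne := fun h => (h rfl).elim }, hα.symm, by rw [hβ]; exact pcl_smul _ _⟩

variable {M : ProjObj C} {ι : Type} [Fintype ι] {Z : ι → ProjObj C} {d : ι → ℤ}

/-- A finite family of homogeneous morphisms to `M` is free if, for every object `T`, the
homogeneous morphisms from `T` to `M` are combinations of the family in at most one way. -/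
def Free (u : ∀ i, ShiftedHom (Z i).obj M.obj (-d i)) : Prop :=
  ∀ (T : C) (n : ℤ) (x : ∀ i, ShiftedHom T (Z i).obj (n + d i)),
    ∑ i, (x i).comp (u i) (show -d i + (n + d i) = n by ring) = 0 → ∀ i, x i = 0

/-- A triangularity criterion: every member of the family is detected by a morphism which kills
all the members of smaller or equal rank. -/
lemma Free.of_triangular (u : ∀ i, ShiftedHom (Z i).obj M.obj (-d i)) (v : ∀ i, M ⟶ Z i)
    (rk : ι → ℕ) (h₁ : ∀ i, pcl (u i) ≫ v i = 𝟙 (Z i))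
    (h₂ : ∀ i j, j ≠ i → rk j ≤ rk i → IsNull ((pcl (u j) : Z j ⟶ M) ≫ v i)) : Free u := by
  classical
  intro T n x hx
  by_contra! hne
  obtain ⟨i, hi, hmax⟩ := Finset.exists_max_image (Finset.univ.filter fun i => x i ≠ 0) rk
    (by obtain ⟨i, hi⟩ := hne; exact ⟨i, by simpa using hi⟩)
  simp only [Finset.mem_filter, Finset.mem_univ, true_and] at hi hmax
  have hd : deg (v i) = d i := by
    have := deg_inv_of_comp_eq_id (h₁ i)
    rw [this]; exact neg_neg _
  obtain ⟨β, hβ⟩ := exists_rep (v i) hd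
  have h₃ : ∑ j, (x j).comp ((u j).comp β rfl)
      (show d i + -d j + (n + d j) = n + d i by ring) = 0 := by
    have := congrArg (fun f => ShiftedHom.comp f β (show _ = n + d i by ring)) hx
    simp only [sum_comp, ShiftedHom.zero_comp] at this
    rw [← this]
    refine Finset.sum_congr rfl fun j _ => ?_
    rw [comp_assoc (x j) (u j) β _ rfl (by ring)]
  rw [Finset.sum_eq_single i] at h₃
  · apply hi
    have h₅ : (pcl ((x i).comp ((u i).comp β rfl)
        (show d i + -d i + (n + d i) = n + d i by ring)) : toProj T ⟶ Z i) = pcl (x i) := by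
      rw [pcl_comp]
      have : (pcl ((u i).comp β rfl) : Z i ⟶ Z i) = 𝟙 _ := by
        rw [pcl_comp, ← hβ]; exact h₁ i
      exact (congrArg (fun f : Z i ⟶ Z i => (pcl (x i) : toProj T ⟶ Z i) ≫ f) this).trans
        (Category.comp_id _)
    rw [h₃] at h₅
    exact isNull_pcl.1 ⟨_, h₅.symm⟩
  · intro j _ hj
    by_cases hxj : x j = 0
    · rw [hxj, ShiftedHom.zero_comp]
    · have h₆ := h₂ i j hj (hmax j hxj)
      rw [comp_eq_pcl rfl hβ rfl] at h₆
      rw [isNull_pcl.1 h₆, ShiftedHom.comp_zero]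
  · simp

/-- The dimension of the space of morphisms of degree `n`. -/
noncomputable def hdim (T : C) (X : ProjObj C) (n : ℤ) : ℕ :=
  Module.finrank ℂ (ShiftedHom T X.obj n)

variable [hfd : ∀ X Y : C, Module.Finite ℂ (X ⟶ Y)]

/-- The linear map whose injectivity is asked for in the definition of a free family. -/
noncomputable def combine (u : ∀ i, ShiftedHom (Z i).obj M.obj (-d i)) (T : C) (n : ℤ) :
    (∀ i, ShiftedHom T (Z i).obj (n + d i)) →ₗ[ℂ] ShiftedHom T M.obj n where
  toFun x := ∑ i, (x i).comp (u i) (show -d i + (n + d i) = n by ring)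
  map_add' x y := by simp [Finset.sum_add_distrib]
  map_smul' c x := by simp [Finset.smul_sum]

lemma Free.injective {u : ∀ i, ShiftedHom (Z i).obj M.obj (-d i)} (h : Free u) (T : C) (n : ℤ) :
    Function.Injective (combine u T n) :=
  (injective_iff_map_eq_zero _).2 fun x hx => funext (h T n x hx)

lemma Free.sum_hdim_le {u : ∀ i, ShiftedHom (Z i).obj M.obj (-d i)} (h : Free u) (T : C)
    (n : ℤ) : ∑ i, hdim T (Z i) (n + d i) ≤ hdim T M n := by
  have := LinearMap.finrank_le_finrank_of_injective (h.injective T n)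
  rwa [Module.finrank_pi_fintype] at this

lemma Decomp.hdim_eq (A : Decomp M Z d) (T : C) (n : ℤ) :
    hdim T M n = ∑ i, hdim T (Z i) (n + d i) := by
  classical
  have e : ShiftedHom T M.obj n ≃ₗ[ℂ] (∀ i, ShiftedHom T (Z i).obj (n + d i)) :=
    { toFun := fun α i => α.comp (A.proj i) (add_comm _ _)
      map_add' := fun α β => by ext i; simp
      map_smul' := fun c α => by ext i; simp
      invFun := fun x => ∑ i, (x i).comp (A.inj i) (by ring)
      left_inv := fun α => by
        have := A.comp_eq_sum' α (mk₀ 0 rfl (𝟙 M.obj)) (zero_add n) (fun i => n + d i)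
          (fun i => -d i) (fun i => add_comm _ _) (fun i => zero_add _)
        simpa using this.symm
      right_inv := fun x => by
        ext i
        simp only [sum_comp]
        rw [Finset.sum_eq_single i]
        · rw [comp_assoc (x i) (A.inj i) (A.proj i) _ (add_neg_cancel _) (by ring),
            A.inj_proj_self, comp_mk₀_id]
        · intro k _ hk
          rw [comp_assoc (x k) (A.inj k) (A.proj i) _ rfl (by ring), A.inj_proj_of_ne hk,
            ShiftedHom.comp_zero]
        · simp }
  rw [hdim, e.finrank_eq, Module.finrank_pi_fintype]
  rfl

/-- A free family of the right size gives a direct sum decomposition. -/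
lemma Free.exists_decomp {u : ∀ i, ShiftedHom (Z i).obj M.obj (-d i)} (h : Free u)
    (hs : ∀ (T : C) (n : ℤ), hdim T M n = ∑ i, hdim T (Z i) (n + d i)) :
    ∃ A : Decomp M Z d, A.inj = u := by
  classical
  have hs' : Function.Surjective (combine u M.obj 0) := by
    refine (LinearMap.injective_iff_surjective_of_finrank_eq_finrank ?_).1 (h.injective _ _)
    rw [Module.finrank_pi_fintype]
    exact (hs _ _).symm
  obtain ⟨x, hx⟩ : ∃ x : ∀ i, ShiftedHom M.obj (Z i).obj (d i),
      ∑ i, (x i).comp (u i) (neg_add_cancel (d i)) = mk₀ 0 rfl (𝟙 M.obj) := by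
    obtain ⟨x, hx⟩ := hs' (mk₀ 0 rfl (𝟙 M.obj))
    have key : ∀ (e : ι → ℤ) (he : ∀ i, e i = d i) (x : ∀ i, ShiftedHom M.obj (Z i).obj (e i)),
        ∑ i, (x i).comp (u i) (show -d i + e i = 0 by rw [he]; ring) = mk₀ 0 rfl (𝟙 M.obj) →
        ∃ x : ∀ i, ShiftedHom M.obj (Z i).obj (d i),
          ∑ i, (x i).comp (u i) (neg_add_cancel (d i)) = mk₀ 0 rfl (𝟙 M.obj) := by
      intro e he x hx
      obtain rfl : d = e := funext fun i => (he i).symm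
      exact ⟨x, hx⟩
    exact key _ (fun i => zero_add (d i)) x hx
  have horth (k i : ι) : (u k).comp (x i) (add_comm _ _) =
      (Pi.single k (mk₀ _ (neg_add_cancel (d k)) (𝟙 _)) :
        ∀ i, ShiftedHom (Z k).obj (Z i).obj (-d k + d i)) i := by
    refine sub_eq_zero.1 (h (Z k).obj (-d k) (fun i => (u k).comp (x i) (add_comm _ _) -
      (Pi.single k (mk₀ _ (neg_add_cancel (d k)) (𝟙 _)) :
        ∀ i, ShiftedHom (Z k).obj (Z i).obj (-d k + d i)) i) ?_ i)
    have e₁ (i : ι) : ((u k).comp (x i) (add_comm (d i) (-d k))).comp (u i)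
        (show -d i + (-d k + d i) = -d k by ring) =
        (u k).comp ((x i).comp (u i) (neg_add_cancel (d i))) (zero_add _) :=
      comp_assoc _ _ _ _ (neg_add_cancel (d i)) (by ring)
    simp only [sub_eq_add_neg, ShiftedHom.add_comp, ShiftedHom.neg_comp, Finset.sum_add_distrib,
      e₁, Finset.sum_neg_distrib]
    rw [← comp_sum, hx, comp_mk₀_id, Finset.sum_eq_single k, Pi.single_eq_same]
    · rw [ShiftedHom.mk₀_id_comp, add_neg_cancel]
    · intro i _ hi
      rw [Pi.single_eq_of_ne hi, ShiftedHom.zero_comp]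
    · simp
  have hself {k : ι} {m : ℤ} (hm : -d k + d k = m) (h₀ : d k + -d k = m) (h₁ : m = 0) :
      (u k).comp (x k) h₀ = mk₀ m h₁ (𝟙 _) := by
    subst hm
    rw [horth k k, Pi.single_eq_same]
  have hne {k i : ι} (hki : k ≠ i) {m : ℤ} (hm : -d k + d i = m) (h₀ : d i + -d k = m) :
      (u k).comp (x i) h₀ = 0 := by
    subst hm
    rw [horth k i, Pi.single_eq_of_ne hki.symm]
  exact ⟨{ proj := x, inj := u, sum_proj_inj := hx
           inj_proj_self := fun i => hself (by ring) _ _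
           inj_proj_of_ne := fun hij => hne hij (by ring) _ }, rfl⟩

end Bases

/-! ### Contractible complexes and homotopy equivalences -/

section Contraction

variable {C : Type u} [Category.{v} C] [Preadditive C] [Linear ℂ C] [HasShift C ℤ]
  [∀ n : ℤ, (shiftFunctor C n).Additive] [∀ n : ℤ, (shiftFunctor C n).Linear ℂ]

open ShiftedHom ProjObj

lemma Decomp.hom_ext {M : ProjObj C} {ι : Type} [Fintype ι] {Z : ι → ProjObj C} {d : ι → ℤ}
    (A : Decomp M Z d) {Y : C} {n : ℤ} {α β : ShiftedHom M.obj Y n}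
    (h : ∀ i, (A.inj i).comp α rfl = (A.inj i).comp β rfl) : α = β := by
  have e (α : ShiftedHom M.obj Y n) : α = (mk₀ 0 rfl (𝟙 _)).comp α (add_zero n) := by simp
  rw [e α, e β, A.comp_eq_sum, A.comp_eq_sum]
  simp only [h]

/-- A complex with compatible bases is contractible: every term has a basis consisting of elements
`x` and of the differentials of the basis elements of the first kind of the preceding term; `p` is
the part of the dual basis which corresponds to the elements of the second kind. The contraction
sends `d x` to `x`, and `x` to `0`. -/
lemma nonempty_homotopy_of_basis (Q : CochainComplex C ℤ) (J : ℤ → Type)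
    [∀ i, Fintype (J i)] (Z : ∀ i, J i → C) (e : ∀ i, J i → ℤ)
    (x : ∀ i (j : J i), ShiftedHom (Z i j) (Q.X i) (-e i j))
    (p : ∀ i (j : J i), ShiftedHom (Q.X (i + 1)) (Z i j) (e i j))
    (h₁ : ∀ i j k, (x (i + 1) j).comp (p i k) rfl = 0)
    (h₂ : ∀ i j, ((x i j).comp (mk₀ 0 rfl (Q.d i (i + 1))) (zero_add _)).comp (p i j)
      (add_neg_cancel _) = mk₀ 0 rfl (𝟙 _))
    (h₃ : ∀ i j k, j ≠ k → ((x i j).comp (mk₀ 0 rfl (Q.d i (i + 1))) (zero_add _)).comp (p i k)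
      rfl = 0)
    (hext : ∀ i (α β : ShiftedHom (Q.X (i + 1)) (Q.X (i + 1)) (0 : ℤ)),
      (∀ j, (x (i + 1) j).comp α (zero_add _) = (x (i + 1) j).comp β (zero_add _)) →
      (∀ j, ((x i j).comp (mk₀ 0 rfl (Q.d i (i + 1))) (zero_add _)).comp α (zero_add _) =
        ((x i j).comp (mk₀ 0 rfl (Q.d i (i + 1))) (zero_add _)).comp β (zero_add _)) → α = β) :
    Nonempty (Homotopy (𝟙 Q) 0) := by
  classical
  let s (i : ℤ) : ShiftedHom (Q.X (i + 1)) (Q.X i) (0 : ℤ) :=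
    ∑ j, (p i j).comp (x i j) (neg_add_cancel (e i j))
  have hs₁ (i : ℤ) (j : J (i + 1)) : (x (i + 1) j).comp (s i) (zero_add _) = 0 := by
    rw [comp_sum]
    refine Finset.sum_eq_zero fun k _ => ?_
    rw [← comp_assoc (x (i + 1) j) (p i k) (x i k) rfl _ (by ring), h₁, ShiftedHom.zero_comp]
  have hs₂ (i : ℤ) (j : J i) : ((x i j).comp (mk₀ 0 rfl (Q.d i (i + 1))) (zero_add _)).comp
      (s i) (zero_add _) = x i j := by
    rw [comp_sum, Finset.sum_eq_single j]
    · rw [← comp_assoc _ (p i j) (x i j) (add_neg_cancel (e i j)) _ (by simp), h₂, mk₀_id_comp]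
    · intro k _ hk
      rw [← comp_assoc _ (p i k) (x i k) rfl _ (by ring), h₃ i j k hk.symm, ShiftedHom.zero_comp]
    · simp
  let s' (i : ℤ) : Q.X (i + 1) ⟶ Q.X i := (homEquiv (0 : ℤ) rfl).symm (s i)
  have hs' (i : ℤ) : mk₀ (0 : ℤ) rfl (s' i) = s i := (homEquiv (0 : ℤ) rfl).apply_symm_apply _
  have key (i : ℤ) : Q.d (i + 1) (i + 1 + 1) ≫ s' (i + 1) + s' i ≫ Q.d i (i + 1) =
      𝟙 (Q.X (i + 1)) := by
    apply mk₀_injective (m₀ := (0 : ℤ)) (hm₀ := rfl)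
    rw [mk₀_add, ← mk₀_comp_mk₀ _ _ (add_zero 0) rfl rfl,
      ← mk₀_comp_mk₀ _ _ (add_zero 0) rfl rfl, hs', hs']
    refine hext i _ _ (fun j => ?_) (fun j => ?_)
    · rw [comp_add, ← comp_assoc (x (i + 1) j) (mk₀ 0 rfl (Q.d (i + 1) (i + 1 + 1))) _
        (zero_add _) _ (by simp), ← comp_assoc (x (i + 1) j) (s i) _ (zero_add _) _ (by simp),
        hs₁, ShiftedHom.zero_comp, add_zero, comp_mk₀_id]
      exact hs₂ (i + 1) j
    · rw [comp_add, ← comp_assoc _ (mk₀ 0 rfl (Q.d (i + 1) (i + 1 + 1))) _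
        (zero_add _) _ (by simp), ← comp_assoc _ (s i) _ (zero_add _) _ (by simp),
        hs₂, comp_assoc (x i j) _ _ (zero_add _) (add_zero 0) (by simp), mk₀_comp_mk₀]
      simp
  let h (i j : ℤ) (hij : (ComplexShape.up ℤ).Rel j i) : Q.X i ⟶ Q.X j :=
    (Q.XIsoOfEq (show j + 1 = i from hij)).inv ≫ s' j
  have hh : Homotopy.nullHomotopicMap' h = 𝟙 Q := by
    ext i
    obtain ⟨i, rfl⟩ : ∃ j, i = j + 1 := ⟨i - 1, by ring⟩
    rw [Homotopy.nullHomotopicMap'_f (k₂ := i) (k₁ := i + 1) (k₀ := i + 1 + 1) rfl rfl]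
    simpa [h] using key i
  exact ⟨(Homotopy.ofEq hh.symm).trans (Homotopy.nullHomotopy' h)⟩

/-- A morphism of complexes with a contractible mapping cone is a homotopy equivalence. -/
lemma isIso_quotient_map_of_cone [HasZeroObject C] [HasBinaryBiproducts C]
    {K L : CochainComplex C ℤ} (f : K ⟶ L)
    (h : Nonempty (Homotopy (𝟙 (CochainComplex.mappingCone f)) 0)) :
    IsIso ((HomotopyCategory.quotient C (ComplexShape.up ℤ)).map f) := by
  have h₁ := (HomotopyCategory.isZero_quotient_obj_iff _).2 h
  exact (Pretriangulated.Triangle.isZero₃_iff_isIso₁ _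
    (HomotopyCategory.mappingCone_triangleh_distinguished f)).1 h₁

/-- A family of morphisms `K.X i ⟶ L.X i` compatible with the differentials up to invertible
scalars can be rescaled to a morphism of complexes. -/
lemma exists_rescale {K L : CochainComplex C ℤ} (f : ∀ i, K.X i ⟶ L.X i)
    (hf : ∀ i, pcl₀ (f i) ≫ pcl₀ (L.d i (i + 1)) = pcl₀ (K.d i (i + 1)) ≫ pcl₀ (f (i + 1))) :
    ∃ (g : K ⟶ L) (c : ℤ → ℂˣ), ∀ i, g.f i = (c i : ℂ) • f i := by
  have h₁ (i : ℤ) : ∃ c : ℂˣ, K.d i (i + 1) ≫ f (i + 1) = (c : ℂ) • (f i ≫ L.d i (i + 1)) := by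
    have := hf i
    rw [← pcl₀_comp, ← pcl₀_comp, pcl₀, pcl₀, pcl_eq_iff] at this
    obtain ⟨c, hc⟩ := this
    exact ⟨c, mk₀_injective (m₀ := (0 : ℤ)) (hm₀ := rfl) (by rw [hc, mk₀_smul])⟩
  choose c hc using h₁
  obtain ⟨b, hb⟩ : ∃ b : ℤ → ℂˣ, ∀ i, b i = c i * b (i + 1) := by
    let a (n : ℕ) : ℂˣ := ∏ m ∈ Finset.range n, (c m)⁻¹
    let a' (n : ℕ) : ℂˣ := ∏ m ∈ Finset.range n, c (-(m : ℤ) - 1)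
    refine ⟨fun i => if 0 ≤ i then a i.toNat else a' (-i).toNat, fun i => ?_⟩
    rcases lt_trichotomy i (-1) with hi | hi | hi
    · obtain ⟨n, rfl⟩ : ∃ n : ℕ, i = -((n : ℤ) + 2) := ⟨(-i - 2).toNat, by omega⟩
      have e₁ : (-(-((n : ℤ) + 2))).toNat = n + 2 := by omega
      have e₂ : (-(-((n : ℤ) + 2) + 1)).toNat = n + 1 := by omega
      simp only [show ¬ (0 ≤ -((n : ℤ) + 2)) by omega, show ¬ (0 ≤ -((n : ℤ) + 2) + 1) by omega,
        if_false, e₁, e₂, a']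
      rw [Finset.prod_range_succ, mul_comm]
      congr 2
    · subst hi
      simp [a, a']
    · obtain ⟨n, rfl⟩ : ∃ n : ℕ, i = n := ⟨i.toNat, by omega⟩
      have e₂ : ((n : ℤ) + 1).toNat = n + 1 := by omega
      simp only [show (0 : ℤ) ≤ (n : ℤ) by omega, show (0 : ℤ) ≤ (n : ℤ) + 1 by omega,
        if_true, e₂, a, Int.toNat_natCast]
      rw [Finset.prod_range_succ, mul_comm (c n), mul_assoc]
      simp
  refine ⟨{ f := fun i => (b i : ℂ) • f i, comm' := ?_ }, b, fun i => rfl⟩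
  rintro i _ rfl
  rw [Linear.smul_comp, Linear.comp_smul, hc, smul_smul, hb i]
  simp [mul_comm]

/-- The decomposition of a biproduct given by decompositions of its two summands. -/
noncomputable def Decomp.ofBinary {M A B : C} (inl : A ⟶ M) (inr : B ⟶ M) (fst : M ⟶ A)
    (snd : M ⟶ B) (h₁ : inl ≫ fst = 𝟙 A) (h₂ : inr ≫ snd = 𝟙 B) (h₃ : inl ≫ snd = 0)
    (h₄ : inr ≫ fst = 0) (h₅ : fst ≫ inl + snd ≫ inr = 𝟙 M) {ι κ : Type} [Fintype ι] [Fintype κ]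
    {Z : ι → ProjObj C} {d : ι → ℤ} {Z' : κ → ProjObj C} {d' : κ → ℤ}
    (D : Decomp (toProj A) Z d) (D' : Decomp (toProj B) Z' d') :
    Decomp (toProj M) (Sum.elim Z Z') (Sum.elim d d') where
  proj
    | .inl i => (mk₀ 0 rfl fst).comp (D.proj i) (add_zero _)
    | .inr i => (mk₀ 0 rfl snd).comp (D'.proj i) (add_zero _)
  inj
    | .inl i => (D.inj i).comp (mk₀ 0 rfl inl) (zero_add _)
    | .inr i => (D'.inj i).comp (mk₀ 0 rfl inr) (zero_add _)
  sum_proj_inj := by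
    rw [Fintype.sum_sum_type]
    have key {A' : C} (i : A' ⟶ M) (q : M ⟶ A') {ν : Type} [Fintype ν] {W : ν → ProjObj C}
        {k : ν → ℤ} (D : Decomp (toProj A') W k) :
        ∑ j, ((mk₀ (0 : ℤ) rfl q).comp (D.proj j) (add_zero _)).comp
          ((D.inj j).comp (mk₀ (0 : ℤ) rfl i) (zero_add _)) (neg_add_cancel (k j)) =
            mk₀ 0 rfl (q ≫ i) := by
      have := congrArg (fun z => (mk₀ (0 : ℤ) rfl q).comp
        (ShiftedHom.comp z (mk₀ 0 rfl i) (zero_add 0)) (zero_add 0)) D.sum_proj_inj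
      simp only [sum_comp, comp_sum, mk₀_comp_mk₀, Category.id_comp] at this
      rw [← this]
      refine Finset.sum_congr rfl fun j _ => ?_
      have e := comp_assoc (mk₀ 0 rfl q) (D.proj j) ((D.inj j).comp (mk₀ 0 rfl i) (zero_add _))
        (add_zero _) (neg_add_cancel (k j)) (show -k j + k j + 0 = 0 by ring)
      exact e.trans (by rw [← comp_assoc (D.proj j) (D.inj j) _ (neg_add_cancel _) _ (by ring)])
    refine (congrArg₂ (fun x y => x + y) (key inl fst D) (key inr snd D')).trans ?_
    exact (mk₀_add _ _ _ _).symm.trans (by rw [h₅])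
  inj_proj_self := by
    have key {A B X : C} {i : A ⟶ B} {q : B ⟶ A} (h : i ≫ q = 𝟙 A) {k : ℤ}
        (α : ShiftedHom X A (-k)) (β : ShiftedHom A X k)
        (hαβ : α.comp β (add_neg_cancel k) = mk₀ 0 rfl (𝟙 X)) :
        (α.comp (mk₀ 0 rfl i) (zero_add _)).comp ((mk₀ 0 rfl q).comp β (add_zero _))
          (add_neg_cancel k) = mk₀ 0 rfl (𝟙 X) := by
      rw [comp_assoc α _ _ (zero_add _) (add_zero k) (by ring),
        ← comp_assoc (mk₀ 0 rfl i) _ β (add_zero 0) _ (by ring), mk₀_comp_mk₀, h]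
      simpa using hαβ
    rintro (i | i)
    · exact key h₁ _ _ (D.inj_proj_self i)
    · exact key h₂ _ _ (D'.inj_proj_self i)
  inj_proj_of_ne := by
    have key {A B A' X Y : C} {i : A ⟶ B} {q : B ⟶ A'} {k l : ℤ}
        (α : ShiftedHom X A (-k)) (β : ShiftedHom A' Y l)
        (hαβ : α.comp ((mk₀ 0 rfl (i ≫ q)).comp β (add_zero _)) rfl = 0) :
        (α.comp (mk₀ 0 rfl i) (zero_add _)).comp ((mk₀ 0 rfl q).comp β (add_zero _)) rfl = 0 := by
      rw [comp_assoc α _ _ (zero_add _) (add_zero l) (by ring),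
        ← comp_assoc (mk₀ 0 rfl i) _ β (add_zero 0) _ (by ring), mk₀_comp_mk₀]
      exact hαβ
    have key₁ {A B X Y : C} {i : A ⟶ B} {q : B ⟶ A} {k l : ℤ}
        (α : ShiftedHom X A (-k)) (β : ShiftedHom A Y l) (h : i ≫ q = 𝟙 A)
        (hαβ : α.comp β rfl = 0) :
        (α.comp (mk₀ 0 rfl i) (zero_add _)).comp ((mk₀ 0 rfl q).comp β (add_zero _)) rfl = 0 :=
      key _ _ (by rw [h, mk₀_id_comp]; exact hαβ)
    have key₂ {A B A' X Y : C} {i : A ⟶ B} {q : B ⟶ A'} {k l : ℤ}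
        (α : ShiftedHom X A (-k)) (β : ShiftedHom A' Y l) (h : i ≫ q = 0) :
        (α.comp (mk₀ 0 rfl i) (zero_add _)).comp ((mk₀ 0 rfl q).comp β (add_zero _)) rfl = 0 :=
      key _ _ (by rw [h]; simp)
    rintro (i | i) (k | k) hik
    · exact key₁ _ _ h₁ (D.inj_proj_of_ne (fun h => hik (by rw [h])))
    · exact key₂ _ _ h₃
    · exact key₂ _ _ h₄
    · exact key₁ _ _ h₂ (D'.inj_proj_of_ne (fun h => hik (by rw [h])))

/-- The decomposition of an object with itself as only summand. -/
noncomputable def Decomp.refl (M : C) :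
    Decomp (toProj M) (fun _ : Unit => toProj M) (fun _ => 0) where
  proj _ := mk₀ 0 rfl (𝟙 M)
  inj _ := mk₀ (-0) neg_zero (𝟙 M)
  sum_proj_inj := by simp
  inj_proj_self _ := by simp
  inj_proj_of_ne h := (h rfl).elim

lemma pcl₀_neg {X Y : C} (f : X ⟶ Y) : pcl₀ (-f) = pcl₀ f := by
  rw [pcl₀, pcl₀, pcl_eq_iff]
  exact ⟨-1, by simp⟩

/-- A criterion for a morphism of complexes `f` to be a homotopy equivalence: the elements `x` of the
terms of `K`, together with their images under the differential of the mapping cone, form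
triangular families of the right size in the terms of the mapping cone. The images are detected
either in `K` (by `v₂`) or in `L` (by `v₃`). -/
lemma isIso_quotient_map_of_triangular [hfd : ∀ X Y : C, Module.Finite ℂ (X ⟶ Y)]
    [HasZeroObject C] [HasBinaryBiproducts C] {K L : CochainComplex C ℤ} (f : K ⟶ L)
    (n : ℤ → ℕ) (Z : ℤ → C) (e : ∀ i, Fin (n i) → ℤ)
    (x : ∀ i (j : Fin (n i)), ShiftedHom (Z i) (K.X i) (-e i j))
    (v₁ : ∀ i, Fin (n i) → (toProj (K.X i) ⟶ toProj (Z i)))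
    (v₂ : ∀ i, Fin (n i) → (toProj (K.X (i + 1)) ⟶ toProj (Z i)))
    (v₃ : ∀ i, Fin (n i) → (toProj (L.X i) ⟶ toProj (Z i)))
    (P : ∀ i, Fin (n i) → Prop)
    (h₁ : ∀ i j, pcl (x i j) ≫ v₁ i j = 𝟙 _)
    (h₁' : ∀ i j k, k < j → IsNull (pcl (x i k) ≫ v₁ i j))
    (h₁'' : ∀ i (j : Fin (n (i + 1))) (k : Fin (n i)), (k : ℕ) ≤ j →
      IsNull (pcl (x i k) ≫ pcl₀ (K.d i (i + 1)) ≫ v₁ (i + 1) j))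
    (h₂ : ∀ i j, P i j → pcl (x i j) ≫ pcl₀ (K.d i (i + 1)) ≫ v₂ i j = 𝟙 _)
    (h₂' : ∀ i j k, P i j → k < j → IsNull (pcl (x i k) ≫ pcl₀ (K.d i (i + 1)) ≫ v₂ i j))
    (h₂'' : ∀ i (j : Fin (n i)) (k : Fin (n (i + 1))), P i j → (k : ℕ) < j →
      IsNull (pcl (x (i + 1) k) ≫ v₂ i j))
    (h₃ : ∀ i j, ¬ P i j → pcl (x i j) ≫ pcl₀ (f.f i) ≫ v₃ i j = 𝟙 _)
    (h₃' : ∀ i j k, ¬ P i j → k < j → IsNull (pcl (x i k) ≫ pcl₀ (f.f i) ≫ v₃ i j))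
    (hs : ∀ i T m, hdim T (toProj (K.X (i + 1))) m + hdim T (toProj (L.X i)) m =
      ∑ j, hdim T (toProj (Z (i + 1))) (m + e (i + 1) j) +
        ∑ j, hdim T (toProj (Z i)) (m + e i j)) :
    IsIso ((HomotopyCategory.quotient C (ComplexShape.up ℤ)).map f) := by
  classical
  apply isIso_quotient_map_of_cone
  let Q := CochainComplex.mappingCone f
  let inl (i : ℤ) : K.X (i + 1) ⟶ Q.X i :=
    (CochainComplex.mappingCone.inl f).v (i + 1) i (by omega)
  let inr (i : ℤ) : L.X i ⟶ Q.X i := (CochainComplex.mappingCone.inr f).f i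
  let fst (i : ℤ) : Q.X i ⟶ K.X (i + 1) := (CochainComplex.mappingCone.fst f).1.v i (i + 1) rfl
  let snd (i : ℤ) : Q.X i ⟶ L.X i := (CochainComplex.mappingCone.snd f).v i i (add_zero i)
  have inl_fst (i : ℤ) : inl i ≫ fst i = 𝟙 _ := CochainComplex.mappingCone.inl_v_fst_v _ _ _ _
  have inl_snd (i : ℤ) : inl i ≫ snd i = 0 := CochainComplex.mappingCone.inl_v_snd_v _ _ _ _
  have inl_d (i : ℤ) : inl i ≫ Q.d i (i + 1) = f.f (i + 1) ≫ inr (i + 1) -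
      K.d (i + 1) (i + 1 + 1) ≫ inl (i + 1) :=
    CochainComplex.mappingCone.inl_v_d f (i + 1) i (i + 1 + 1) (by omega) (by omega)
  have inr_fst (i : ℤ) : inr i ≫ fst i = 0 := CochainComplex.mappingCone.inr_f_fst_v _ _ _ _
  have inr_snd (i : ℤ) : inr i ≫ snd i = 𝟙 _ := CochainComplex.mappingCone.inr_f_snd_v _ _
  have d_fst (i : ℤ) : inl i ≫ Q.d i (i + 1) ≫ fst (i + 1) = -K.d (i + 1) (i + 1 + 1) := by
    rw [← Category.assoc, inl_d, Preadditive.sub_comp, Category.assoc, Category.assoc, inr_fst,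
      inl_fst]
    simp
  have d_snd (i : ℤ) : inl i ≫ Q.d i (i + 1) ≫ snd (i + 1) = f.f (i + 1) := by
    rw [← Category.assoc, inl_d, Preadditive.sub_comp, Category.assoc, Category.assoc, inr_snd,
      inl_snd]
    simp
  let y (i : ℤ) (j : Fin (n (i + 1))) : ShiftedHom (Z (i + 1)) (Q.X i) (-e (i + 1) j) :=
    (x (i + 1) j).comp (mk₀ 0 rfl (inl i)) (zero_add _)
  let dy (i : ℤ) (j : Fin (n (i + 1))) : ShiftedHom (Z (i + 1)) (Q.X (i + 1)) (-e (i + 1) j) :=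
    (y i j).comp (mk₀ 0 rfl (Q.d i (i + 1))) (zero_add _)
  have hy (i j) : pcl (y i j) = pcl (x (i + 1) j) ≫ pcl₀ (inl i) := pcl_comp _ _ _
  have hdy (i j) : pcl (dy i j) = pcl (x (i + 1) j) ≫ pcl₀ (inl i ≫ Q.d i (i + 1)) := by
    rw [pcl_comp, hy, pcl₀_comp, Category.assoc]; rfl
  have A₁ (i j) : pcl (y i j) ≫ pcl₀ (fst i) = pcl (x (i + 1) j) := by
    rw [hy, Category.assoc, ← pcl₀_comp, inl_fst, pcl₀_id, Category.comp_id]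
  have A₂ (i j) : IsNull (pcl (y i j) ≫ pcl₀ (snd i)) := by
    rw [hy, Category.assoc, ← pcl₀_comp, inl_snd]
    exact (isNull_pcl₀.2 rfl).comp_left _
  have B₁ (i j) : pcl (dy i j) ≫ pcl₀ (fst (i + 1)) =
      pcl (x (i + 1) j) ≫ pcl₀ (K.d (i + 1) (i + 1 + 1)) := by
    rw [hdy, Category.assoc, ← pcl₀_comp, Category.assoc, d_fst, pcl₀_neg]
  have B₂ (i j) : pcl (dy i j) ≫ pcl₀ (snd (i + 1)) =
      pcl (x (i + 1) j) ≫ pcl₀ (f.f (i + 1)) := by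
    rw [hdy, Category.assoc, ← pcl₀_comp, Category.assoc, d_snd]
  have main (i : ℤ) := by
    let Zs : Fin (n (i + 1 + 1)) ⊕ Fin (n (i + 1)) → ProjObj C :=
      fun s => toProj (Sum.elim (fun _ => Z (i + 1 + 1)) (fun _ => Z (i + 1)) s)
    let es : Fin (n (i + 1 + 1)) ⊕ Fin (n (i + 1)) → ℤ := Sum.elim (e (i + 1 + 1)) (e (i + 1))
    let us : ∀ s, ShiftedHom (Zs s).obj (toProj (Q.X (i + 1))).obj (-es s) := fun s =>
      match s with
      | .inl j => y (i + 1) j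
      | .inr j => dy i j
    let vs : ∀ s, toProj (Q.X (i + 1)) ⟶ Zs s := fun s =>
      match s with
      | .inl j => pcl₀ (fst (i + 1)) ≫ v₁ (i + 1 + 1) j
      | .inr j => if P (i + 1) j then pcl₀ (fst (i + 1)) ≫ v₂ (i + 1) j
          else pcl₀ (snd (i + 1)) ≫ v₃ (i + 1) j
    have hfree : Free us := by
      -- the triangular order alternates between the two kinds of basis elements
      refine Free.of_triangular us vs (Sum.elim
        (fun j : Fin (n (i + 1 + 1)) => 2 * (j : ℕ) + 1)
        (fun j : Fin (n (i + 1)) => 2 * (j : ℕ))) ?_ ?_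
      · rintro (j | j)
        · refine Eq.trans (?_ : _ = pcl (x (i + 1 + 1) j) ≫ v₁ (i + 1 + 1) j) (h₁ _ _)
          exact (Category.assoc _ _ _).symm.trans (congrArg (· ≫ _) (A₁ _ _))
        · by_cases hP : P (i + 1) j
          · simp only [vs, if_pos hP]
            refine Eq.trans ?_ (h₂ _ _ hP)
            rw [← Category.assoc (pcl (x (i + 1) j)), ← B₁]
            exact (Category.assoc _ _ _).symm
          · simp only [vs, if_neg hP]
            refine Eq.trans ?_ (h₃ _ _ hP)
            rw [← Category.assoc (pcl (x (i + 1) j)), ← B₂]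
            exact (Category.assoc _ _ _).symm
      · rintro (j | j) (k | k) hne hle
        · replace hle : 2 * (k : ℕ) + 1 ≤ 2 * (j : ℕ) + 1 := hle
          have hkj : k < j := lt_of_le_of_ne (Fin.le_def.2 (by omega)) fun h => hne (by rw [h])
          have := h₁' (i + 1 + 1) j k hkj
          rw [← A₁, Category.assoc] at this
          exact this
        · replace hle : 2 * (k : ℕ) ≤ 2 * (j : ℕ) + 1 := hle
          have := h₁'' (i + 1) j k (by omega)
          rw [← Category.assoc, ← B₁, Category.assoc] at this
          exact this
        · replace hle : 2 * (k : ℕ) + 1 ≤ 2 * (j : ℕ) := hle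
          by_cases hP : P (i + 1) j
          · simp only [vs, if_pos hP]
            have := h₂'' (i + 1) j k hP (by omega)
            rw [← A₁, Category.assoc] at this
            exact this
          · simp only [vs, if_neg hP]
            have := (A₂ (i + 1) k).comp (v₃ (i + 1) j)
            rw [Category.assoc] at this
            exact this
        · replace hle : 2 * (k : ℕ) ≤ 2 * (j : ℕ) := hle
          have hkj : k < j := lt_of_le_of_ne (Fin.le_def.2 (by omega)) fun h => hne (by rw [h])
          by_cases hP : P (i + 1) j
          · simp only [vs, if_pos hP]
            have := h₂' (i + 1) j k hP hkj
            rw [← Category.assoc, ← B₁, Category.assoc] at this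
            exact this
          · simp only [vs, if_neg hP]
            have := h₃' (i + 1) j k hP hkj
            rw [← Category.assoc, ← B₂, Category.assoc] at this
            exact this
    refine (hfree.exists_decomp fun T m => ?_ :
      ∃ A : Decomp (toProj (Q.X (i + 1))) Zs es, A.inj = us)
    have D := Decomp.ofBinary (inl (i + 1)) (inr (i + 1)) (fst (i + 1)) (snd (i + 1))
      (inl_fst _) (inr_snd _) (inl_snd _) (inr_fst _)
      (CochainComplex.mappingCone.id_X f (i + 1) (i + 1 + 1) rfl)
      (Decomp.refl _) (Decomp.refl _)
    have := D.hdim_eq T m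
    simp only [Fintype.sum_sum_type, Sum.elim_inl, Sum.elim_inr, Finset.univ_unique,
      Finset.sum_singleton, add_zero] at this
    rw [this, hs, Fintype.sum_sum_type]
    rfl
  choose A hA using main
  -- the elements `y` and `dy` are bases of the terms of the mapping cone
  refine nonempty_homotopy_of_basis Q (fun i => Fin (n (i + 1))) (fun i _ => Z (i + 1))
    (fun i => e (i + 1)) y (fun i j => (A i).proj (Sum.inr j)) ?_ ?_ ?_ ?_
  · intro i j k
    have := (A i).inj_proj_of_ne (i := Sum.inl j) (j := Sum.inr k) (by simp)
    rw [hA] at this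
    exact this
  · intro i j
    have := (A i).inj_proj_self (Sum.inr j)
    rw [hA] at this
    exact this
  · intro i j k hjk
    have := (A i).inj_proj_of_ne (i := Sum.inr j) (j := Sum.inr k) (by simpa using hjk)
    rw [hA] at this
    exact this
  · intro i α β hα hβ
    refine (A i).hom_ext ?_
    rw [hA]
    have key {X Y Y' : C} {k : ℤ} (γ : ShiftedHom X Y k) (α β : ShiftedHom Y Y' (0 : ℤ))
        (h : γ.comp α (zero_add k) = γ.comp β (zero_add k)) :
        γ.comp α rfl = γ.comp β (rfl : 0 + k = _) := by
      have : ∀ (l : ℤ) (hl : k = l), γ.comp α (by omega : 0 + k = l) =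
          γ.comp β (by omega : 0 + k = l) := by rintro _ rfl; exact h
      exact this (0 + k) (by omega)
    rintro (j | j)
    · exact key (y (i + 1) j) α β (hα j)
    · exact key (dy i j) α β (hβ j)

end Contraction

/-! ### Quantum direct sums -/

section QuantumSums

variable {C : Type u} [Category.{v} C] [Preadditive C] [Linear ℂ C] [HasShift C ℤ]
  [∀ n : ℤ, (shiftFunctor C n).Additive] [∀ n : ℤ, (shiftFunctor C n).Linear ℂ]

open ShiftedHom ProjObj

/-- A decomposition of `M` as the direct sum of `n` copies of `X`, shifted according to the quantum
integer `[n]`. -/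
abbrev QDecomp (M : ProjObj C) (n : ℕ) (X : ProjObj C) :=
  Decomp M (fun _ : Fin n => X) (fun k => (n : ℤ) - 1 - 2 * ((k : ℕ) : ℤ))

/-- The decomposition given by an isomorphism with a quantum direct sum. -/
noncomputable def QDecomp.ofIso [HasFiniteBiproducts C] {M X : C} {n : ℕ}
    (e : M ≅ quantumSum n X) : QDecomp (toProj M) n (toProj X) :=
  Decomp.ofIso (Z := fun _ : Fin n => X) e

/-- The projective class of a lowest degree inclusion belongs to a decomposition. -/
lemma IsLowestInclusion.exists_decomp [HasFiniteBiproducts C] {m : ℕ} {X Y : C}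
    {ι : ShiftedHom X Y (-(m : ℤ))} (h : IsLowestInclusion m ι) :
    ∃ D : QDecomp (toProj Y) (m + 1) (toProj X), D.j 0 = pcl ι := by
  obtain ⟨φ, rfl⟩ := h
  refine ⟨QDecomp.ofIso φ, ?_⟩
  have key {k l : ℤ} (hkl : k + l = 0) (g : X⟦k⟧ ⟶ Y) :
      (pcl ((toShift X k).comp (mk₀ (0 : ℤ) rfl g) (zero_add _)) : toProj X ⟶ toProj Y) =
      pcl ((shiftFunctorCompIsoId C k l hkl).inv.app X ≫ g⟦l⟧' : ShiftedHom X Y l) := by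
    obtain rfl : l = -k := by omega
    rw [comp_mk₀]; rfl
  exact key _ _

/-- The decomposition given by an isomorphism with a binary biproduct. -/
noncomputable def Decomp.ofBiprodIso {M A B : C} [HasBinaryBiproduct A B] (e : M ≅ A ⊞ B)
    {ι κ : Type} [Fintype ι] [Fintype κ] {Z : ι → ProjObj C} {d : ι → ℤ} {Z' : κ → ProjObj C}
    {d' : κ → ℤ} (D : Decomp (toProj A) Z d) (D' : Decomp (toProj B) Z' d') :
    Decomp (toProj M) (Sum.elim Z Z') (Sum.elim d d') :=
  Decomp.ofBinary (biprod.inl ≫ e.inv) (biprod.inr ≫ e.inv) (e.hom ≫ biprod.fst)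
    (e.hom ≫ biprod.snd) (by simp) (by simp) (by simp) (by simp)
    (by
      rw [Category.assoc, Category.assoc, ← Preadditive.comp_add, ← Category.assoc biprod.fst,
        ← Category.assoc biprod.snd, ← Preadditive.add_comp, biprod.total]
      simp) D D'

end QuantumSums

/-! ### The bicategory of projective classes -/

section ProjectiveFunctors

variable {C : Type u} [Category.{v} C] [Preadditive C] [Linear ℂ C] [HasShift C ℤ]
  [∀ n : ℤ, (shiftFunctor C n).Additive] [∀ n : ℤ, (shiftFunctor C n).Linear ℂ]
  {D : Type u'} [Category.{v'} D] [Preadditive D] [Linear ℂ D] [HasShift D ℤ]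
  [∀ n : ℤ, (shiftFunctor D n).Additive] [∀ n : ℤ, (shiftFunctor D n).Linear ℂ]

open ShiftedHom ProjObj

/-- The functor between categories of projective classes induced by a functor compatible with
shifts. -/
noncomputable def projFunctor (F : C ⥤ D) [F.Additive] [F.Linear ℂ] [F.CommShift ℤ] :
    ProjObj C ⥤ ProjObj D where
  obj X := ⟨F.obj X.obj⟩
  map := Quotient.map (fun p => ⟨p.1, p.2.map F⟩) (by
    rintro ⟨k, α⟩ _ ⟨c, rfl⟩
    exact ⟨c, by simp [ShiftedHom.map, F.map_smul]⟩)
  map_id X := by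
    change cl ((mk₀ (0 : ℤ) rfl (𝟙 X.obj)).map F) = cl (mk₀ 0 rfl (𝟙 (F.obj X.obj)))
    rw [map_mk₀, F.map_id]
  map_comp {X Y Z} φ ψ := by
    obtain ⟨⟨k, α⟩, rfl⟩ := Quotient.exists_rep φ
    obtain ⟨⟨l, β⟩, rfl⟩ := Quotient.exists_rep ψ
    change cl ((α.comp β rfl).map F) = cl ((α.map F).comp (β.map F) rfl)
    rw [map_comp]

variable (F : C ⥤ D) [F.Additive] [F.Linear ℂ] [F.CommShift ℤ]

lemma projFunctor_pcl {X Y : C} {k : ℤ} (α : ShiftedHom X Y k) :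
    (projFunctor F).map (pcl α) = pcl (α.map F) := rfl

lemma projFunctor_pcl₀ {X Y : C} (f : X ⟶ Y) : (projFunctor F).map (pcl₀ f) = pcl₀ (F.map f) := by
  rw [pcl₀, projFunctor_pcl, map_mk₀]; rfl

@[simp] lemma deg_projFunctor {X Y : ProjObj C} (φ : X ⟶ Y) :
    deg ((projFunctor F).map φ) = deg φ := by
  obtain ⟨k, α, rfl⟩ := exists_pcl φ
  rfl

lemma isNull_projFunctor {X Y : ProjObj C} {φ : X ⟶ Y} (h : IsNull φ) :
    IsNull ((projFunctor F).map φ) := by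
  obtain ⟨k, rfl⟩ := h
  exact ⟨k, by rw [projFunctor_pcl, ShiftedHom.map_zero]; rfl⟩

end ProjectiveFunctors

section ProjectiveBicategory

variable {B : Type u} [Bicategory.{w, v} B] [GradedLinearBicategory B]

open ShiftedHom ProjObj

instance {a b : B} (c : B) (f : a ⟶ b) : (Bicategory.precomp c f).Linear ℂ where
  map_smul _ _ := AdditiveLinearBicategory.whiskerLeft_smul f _ _

instance {b c : B} (a : B) (f : b ⟶ c) : (Bicategory.postcomp a f).Linear ℂ where
  map_smul _ _ := AdditiveLinearBicategory.smul_whiskerRight _ _ f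

/-- The morphism `f ≫ g⟨n⟩ ⟶ (f ≫ g)⟨n⟩`. -/
noncomputable def shiftOutLeft {a b c : B} (f : a ⟶ b) (g : b ⟶ c) (n : ℤ) :
    f ≫ g⟦n⟧ ⟶ (f ≫ g)⟦n⟧ :=
  ((Bicategory.precomp c f).commShiftIso n).hom.app g

/-- The morphism `f⟨n⟩ ≫ g ⟶ (f ≫ g)⟨n⟩`. -/
noncomputable def shiftOutRight {a b c : B} (f : a ⟶ b) (g : b ⟶ c) (n : ℤ) :
    f⟦n⟧ ≫ g ⟶ (f ≫ g)⟦n⟧ :=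
  ((Bicategory.postcomp a g).commShiftIso n).hom.app f

section

variable {a b c d : B}

lemma gradedWhiskerLeft_eq (f : a ⟶ b) {g h : b ⟶ c} {n : ℤ} (η : ShiftedHom g h n) :
    gradedWhiskerLeft f η = f ◁ η ≫ shiftOutLeft f h n := rfl

lemma gradedWhiskerRight_eq {f g : a ⟶ b} (h : b ⟶ c) {n : ℤ} (η : ShiftedHom f g n) :
    gradedWhiskerRight η h = η ▷ h ≫ shiftOutRight g h n := rfl

lemma shiftOutLeft_naturality_left {f f' : a ⟶ b} (η : f ⟶ f') (g : b ⟶ c) (n : ℤ) :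
    η ▷ (g⟦n⟧) ≫ shiftOutLeft f' g n = shiftOutLeft f g n ≫ (η ▷ g)⟦n⟧' :=
  GradedLinearBicategory.left_naturality η g n

lemma shiftOutRight_naturality_right (f : a ⟶ b) {g g' : b ⟶ c} (η : g ⟶ g') (n : ℤ) :
    (f⟦n⟧) ◁ η ≫ shiftOutRight f g' n = shiftOutRight f g n ≫ (f ◁ η)⟦n⟧' :=
  GradedLinearBicategory.right_naturality f η n

lemma shiftOutLeft_id (g : a ⟶ b) (n : ℤ) :
    shiftOutLeft (𝟙 a) g n ≫ (λ_ g).hom⟦n⟧' = (λ_ (g⟦n⟧)).hom :=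
  GradedLinearBicategory.left_unitor g n

lemma shiftOutRight_id (f : a ⟶ b) (n : ℤ) :
    shiftOutRight f (𝟙 b) n ≫ (ρ_ f).hom⟦n⟧' = (ρ_ (f⟦n⟧)).hom :=
  GradedLinearBicategory.right_unitor f n

lemma shiftOut_assoc_left (f : a ⟶ b) (g : b ⟶ c) (h : c ⟶ d) (n : ℤ) :
    shiftOutLeft (f ≫ g) h n ≫ (α_ f g h).hom⟦n⟧' =
      (α_ f g (h⟦n⟧)).hom ≫ f ◁ shiftOutLeft g h n ≫ shiftOutLeft f (g ≫ h) n :=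
  GradedLinearBicategory.associator_left f g h n

lemma shiftOut_assoc_middle (f : a ⟶ b) (g : b ⟶ c) (h : c ⟶ d) (n : ℤ) :
    shiftOutLeft f g n ▷ h ≫ shiftOutRight (f ≫ g) h n ≫ (α_ f g h).hom⟦n⟧' =
      (α_ f (g⟦n⟧) h).hom ≫ f ◁ shiftOutRight g h n ≫ shiftOutLeft f (g ≫ h) n :=
  GradedLinearBicategory.associator_middle f g h n

lemma shiftOut_assoc_right (f : a ⟶ b) (g : b ⟶ c) (h : c ⟶ d) (n : ℤ) :
    shiftOutRight f g n ▷ h ≫ shiftOutRight (f ≫ g) h n ≫ (α_ f g h).hom⟦n⟧' =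
      (α_ (f⟦n⟧) g h).hom ≫ shiftOutRight f (g ≫ h) n :=
  GradedLinearBicategory.associator_right f g h n

lemma shiftOut_interchange (f : a ⟶ b) (g : b ⟶ c) (m n : ℤ) :
    shiftOutLeft (f⟦m⟧) g n ≫ (shiftOutRight f g m)⟦n⟧' =
      GradedLinearBicategory.sign B ^ (m * n) •
        (shiftOutRight f (g⟦n⟧) m ≫ (shiftOutLeft f g n)⟦m⟧' ≫ (shiftComm (f ≫ g) n m).hom) :=
  GradedLinearBicategory.interchange f g m n

end

lemma pcl_gradedWhiskerLeft_id {a b : B} {g h : a ⟶ b} {n : ℤ} (η : ShiftedHom g h n) :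
    pcl (gradedWhiskerLeft (𝟙 a) η) ≫ pcl₀ (λ_ h).hom = pcl₀ (λ_ g).hom ≫ pcl η := by
  rw [← pcl_comp_pcl₀, ← pcl₀_comp_pcl, gradedWhiskerLeft_eq, Category.assoc, shiftOutLeft_id]
  congr 1
  exact Bicategory.leftUnitor_naturality _

lemma pcl_gradedWhiskerRight_id {a b : B} {g h : a ⟶ b} {n : ℤ} (η : ShiftedHom g h n) :
    pcl (gradedWhiskerRight η (𝟙 b)) ≫ pcl₀ (ρ_ h).hom = pcl₀ (ρ_ g).hom ≫ pcl η := by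
  rw [← pcl_comp_pcl₀, ← pcl₀_comp_pcl, gradedWhiskerRight_eq, Category.assoc, shiftOutRight_id]
  congr 1
  exact Bicategory.rightUnitor_naturality _

lemma pcl_gradedWhiskerLeft_comp {a b c d : B} (f : a ⟶ b) (g : b ⟶ c) {h h' : c ⟶ d} {n : ℤ}
    (η : ShiftedHom h h' n) :
    pcl (gradedWhiskerLeft (f ≫ g) η) ≫ pcl₀ (α_ f g h').hom =
      pcl₀ (α_ f g h).hom ≫ pcl (gradedWhiskerLeft f (gradedWhiskerLeft g η)) := by
  rw [← pcl_comp_pcl₀, ← pcl₀_comp_pcl]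
  congr 1
  rw [gradedWhiskerLeft_eq, gradedWhiskerLeft_eq, gradedWhiskerLeft_eq, Category.assoc,
    shiftOut_assoc_left, Bicategory.whiskerLeft_comp]
  simp [Bicategory.comp_whiskerLeft]

lemma pcl_gradedWhiskerRight_comp {a b c d : B} {f f' : a ⟶ b} (g : b ⟶ c) (h : c ⟶ d) {n : ℤ}
    (η : ShiftedHom f f' n) :
    pcl (gradedWhiskerRight (gradedWhiskerRight η g) h) ≫ pcl₀ (α_ f' g h).hom =
      pcl₀ (α_ f g h).hom ≫ pcl (gradedWhiskerRight η (g ≫ h)) := by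
  rw [← pcl_comp_pcl₀, ← pcl₀_comp_pcl]
  congr 1
  rw [gradedWhiskerRight_eq, gradedWhiskerRight_eq, gradedWhiskerRight_eq,
    Bicategory.comp_whiskerRight, Category.assoc, Category.assoc, shiftOut_assoc_right]
  simp

lemma pcl_gradedWhisker_assoc {a b c d : B} (f : a ⟶ b) {g g' : b ⟶ c} (h : c ⟶ d) {n : ℤ}
    (η : ShiftedHom g g' n) :
    pcl (gradedWhiskerRight (gradedWhiskerLeft f η) h) ≫ pcl₀ (α_ f g' h).hom =
      pcl₀ (α_ f g h).hom ≫ pcl (gradedWhiskerLeft f (gradedWhiskerRight η h)) := by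
  rw [← pcl_comp_pcl₀, ← pcl₀_comp_pcl]
  congr 1
  rw [gradedWhiskerRight_eq, gradedWhiskerRight_eq, gradedWhiskerLeft_eq, gradedWhiskerLeft_eq,
    Bicategory.comp_whiskerRight, Category.assoc, Category.assoc, shiftOut_assoc_middle]
  simp

/-- The signs in the interchange law disappear on projective classes. -/
lemma pcl_gradedWhisker_exchange {a b c : B} {f g : a ⟶ b} {h i : b ⟶ c} {m n : ℤ}
    (η : ShiftedHom h i n) (θ : ShiftedHom f g m) :
    pcl (gradedWhiskerLeft f η) ≫ pcl (gradedWhiskerRight θ i) =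
      pcl (gradedWhiskerRight θ h) ≫ pcl (gradedWhiskerLeft g η) := by
  rw [← pcl_comp _ _ rfl, ← pcl_comp _ _ (add_comm n m), eq_comm, pcl_eq_iff]
  let sg : ℤˣ := GradedLinearBicategory.sign B ^ (m * n)
  refine ⟨Units.map (Int.castRingHom ℂ).toMonoidHom sg, ?_⟩
  have h₁ : (((Units.map (Int.castRingHom ℂ).toMonoidHom sg : ℂˣ)) : ℂ) = ((sg : ℤ) : ℂ) := rfl
  rw [h₁, Int.cast_smul_eq_zsmul]
  have h₅ : f ◁ η ≫ θ ▷ (i⟦n⟧) = θ ▷ h ≫ (g⟦m⟧) ◁ η := Bicategory.whisker_exchange θ η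
  have h₆ : (shiftComm (g ≫ i) n m).hom =
      (shiftFunctorAdd' _ n m (m + n) (add_comm n m)).inv.app (g ≫ i) ≫
        (shiftFunctorAdd' _ m n (m + n) rfl).hom.app (g ≫ i) := by
    simp [shiftComm, shiftFunctorComm_eq _ n m (m + n) (add_comm n m)]
  have e₂ : (shiftComm (g ≫ i) n m).hom ≫
      (shiftFunctorAdd' _ m n (m + n) rfl).inv.app (g ≫ i) =
      (shiftFunctorAdd' _ n m (m + n) (add_comm n m)).inv.app (g ≫ i) := by
    rw [h₆]; simp
  have l₁ : (gradedWhiskerLeft f η).comp (gradedWhiskerRight θ i) rfl =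
      f ◁ η ≫ (θ ▷ (i⟦n⟧) ≫ (shiftOutLeft (g⟦m⟧) i n ≫ (shiftOutRight g i m)⟦n⟧')) ≫
        (shiftFunctorAdd' _ m n (m + n) rfl).inv.app (g ≫ i) := by
    rw [ShiftedHom.comp, gradedWhiskerLeft_eq, gradedWhiskerRight_eq, Functor.map_comp,
      reassoc_of% shiftOutLeft_naturality_left θ i n]
    simp only [Category.assoc]
  have l₂ : (gradedWhiskerRight θ h).comp (gradedWhiskerLeft g η) (add_comm n m) =
      θ ▷ h ≫ (((g⟦m⟧) ◁ η ≫ shiftOutRight g (i⟦n⟧) m) ≫ (shiftOutLeft g i n)⟦m⟧') ≫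
        (shiftFunctorAdd' _ n m (m + n) (add_comm n m)).inv.app (g ≫ i) := by
    rw [ShiftedHom.comp, gradedWhiskerLeft_eq, gradedWhiskerRight_eq, Functor.map_comp,
      shiftOutRight_naturality_right]
    simp only [Category.assoc]
  rw [l₁, l₂, shiftOut_interchange]
  simp only [Units.smul_def, Preadditive.comp_zsmul, Preadditive.zsmul_comp, Category.assoc, e₂]
  rw [reassoc_of% h₅]

/-- The objects of a graded linear bicategory, regarded as the objects of the bicategory whose
2-morphisms are the homogeneous 2-morphisms up to invertible scalars. -/
structure PB (B : Type u) where
  /-- the underlying object -/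
  as : B

noncomputable instance : Bicategory (PB B) where
  Hom X Y := ProjObj (X.as ⟶ Y.as)
  id X := ⟨𝟙 X.as⟩
  comp f g := ⟨f.obj ≫ g.obj⟩
  homCategory _ _ := inferInstance
  whiskerLeft {_ _ c} f _ _ η := (projFunctor (Bicategory.precomp c.as f.obj)).map η
  whiskerRight {a _ _ _ _} η h := (projFunctor (Bicategory.postcomp a.as h.obj)).map η
  associator f g h := pisoOfIso (α_ f.obj g.obj h.obj)
  leftUnitor f := pisoOfIso (λ_ f.obj)
  rightUnitor f := pisoOfIso (ρ_ f.obj)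
  whiskerLeft_id _ _ := CategoryTheory.Functor.map_id _ _
  whiskerLeft_comp _ _ _ _ _ _ := CategoryTheory.Functor.map_comp _ _ _
  id_whiskerLeft η := by
    obtain ⟨k, α, rfl⟩ := exists_pcl η
    rw [← Category.assoc]
    exact (Iso.eq_comp_inv _).2 (pcl_gradedWhiskerLeft_id α)
  comp_whiskerLeft f g _ _ η := by
    obtain ⟨k, α, rfl⟩ := exists_pcl η
    exact ((Iso.eq_comp_inv _).2 (pcl_gradedWhiskerLeft_comp f.obj g.obj α)).trans
      (Category.assoc _ _ _)
  id_whiskerRight _ _ := CategoryTheory.Functor.map_id _ _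
  comp_whiskerRight _ _ _ := CategoryTheory.Functor.map_comp _ _ _
  whiskerRight_id η := by
    obtain ⟨k, α, rfl⟩ := exists_pcl η
    rw [← Category.assoc]
    exact (Iso.eq_comp_inv _).2 (pcl_gradedWhiskerRight_id α)
  whiskerRight_comp η g h := by
    obtain ⟨k, α, rfl⟩ := exists_pcl η
    exact (Iso.eq_inv_comp _).2 (pcl_gradedWhiskerRight_comp g.obj h.obj α).symm
  whisker_assoc f _ _ η h := by
    obtain ⟨k, α, rfl⟩ := exists_pcl η
    exact ((Iso.eq_comp_inv _).2 (pcl_gradedWhisker_assoc f.obj h.obj α)).trans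
      (Category.assoc _ _ _)
  whisker_exchange θ η := by
    obtain ⟨k, α, rfl⟩ := exists_pcl η
    obtain ⟨l, β, rfl⟩ := exists_pcl θ
    exact pcl_gradedWhisker_exchange α β
  pentagon {a _ _ _ e} f g h i := by
    have := congrArg pcl₀ (Bicategory.pentagon f.obj g.obj h.obj i.obj)
    simp only [pcl₀_comp] at this
    exact (congrArg₂ (· ≫ ·) (projFunctor_pcl₀ (Bicategory.postcomp a.as i.obj) _)
      (congrArg₂ (· ≫ ·) rfl (projFunctor_pcl₀ (Bicategory.precomp e.as f.obj) _))).trans this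
  triangle {a _ c} f g := by
    have := congrArg pcl₀ (Bicategory.triangle f.obj g.obj)
    simp only [pcl₀_comp] at this
    exact (congrArg₂ (· ≫ ·) rfl (projFunctor_pcl₀ (Bicategory.precomp c.as f.obj) _)).trans
      (this.trans (projFunctor_pcl₀ (Bicategory.postcomp a.as g.obj) _).symm)

namespace PB

variable {a b c : PB B}

/-- The degree of a homogeneous 2-morphism up to scalars. -/
def deg {f g : a ⟶ b} (φ : f ⟶ g) : ℤ := ProjObj.deg φ

/-- A 2-morphism of projective classes is null if it is the class of a zero morphism. -/
def IsNull {f g : a ⟶ b} (φ : f ⟶ g) : Prop := ProjObj.IsNull φ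

section

variable {f g h : a ⟶ b}

@[simp] lemma deg_comp (φ : f ⟶ g) (ψ : g ⟶ h) : deg (φ ≫ ψ) = deg φ + deg ψ :=
  ProjObj.deg_comp φ ψ

@[simp] lemma deg_id (f : a ⟶ b) : deg (𝟙 f) = 0 := rfl

@[simp] lemma deg_iso_inv (e : f ≅ g) : deg e.inv = -deg e.hom := ProjObj.deg_iso_inv e

lemma deg_of_comp_eq_id {φ : f ⟶ g} {ψ : g ⟶ f} (h : φ ≫ ψ = 𝟙 f) : deg ψ = -deg φ :=
  ProjObj.deg_inv_of_comp_eq_id h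

lemma IsNull.comp {φ : f ⟶ g} (hφ : IsNull φ) (ψ : g ⟶ h) : IsNull (φ ≫ ψ) :=
  ProjObj.IsNull.comp hφ ψ

lemma IsNull.comp_left {ψ : g ⟶ h} (hψ : IsNull ψ) (φ : f ⟶ g) : IsNull (φ ≫ ψ) :=
  ProjObj.IsNull.comp_left hψ φ

lemma IsNull.eq {φ ψ : f ⟶ g} (hφ : IsNull φ) (hψ : IsNull ψ) (h : deg φ = deg ψ) : φ = ψ :=
  ProjObj.IsNull.eq hφ hψ h

lemma exists_isNull (f g : a ⟶ b) (n : ℤ) : ∃ φ : f ⟶ g, IsNull φ ∧ deg φ = n :=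
  ProjObj.exists_isNull f g n

lemma isNull_of_isNull_id (hf : IsNull (𝟙 f)) (φ : f ⟶ g) : IsNull φ :=
  ProjObj.isNull_of_isNull_id hf φ

lemma isNull_of_isNull_id' (hg : IsNull (𝟙 g)) (φ : f ⟶ g) : IsNull φ :=
  ProjObj.isNull_of_isNull_id' hg φ

@[simp] lemma isNull_comp_iso (φ : f ⟶ g) (e : g ≅ h) : IsNull (φ ≫ e.hom) ↔ IsNull φ :=
  ProjObj.isNull_comp_iso φ e

@[simp] lemma isNull_iso_comp (e : f ≅ g) (φ : g ⟶ h) : IsNull (e.hom ≫ φ) ↔ IsNull φ :=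
  ProjObj.isNull_iso_comp e φ

@[simp] lemma isNull_comp_iso_inv (φ : f ⟶ g) (e : h ≅ g) : IsNull (φ ≫ e.inv) ↔ IsNull φ :=
  isNull_comp_iso φ e.symm

@[simp] lemma isNull_iso_inv_comp (e : g ≅ f) (φ : g ⟶ h) : IsNull (e.inv ≫ φ) ↔ IsNull φ :=
  isNull_iso_comp e.symm φ

end

@[simp] lemma deg_whiskerLeft (f : a ⟶ b) {g h : b ⟶ c} (η : g ⟶ h) : deg (f ◁ η) = deg η :=
  deg_projFunctor _ _

@[simp] lemma deg_whiskerRight {f g : a ⟶ b} (η : f ⟶ g) (h : b ⟶ c) : deg (η ▷ h) = deg η :=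
  deg_projFunctor _ _

lemma IsNull.whiskerLeft {g h : b ⟶ c} {η : g ⟶ h} (hη : IsNull η) (f : a ⟶ b) :
    IsNull (f ◁ η) := isNull_projFunctor _ hη

lemma IsNull.whiskerRight {f g : a ⟶ b} {η : f ⟶ g} (hη : IsNull η) (h : b ⟶ c) :
    IsNull (η ▷ h) := isNull_projFunctor _ hη

@[simp] lemma deg_associator_hom {d : PB B} (f : a ⟶ b) (g : b ⟶ c) (h : c ⟶ d) :
    deg (α_ f g h).hom = 0 := rfl

@[simp] lemma deg_leftUnitor_hom (f : a ⟶ b) : deg (λ_ f).hom = 0 := rfl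
@[simp] lemma deg_rightUnitor_hom (f : a ⟶ b) : deg (ρ_ f).hom = 0 := rfl

variable {ι : Type} [Fintype ι] {d : ι → ℤ}

/-- Left whiskering of a factorization of the identity. -/
noncomputable def facLeft (f : a ⟶ b) {g : b ⟶ c} {Z : ι → (b ⟶ c)} (D : Fac g Z d) :
    Fac (f ≫ g) (fun i => f ≫ Z i) d :=
  Fac.map (Z := fun i => (Z i).obj) D (Bicategory.precomp c.as f.obj)

/-- Left whiskering of a direct sum decomposition. -/
noncomputable def decompLeft (f : a ⟶ b) {g : b ⟶ c} {Z : ι → (b ⟶ c)} (D : Decomp g Z d) :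
    Decomp (f ≫ g) (fun i => f ≫ Z i) d :=
  Decomp.map (Z := fun i => (Z i).obj) D (Bicategory.precomp c.as f.obj)

/-- Right whiskering of a direct sum decomposition. -/
noncomputable def decompRight {f : a ⟶ b} {Z : ι → (a ⟶ b)} (D : Decomp f Z d) (g : b ⟶ c) :
    Decomp (f ≫ g) (fun i => Z i ≫ g) d :=
  Decomp.map (Z := fun i => (Z i).obj) D (Bicategory.postcomp a.as g.obj)

section

variable (f : a ⟶ b) {g : b ⟶ c} {Z : ι → (b ⟶ c)} (i : ι)

@[simp] lemma facLeft_p (D : Fac g Z d) : (facLeft f D).p i = f ◁ D.p i := rfl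
@[simp] lemma facLeft_j (D : Fac g Z d) : (facLeft f D).j i = f ◁ D.j i := rfl
@[simp] lemma decompLeft_p (D : Decomp g Z d) : (decompLeft f D).p i = f ◁ D.p i := rfl
@[simp] lemma decompLeft_j (D : Decomp g Z d) : (decompLeft f D).j i = f ◁ D.j i := rfl

end

section

variable {f : a ⟶ b} {Z : ι → (a ⟶ b)} (g : b ⟶ c) (i : ι)

@[simp] lemma decompRight_p (D : Decomp f Z d) : (decompRight D g).p i = D.p i ▷ g := rfl
@[simp] lemma decompRight_j (D : Decomp f Z d) : (decompRight D g).j i = D.j i ▷ g := rfl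

end

end PB

end ProjectiveBicategory

/-! ### The opposite bicategory -/

section Opposite

variable {B : Type u} [Bicategory.{w, v} B]

/-- The bicategory with reversed 1-morphisms. -/
structure BOp (B : Type u) where
  /-- the underlying object -/
  of : B

instance : Bicategory (BOp B) where
  Hom X Y := Y.of ⟶ X.of
  id X := 𝟙 X.of
  comp f g := g ≫ f
  homCategory X Y := inferInstanceAs (Category (Y.of ⟶ X.of))
  whiskerLeft f _ _ η := η ▷ f
  whiskerRight η f := f ◁ η
  associator f g h := (α_ h g f).symm
  leftUnitor f := ρ_ f
  rightUnitor f := λ_ f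
  whiskerLeft_id f _ := Bicategory.id_whiskerRight _ f
  whiskerLeft_comp f _ _ _ η θ := Bicategory.comp_whiskerRight η θ f
  id_whiskerLeft η := Bicategory.whiskerRight_id η
  comp_whiskerLeft f g _ _ η := Bicategory.whiskerRight_comp η g f
  id_whiskerRight f g := Bicategory.whiskerLeft_id _ _
  comp_whiskerRight η θ f := Bicategory.whiskerLeft_comp f η θ
  whiskerRight_id η := Bicategory.id_whiskerLeft η
  whiskerRight_comp η g h := Bicategory.comp_whiskerLeft h g η
  whisker_assoc f _ _ η h := by
    have := Bicategory.whisker_assoc h η f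
    change h ◁ (η ▷ f) = (α_ _ _ _).inv ≫ (h ◁ η) ▷ f ≫ (α_ _ _ _).hom
    simp
  whisker_exchange η θ := (Bicategory.whisker_exchange θ η).symm
  pentagon f g h i := Bicategory.pentagon_inv i h g f
  triangle f g := Bicategory.triangle_assoc_comp_right g f

variable [GradedLinearBicategory B]

noncomputable instance : GradedLinearBicategory (BOp B) where
  preadditive a b := inferInstanceAs (Preadditive (b.of ⟶ a.of))
  linear a b := inferInstanceAs (Linear ℂ (b.of ⟶ a.of))
  hasFiniteBiproducts a b := inferInstanceAs (HasFiniteBiproducts (b.of ⟶ a.of))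
  whiskerLeft_add f _ _ η θ := AdditiveLinearBicategory.add_whiskerRight (B := B) η θ f
  add_whiskerRight η θ f := AdditiveLinearBicategory.whiskerLeft_add (B := B) f η θ
  whiskerLeft_smul f _ _ z η := AdditiveLinearBicategory.smul_whiskerRight (B := B) z η f
  smul_whiskerRight z η f := AdditiveLinearBicategory.whiskerLeft_smul (B := B) f z η
  hasShift a b := inferInstanceAs (HasShift (b.of ⟶ a.of) ℤ)
  shift_additive a b n := inferInstanceAs ((shiftFunctor (b.of ⟶ a.of) n).Additive)
  shift_linear a b n := inferInstanceAs ((shiftFunctor (b.of ⟶ a.of) n).Linear ℂ)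
  commShiftLeft c f := GradedLinearBicategory.commShiftRight (B := B) c.of f
  commShiftRight a _ _ g := GradedLinearBicategory.commShiftLeft (B := B) a.of g
  left_naturality η g n := GradedLinearBicategory.right_naturality (B := B) g η n
  right_naturality f _ _ η n := GradedLinearBicategory.left_naturality (B := B) η f n
  left_unitor g n := GradedLinearBicategory.right_unitor (B := B) g n
  right_unitor f n := GradedLinearBicategory.left_unitor (B := B) f n
  associator_left {a b c d} f g h n := by
    let f : b.of ⟶ a.of := f
    let g : c.of ⟶ b.of := g
    let h : d.of ⟶ c.of := h
    have e := shiftOut_assoc_right (B := B) h g f n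
    change shiftOutRight h (g ≫ f) n ≫ (α_ h g f).inv⟦n⟧' = (α_ (h⟦n⟧) g f).inv ≫
      shiftOutRight h g n ▷ f ≫ shiftOutRight (h ≫ g) f n
    rw [Iso.eq_inv_comp, ← Category.assoc, ← e]
    simp only [Category.assoc, ← Functor.map_comp, Iso.hom_inv_id]
    simp
  associator_middle {a b c d} f g h n := by
    let f : b.of ⟶ a.of := f
    let g : c.of ⟶ b.of := g
    let h : d.of ⟶ c.of := h
    have e := shiftOut_assoc_middle (B := B) h g f n
    change h ◁ shiftOutRight g f n ≫ shiftOutLeft h (g ≫ f) n ≫ (α_ h g f).inv⟦n⟧' =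
      (α_ h (g⟦n⟧) f).inv ≫ shiftOutLeft h g n ▷ f ≫ shiftOutRight (h ≫ g) f n
    rw [Iso.eq_inv_comp, ← Category.assoc (h ◁ _), ← Category.assoc, ← e]
    simp only [Category.assoc, ← Functor.map_comp, Iso.hom_inv_id]
    simp
  associator_right {a b c d} f g h n := by
    let f : b.of ⟶ a.of := f
    let g : c.of ⟶ b.of := g
    let h : d.of ⟶ c.of := h
    have e := shiftOut_assoc_left (B := B) h g f n
    change h ◁ shiftOutLeft g f n ≫ shiftOutLeft h (g ≫ f) n ≫ (α_ h g f).inv⟦n⟧' =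
      (α_ h g (f⟦n⟧)).inv ≫ shiftOutLeft (h ≫ g) f n
    rw [Iso.eq_inv_comp, ← Category.assoc (h ◁ _), ← Category.assoc, ← e]
    simp only [Category.assoc, ← Functor.map_comp, Iso.hom_inv_id]
    simp
  sign := GradedLinearBicategory.sign B
  interchange {a b c} f g m n := by
    let f : b.of ⟶ a.of := f
    let g : c.of ⟶ b.of := g
    have e := shiftOut_interchange (B := B) g f n m
    change shiftOutRight g (f⟦m⟧) n ≫ (shiftOutLeft g f m)⟦n⟧' =
      GradedLinearBicategory.sign B ^ (m * n) •
        (shiftOutLeft (g⟦n⟧) f m ≫ (shiftOutRight g f n)⟦m⟧' ≫ (shiftComm (g ≫ f) n m).hom)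
    have e' := congrArg (· ≫ (shiftComm (g ≫ f) n m).hom) e
    simp only [Category.assoc, Units.smul_def, Preadditive.zsmul_comp] at e'
    rw [e', Units.smul_def, smul_smul]
    have h₁ : (shiftComm (g ≫ f) m n).hom ≫ (shiftComm (g ≫ f) n m).hom = 𝟙 _ :=
      (congrArg (fun e : _ ≅ _ => (shiftComm (g ≫ f) m n).hom ≫ e.hom)
        (shiftComm_symm (g ≫ f) m n).symm).trans (Iso.hom_inv_id _)
    rw [h₁, Category.comp_id, mul_comm n m, ← Units.val_mul, ← mul_zpow, Int.units_mul_self]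
    simp

end Opposite

namespace CategoryTheory.Bicategory.Adjunction

variable {B : Type u} [Bicategory.{w, v} B] {a b : B}

lemma left_triangle_explicit {f : a ⟶ b} {g : b ⟶ a} (adj : f ⊣ g) :
    adj.unit ▷ f ≫ (α_ f g f).hom ≫ f ◁ adj.counit = (λ_ f).hom ≫ (ρ_ f).inv := by
  have := adj.left_triangle
  simpa [leftZigzag, bicategoricalComp] using this

lemma right_triangle_explicit {f : a ⟶ b} {g : b ⟶ a} (adj : f ⊣ g) :
    g ◁ adj.unit ≫ (α_ g f g).inv ≫ adj.counit ▷ g = (ρ_ g).hom ≫ (λ_ g).inv := by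
  have := adj.right_triangle
  simpa [rightZigzag, bicategoricalComp] using this

/-- An adjunction from the explicit form of the triangle identities. -/
def mkExplicit {f : a ⟶ b} {g : b ⟶ a} (η : 𝟙 a ⟶ f ≫ g) (e : g ≫ f ⟶ 𝟙 b)
    (h₁ : η ▷ f ≫ (α_ f g f).hom ≫ f ◁ e = (λ_ f).hom ≫ (ρ_ f).inv)
    (h₂ : g ◁ η ≫ (α_ g f g).inv ≫ e ▷ g = (ρ_ g).hom ≫ (λ_ g).inv) : f ⊣ g where
  unit := η
  counit := e
  left_triangle := by simpa [leftZigzag, bicategoricalComp] using h₁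
  right_triangle := by simpa [rightZigzag, bicategoricalComp] using h₂

/-- Replacing the right adjoint by an isomorphic 1-morphism. -/
def ofIsoRight {f : a ⟶ b} {g g' : b ⟶ a} (adj : f ⊣ g) (e : g ≅ g') : f ⊣ g' :=
  mkExplicit (adj.unit ≫ f ◁ e.hom) (e.inv ▷ f ≫ adj.counit)
    (by
      rw [← adj.left_triangle_explicit]
      simp only [comp_whiskerRight, whiskerLeft_comp, Category.assoc]
      have : (f ◁ e.hom) ▷ f ≫ (α_ f g' f).hom ≫ f ◁ e.inv ▷ f = (α_ f g f).hom := by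
        rw [associator_naturality_middle_assoc, ← whiskerLeft_comp, ← comp_whiskerRight]
        simp
      rw [reassoc_of% this])
    (by
      simp only [comp_whiskerRight, whiskerLeft_comp, Category.assoc]
      rw [associator_inv_naturality_right_assoc, whisker_exchange_assoc (e.inv ▷ f) e.hom,
        whisker_exchange adj.counit e.hom, ← associator_inv_naturality_left_assoc,
        whisker_exchange_assoc e.inv adj.unit, reassoc_of% adj.right_triangle_explicit]
      simp)

/-- Replacing the left adjoint by an isomorphic 1-morphism. -/
def ofIsoLeft {f f' : a ⟶ b} {g : b ⟶ a} (adj : f ⊣ g) (e : f ≅ f') : f' ⊣ g :=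
  mkExplicit (adj.unit ≫ e.hom ▷ g) (g ◁ e.inv ≫ adj.counit)
    (by
      simp only [comp_whiskerRight, whiskerLeft_comp, Category.assoc]
      rw [associator_naturality_left_assoc, ← whisker_exchange_assoc e.hom (g ◁ e.inv),
        ← whisker_exchange e.hom adj.counit, ← associator_naturality_right_assoc,
        ← whisker_exchange_assoc adj.unit e.inv, reassoc_of% adj.left_triangle_explicit]
      simp)
    (by
      rw [← adj.right_triangle_explicit]
      simp only [comp_whiskerRight, whiskerLeft_comp, Category.assoc]
      have : g ◁ (e.hom ▷ g) ≫ (α_ g f' g).inv ≫ (g ◁ e.inv) ▷ g = (α_ g f g).inv := by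
        rw [← associator_inv_naturality_middle, ← whiskerLeft_comp_assoc, ← comp_whiskerRight]
        simp
      rw [reassoc_of% this])

end CategoryTheory.Bicategory.Adjunction

/-! ### The data of an `sl₂`-action on projective classes -/

section Transport

variable {B : Type u} [Bicategory.{w, v} B] [GradedLinearBicategory B]

open ShiftedHom ProjObj Bicategory

/-- A 1-morphism, regarded as a 1-morphism of the bicategory of projective classes. -/
abbrev toPB {a b : B} (f : a ⟶ b) : (⟨a⟩ : PB B) ⟶ ⟨b⟩ := (⟨f⟩ : ProjObj (a ⟶ b))

lemma pcl₀_whiskerLeft {a b c : B} (f : a ⟶ b) {g h : b ⟶ c} (η : g ⟶ h) :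
    pcl₀ (f ◁ η) = toPB f ◁ (pcl₀ η : toPB g ⟶ toPB h) :=
  (projFunctor_pcl₀ (Bicategory.precomp c f) η).symm

lemma pcl₀_whiskerRight {a b c : B} {f g : a ⟶ b} (η : f ⟶ g) (h : b ⟶ c) :
    pcl₀ (η ▷ h) = (pcl₀ η : toPB f ⟶ toPB g) ▷ toPB h :=
  (projFunctor_pcl₀ (Bicategory.postcomp a h) η).symm

/-- An adjunction gives an adjunction between projective classes. -/
noncomputable def Adjunction.toPB {a b : B} {f : a ⟶ b} {g : b ⟶ a} (adj : f ⊣ g) :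
    toPB f ⊣ toPB g :=
  Adjunction.mkExplicit (pcl₀ adj.unit) (pcl₀ adj.counit)
    (by
      have := congrArg pcl₀ adj.left_triangle_explicit
      simp only [pcl₀_comp] at this
      rw [pcl₀_whiskerLeft, pcl₀_whiskerRight] at this
      exact this)
    (by
      have := congrArg pcl₀ adj.right_triangle_explicit
      simp only [pcl₀_comp] at this
      rw [pcl₀_whiskerLeft, pcl₀_whiskerRight] at this
      exact this)

/-- The isomorphism of degree `k` between `X⟨k⟩` and `X`. -/
@[simps]
noncomputable def shiftPIso {C : Type u} [Category.{v} C] [Preadditive C] [Linear ℂ C]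
    [HasShift C ℤ] [∀ n : ℤ, (shiftFunctor C n).Additive] [∀ n : ℤ, (shiftFunctor C n).Linear ℂ]
    (X : C) (k : ℤ) : toProj (X⟦k⟧) ≅ toProj X where
  hom := pcl (ofShift X k)
  inv := pcl (toShift X k)
  hom_inv_id := by rw [← pcl_comp _ _ (neg_add_cancel k), ofShift_toShift]; rfl
  inv_hom_id := by rw [← pcl_comp _ _ (add_neg_cancel k), toShift_ofShift]; rfl

/-- A functor compatible with shifts preserves the isomorphisms between objects and their
shifts. -/
lemma projFunctor_shiftPIso_inv {C : Type u} [Category.{v} C] [Preadditive C] [Linear ℂ C]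
    [HasShift C ℤ] [∀ n : ℤ, (shiftFunctor C n).Additive] [∀ n : ℤ, (shiftFunctor C n).Linear ℂ]
    {D : Type u'} [Category.{v'} D] [Preadditive D] [Linear ℂ D]
    [HasShift D ℤ] [∀ n : ℤ, (shiftFunctor D n).Additive] [∀ n : ℤ, (shiftFunctor D n).Linear ℂ]
    (F : C ⥤ D) [F.Additive] [F.Linear ℂ] [F.CommShift ℤ] (X : C) (k : ℤ) :
    (projFunctor F).map (shiftPIso X k).inv =
      (shiftPIso (F.obj X) k).inv ≫ pcl₀ ((F.commShiftIso k).inv.app X) := by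
  have h : (projFunctor F).map (shiftPIso X k).hom =
      pcl₀ ((F.commShiftIso k).hom.app X) ≫ (shiftPIso (F.obj X) k).hom := by
    rw [shiftPIso_hom, shiftPIso_hom, projFunctor_pcl, ← pcl₀_comp_pcl]
    congr 1
    simp [ShiftedHom.map, ofShift]
  have h' : (projFunctor F).mapIso (shiftPIso X k) =
      pisoOfIso ((F.commShiftIso k).app X) ≪≫ shiftPIso (F.obj X) k := Iso.ext h
  exact congrArg Iso.inv h'

/-- The adjunction between projective classes given by an adjunction `f ⊣ g⟨n⟩`. -/
noncomputable def Adjunction.ofRightShift {a b : B} {f : a ⟶ b} {g : b ⟶ a} {n : ℤ}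
    (adj : f ⊣ g⟦n⟧) : _root_.toPB f ⊣ _root_.toPB g :=
  (Adjunction.toPB adj).ofIsoRight (g := _root_.toPB (g⟦n⟧)) (g' := _root_.toPB g)
    (shiftPIso g n)

/-- The adjunction between projective classes given by an adjunction `f⟨n⟩ ⊣ g`. -/
noncomputable def Adjunction.ofLeftShift {a b : B} {f : a ⟶ b} {g : b ⟶ a} {n : ℤ}
    (adj : f⟦n⟧ ⊣ g) : _root_.toPB f ⊣ _root_.toPB g :=
  (Adjunction.toPB adj).ofIsoLeft (f := _root_.toPB (f⟦n⟧)) (f' := _root_.toPB f)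
    (shiftPIso f n)

lemma Adjunction.deg_unit_ofRightShift {a b : B} {f : a ⟶ b} {g : b ⟶ a} {n : ℤ}
    (adj : f ⊣ g⟦n⟧) : deg (Adjunction.ofRightShift adj).unit = n :=
  (deg_comp _ _).trans ((congrArg₂ (· + ·) (deg_pcl₀ _) (PB.deg_whiskerLeft _ _)).trans
    (zero_add n))

lemma Adjunction.deg_unit_ofLeftShift {a b : B} {f : a ⟶ b} {g : b ⟶ a} {n : ℤ}
    (adj : f⟦n⟧ ⊣ g) : deg (Adjunction.ofLeftShift adj).unit = n :=
  (deg_comp _ _).trans ((congrArg₂ (· + ·) (deg_pcl₀ _) (PB.deg_whiskerRight _ _)).trans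
    (zero_add n))

lemma pcl_counitOfRightShift {a b : B} {f : a ⟶ b} {g : b ⟶ a} {n : ℤ} (adj : f ⊣ g⟦n⟧) :
    pcl (counitOfRightShift adj) = (Adjunction.ofRightShift adj).counit := by
  have h := projFunctor_shiftPIso_inv (Bicategory.postcomp b f) g n
  have h' : pcl (counitOfRightShift adj) = (shiftPIso (g ≫ f) n).inv ≫
      pcl₀ (((Bicategory.postcomp b f).commShiftIso n).inv.app g ≫ adj.counit) :=
    pcl_comp_pcl₀ (toShift (g ≫ f) n) _
  refine h'.trans ((congrArg _ (pcl₀_comp _ _)).trans ((Category.assoc _ _ _).symm.trans ?_))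
  exact congrArg (· ≫ pcl₀ adj.counit) h.symm

lemma pcl_counitOfLeftShift {a b : B} {f : a ⟶ b} {g : b ⟶ a} {n : ℤ} (adj : f⟦n⟧ ⊣ g) :
    pcl (counitOfLeftShift adj) = (Adjunction.ofLeftShift adj).counit := by
  have h := projFunctor_shiftPIso_inv (Bicategory.precomp b g) f n
  have h' : pcl (counitOfLeftShift adj) = (shiftPIso (g ≫ f) n).inv ≫
      pcl₀ (((Bicategory.precomp b g).commShiftIso n).inv.app f ≫ adj.counit) :=
    pcl_comp_pcl₀ (toShift (g ≫ f) n) _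
  refine h'.trans ((congrArg _ (pcl₀_comp _ _)).trans ((Category.assoc _ _ _).symm.trans ?_))
  exact congrArg (· ≫ pcl₀ adj.counit) h.symm

/-- An adjunction in the opposite bicategory. -/
noncomputable def Adjunction.toOp {a b : PB B} {f : a ⟶ b} {g : b ⟶ a} (adj : f ⊣ g) :
    Adjunction (B := PB (BOp B)) (a := ⟨⟨a.as⟩⟩) (b := ⟨⟨b.as⟩⟩) (g : ProjObj (b.as ⟶ a.as))
      (f : ProjObj (a.as ⟶ b.as)) :=
  Adjunction.mkExplicit (B := PB (BOp B)) adj.unit adj.counit adj.right_triangle_explicit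
    adj.left_triangle_explicit

end Transport

section

open ShiftedHom ProjObj Bicategory

/-- An action of `sl₂` on a graded linear bicategory, as far as it is visible on homogeneous
2-morphisms up to scalars. -/
structure Sl2Data (B : Type u) [Bicategory.{w, v} B] [GradedLinearBicategory B] where
  /-- the weight objects -/
  wt : ℤ → PB B
  /-- the divided powers `E^(r)` -/
  E (r : ℕ) {l m : ℤ} (h : m = l + 2 * (r : ℤ)) : wt l ⟶ wt m
  /-- the divided powers `F^(r)` -/
  F (r : ℕ) {l m : ℤ} (h : m = l + 2 * (r : ℤ)) : wt m ⟶ wt l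
  finite_dimensional {a b : B} (f g : a ⟶ b) : FiniteDimensional ℂ (f ⟶ g)
  integrable (l : ℤ) : ∃ N : ℕ, ∀ r : ℕ, N ≤ r →
    PB.IsNull (𝟙 (𝟙 (wt (l + 2 * (r : ℤ))))) ∧ PB.IsNull (𝟙 (𝟙 (wt (l - 2 * (r : ℤ)))))
  low_id (l : ℤ) : Low (𝟙 (wt l)) (𝟙 (wt l)) 0
  E_zero {l : ℤ} (h : l = l + 2 * ((0 : ℕ) : ℤ)) : ∃ e : E 0 h ≅ 𝟙 (wt l), PB.deg e.hom = 0
  F_zero {l : ℤ} (h : l = l + 2 * ((0 : ℕ) : ℤ)) : ∃ e : F 0 h ≅ 𝟙 (wt l), PB.deg e.hom = 0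
  adj_right (r : ℕ) {l m : ℤ} (h : m = l + 2 * (r : ℤ)) :
    ∃ adj : E r h ⊣ F r h, PB.deg adj.unit = r * (l + r)
  adj_left (r : ℕ) {l m : ℤ} (h : m = l + 2 * (r : ℤ)) :
    ∃ adj : F r h ⊣ E r h, PB.deg adj.unit = -(r * (l + r))
  FE {k l m : ℤ} (h : l = k + 2 * ((1 : ℕ) : ℤ)) (h' : m = l + 2 * ((1 : ℕ) : ℤ)) (n : ℕ)
    (hn : l = -(n : ℤ)) :
    Nonempty (Decomp (E 1 h' ≫ F 1 h')
      (Sum.elim (fun _ : Unit => F 1 h ≫ E 1 h) (fun _ : Fin n => 𝟙 (wt l)))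
      (Sum.elim (fun _ => 0) (fun k => (n : ℤ) - 1 - 2 * ((k : ℕ) : ℤ))))
  EF {k l m : ℤ} (h : l = k + 2 * ((1 : ℕ) : ℤ)) (h' : m = l + 2 * ((1 : ℕ) : ℤ)) (n : ℕ)
    (hn : l = n) :
    Nonempty (Decomp (F 1 h ≫ E 1 h)
      (Sum.elim (fun _ : Unit => E 1 h' ≫ F 1 h') (fun _ : Fin n => 𝟙 (wt l)))
      (Sum.elim (fun _ => 0) (fun k => (n : ℤ) - 1 - 2 * ((k : ℕ) : ℤ))))
  E_E_pow (r : ℕ) {l m k : ℤ} (h : m = l + 2 * (r : ℤ)) (h' : k = m + 2 * ((1 : ℕ) : ℤ))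
    (h'' : k = l + 2 * ((r + 1 : ℕ) : ℤ)) :
    Nonempty (QDecomp (E r h ≫ E 1 h') (r + 1) (E (r + 1) h''))
  E_pow_E (r : ℕ) {l m k : ℤ} (h : m = l + 2 * ((1 : ℕ) : ℤ)) (h' : k = m + 2 * (r : ℤ))
    (h'' : k = l + 2 * ((r + 1 : ℕ) : ℤ)) :
    Nonempty (QDecomp (E 1 h ≫ E r h') (r + 1) (E (r + 1) h''))
  F_F_pow (r : ℕ) {l m k : ℤ} (h : m = l + 2 * ((1 : ℕ) : ℤ)) (h' : k = m + 2 * (r : ℤ))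
    (h'' : k = l + 2 * ((r + 1 : ℕ) : ℤ)) :
    Nonempty (QDecomp (F r h' ≫ F 1 h) (r + 1) (F (r + 1) h''))
  F_pow_F (r : ℕ) {l m k : ℤ} (h : m = l + 2 * (r : ℤ)) (h' : k = m + 2 * ((1 : ℕ) : ℤ))
    (h'' : k = l + 2 * ((r + 1 : ℕ) : ℤ)) :
    Nonempty (QDecomp (F 1 h' ≫ F r h) (r + 1) (F (r + 1) h''))

namespace Sl2Data

variable {B : Type u} [Bicategory.{w, v} B] [GradedLinearBicategory B]

/-- The action obtained by exchanging `E` and `F`. -/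
def chev (S : Sl2Data B) : Sl2Data B where
  wt l := S.wt (-l)
  E r {l m} h := S.F r (l := -m) (m := -l) (by omega)
  F r {l m} h := S.E r (l := -m) (m := -l) (by omega)
  finite_dimensional := S.finite_dimensional
  integrable l := by
    obtain ⟨N, hN⟩ := S.integrable (-l)
    refine ⟨N, fun r hr => ?_⟩
    have := hN r hr
    rw [neg_add', neg_sub', sub_neg_eq_add]
    exact ⟨this.2, this.1⟩
  low_id l := S.low_id (-l)
  E_zero h := S.F_zero _
  F_zero h := S.E_zero _
  adj_right r {l m} h := by
    obtain ⟨adj, h'⟩ := S.adj_left r (l := -m) (m := -l) (by omega)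
    exact ⟨adj, by rw [h', h]; ring⟩
  adj_left r {l m} h := by
    obtain ⟨adj, h'⟩ := S.adj_right r (l := -m) (m := -l) (by omega)
    exact ⟨adj, by rw [h', h]; ring⟩
  FE h h' n hn := S.EF _ _ n (by omega)
  EF h h' n hn := S.FE _ _ n (by omega)
  E_E_pow r _ _ _ h h' h'' := S.F_F_pow r _ _ _
  E_pow_E r _ _ _ h h' h'' := S.F_pow_F r _ _ _
  F_F_pow r _ _ _ h h' h'' := S.E_E_pow r _ _ _
  F_pow_F r _ _ _ h h' h'' := S.E_pow_E r _ _ _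

/-- The action on the opposite bicategory. -/
noncomputable def op (S : Sl2Data B) : Sl2Data (BOp B) where
  wt l := ⟨⟨(S.wt (-l)).as⟩⟩
  E r {l m} h := S.E r (l := -m) (m := -l) (by omega)
  F r {l m} h := S.F r (l := -m) (m := -l) (by omega)
  finite_dimensional := S.finite_dimensional
  integrable l := by
    obtain ⟨N, hN⟩ := S.integrable (-l)
    refine ⟨N, fun r hr => ?_⟩
    have := hN r hr
    rw [neg_add', neg_sub', sub_neg_eq_add]
    exact ⟨this.2, this.1⟩
  low_id l := S.low_id (-l)
  E_zero h := S.E_zero _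
  F_zero h := S.F_zero _
  adj_right r {l m} h := by
    obtain ⟨adj, h'⟩ := S.adj_left r (l := -m) (m := -l) (by omega)
    exact ⟨Adjunction.toOp adj, h'.trans (by rw [h]; ring)⟩
  adj_left r {l m} h := by
    obtain ⟨adj, h'⟩ := S.adj_right r (l := -m) (m := -l) (by omega)
    exact ⟨Adjunction.toOp adj, h'.trans (by rw [h]; ring)⟩
  FE h h' n hn := S.EF _ _ n (by omega)
  EF h h' n hn := S.FE _ _ n (by omega)
  E_E_pow r _ _ _ h h' h'' := S.E_pow_E r _ _ _
  E_pow_E r _ _ _ h h' h'' := S.E_E_pow r _ _ _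
  F_F_pow r _ _ _ h h' h'' := S.F_pow_F r _ _ _
  F_pow_F r _ _ _ h h' h'' := S.F_F_pow r _ _ _

end Sl2Data

namespace CategoricalSl2Rep

variable {B : Type u} [Bicategory.{w, v} B] [GradedLinearBicategory B]

lemma low_id (R : CategoricalSl2Rep B) (l : ℤ) :
    Low (toProj (𝟙 (R.wt l))) (toProj (𝟙 (R.wt l))) 0 := by
  by_cases hl : IsZero (𝟙 (R.wt l))
  · have h := isNull_id_iff.2 hl
    exact ⟨fun φ _ => isNull_of_isNull_id h φ,
      fun φ ψ _ _ h₁ _ => (h₁ (isNull_of_isNull_id h φ)).elim⟩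
  · refine ⟨fun φ hφ => ?_, fun φ ψ hφ hψ h₁ h₂ => ?_⟩
    · obtain ⟨k, α, rfl⟩ := exists_pcl φ
      exact isNull_pcl.2 (R.end_neg l hl _ hφ α)
    · obtain ⟨α, rfl⟩ := exists_rep φ hφ
      obtain ⟨β, rfl⟩ := exists_rep ψ hψ
      rw [isNull_pcl] at h₁ h₂
      let f := (homEquiv (X := 𝟙 (R.wt l)) (Y := 𝟙 (R.wt l)) (0 : ℤ) rfl).symm α
      let g := (homEquiv (X := 𝟙 (R.wt l)) (Y := 𝟙 (R.wt l)) (0 : ℤ) rfl).symm β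
      have hf : mk₀ (0 : ℤ) rfl f = α := (homEquiv (0 : ℤ) rfl).apply_symm_apply α
      have hg : mk₀ (0 : ℤ) rfl g = β := (homEquiv (0 : ℤ) rfl).apply_symm_apply β
      have hf₀ : f ≠ 0 := fun h => h₁ (by rw [← hf, h, mk₀_zero])
      have hg₀ : g ≠ 0 := fun h => h₂ (by rw [← hg, h, mk₀_zero])
      obtain ⟨c, hc⟩ := (finrank_eq_one_iff_of_nonzero' f hf₀).1 (R.end_zero l hl) g
      have hc₀ : c ≠ 0 := by rintro rfl; exact hg₀ (by rw [← hc, zero_smul])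
      refine pcl_eq_iff.2 ⟨Units.mk0 c hc₀, ?_⟩
      rw [← hf, ← hg, ← hc, mk₀_smul]; rfl

/-- The action on projective classes given by a categorical 2-representation. -/
noncomputable def toSl2Data (R : CategoricalSl2Rep B) : Sl2Data B where
  wt l := ⟨R.wt l⟩
  E r _ _ h := toPB (R.E r h)
  F r _ _ h := toPB (R.F r h)
  finite_dimensional := R.finite_dimensional
  integrable l := by
    obtain ⟨N, hN⟩ := R.integrable l
    exact ⟨N, fun r hr => ⟨isNull_id_iff.2 (hN r hr).1, isNull_id_iff.2 (hN r hr).2⟩⟩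
  low_id := R.low_id
  E_zero h := by
    obtain ⟨e⟩ := R.E_zero _ h
    exact ⟨pisoOfIso e, rfl⟩
  F_zero h := by
    obtain ⟨e⟩ := R.F_zero _ h
    exact ⟨pisoOfIso e, rfl⟩
  adj_right r {l m} h := by
    obtain ⟨adj⟩ := R.adj_right r h
    exact ⟨Adjunction.ofRightShift adj, Adjunction.deg_unit_ofRightShift adj⟩
  adj_left r {l m} h := by
    obtain ⟨adj⟩ := R.adj_left r h
    exact ⟨Adjunction.ofLeftShift adj, Adjunction.deg_unit_ofLeftShift adj⟩
  FE h h' n hn := by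
    obtain ⟨e⟩ := R.FE_iso h h' (by omega)
    rw [show (-_ : ℤ).toNat = n by omega] at e
    exact ⟨Decomp.ofBiprodIso e (Decomp.refl _) (QDecomp.ofIso (Iso.refl _))⟩
  EF h h' n hn := by
    obtain ⟨e⟩ := R.EF_iso h h' (by omega)
    rw [show (_ : ℤ).toNat = n by rw [hn]; rfl] at e
    exact ⟨Decomp.ofBiprodIso e (Decomp.refl _) (QDecomp.ofIso (Iso.refl _))⟩
  E_E_pow r _ _ _ h h' h'' := (R.E_E_pow r h h' h'').map QDecomp.ofIso
  E_pow_E r _ _ _ h h' h'' := (R.E_pow_E r h h' h'').map QDecomp.ofIso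
  F_F_pow r _ _ _ h h' h'' := (R.F_F_pow r h h' h'').map QDecomp.ofIso
  F_pow_F r _ _ _ h h' h'' := (R.F_pow_F r h h' h'').map QDecomp.ofIso

end CategoricalSl2Rep

end

/-! ### Bounds on degrees: general tools -/

section Tools

variable {C : Type u} [Category.{v} C] [Preadditive C] [Linear ℂ C] [HasShift C ℤ]
  [∀ n : ℤ, (shiftFunctor C n).Additive] [∀ n : ℤ, (shiftFunctor C n).Linear ℂ]

open ShiftedHom ProjObj

/-- Transport of a decomposition along an isomorphism of degree `0`. -/
noncomputable def Fac.precompIso {M N : C} (e : M ≅ N) {ι : Type} [Fintype ι]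
    {Z : ι → ProjObj C} {d : ι → ℤ} (A : Fac (toProj N) Z d) : Fac (toProj M) Z d where
  proj i := (mk₀ 0 rfl e.hom).comp (A.proj i) (add_zero _)
  inj i := (A.inj i).comp (mk₀ 0 rfl e.inv) (zero_add _)
  sum_proj_inj := by
    have := congrArg (fun z => (mk₀ (0 : ℤ) rfl e.hom).comp
      (ShiftedHom.comp z (mk₀ 0 rfl e.inv) (zero_add 0)) (zero_add 0)) A.sum_proj_inj
    simp only [sum_comp, comp_sum, mk₀_comp_mk₀, Category.id_comp, e.hom_inv_id] at this
    rw [← this]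
    refine Finset.sum_congr rfl fun j _ => ?_
    have e := comp_assoc (mk₀ 0 rfl e.hom) (A.proj j)
      ((A.inj j).comp (mk₀ 0 rfl e.inv) (zero_add _))
      (add_zero _) (neg_add_cancel (d j)) (show -d j + d j + 0 = 0 by ring)
    exact e.trans (by rw [← comp_assoc (A.proj j) (A.inj j) _ (neg_add_cancel _) _ (by ring)])

/-- Transport of a decomposition along an isomorphism of degree `0`. -/
noncomputable def Decomp.precompIso {M N : C} (e : M ≅ N) {ι : Type} [Fintype ι]
    {Z : ι → ProjObj C} {d : ι → ℤ} (A : Decomp (toProj N) Z d) : Decomp (toProj M) Z d where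
  toFac := A.toFac.precompIso e
  inj_proj_self i := by
    have key {X Y : C} {k l n : ℤ} (α : ShiftedHom X N k) (β : ShiftedHom N Y l) (h : l + k = n) :
        (α.comp (mk₀ 0 rfl e.inv) (zero_add _)).comp ((mk₀ 0 rfl e.hom).comp β (add_zero _)) h =
          α.comp β h := by
      rw [comp_assoc α _ _ (zero_add _) (add_zero l) (by omega),
        ← comp_assoc (mk₀ 0 rfl e.inv) _ β (add_zero 0) _ (by ring), mk₀_comp_mk₀]
      simp
    exact (key _ _ _).trans (A.inj_proj_self i)
  inj_proj_of_ne hij := by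
    have key {X Y : C} {k l n : ℤ} (α : ShiftedHom X N k) (β : ShiftedHom N Y l) (h : l + k = n) :
        (α.comp (mk₀ 0 rfl e.inv) (zero_add _)).comp ((mk₀ 0 rfl e.hom).comp β (add_zero _)) h =
          α.comp β h := by
      rw [comp_assoc α _ _ (zero_add _) (add_zero l) (by omega),
        ← comp_assoc (mk₀ 0 rfl e.inv) _ β (add_zero 0) _ (by ring), mk₀_comp_mk₀]
      simp
    exact (key _ _ _).trans (A.inj_proj_of_ne hij)

namespace ProjObj

variable {X Y X' Y' M : ProjObj C}

lemma VanishBelow.of_iso {N : ℤ} (e : X ≅ X') (e' : Y ≅ Y') {M : ℤ} (h : VanishBelow X' Y' M)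
    (hM : M = N + deg e'.hom - deg e.hom) : VanishBelow X Y N :=
  VanishBelow.of_map (fun φ => e.inv ≫ φ ≫ e'.hom) (deg e'.hom - deg e.hom)
    (fun φ => by simp; ring) (fun φ hφ => by simpa using (hφ.comp_left e.hom).comp e'.inv) h
    (by omega)

lemma Low.of_iso {N : ℤ} (e : X ≅ X') (e' : Y ≅ Y') {M : ℤ} (h : Low X' Y' M)
    (hM : M = N + deg e'.hom - deg e.hom) : Low X Y N :=
  Low.of_map (fun φ => e.inv ≫ φ ≫ e'.hom) (deg e'.hom - deg e.hom)
    (fun φ => by simp; ring) (fun φ hφ => by simpa using (hφ.comp_left e.hom).comp e'.inv)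
    (fun φ ψ h => by simpa using h) h (by omega)

lemma VanishBelow.of_isNull_left {N : ℤ} (h : IsNull (𝟙 X)) : VanishBelow X Y N :=
  fun φ _ => isNull_of_isNull_id h φ

lemma Low.of_isNull_left {N : ℤ} (h : IsNull (𝟙 X)) : Low X Y N :=
  ⟨fun φ _ => isNull_of_isNull_id h φ, fun φ _ _ _ h₁ => (h₁ (isNull_of_isNull_id h φ)).elim⟩

lemma Low.of_isNull_right {N : ℤ} (h : IsNull (𝟙 Y)) : Low X Y N :=
  ⟨fun φ _ => isNull_of_isNull_id' h φ, fun φ _ _ _ h₁ => (h₁ (isNull_of_isNull_id' h φ)).elim⟩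

/-- `X` is a retract of `Y`, by morphisms of degrees `k` and `-k`. -/
def Retract (X Y : ProjObj C) (k : ℤ) : Prop :=
  ∃ (α : X ⟶ Y) (β : Y ⟶ X), α ≫ β = 𝟙 X ∧ deg α = k

lemma Low.of_retract_left {N k : ℤ} (h : Retract X X' k) {M : ℤ} (h' : Low X' Y M)
    (hM : M = N - k) : Low X Y N := by
  obtain ⟨α, β, hαβ, rfl⟩ := h
  have := deg_inv_of_comp_eq_id hαβ
  exact Low.of_map (fun φ => β ≫ φ) (deg β) (fun φ => by simp; ring)
    (fun φ hφ => by simpa [← Category.assoc, hαβ] using hφ.comp_left α)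
    (fun φ ψ h => by
      have := congrArg (α ≫ ·) h
      simpa [← Category.assoc, hαβ] using this) h' (by omega)

lemma VanishBelow.of_retract_right {N k : ℤ} (h : Retract Y Y' k) {M : ℤ} (h' : VanishBelow X Y' M)
    (hM : M = N + k) : VanishBelow X Y N := by
  obtain ⟨α, β, hαβ, rfl⟩ := h
  exact VanishBelow.of_map (fun φ => φ ≫ α) (deg α) (fun φ => by simp)
    (fun φ hφ => by simpa [Category.assoc, hαβ] using hφ.comp β) h' (by omega)

lemma Low.of_retract_right {N k : ℤ} (h : Retract Y Y' k) {M : ℤ} (h' : Low X Y' M)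
    (hM : M = N + k) : Low X Y N := by
  obtain ⟨α, β, hαβ, rfl⟩ := h
  exact Low.of_map (fun φ => φ ≫ α) (deg α) (fun φ => by simp)
    (fun φ hφ => by simpa [Category.assoc, hαβ] using hφ.comp β)
    (fun φ ψ h => by
      have := congrArg (· ≫ β) h
      simpa [Category.assoc, hαβ] using this) h' (by omega)

lemma Retract.trans {k l : ℤ} (h : Retract X Y k) (h' : Retract Y M l) : Retract X M (k + l) := by
  obtain ⟨α, β, hαβ, rfl⟩ := h
  obtain ⟨γ, δ, hγδ, rfl⟩ := h'
  exact ⟨α ≫ γ, δ ≫ β, by simp [reassoc_of% hγδ, hαβ], by simp⟩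

lemma _root_.Decomp.retract {ι : Type} [Fintype ι] {Z : ι → ProjObj C} {d : ι → ℤ}
    (A : Decomp M Z d) (i : ι) : Retract (Z i) M (-d i) := ⟨A.j i, A.p i, A.j_p_self i, rfl⟩

/-- If `X` has only scalar endomorphisms of degree `0` and no endomorphisms of negative degree,
the non-vanishing endomorphisms of degree `0` are identities up to scalars. -/
lemma Low.eq_id (h : Low X X 0) {φ : X ⟶ X} (hd : deg φ = 0) (hφ : ¬ IsNull φ) : φ = 𝟙 X := by
  refine h.2 φ (𝟙 X) hd rfl hφ fun h' => hφ (isNull_of_isNull_id h' φ)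

lemma Retract.of_isNull (h : IsNull (𝟙 X)) (Y : ProjObj C) (k : ℤ) : Retract X Y k := by
  obtain ⟨α, hα, hd⟩ := exists_isNull X Y k
  obtain ⟨β, hβ, hd'⟩ := exists_isNull Y X (-k)
  exact ⟨α, β, (hα.comp β).eq h (by simp [hd, hd']), hd⟩

/-- A retract of `M` which has no proper idempotents is a retract of one of the objects through
which the identity of `M` factors. -/
lemma Retract.exists_of_fac {k : ℤ} (hX : Low X X 0) (h : Retract X M k) {ι : Type} [Fintype ι]
    {Z : ι → ProjObj C} {d : ι → ℤ} (A : Fac M Z d) (h₀ : ¬ IsNull (𝟙 X)) :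
    ∃ i, Retract X (Z i) (k + d i) ∧ ∃ (α : X ⟶ Z i) (β : Z i ⟶ X), ¬ IsNull (α ≫ β) ∧
      deg α = k + d i ∧ deg β = -(k + d i) := by
  obtain ⟨α, β, hαβ, rfl⟩ := h
  have hβ := deg_inv_of_comp_eq_id hαβ
  by_contra! hne
  apply h₀
  rw [← hαβ]
  refine A.isNull_comp α β fun i => ?_
  by_contra hi
  rw [← Category.assoc] at hi
  refine hne i ⟨α ≫ A.p i, A.j i ≫ β, hX.eq_id (by simp; omega) hi, by simp⟩ _ _ hi (by simp)
    (by simp; omega)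

end ProjObj

end Tools

namespace PB

open ProjObj (Low VanishBelow Retract)
open Bicategory

variable {B : Type u} [Bicategory.{w, v} B] [GradedLinearBicategory B] {a b c d : PB B}

section Transfer

lemma retract_mk {f g : a ⟶ b} {k : ℤ} (α : f ⟶ g) (β : g ⟶ f) (h : α ≫ β = 𝟙 f)
    (hk : deg α = k) : Retract f g k := ⟨α, β, h, hk⟩

lemma exists_of_retract {f g : a ⟶ b} {k : ℤ} (h : Retract f g k) :
    ∃ (α : f ⟶ g) (β : g ⟶ f), α ≫ β = 𝟙 f ∧ deg α = k := h

variable {f g : a ⟶ b} {N : ℤ}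

lemma low_of_map {x y : PB B} {f' g' : x ⟶ y} (T : (f ⟶ g) → (f' ⟶ g')) (k : ℤ)
    (hd : ∀ φ, deg (T φ) = deg φ + k) (hn : ∀ φ, IsNull (T φ) → IsNull φ)
    (hT : Function.Injective T) {M : ℤ} (h : Low f' g' M) (hM : M = N + k) : Low f g N :=
  Low.of_map T k hd hn hT h hM

lemma vanish_of_map {x y : PB B} {f' g' : x ⟶ y} (T : (f ⟶ g) → (f' ⟶ g')) (k : ℤ)
    (hd : ∀ φ, deg (T φ) = deg φ + k) (hn : ∀ φ, IsNull (T φ) → IsNull φ)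
    {M : ℤ} (h : VanishBelow f' g' M) (hM : M = N + k) : VanishBelow f g N :=
  fun φ hφ => hn φ (h (T φ) (lt_of_eq_of_lt (hd φ) (by
    have : deg φ < N := hφ
    omega)))

lemma isNull_of_vanish (h : VanishBelow f g N) {φ : f ⟶ g} (hφ : deg φ < N) : IsNull φ := h φ hφ

lemma isNull_of_low (h : Low f g N) {φ : f ⟶ g} (hφ : deg φ < N) : IsNull φ := h.1 φ hφ

lemma eq_of_low (h : Low f g N) {φ ψ : f ⟶ g} (hφ : deg φ = N) (hψ : deg ψ = N)
    (h₁ : ¬ IsNull φ) (h₂ : ¬ IsNull ψ) : φ = ψ := h.2 φ ψ hφ hψ h₁ h₂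

lemma eq_id_of_low (h : Low f f 0) {φ : f ⟶ f} (hd : deg φ = 0) (hφ : ¬ IsNull φ) : φ = 𝟙 f :=
  Low.eq_id h hd hφ

variable {ι : Type} [Fintype ι] {Z : ι → (a ⟶ b)} {k : ι → ℤ}

lemma fac_comp_eq (D : Fac f Z k) {t w : a ⟶ b} (φ : t ⟶ f) (ψ : f ⟶ w) (i₀ : ι)
    (h : ∀ i, i ≠ i₀ → IsNull (φ ≫ (D.p i : f ⟶ Z i) ≫ (D.j i : Z i ⟶ f) ≫ ψ)) :
    φ ≫ ψ = φ ≫ (D.p i₀ : f ⟶ Z i₀) ≫ (D.j i₀ : Z i₀ ⟶ f) ≫ ψ := D.comp_eq φ ψ i₀ h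

lemma fac_isNull_comp (D : Fac f Z k) {t w : a ⟶ b} (φ : t ⟶ f) (ψ : f ⟶ w)
    (h : ∀ i, IsNull (φ ≫ (D.p i : f ⟶ Z i) ≫ (D.j i : Z i ⟶ f) ≫ ψ)) : IsNull (φ ≫ ψ) :=
  D.isNull_comp φ ψ h

lemma fac_eq_p_j (D : Fac f Z k) {t : a ⟶ b} (φ : t ⟶ f) (i₀ : ι)
    (h : ∀ i, i ≠ i₀ → IsNull (φ ≫ (D.p i : f ⟶ Z i))) :
    φ = φ ≫ (D.p i₀ : f ⟶ Z i₀) ≫ (D.j i₀ : Z i₀ ⟶ f) := D.eq_p_j φ i₀ h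

lemma fac_eq_p_j' (D : Fac f Z k) {w : a ⟶ b} (ψ : f ⟶ w) (i₀ : ι)
    (h : ∀ i, i ≠ i₀ → IsNull ((D.j i : Z i ⟶ f) ≫ ψ)) :
    ψ = (D.p i₀ : f ⟶ Z i₀) ≫ (D.j i₀ : Z i₀ ⟶ f) ≫ ψ := D.eq_p_j' ψ i₀ h

lemma fac_isNull_of_p (D : Fac f Z k) {t : a ⟶ b} (φ : t ⟶ f)
    (h : ∀ i, IsNull (φ ≫ (D.p i : f ⟶ Z i))) : IsNull φ := D.isNull_of_p φ h

lemma decomp_j_p_self (D : Decomp f Z k) (i : ι) :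
    (D.j i : Z i ⟶ f) ≫ (D.p i : f ⟶ Z i) = 𝟙 (Z i) := D.j_p_self i

@[simp] lemma deg_fac_p (D : Fac f Z k) (i : ι) : deg (D.p i : f ⟶ Z i) = k i := rfl

@[simp] lemma deg_fac_j (D : Fac f Z k) (i : ι) : deg (D.j i : Z i ⟶ f) = -k i := rfl

end Transfer

section Associators

variable {ι : Type} [Fintype ι] {k : ι → ℤ}

/-- A decomposition of `f ≫ g` gives one of `f ≫ (g ≫ h)`. -/
noncomputable def decompAssoc {f : a ⟶ b} {g : b ⟶ c} {Z : ι → (a ⟶ c)} (D : Decomp (f ≫ g) Z k)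
    (h : c ⟶ d) : Decomp (f ≫ g ≫ h) (fun i => Z i ≫ h) k :=
  Decomp.precompIso (M := f.obj ≫ g.obj ≫ h.obj) (α_ f.obj g.obj h.obj).symm (decompRight D h)

variable {f : a ⟶ b} {g : b ⟶ c} {Z : ι → (a ⟶ c)} (h : c ⟶ d) (i : ι)

lemma decompAssoc_p (D : Decomp (f ≫ g) Z k) :
    (decompAssoc D h).p i = (α_ f g h).inv ≫ D.p i ▷ h := pcl_comp _ _ _

lemma decompAssoc_j (D : Decomp (f ≫ g) Z k) :
    (decompAssoc D h).j i = D.j i ▷ h ≫ (α_ f g h).hom := pcl_comp _ _ _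

end Associators

lemma retract_whiskerLeft (f : a ⟶ b) {g h : b ⟶ c} {k : ℤ} (H : Retract g h k) :
    Retract (f ≫ g) (f ≫ h) k := by
  obtain ⟨α, β, hαβ, hk⟩ := exists_of_retract H
  exact retract_mk (f ◁ α) (f ◁ β) (by rw [← whiskerLeft_comp, hαβ, whiskerLeft_id]) (by simpa using hk)

lemma retract_whiskerRight {f g : a ⟶ b} {k : ℤ} (H : Retract f g k) (h : b ⟶ c) :
    Retract (f ≫ h) (g ≫ h) k := by
  obtain ⟨α, β, hαβ, hk⟩ := exists_of_retract H
  exact retract_mk (α ▷ h) (β ▷ h) (by rw [← comp_whiskerRight, hαβ, id_whiskerRight]) (by simpa using hk)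

lemma isNull_id_comp_left {f : a ⟶ b} (h : IsNull (𝟙 f)) (g : b ⟶ c) : IsNull (𝟙 (f ≫ g)) := by
  rw [← id_whiskerRight]; exact h.whiskerRight g

lemma isNull_id_comp_right (f : a ⟶ b) {g : b ⟶ c} (h : IsNull (𝟙 g)) : IsNull (𝟙 (f ≫ g)) := by
  rw [← whiskerLeft_id]; exact h.whiskerLeft f

lemma isNull_id_source (h : IsNull (𝟙 (𝟙 a))) (f : a ⟶ b) : IsNull (𝟙 f) := by
  have := ((isNull_id_comp_left h f).comp_left (λ_ f).inv).comp (λ_ f).hom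
  simpa using this

section Adjunction

variable {f : a ⟶ b} {g : b ⟶ a} (adj : f ⊣ g)

lemma deg_counit : deg adj.counit = -deg adj.unit := by
  have := congrArg deg adj.left_triangle_explicit
  simp only [deg_comp, deg_whiskerLeft, deg_whiskerRight, deg_associator_hom, deg_leftUnitor_hom,
    deg_iso_inv, deg_rightUnitor_hom] at this
  omega

lemma deg_homEquiv₁ {X : a ⟶ c} {Y : b ⟶ c} (φ : X ⟶ f ≫ Y) :
    deg (adj.homEquiv₁ φ) = deg φ - deg adj.unit := by
  simp [Adjunction.homEquiv₁, deg_counit]; ring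

lemma deg_homEquiv₁_symm {X : a ⟶ c} {Y : b ⟶ c} (φ : g ≫ X ⟶ Y) :
    deg (adj.homEquiv₁.symm φ) = deg φ + deg adj.unit := by
  simp [Adjunction.homEquiv₁]; ring

lemma deg_homEquiv₂ {X : c ⟶ a} {Y : c ⟶ b} (φ : X ≫ f ⟶ Y) :
    deg (adj.homEquiv₂ φ) = deg φ + deg adj.unit := by
  simp [Adjunction.homEquiv₂]; ring

lemma deg_homEquiv₂_symm {X : c ⟶ a} {Y : c ⟶ b} (φ : X ⟶ Y ≫ g) :
    deg (adj.homEquiv₂.symm φ) = deg φ - deg adj.unit := by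
  simp [Adjunction.homEquiv₂, deg_counit]; ring

lemma isNull_homEquiv₁ {X : a ⟶ c} {Y : b ⟶ c} {φ : X ⟶ f ≫ Y} (h : IsNull φ) :
    IsNull (adj.homEquiv₁ φ) := (h.whiskerLeft g).comp _

lemma isNull_homEquiv₁_symm {X : a ⟶ c} {Y : b ⟶ c} {φ : g ≫ X ⟶ Y} (h : IsNull φ) :
    IsNull (adj.homEquiv₁.symm φ) :=
  (((h.whiskerLeft f).comp_left (α_ f g X).hom).comp_left
    (adj.unit ▷ X)).comp_left (λ_ X).inv

lemma isNull_homEquiv₂ {X : c ⟶ a} {Y : c ⟶ b} {φ : X ≫ f ⟶ Y} (h : IsNull φ) :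
    IsNull (adj.homEquiv₂ φ) :=
  (((h.whiskerRight g).comp_left (α_ X f g).inv).comp_left
    (X ◁ adj.unit)).comp_left (ρ_ X).inv

lemma isNull_homEquiv₂_symm {X : c ⟶ a} {Y : c ⟶ b} {φ : X ⟶ Y ≫ g} (h : IsNull φ) :
    IsNull (adj.homEquiv₂.symm φ) := (h.whiskerRight f).comp _

/-- Moving a 1-morphism to the other side changes the degrees by the degree of the unit. -/
lemma low_adj₁ {X : a ⟶ c} {Y : b ⟶ c} {M N : ℤ} (h : Low X (f ≫ Y) M)
    (hM : M = N + deg adj.unit) : Low (g ≫ X) Y N :=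
  low_of_map adj.homEquiv₁.symm (deg adj.unit) (deg_homEquiv₁_symm adj)
    (fun φ hφ => by simpa using isNull_homEquiv₁ adj hφ) adj.homEquiv₁.symm.injective h hM

lemma low_adj₁' {X : a ⟶ c} {Y : b ⟶ c} {M N : ℤ} (h : Low (g ≫ X) Y M)
    (hM : N = M + deg adj.unit) : Low X (f ≫ Y) N :=
  low_of_map adj.homEquiv₁ (-deg adj.unit) (fun φ => by rw [deg_homEquiv₁]; ring)
    (fun φ hφ => by simpa using isNull_homEquiv₁_symm adj hφ) adj.homEquiv₁.injective h
    (by omega)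

lemma low_adj₂ {X : c ⟶ a} {Y : c ⟶ b} {M N : ℤ} (h : Low X (Y ≫ g) M)
    (hM : M = N + deg adj.unit) : Low (X ≫ f) Y N :=
  low_of_map adj.homEquiv₂ (deg adj.unit) (deg_homEquiv₂ adj)
    (fun φ hφ => by simpa using isNull_homEquiv₂_symm adj hφ) adj.homEquiv₂.injective h hM

lemma low_adj₂' {X : c ⟶ a} {Y : c ⟶ b} {M N : ℤ} (h : Low (X ≫ f) Y M)
    (hM : N = M + deg adj.unit) : Low X (Y ≫ g) N :=
  low_of_map adj.homEquiv₂.symm (-deg adj.unit) (fun φ => by rw [deg_homEquiv₂_symm]; ring)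
    (fun φ hφ => by simpa using isNull_homEquiv₂ adj hφ) adj.homEquiv₂.symm.injective h
    (by omega)

lemma vanish_adj₁' {X : a ⟶ c} {Y : b ⟶ c} {M N : ℤ} (h : VanishBelow (g ≫ X) Y M)
    (hM : N = M + deg adj.unit) : VanishBelow X (f ≫ Y) N :=
  vanish_of_map adj.homEquiv₁ (-deg adj.unit) (fun φ => by rw [deg_homEquiv₁]; ring)
    (fun φ hφ => by simpa using isNull_homEquiv₁_symm adj hφ) h (by omega)

end Adjunction

end PB

namespace PB

open ProjObj (Low VanishBelow Retract)
open Bicategory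

variable {B : Type u} [Bicategory.{w, v} B] [GradedLinearBicategory B] {a b c d : PB B}

lemma low_congr_right {t f g : a ⟶ b} {N : ℤ} (e : f ≅ g) (he : deg e.hom = 0) (h : Low t f N) :
    Low t g N :=
  Low.of_retract_right (retract_mk e.inv e.hom e.inv_hom_id (by rw [deg_iso_inv, he, neg_zero])) h
    (add_zero N).symm

lemma vanish_congr_right {t f g : a ⟶ b} {N : ℤ} (e : f ≅ g) (he : deg e.hom = 0)
    (h : VanishBelow t f N) : VanishBelow t g N :=
  VanishBelow.of_retract_right
    (retract_mk e.inv e.hom e.inv_hom_id (by rw [deg_iso_inv, he, neg_zero])) h (add_zero N).symm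

lemma low_congr_left {t f g : a ⟶ b} {N : ℤ} (e : f ≅ g) (he : deg e.hom = 0) (h : Low f t N) :
    Low g t N :=
  Low.of_retract_left (retract_mk e.inv e.hom e.inv_hom_id (by rw [deg_iso_inv, he, neg_zero])) h
    (by omega)

end PB

namespace Sl2Data

open PB Bicategory
open ProjObj (Low VanishBelow Retract)

variable {B : Type u} [Bicategory.{w, v} B] [GradedLinearBicategory B] (S : Sl2Data B)

/-! ### Morphisms between divided powers -/

lemma low_comm_zero {k l y : ℤ} (hk : l = k + 2 * ((1 : ℕ) : ℤ)) (hy : y = l + 2 * ((1 : ℕ) : ℤ))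
    {c : PB B} (G : S.wt l ⟶ c) (T : S.wt l ⟶ c) (N : ℤ) (h₁ : Low T G N)
    (h₂ : VanishBelow T (S.F 1 hk ≫ S.E 1 hk ≫ G) (N + l + 2)) :
    Low T (S.E 1 hy ≫ S.F 1 hy ≫ G) (N + l + 1) := by
  have h₂' : VanishBelow T ((S.F 1 hk ≫ S.E 1 hk) ≫ G) (N + l + 2) :=
    vanish_congr_right (α_ _ _ _).symm rfl h₂
  have h₁' : Low T (𝟙 _ ≫ G) N := low_congr_right (λ_ G).symm rfl h₁
  rcases le_total l 0 with hl | hl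
  · obtain ⟨n, hn⟩ : ∃ n : ℕ, l = -(n : ℤ) := ⟨l.natAbs, by omega⟩
    obtain ⟨D⟩ := S.FE hk hy n hn
    rcases n with _ | n
    · refine (decompAssoc D G).low_right (.inl ()) (h₂'.low ?_) ?_
      · show N + l + 1 + 0 < N + l + 2
        omega
      · rintro (i | i) hi
        · exact (hi rfl).elim
        · exact i.elim0
    · refine (decompAssoc D G).low_right (.inr 0) (h₁'.mono ?_) ?_
      · show N + l + 1 + (((n + 1 : ℕ) : ℤ) - 1 - 2 * ((0 : ℕ) : ℤ)) ≤ N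
        push_cast at hn ⊢; omega
      · rintro (i | i) hi
        · refine h₂'.mono ?_
          show N + l + 1 + 0 + 1 ≤ N + l + 2
          omega
        · refine h₁'.1.mono ?_
          show N + l + 1 + (((n + 1 : ℕ) : ℤ) - 1 - 2 * ((i : ℕ) : ℤ)) + 1 ≤ N
          have : (i : ℕ) ≠ 0 := fun h => hi (congrArg Sum.inr (Fin.ext h))
          omega
  · obtain ⟨n, hn⟩ : ∃ n : ℕ, l = (n : ℤ) := ⟨l.natAbs, by omega⟩
    obtain ⟨D⟩ := S.EF hk hy n hn
    have := retract_whiskerRight (D.retract (.inl ())) G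
    refine low_congr_right (α_ _ _ _) rfl ((VanishBelow.of_retract_right this h₂' ?_).low
      (N := N + l + 2) (by omega))
    exact (add_zero _).symm

/-- Moving `F` past `E^(m+1)` with the commutation relations, by induction on `m`. -/
lemma low_comm (m : ℕ) : ∀ {k l x y : ℤ} (hk : l = k + 2 * ((1 : ℕ) : ℤ))
    (hx : x = l + 2 * (m : ℤ)) (hy : y = l + 2 * ((m + 1 : ℕ) : ℤ))
    (hkx : x = k + 2 * ((m + 1 : ℕ) : ℤ)) (hxy : y = x + 2 * ((1 : ℕ) : ℤ)) {c : PB B}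
    (G : S.wt x ⟶ c) (T : S.wt l ⟶ c) (N : ℤ), Low T (S.E m hx ≫ G) N →
    VanishBelow T (S.F 1 hk ≫ S.E (m + 1) hkx ≫ G) (N + l + m + 2) →
    Low T (S.E (m + 1) hy ≫ S.F 1 hxy ≫ G) (N + l + m + 1) := by
  induction m with
  | zero =>
    intro k l x y hk hx hy hkx hxy c G T N h₁ h₂
    obtain rfl : x = l := by simpa using hx
    obtain ⟨e, he⟩ := S.E_zero hx
    have h₁' : Low T G N := low_congr_right (whiskerRightIso e G ≪≫ λ_ G) (by simp [he]) h₁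
    have := S.low_comm_zero hk hxy G T N h₁' (h₂.mono (by simp))
    exact this.mono (by simp)
  | succ m ih =>
    intro k l x y hk hx hy hkx hxy c G T N h₁ h₂
    obtain ⟨D₁⟩ := S.E_E_pow (m + 1) hx hxy hy
    refine Low.of_retract_right ((decompAssoc D₁ (S.F 1 hxy ≫ G)).retract 0)
      (M := N + l + 1) ?_ (by simp; ring)
    have hwx : x = (x - 2) + 2 * ((1 : ℕ) : ℤ) := by simp
    have hlw : x - 2 = l + 2 * (m : ℤ) := by push_cast at hx; omega
    have hkw : x - 2 = k + 2 * ((m + 1 : ℕ) : ℤ) := by push_cast at hkx ⊢; omega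
    have L : Low T (S.E (m + 1) hx ≫ S.F 1 hwx ≫ (S.E 1 hwx ≫ G)) (N + l + 1) := by
      obtain ⟨D₂⟩ := S.E_E_pow m hlw hwx hx
      obtain ⟨D₃⟩ := S.E_E_pow (m + 1) hkw hwx hkx
      have := ih hk hlw hx hkw hwx (S.E 1 hwx ≫ G) T (N - m) ?_ ?_
      · exact this.mono (by omega)
      · refine (decompAssoc D₂ G).low_right 0 (h₁.mono (by simp)) fun i hi => h₁.1.mono ?_
        have : (i : ℕ) ≠ 0 := fun h => hi (Fin.ext h)
        push_cast; omega
      · refine (decompLeft (S.F 1 hk) (decompAssoc D₃ G)).vanish_right fun i => h₂.mono ?_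
        push_cast; omega
    have L' : Low T (S.E (m + 1) hx ≫ ((S.F 1 hwx ≫ S.E 1 hwx) ≫ G)) (N + l + 1) :=
      low_congr_right (whiskerLeftIso _ (α_ _ _ _).symm) (by simp) L
    have h₁' : Low T (S.E (m + 1) hx ≫ (𝟙 _ ≫ G)) N :=
      low_congr_right (whiskerLeftIso _ (λ_ G).symm) (by simp) h₁
    rcases le_total x 0 with hl | hl
    · obtain ⟨n, hn⟩ : ∃ n : ℕ, x = -(n : ℤ) := ⟨x.natAbs, by omega⟩
      obtain ⟨D⟩ := S.FE hwx hxy n hn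
      refine (decompLeft (S.E (m + 1) hx) (decompAssoc D G)).low_right (.inl ()) (L'.mono ?_) ?_
      · show N + l + 1 + 0 ≤ N + l + 1
        omega
      · rintro (i | i) hi
        · exact (hi rfl).elim
        · refine h₁'.1.mono ?_
          show N + l + 1 + ((n : ℤ) - 1 - 2 * ((i : ℕ) : ℤ)) + 1 ≤ N
          push_cast at hx; omega
    · obtain ⟨n, hn⟩ : ∃ n : ℕ, x = (n : ℤ) := ⟨x.natAbs, by omega⟩
      obtain ⟨D⟩ := S.EF hwx hxy n hn
      have := retract_whiskerLeft (S.E (m + 1) hx) (retract_whiskerRight (D.retract (.inl ())) G)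
      refine low_congr_right (whiskerLeftIso _ (α_ _ _ _)) (by simp)
        (Low.of_retract_right this L' ?_)
      exact (add_zero _).symm

/-- Induction on the weight, in steps of `2`, starting from the zero objects. -/
lemma weight_induction {P : ℤ → Prop} {M : ℤ} (h₀ : ∀ l, IsNull (𝟙 (𝟙 (S.wt l))) → P l)
    (hs : ∀ l ≤ M, P (l - 2) → P l) (l : ℤ) (hl : l ≤ M) : P l := by
  obtain ⟨N, hN⟩ := S.integrable l
  have (r : ℕ) (hr : r ≤ N) : P (l - 2 * (N : ℤ) + 2 * (r : ℤ)) := by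
    induction r with
    | zero =>
      refine h₀ _ ?_
      have := (hN N le_rfl).2
      rwa [show l - 2 * (N : ℤ) = l - 2 * (N : ℤ) + 2 * ((0 : ℕ) : ℤ) by simp] at this
    | succ r ih =>
      refine hs _ (by omega) ?_
      have := ih (by omega)
      convert this using 1
      push_cast; ring
  simpa using this N le_rfl

/-- Endomorphisms of `E^(n) 1_l` in the weights `l ≤ -n`. The other weights follow by passing to the
opposite bicategory. -/
lemma low_E_aux (n : ℕ) : ∀ {l m : ℤ} (h : m = l + 2 * (n : ℤ)), l + n ≤ 0 →
    Low (S.E n h) (S.E n h) 0 := by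
  induction n with
  | zero =>
    intro l m h _
    obtain rfl : m = l := by simpa using h
    obtain ⟨e, he⟩ := S.E_zero h
    refine low_congr_right e.symm (by simp [he]) (low_congr_left e.symm (by simp [he]) (S.low_id m))
  | succ n ih =>
    intro l m h hl
    refine S.weight_induction (P := fun l => ∀ {m : ℤ} (h : m = l + 2 * ((n + 1 : ℕ) : ℤ)),
      Low (S.E (n + 1) h) (S.E (n + 1) h) 0) (M := -(n + 1 : ℕ)) ?_ ?_ l (by push_cast at hl ⊢; omega) h
    · intro l hl m h
      exact Low.of_isNull_left (isNull_id_source hl _)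
    · intro l hl hP m h
      have hlx : l + 2 * n = l + 2 * (n : ℤ) := rfl
      have hxm : m = l + 2 * n + 2 * ((1 : ℕ) : ℤ) := by push_cast at h ⊢; omega
      have hk : l = (l - 2) + 2 * ((1 : ℕ) : ℤ) := by simp
      have hkx : l + 2 * n = (l - 2) + 2 * ((n + 1 : ℕ) : ℤ) := by push_cast; ring
      obtain ⟨D⟩ := S.E_E_pow n hlx hxm h
      obtain ⟨D'⟩ := S.E_pow_E n hk hlx hkx
      refine Low.of_retract_left (D.retract (Fin.last n)) (M := -(n : ℤ)) ?_ (by simp; ring)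
      obtain ⟨adj, ha⟩ := S.adj_right 1 hxm
      obtain ⟨adj', ha'⟩ := S.adj_left 1 hk
      refine low_adj₂ adj (M := l + n + 1) ?_ (by rw [ha]; push_cast; ring)
      refine low_congr_right (whiskerLeftIso _ (ρ_ _)) (by simp) ?_
      have L₀ := ih hlx (by push_cast at hl; omega)
      have := S.low_comm n hk hlx h hkx hxm (𝟙 _) (S.E n hlx) 0
        (low_congr_right (ρ_ _).symm rfl L₀) ?_
      · exact this.mono (by omega)
      refine vanish_congr_right (whiskerLeftIso _ (ρ_ _).symm) (by simp) ?_
      have h3 : VanishBelow (S.E 1 hk ≫ S.E n hlx) (S.E (n + 1) hkx) (-n) :=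
        D'.vanish_left fun i => (hP hkx).1.mono (by push_cast; omega)
      refine (vanish_adj₁' adj' h3 rfl).mono ?_
      rw [ha']; push_cast at hl ⊢; omega

lemma low_E (n : ℕ) {l m : ℤ} (h : m = l + 2 * (n : ℤ)) : Low (S.E n h) (S.E n h) 0 := by
  rcases le_total (l + n) 0 with hl | hl
  · exact S.low_E_aux n h hl
  · obtain ⟨l, rfl⟩ : ∃ k, l = -k := ⟨-l, by simp⟩
    obtain ⟨m, rfl⟩ : ∃ k, m = -k := ⟨-m, by simp⟩
    exact S.op.low_E_aux n (l := m) (m := l) (by omega) (by omega)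

lemma low_F (n : ℕ) {l m : ℤ} (h : m = l + 2 * (n : ℤ)) : Low (S.F n h) (S.F n h) 0 := by
  obtain ⟨l, rfl⟩ : ∃ k, l = -k := ⟨-l, by simp⟩
  obtain ⟨m, rfl⟩ : ∃ k, m = -k := ⟨-m, by simp⟩
  exact S.chev.low_E n (l := m) (m := l) (by omega)

end Sl2Data

section

variable {C : Type u} [Category.{v} C] [Preadditive C] [Linear ℂ C] [HasShift C ℤ]
  [∀ n : ℤ, (shiftFunctor C n).Additive] [∀ n : ℤ, (shiftFunctor C n).Linear ℂ]

open ProjObj ShiftedHom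

/-- If the identity of `M` is a sum of endomorphisms which are proportional to a single one, the
latter is proportional to the identity. -/
lemma Fac.id_eq_of_forall {M : ProjObj C} {ι : Type} [Fintype ι] {Z : ι → ProjObj C} {d : ι → ℤ}
    (D : Fac M Z d) (θ : M ⟶ M) (h : ∀ i, IsNull (D.p i ≫ D.j i) ∨ D.p i ≫ D.j i = θ) :
    IsNull (𝟙 M) ∨ θ = 𝟙 M := by
  by_cases hθ : deg θ = 0
  · obtain ⟨γ, rfl⟩ := exists_rep θ hθ
    have h' (i : ι) : ∃ c : ℂ, (D.proj i).comp (D.inj i) (neg_add_cancel (d i)) = c • γ := by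
      have e : D.p i ≫ D.j i = pcl ((D.proj i).comp (D.inj i) (neg_add_cancel (d i))) :=
        (pcl_comp _ _ _).symm
      rcases h i with hi | hi
      · rw [e] at hi
        exact ⟨0, by rw [zero_smul]; exact isNull_pcl.1 hi⟩
      · rw [e] at hi
        obtain ⟨c, hc⟩ := pcl_eq_iff.1 hi.symm
        exact ⟨c, hc⟩
    choose c hc using h'
    have hs := D.sum_proj_inj
    simp only [hc] at hs
    rw [← Finset.sum_smul] at hs
    by_cases hc0 : ∑ i, c i = 0
    · rw [hc0, zero_smul] at hs
      exact .inl (isNull_pcl.2 hs.symm)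
    · refine .inr (pcl_eq_iff.2 ⟨Units.mk0 _ hc0, ?_⟩)
      exact hs.symm
  · refine .inl ?_
    have := D.isNull_comp (𝟙 M) (𝟙 M) fun i => ?_
    · simpa using this
    · rcases h i with hi | hi
      · simpa using hi
      · exact (hθ (by rw [← hi]; simp)).elim

/-- A retraction, as a factorization of the identity through a single object. -/
lemma ProjObj.Retract.exists_fac {M N : ProjObj C} {k : ℤ} (h : Retract M N k) :
    Nonempty (Fac M (fun _ : Unit => N) (fun _ => k)) := by
  obtain ⟨α, β, hαβ, hk⟩ := h
  have hβ := deg_inv_of_comp_eq_id hαβ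
  obtain ⟨α, rfl⟩ := exists_rep α hk
  obtain ⟨β, rfl⟩ := exists_rep β (n := -k) (by rw [hβ, hk])
  rw [← pcl_comp _ _ (neg_add_cancel k)] at hαβ
  obtain ⟨c, hc⟩ := pcl_eq_iff.1 hαβ
  exact ⟨{ proj := fun _ => α
           inj := fun _ => (c : ℂ) • β
           sum_proj_inj := by
            rw [Finset.univ_unique, Finset.sum_singleton, comp_smul, ← hc] }⟩

end

namespace PB

open ProjObj (Low VanishBelow Retract)
open Bicategory

variable {B : Type u} [Bicategory.{w, v} B] [GradedLinearBicategory B] {a b c d : PB B}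

lemma isNull_whiskerRight_of_fac {f f' : a ⟶ b} (φ : f ⟶ f') {g : b ⟶ c} {ι : Type} [Fintype ι]
    {Z : ι → (b ⟶ c)} {k : ι → ℤ} (D : Fac g Z k) (h : ∀ i, IsNull (φ ▷ Z i)) :
    IsNull (φ ▷ g) := by
  refine fac_isNull_of_p (facLeft f' D) _ fun i => ?_
  have : φ ▷ g ≫ f' ◁ (D.p i : g ⟶ Z i) = f ◁ (D.p i : g ⟶ Z i) ≫ φ ▷ Z i :=
    (whisker_exchange φ (D.p i : g ⟶ Z i)).symm
  rw [facLeft_p, this]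
  exact (h i).comp_left _

lemma isNull_whiskerRight_of_retract {f f' : a ⟶ b} (φ : f ⟶ f') {g g' : b ⟶ c} {k : ℤ}
    (H : Retract g g' k) (h : IsNull (φ ▷ g')) : IsNull (φ ▷ g) := by
  obtain ⟨α, β, hαβ, -⟩ := exists_of_retract H
  have : φ ▷ g = f ◁ α ≫ φ ▷ g' ≫ f' ◁ β := by
    rw [← whisker_exchange, ← whiskerLeft_comp_assoc, hαβ, whiskerLeft_id, Category.id_comp]
  rw [this]
  exact (h.comp _).comp_left _

lemma retract_iso {f g : a ⟶ b} (e : f ≅ g) : Retract f g (deg e.hom) :=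
  retract_mk e.hom e.inv e.hom_inv_id rfl

lemma exists_retract_of_fac {f g : a ⟶ b} {k : ℤ} (hf : Low f f 0) (h : Retract f g k) {ι : Type}
    [Fintype ι] {Z : ι → (a ⟶ b)} {d : ι → ℤ} (A : Fac g Z d) (h₀ : ¬ IsNull (𝟙 f)) :
    ∃ i, Retract f (Z i) (k + d i) ∧ ∃ (α : f ⟶ Z i) (β : Z i ⟶ f), ¬ IsNull (α ≫ β) ∧
      deg α = k + d i ∧ deg β = -(k + d i) :=
  Retract.exists_of_fac hf h A h₀

end PB

namespace Sl2Data

open PB Bicategory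
open ProjObj (Low VanishBelow Retract)

variable {B : Type u} [Bicategory.{w, v} B] [GradedLinearBicategory B] (S : Sl2Data B)

/-! ### Morphisms between products of divided powers -/

/-- The product `E^(d) E^(a)` consists of shifts of `E^(a+d)`, the extreme ones by `± a d`. -/
lemma low_right_E_E (a : ℕ) : ∀ (d : ℕ) {x y z : ℤ} (h : y = x + 2 * (a : ℤ))
    (h' : z = y + 2 * (d : ℤ)) (h'' : z = x + 2 * ((a + d : ℕ) : ℤ)) (T : S.wt x ⟶ S.wt z)
    (N : ℤ), Low T (S.E (a + d) h'') N → Low T (S.E a h ≫ S.E d h') (N - a * d) := by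
  induction a with
  | zero =>
    intro d x y z h h' h'' T N hT
    obtain rfl : y = x := by simpa using h
    obtain ⟨e, he⟩ := S.E_zero h
    have key : ∀ (n : ℕ) (hn : n = d) (h'' : z = y + 2 * (n : ℤ)), Low T (S.E n h'') N →
        Low T (S.E d h') N := by
      rintro n rfl h'' hT; exact hT
    have hT' := key _ (Nat.zero_add d) _ hT
    have := low_congr_right (whiskerRightIso e.symm (S.E d h'))
      (by simp [he]) (low_congr_right (λ_ _).symm rfl hT')
    simpa using this
  | succ a ih =>
    intro d x y z h h' h'' T N hT
    have h₁ : x + 2 = x + 2 * ((1 : ℕ) : ℤ) := by simp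
    have h₂ : y = x + 2 + 2 * (a : ℤ) := by push_cast at h; omega
    have h₃ : z = x + 2 + 2 * ((a + d : ℕ) : ℤ) := by push_cast at h'' ⊢; omega
    have h₄ : z = x + 2 * ((a + d + 1 : ℕ) : ℤ) := by push_cast at h'' ⊢; omega
    have key : ∀ (n : ℕ) (hn : n = a + d + 1) (h'' : z = x + 2 * (n : ℤ)), Low T (S.E n h'') N →
        Low T (S.E (a + d + 1) h₄) N := by
      rintro n rfl h'' hT; exact hT
    have hT' := key _ (by omega) _ hT
    obtain ⟨D⟩ := S.E_pow_E a h₁ h₂ h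
    obtain ⟨D'⟩ := S.E_pow_E (a + d) h₁ h₃ h₄
    obtain ⟨adj, -⟩ := S.adj_left 1 h₁
    have L₁ : Low T (S.E 1 h₁ ≫ S.E (a + d) h₃) (N - (a + d)) :=
      D'.low_right 0 (hT'.mono (by simp)) fun i hi => hT'.1.mono (by
        have : (i : ℕ) ≠ 0 := fun h => hi (Fin.ext h)
        push_cast; omega)
    obtain ⟨adj, -⟩ := S.adj_right 1 h₁
    have L₂ := ih d h₂ h' h₃ (S.F 1 h₁ ≫ T) (N - (a + d) - deg adj.unit)
      (low_adj₁ adj L₁ (by ring))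
    have L₃ := low_adj₁' adj L₂ rfl
    have L₄ := low_congr_right (α_ _ _ _).symm rfl L₃
    refine Low.of_retract_right (retract_whiskerRight (D.retract 0) (S.E d h')) L₄ ?_
    simp; ring

lemma low_left_E_E (a : ℕ) : ∀ (d : ℕ) {x y z : ℤ} (h : y = x + 2 * (a : ℤ))
    (h' : z = y + 2 * (d : ℤ)) (h'' : z = x + 2 * ((a + d : ℕ) : ℤ)) (T : S.wt x ⟶ S.wt z)
    (N : ℤ), Low (S.E (a + d) h'') T N → Low (S.E a h ≫ S.E d h') T (N - a * d) := by
  induction a with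
  | zero =>
    intro d x y z h h' h'' T N hT
    obtain rfl : y = x := by simpa using h
    obtain ⟨e, he⟩ := S.E_zero h
    have key : ∀ (n : ℕ) (hn : n = d) (h'' : z = y + 2 * (n : ℤ)), Low (S.E n h'') T N →
        Low (S.E d h') T N := by
      rintro n rfl h'' hT; exact hT
    have hT' := key _ (Nat.zero_add d) _ hT
    have := low_congr_left (whiskerRightIso e.symm (S.E d h'))
      (by simp [he]) (low_congr_left (λ_ _).symm rfl hT')
    simpa using this
  | succ a ih =>
    intro d x y z h h' h'' T N hT
    have h₁ : x + 2 = x + 2 * ((1 : ℕ) : ℤ) := by simp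
    have h₂ : y = x + 2 + 2 * (a : ℤ) := by push_cast at h; omega
    have h₃ : z = x + 2 + 2 * ((a + d : ℕ) : ℤ) := by push_cast at h'' ⊢; omega
    have h₄ : z = x + 2 * ((a + d + 1 : ℕ) : ℤ) := by push_cast at h'' ⊢; omega
    have key : ∀ (n : ℕ) (hn : n = a + d + 1) (h'' : z = x + 2 * (n : ℤ)), Low (S.E n h'') T N →
        Low (S.E (a + d + 1) h₄) T N := by
      rintro n rfl h'' hT; exact hT
    have hT' := key _ (by omega) _ hT
    obtain ⟨D⟩ := S.E_pow_E a h₁ h₂ h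
    obtain ⟨D'⟩ := S.E_pow_E (a + d) h₁ h₃ h₄
    have L₁ : Low (S.E 1 h₁ ≫ S.E (a + d) h₃) T (N - (a + d)) :=
      D'.low_left (Fin.last _) (hT'.mono (by simp; omega)) fun i hi => hT'.1.mono (by
        have : (i : ℕ) ≠ a + d := fun h => hi (Fin.ext h)
        push_cast; omega)
    obtain ⟨adj, -⟩ := S.adj_left 1 h₁
    have L₂ := ih d h₂ h' h₃ (S.F 1 h₁ ≫ T) _ (low_adj₁' adj L₁ rfl)
    have L₃ := low_adj₁ adj L₂ (N := N - (a + d) - a * d) (by ring)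
    have L₄ := low_congr_left (α_ _ _ _).symm rfl L₃
    refine Low.of_retract_left (retract_whiskerRight (D.retract (Fin.last _)) (S.E d h')) L₄ ?_
    simp; ring

lemma low_E_E_E_E {a b c d : ℕ} (h : a + d = b + c) {x y y' z : ℤ} (ha : y = x + 2 * (a : ℤ))
    (hd : z = y + 2 * (d : ℤ)) (hb : y' = x + 2 * (b : ℤ)) (hc : z = y' + 2 * (c : ℤ)) :
    Low (S.E a ha ≫ S.E d hd) (S.E b hb ≫ S.E c hc) (-(a * d) - b * c) := by
  have h₁ : z = x + 2 * ((a + d : ℕ) : ℤ) := by push_cast; omega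
  have h₂ : z = x + 2 * ((b + c : ℕ) : ℤ) := by push_cast; omega
  have key : ∀ (n m : ℕ) (hn : n = m) (h : z = x + 2 * (n : ℤ)) (h' : z = x + 2 * (m : ℤ)),
      Low (S.E n h) (S.E m h') 0 := by
    rintro n _ rfl h h'; exact S.low_E n h
  have := S.low_right_E_E b c hb hc h₂ _ _ (S.low_left_E_E a d ha hd h₁ _ _ (key _ _ h h₁ h₂))
  exact this.mono (by simp)

/-- The bound on the degrees of the 2-morphisms `E^(a) F^(b) ⟶ F^(d) E^(c)`. -/
lemma low_FE_EF {a b c d : ℕ} (h : a + d = b + c) {x y z w : ℤ} (hb : x = z + 2 * (b : ℤ))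
    (ha : y = z + 2 * (a : ℤ)) (hc : w = x + 2 * (c : ℤ)) (hd : w = y + 2 * (d : ℤ)) {N : ℤ}
    (hN : N = ((b : ℤ) - d) * (2 * b - a - x - d)) :
    Low (S.F b hb ≫ S.E a ha) (S.E c hc ≫ S.F d hd) N := by
  have L₁ := S.low_E_E_E_E h ha hd hb hc
  obtain ⟨adj, had⟩ := S.adj_right b hb
  obtain ⟨adj', had'⟩ := S.adj_right d hd
  have L₂ := low_congr_left (α_ _ _ _).symm rfl
    (low_adj₁ adj L₁ (N := -(a * d) - b * c - deg adj.unit) (by ring))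
  refine (low_adj₂' adj' L₂ rfl).mono (le_of_eq ?_)
  have h' : (a : ℤ) + d = b + c := by exact_mod_cast h
  obtain rfl : z = x - 2 * b := by omega
  rw [hN, had, had', ha, show (c : ℤ) = a + d - b by omega]
  ring

/-- The bound on the degrees of the 2-morphisms `F^(d) E^(c) ⟶ E^(a) F^(b)`. -/
lemma low_EF_FE {a b c d : ℕ} (h : a + d = b + c) {x y z w : ℤ} (hb : x = z + 2 * (b : ℤ))
    (ha : y = z + 2 * (a : ℤ)) (hc : w = x + 2 * (c : ℤ)) (hd : w = y + 2 * (d : ℤ)) {N : ℤ}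
    (hN : N = ((b : ℤ) - d) * (2 * b - a - x - d)) :
    Low (S.E c hc ≫ S.F d hd) (S.F b hb ≫ S.E a ha) N := by
  have L₁ := S.low_E_E_E_E h.symm hb hc ha hd
  obtain ⟨adj, had⟩ := S.adj_left b hb
  obtain ⟨adj', had'⟩ := S.adj_left d hd
  have L₂ := low_congr_left (α_ _ _ _) rfl
    (low_adj₂ adj' L₁ (N := -(b * c) - a * d - deg adj'.unit) (by ring))
  refine (low_adj₁' adj L₂ rfl).mono (le_of_eq ?_)
  have h' : (a : ℤ) + d = b + c := by exact_mod_cast h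
  obtain rfl : z = x - 2 * b := by omega
  rw [hN, had, had', ha, show (c : ℤ) = a + d - b by omega]
  ring

end Sl2Data

namespace Sl2Data

open PB Bicategory
open ProjObj (Low VanishBelow Retract)

variable {B : Type u} [Bicategory.{w, v} B] [GradedLinearBicategory B] (S : Sl2Data B)

/-! ### Reordering the divided powers -/

/-- The identity of `M` factors through objects of the form `F^(b) E^(a)` with `a ≤ n`. -/
def Hull (n : ℕ) {x y : ℤ} (M : S.wt x ⟶ S.wt y) : Prop :=
  ∃ (ι : Type) (_ : Fintype ι) (a b : ι → ℕ) (z : ι → ℤ) (ha : ∀ i, z i = x + 2 * (a i : ℤ))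
    (hb : ∀ i, z i = y + 2 * (b i : ℤ)) (d : ι → ℤ),
    Nonempty (Fac M (fun i => S.E (a i) (ha i) ≫ S.F (b i) (hb i)) d) ∧ ∀ i, a i ≤ n

variable {S}

lemma Hull.mono {m n : ℕ} (h : m ≤ n) {x y : ℤ} {M : S.wt x ⟶ S.wt y} (hM : S.Hull m M) :
    S.Hull n M := by
  obtain ⟨ι, _, a, b, z, ha, hb, d, D, hD⟩ := hM
  exact ⟨ι, _, a, b, z, ha, hb, d, D, fun i => (hD i).trans h⟩

lemma Hull.of_fac {n : ℕ} {x y : ℤ} {M : S.wt x ⟶ S.wt y} {κ : Type} [Fintype κ]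
    {Z : κ → (S.wt x ⟶ S.wt y)} {e : κ → ℤ} (A : Fac M Z e) (h : ∀ k, S.Hull n (Z k)) :
    S.Hull n M := by
  choose ι _ a b z ha hb d D hD using h
  exact ⟨Σ k, ι k, inferInstance, fun s => a s.1 s.2, fun s => b s.1 s.2, fun s => z s.1 s.2,
    fun s => ha s.1 s.2, fun s => hb s.1 s.2, _, ⟨A.trans fun k => (D k).some⟩, fun s => hD _ _⟩

lemma Hull.of_retract {n : ℕ} {x y : ℤ} {M N : S.wt x ⟶ S.wt y} {k : ℤ} (h : Retract M N k)
    (hN : S.Hull n N) : S.Hull n M := by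
  obtain ⟨α, β, hαβ, hk⟩ := exists_of_retract h
  obtain ⟨A⟩ := ProjObj.Retract.exists_fac h
  exact Hull.of_fac A fun _ => hN

lemma Hull.of_iso {n : ℕ} {x y : ℤ} {M N : S.wt x ⟶ S.wt y} (e : M ≅ N)
    (hN : S.Hull n N) : S.Hull n M := hN.of_retract (retract_iso e)

variable (S)

lemma hull_EF (a b : ℕ) {x y z : ℤ} (ha : z = x + 2 * (a : ℤ)) (hb : z = y + 2 * (b : ℤ)) :
    S.Hull a (S.E a ha ≫ S.F b hb) := by
  obtain ⟨A⟩ := ProjObj.Retract.exists_fac (retract_iso (Iso.refl (S.E a ha ≫ S.F b hb)))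
  exact ⟨Unit, inferInstance, fun _ => a, fun _ => b, fun _ => z, fun _ => ha, fun _ => hb, _, ⟨A⟩,
    fun _ => le_rfl⟩

lemma hull_E {n : ℕ} {w x y : ℤ} (h : x = w + 2 * ((1 : ℕ) : ℤ)) {M : S.wt x ⟶ S.wt y}
    (hM : S.Hull n M) : S.Hull (n + 1) (S.E 1 h ≫ M) := by
  obtain ⟨ι, _, a, b, z, ha, hb, d, ⟨D⟩, hD⟩ := hM
  refine Hull.of_fac (facLeft (S.E 1 h) D) fun i => ?_
  have h' : z i = w + 2 * ((a i + 1 : ℕ) : ℤ) := by have := ha i; push_cast at *; omega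
  obtain ⟨A⟩ := S.E_pow_E (a i) h (ha i) h'
  exact Hull.of_iso (α_ _ _ _).symm (Hull.of_fac (decompRight A _).toFac fun _ =>
    (S.hull_EF (a i + 1) (b i) h' (hb i)).mono (by have := hD i; omega))

/-- Reordering `F^(b) E^(a) F`, by induction on `a`. -/
lemma hull_F_EF (a : ℕ) : ∀ (b : ℕ) {w x y z : ℤ} (h : w = x + 2 * ((1 : ℕ) : ℤ))
    (ha : z = x + 2 * ((a : ℕ) : ℤ)) (hb : z = y + 2 * (b : ℤ)),
    S.Hull a (S.F 1 h ≫ S.E a ha ≫ S.F b hb) := by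
  induction a with
  | zero =>
    intro b w x y z h ha hb
    obtain rfl : z = x := by simpa using ha
    obtain ⟨e, -⟩ := S.E_zero ha
    have hb' : w = y + 2 * ((b + 1 : ℕ) : ℤ) := by push_cast at *; omega
    have hw : w = w + 2 * ((0 : ℕ) : ℤ) := by simp
    obtain ⟨e', -⟩ := S.E_zero hw
    obtain ⟨A⟩ := S.F_pow_F b hb h hb'
    refine Hull.of_iso (whiskerLeftIso _ (whiskerRightIso e _ ≪≫ λ_ _)) (Hull.of_fac A.toFac fun _ => ?_)
    exact Hull.of_iso ((λ_ _).symm ≪≫ whiskerRightIso e'.symm _) (S.hull_EF 0 (b + 1) hw hb')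
  | succ a ih =>
    intro b w x y z h ha hb
    have h₁ : w = x + 2 * ((1 : ℕ) : ℤ) := h
    have h₂ : z = w + 2 * (a : ℤ) := by push_cast at *; omega
    have h₃ : x = (x - 2) + 2 * ((1 : ℕ) : ℤ) := by simp
    have h₄ : w + 2 = w + 2 * ((1 : ℕ) : ℤ) := by simp
    obtain ⟨A⟩ := S.E_pow_E a h₁ h₂ ha
    -- the factor `E^(a+1)` is split off, and `E` is moved past `F`
    refine Hull.of_retract (retract_whiskerLeft _ (retract_whiskerRight (A.retract 0) _)) ?_
    refine Hull.of_iso (N := (S.F 1 h ≫ S.E 1 h₁) ≫ S.E a h₂ ≫ S.F b hb)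
      (whiskerLeftIso _ (α_ _ _ _) ≪≫ (α_ _ _ _).symm) ?_
    have hE : S.Hull (a + 1) ((S.E 1 h₄ ≫ S.F 1 h₄) ≫ S.E a h₂ ≫ S.F b hb) :=
      Hull.of_iso (α_ _ _ _) (S.hull_E h₄ (ih b h₄ h₂ hb))
    rcases le_total w 0 with hl | hl
    · obtain ⟨n, hn⟩ : ∃ n : ℕ, w = -(n : ℤ) := ⟨w.natAbs, by omega⟩
      obtain ⟨D⟩ := S.FE h h₄ n hn
      exact Hull.of_retract (retract_whiskerRight (D.retract (.inl ())) _) hE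
    · obtain ⟨n, hn⟩ : ∃ n : ℕ, w = n := ⟨w.natAbs, by omega⟩
      obtain ⟨D⟩ := S.EF h h₄ n hn
      refine Hull.of_fac (decompRight D _).toFac ?_
      rintro (i | i)
      · exact hE
      · exact Hull.of_iso (λ_ _) ((S.hull_EF a b h₂ hb).mono (Nat.le_succ a))

lemma hull_F {n : ℕ} {w x y : ℤ} (h : w = x + 2 * ((1 : ℕ) : ℤ)) {M : S.wt x ⟶ S.wt y}
    (hM : S.Hull n M) : S.Hull n (S.F 1 h ≫ M) := by
  obtain ⟨ι, _, a, b, z, ha, hb, d, ⟨D⟩, hD⟩ := hM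
  exact Hull.of_fac (facLeft (S.F 1 h) D) fun i => (S.hull_F_EF (a i) (b i) h _ _).mono (hD i)

lemma hull_FE (a b : ℕ) : ∀ {x y z : ℤ} (hb : x = z + 2 * (b : ℤ)) (ha : y = z + 2 * (a : ℤ)),
    S.Hull a (S.F b hb ≫ S.E a ha) := by
  induction b with
  | zero =>
    intro x y z hb ha
    obtain rfl : x = z := by simpa using hb
    obtain ⟨e, -⟩ := S.F_zero hb
    have hy : y = y + 2 * ((0 : ℕ) : ℤ) := by simp
    obtain ⟨e', -⟩ := S.F_zero hy
    exact Hull.of_iso (whiskerRightIso e _ ≪≫ λ_ _ ≪≫ (ρ_ _).symm ≪≫ whiskerLeftIso _ e'.symm)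
      (S.hull_EF a 0 ha hy)
  | succ b ih =>
    intro x y z hb ha
    have h₁ : x = (x - 2) + 2 * ((1 : ℕ) : ℤ) := by simp
    have h₂ : x - 2 = z + 2 * (b : ℤ) := by push_cast at *; omega
    obtain ⟨A⟩ := S.F_pow_F b h₂ h₁ hb
    exact Hull.of_retract (retract_whiskerRight (A.retract 0) _)
      (Hull.of_iso (α_ _ _ _) (S.hull_F h₁ (ih h₂ ha)))

/-- `E^(a) F^(b)` is a direct summand of `F^(b) E^(a)` if `b - a ≥ x`. -/
lemma exists_retract_FE (a b : ℕ) {x y z w : ℤ} (hb : x = z + 2 * (b : ℤ))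
    (ha : y = z + 2 * (a : ℤ)) (ha' : w = x + 2 * (a : ℤ)) (hb' : w = y + 2 * (b : ℤ))
    (hr : 0 ≤ (b : ℤ) - a - x) :
    Retract (S.F b hb ≫ S.E a ha) (S.E a ha' ≫ S.F b hb') 0 := by
  obtain ⟨ι, _, a', b', z', ha'', hb'', d, ⟨D⟩, hD⟩ := S.hull_FE a b hb ha
  -- `D` factors the identity through objects `F^(b') E^(a')` with `a' ≤ a`; for degree reasons only
  -- the terms with `a' = a` can be nonzero
  have hz : ∀ i, (a : ℤ) + b' i = b + a' i := fun i => by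
    have := ha'' i; have := hb'' i; omega
  have L₁ (i) := S.low_FE_EF (a := a) (b := b) (c := a' i) (d := b' i)
    (by exact_mod_cast hz i) hb ha (ha'' i) (hb'' i) rfl
  have L₂ (i) := S.low_EF_FE (a := a) (b := b) (c := a' i) (d := b' i)
    (by exact_mod_cast hz i) hb ha (ha'' i) (hb'' i) rfl
  have M₁ := S.low_FE_EF (N := 0) (add_comm a b) hb ha ha' hb' (by ring)
  have M₂ := S.low_EF_FE (N := 0) (add_comm a b) hb ha ha' hb' (by ring)
  have key (i : ι) (hi : ¬ IsNull ((D.p i : _ ⟶ S.E (a' i) (ha'' i) ≫ S.F (b' i) (hb'' i)) ≫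
      (D.j i : S.E (a' i) (ha'' i) ≫ S.F (b' i) (hb'' i) ⟶ _))) : a' i = a ∧ b' i = b ∧ d i = 0 := by
    have h₁ : ((b : ℤ) - b' i) * (2 * b - a - x - b' i) ≤ d i := by
      by_contra! h'
      exact hi ((isNull_of_low (φ := D.p i) (L₁ i) h').comp _)
    have h₂ : ((b : ℤ) - b' i) * (2 * b - a - x - b' i) ≤ -d i := by
      by_contra! h'
      exact hi ((isNull_of_low (φ := D.j i) (L₂ i) h').comp_left _)
    have h₃ := hD i
    have h₄ := hz i
    by_cases h₅ : a' i = a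
    · refine ⟨h₅, by omega, ?_⟩
      rw [show (b : ℤ) - b' i = 0 by omega, zero_mul] at h₁ h₂
      omega
    · have : 0 < ((b : ℤ) - b' i) * (2 * b - a - x - b' i) :=
        mul_pos (by omega) (by omega)
      omega
  by_cases hn : IsNull (𝟙 (S.F b hb ≫ S.E a ha))
  · exact Retract.of_isNull hn _ _
  obtain ⟨i, hi⟩ : ∃ i, ¬ IsNull ((D.p i : _ ⟶ S.E (a' i) (ha'' i) ≫ S.F (b' i) (hb'' i)) ≫
      (D.j i : S.E (a' i) (ha'' i) ≫ S.F (b' i) (hb'' i) ⟶ _)) := by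
    by_contra! h
    exact hn (by simpa using fac_isNull_comp D (𝟙 _) (𝟙 _) fun i => by simpa using h i)
  have gen : ∀ (a₁ b₁ : ℕ) (z₁ : ℤ) (h₁ : z₁ = x + 2 * (a₁ : ℤ)) (h₂ : z₁ = y + 2 * (b₁ : ℤ)),
      a₁ = a → b₁ = b → ∀ (p : S.F b hb ≫ S.E a ha ⟶ S.E a₁ h₁ ≫ S.F b₁ h₂)
      (j : S.E a₁ h₁ ≫ S.F b₁ h₂ ⟶ S.F b hb ≫ S.E a ha), deg p = 0 → deg j = 0 →
      ∃ (p' : S.F b hb ≫ S.E a ha ⟶ S.E a ha' ≫ S.F b hb')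
        (j' : S.E a ha' ≫ S.F b hb' ⟶ S.F b hb ≫ S.E a ha), deg p' = 0 ∧ deg j' = 0 ∧
        p ≫ j = p' ≫ j' := by
    rintro _ _ z₁ h₁ h₂ rfl rfl p j hp hj
    obtain rfl : z₁ = w := by omega
    exact ⟨p, j, hp, hj, rfl⟩
  have gen' (k) (hk : ¬ IsNull ((D.p k : _ ⟶ S.E (a' k) (ha'' k) ≫ S.F (b' k) (hb'' k)) ≫
      (D.j k : S.E (a' k) (ha'' k) ≫ S.F (b' k) (hb'' k) ⟶ _))) :=
    gen _ _ _ (ha'' k) (hb'' k) (key k hk).1 (key k hk).2.1 (D.p k) (D.j k) (key k hk).2.2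
      (by rw [deg_fac_j, (key k hk).2.2, neg_zero])
  obtain ⟨p, j, hp, hj, hpj⟩ := gen' i hi
  rw [hpj] at hi
  have hall : ∀ k, IsNull ((D.p k : _ ⟶ S.E (a' k) (ha'' k) ≫ S.F (b' k) (hb'' k)) ≫
      (D.j k : S.E (a' k) (ha'' k) ≫ S.F (b' k) (hb'' k) ⟶ _)) ∨
      (D.p k : _ ⟶ S.E (a' k) (ha'' k) ≫ S.F (b' k) (hb'' k)) ≫
      (D.j k : S.E (a' k) (ha'' k) ≫ S.F (b' k) (hb'' k) ⟶ _) = p ≫ j := fun k => by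
    by_cases hk : IsNull ((D.p k : _ ⟶ S.E (a' k) (ha'' k) ≫ S.F (b' k) (hb'' k)) ≫
      (D.j k : S.E (a' k) (ha'' k) ≫ S.F (b' k) (hb'' k) ⟶ _))
    · exact .inl hk
    · obtain ⟨p', j', hp', hj', h'⟩ := gen' k hk
      refine .inr (h'.trans ?_)
      rw [h'] at hk
      rw [eq_of_low M₁ hp' hp (fun h => hk (h.comp _)) (fun h => hi (h.comp _)),
        eq_of_low M₂ hj' hj (fun h => hk (h.comp_left _)) (fun h => hi (h.comp_left _))]
  -- all nonzero terms agree, and their sum is the identity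
  exact retract_mk p j ((D.id_eq_of_forall (p ≫ j) hall).resolve_left hn) hp

/-- `E^(a) F^(b)` and `F^(b) E^(a)` are isomorphic if `b - a = x`. -/
lemma exists_iso_FE (a b : ℕ) {x y z w : ℤ} (hb : x = z + 2 * (b : ℤ))
    (ha : y = z + 2 * (a : ℤ)) (ha' : w = x + 2 * (a : ℤ)) (hb' : w = y + 2 * (b : ℤ))
    (hr : (b : ℤ) - a - x = 0) :
    ∃ e : S.F b hb ≫ S.E a ha ≅ S.E a ha' ≫ S.F b hb', deg e.hom = 0 := by
  obtain ⟨α, β, hαβ, hα⟩ := exists_of_retract (S.exists_retract_FE a b hb ha ha' hb' hr.ge)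
  obtain ⟨α', β', hαβ', hα'⟩ : ∃ (α' : S.E a ha' ≫ S.F b hb' ⟶ S.F b hb ≫ S.E a ha)
      (β' : S.F b hb ≫ S.E a ha ⟶ S.E a ha' ≫ S.F b hb'), α' ≫ β' = 𝟙 _ ∧ deg α' = 0 := by
    obtain ⟨x, rfl⟩ : ∃ k, x = -k := ⟨-x, by simp⟩
    obtain ⟨y, rfl⟩ : ∃ k, y = -k := ⟨-y, by simp⟩
    obtain ⟨z, rfl⟩ : ∃ k, z = -k := ⟨-z, by simp⟩
    obtain ⟨w, rfl⟩ : ∃ k, w = -k := ⟨-w, by simp⟩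
    exact exists_of_retract (S.chev.exists_retract_FE b a (x := x) (y := y) (z := w) (w := z)
      (by omega) (by omega) (by omega) (by omega) (by omega))
  have hβ := deg_of_comp_eq_id hαβ
  have hβ' := deg_of_comp_eq_id hαβ'
  by_cases hn : IsNull (𝟙 (S.F b hb ≫ S.E a ha))
  · have hn' : IsNull (𝟙 (S.E a ha' ≫ S.F b hb')) := by
      rw [← hαβ']; exact (isNull_of_isNull_id' hn α').comp _
    exact ⟨⟨α, β, hαβ, ((isNull_of_isNull_id hn' β).comp α).eq hn' (by simp [hα, hβ])⟩, hα⟩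
  · have h₁ : ¬ IsNull α := fun h => hn (by rw [← hαβ]; exact h.comp _)
    have h₂ : ¬ IsNull β := fun h => hn (by rw [← hαβ]; exact h.comp_left _)
    have hn' : ¬ IsNull (𝟙 (S.E a ha' ≫ S.F b hb')) := fun h => h₁ (isNull_of_isNull_id' h _)
    have h₃ : ¬ IsNull α' := fun h => hn' (by rw [← hαβ']; exact h.comp _)
    have h₄ : ¬ IsNull β' := fun h => hn' (by rw [← hαβ']; exact h.comp_left _)
    have M₁ := S.low_FE_EF (N := 0) (add_comm a b) hb ha ha' hb' (by ring)
    have M₂ := S.low_EF_FE (N := 0) (add_comm a b) hb ha ha' hb' (by ring)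
    obtain rfl := eq_of_low M₁ hα (by omega) h₁ h₄
    obtain rfl := eq_of_low M₂ hα' (by omega) h₃ h₂
    exact ⟨⟨α, α', hαβ, hαβ'⟩, hα⟩

/-- The bound on the degrees of the 2-morphisms `E^(a) F^(b) ⟶ E^(c) F^(d)`. -/
lemma low_FE_FE {a b c d : ℕ} (h : a + d = b + c) {x y z z' : ℤ} (hb : x = z + 2 * (b : ℤ))
    (ha : y = z + 2 * (a : ℤ)) (hd : x = z' + 2 * (d : ℤ)) (hc : y = z' + 2 * (c : ℤ))
    (hr : 0 ≤ (b : ℤ) - a - x) {N : ℤ}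
    (hN : N = ((b : ℤ) - d) * (2 * b - a - x - d)) :
    Low (S.F b hb ≫ S.E a ha) (S.F d hd ≫ S.E c hc) N := by
  have hc' : x + 2 * (c : ℤ) = x + 2 * (c : ℤ) := rfl
  have hd' : x + 2 * (c : ℤ) = y + 2 * (d : ℤ) := by omega
  exact Low.of_retract_right (S.exists_retract_FE c d hd hc hc' hd' (by omega))
    (S.low_FE_EF h hb ha hc' hd' hN) (by simp)

/-! ### Direct summands of `F^(b+1) E` -/

/-- In weights `y ≤ b - 1`, the 1-morphism `F^(b)` is, up to a shift, a direct summand of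
`F^(b+1) E`, by induction on `b`: in weights `y < 0` the identity is a summand of `F E`. -/
lemma exists_retract_E_F (b : ℕ) : ∀ {x y z : ℤ} (h : y = z + 2 * (b : ℤ))
    (h₁ : x = y + 2 * ((1 : ℕ) : ℤ)) (h₂ : x = z + 2 * ((b + 1 : ℕ) : ℤ)), y ≤ b - 1 →
    ∃ k, Retract (S.F b h) (S.E 1 h₁ ≫ S.F (b + 1) h₂) k := by
  have main (b : ℕ) {x y z : ℤ} (h : y = z + 2 * (b : ℤ))
      (h₁ : x = y + 2 * ((1 : ℕ) : ℤ)) (h₂ : x = z + 2 * ((b + 1 : ℕ) : ℤ)) {k : ℤ}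
      (H : Retract (S.F b h) ((S.E 1 h₁ ≫ S.F 1 h₁) ≫ S.F b h) k) :
      ∃ k, Retract (S.F b h) (S.E 1 h₁ ≫ S.F (b + 1) h₂) k := by
    by_cases hn : IsNull (𝟙 (S.F b h))
    · exact ⟨0, Retract.of_isNull hn _ _⟩
    obtain ⟨A⟩ := S.F_pow_F b h h₁ h₂
    obtain ⟨i, hi, -⟩ := exists_retract_of_fac (S.low_F b h)
      (H.trans (retract_iso (α_ _ _ _))) (decompLeft (S.E 1 h₁) A).toFac hn
    exact ⟨_, hi⟩
  have neg (b : ℕ) {x y z : ℤ} (h : y = z + 2 * (b : ℤ))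
      (h₁ : x = y + 2 * ((1 : ℕ) : ℤ)) (h₂ : x = z + 2 * ((b + 1 : ℕ) : ℤ)) (hy : y < 0) :
      ∃ k, Retract (S.F b h) (S.E 1 h₁ ≫ S.F (b + 1) h₂) k := by
    have h₃ : y = (y - 2) + 2 * ((1 : ℕ) : ℤ) := by simp
    obtain ⟨n, hn⟩ : ∃ n : ℕ, y = -((n + 1 : ℕ) : ℤ) := ⟨y.natAbs - 1, by omega⟩
    obtain ⟨D⟩ := S.FE h₃ h₁ _ hn
    exact main b h h₁ h₂ ((retract_iso (λ_ _).symm).trans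
      (retract_whiskerRight (D.retract (.inr 0)) (S.F b h)))
  induction b with
  | zero =>
    intro x y z h h₁ h₂ hy
    exact neg 0 h h₁ h₂ (by push_cast at hy; omega)
  | succ b ih =>
    intro x y z h h₁ h₂ hy
    rcases lt_or_ge y 0 with hy' | hy'
    · exact neg _ h h₁ h₂ hy'
    by_cases hnull : IsNull (𝟙 (S.F (b + 1) h))
    · exact ⟨0, Retract.of_isNull hnull _ _⟩
    have h₃ : y = (y - 2) + 2 * ((1 : ℕ) : ℤ) := by simp
    have h₄ : y - 2 = z + 2 * (b : ℤ) := by push_cast at h; omega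
    obtain ⟨k, hk⟩ := ih h₄ h₃ h (by push_cast at hy; omega)
    obtain ⟨A⟩ := S.F_pow_F b h₄ h₃ h
    obtain ⟨n, hn⟩ : ∃ n : ℕ, y = n := ⟨y.natAbs, by omega⟩
    obtain ⟨D⟩ := S.EF h₃ h₁ n hn
    -- the copy of `F^(b+1)` is chosen so that the total degree is far from zero
    obtain ⟨i, hi⟩ : ∃ i : Fin (b + 1), (b : ℤ) ≤ |-(((b + 1 : ℕ) : ℤ) - 1 - 2 * ((i : ℕ) : ℤ)) + k| := by
      rcases le_total 0 k with hk | hk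
      · refine ⟨Fin.last b, le_abs.2 (.inl ?_)⟩
        simp only [Fin.val_last]; push_cast; omega
      · refine ⟨0, le_abs.2 (.inr ?_)⟩
        simp only [Fin.val_zero]; push_cast; omega
    have H := ((A.retract i).trans (retract_whiskerLeft (S.F 1 h₃) hk)).trans
      (retract_iso (α_ _ _ _).symm)
    obtain ⟨j, hj, α, β, hαβ, hα, hβ⟩ := exists_retract_of_fac (S.low_F _ h) H
      (decompRight D (S.F (b + 1) h)).toFac hnull
    rcases j with j | j
    · exact main _ h h₁ h₂ hj
    · exfalso
      have L := low_congr_right (λ_ _).symm rfl (S.low_F _ h)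
      have L' := low_congr_left (λ_ _).symm rfl (S.low_F _ h)
      have hα' : deg α = -(((b + 1 : ℕ) : ℤ) - 1 - 2 * ((i : ℕ) : ℤ)) + k + 0 +
        ((n : ℤ) - 1 - 2 * ((j : ℕ) : ℤ)) := hα
      have hβ' : deg β = -(-(((b + 1 : ℕ) : ℤ) - 1 - 2 * ((i : ℕ) : ℤ)) + k + 0 +
        ((n : ℤ) - 1 - 2 * ((j : ℕ) : ℤ))) := hβ
      have hα₀ : 0 ≤ deg α := by
        by_contra! h'; exact hαβ ((isNull_of_low L h').comp _)
      have hβ₀ : 0 ≤ deg β := by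
        by_contra! h'; exact hαβ ((isNull_of_low L' h').comp_left _)
      have hj' := j.2
      push_cast at hy
      rcases le_abs.1 hi with hi | hi <;> omega

/-- Composition with `E^(N)` does not kill any 2-morphism if the weights are small enough. -/
lemma isNull_of_whiskerRight_E (N : ℕ) {z y : ℤ} (h : y = z + 2 * (N : ℤ)) (hz : z + N ≤ 0)
    {c : PB B} {f f' : c ⟶ S.wt z} (φ : f ⟶ f') (hφ : IsNull (φ ▷ S.E N h)) : IsNull φ := by
  have key (k : ℕ) : ∀ {y : ℤ} (h : y = z + 2 * (k : ℤ)), z + k ≤ 0 →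
      IsNull (φ ▷ (S.E k h ≫ S.F k h)) → IsNull φ := by
    induction k with
    | zero =>
      intro y h _ hn
      obtain rfl : y = z := by simpa using h
      obtain ⟨e, -⟩ := S.E_zero h
      obtain ⟨e', -⟩ := S.F_zero h
      have : IsNull (φ ▷ 𝟙 _) := isNull_whiskerRight_of_retract φ
        (retract_iso ((λ_ (𝟙 _)).symm ≪≫ whiskerRightIso e.symm _ ≪≫ whiskerLeftIso _ e'.symm)) hn
      simpa using this
    | succ k ih =>
      intro y h hz hn
      have h₁ : z + 2 * (k : ℤ) = z + 2 * (k : ℤ) := rfl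
      have h₂ : y = z + 2 * (k : ℤ) + 2 * ((1 : ℕ) : ℤ) := by push_cast at h ⊢; omega
      obtain ⟨A⟩ := S.E_E_pow k h₁ h₂ h
      obtain ⟨e, he⟩ := S.exists_retract_E_F k h₁ h₂ h (by push_cast at hz ⊢; omega)
      refine ih h₁ (by push_cast at hz ⊢; omega) ?_
      refine isNull_whiskerRight_of_retract φ (retract_whiskerLeft (S.E k h₁) he) ?_
      exact isNull_whiskerRight_of_fac φ (decompAssoc A (S.F (k + 1) h)).toFac fun _ => hn
  refine key N h hz ?_
  rw [whiskerRight_comp]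
  exact ((hφ.whiskerRight _).comp _).comp_left _

end Sl2Data

namespace PB

open ProjObj (Low VanishBelow Retract)
open Bicategory

variable {B : Type u} [Bicategory.{w, v} B] [GradedLinearBicategory B] {a b c d : PB B}

/-- The powers of an endomorphism. -/
noncomputable def iter {f : a ⟶ b} (φ : f ⟶ f) : ℕ → (f ⟶ f)
  | 0 => 𝟙 f
  | k + 1 => φ ≫ iter φ k

@[simp] lemma iter_zero {f : a ⟶ b} (φ : f ⟶ f) : iter φ 0 = 𝟙 f := rfl

lemma iter_succ {f : a ⟶ b} (φ : f ⟶ f) (k : ℕ) : iter φ (k + 1) = φ ≫ iter φ k := rfl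

lemma iter_add {f : a ⟶ b} (φ : f ⟶ f) (k l : ℕ) : iter φ (k + l) = iter φ k ≫ iter φ l := by
  induction k with
  | zero => simp
  | succ k ih => rw [Nat.succ_add, iter_succ, iter_succ, ih, Category.assoc]

@[simp] lemma deg_iter {f : a ⟶ b} (φ : f ⟶ f) (k : ℕ) : deg (iter φ k) = k * deg φ := by
  induction k with
  | zero => simp
  | succ k ih => rw [iter_succ, deg_comp, ih]; push_cast; ring

lemma not_isNull_of_comp_eq_id {f g : a ⟶ b} {α : f ⟶ g} {β : g ⟶ f} (h : α ≫ β = 𝟙 f)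
    (hf : ¬ IsNull (𝟙 f)) : ¬ IsNull α := fun h' => hf (by rw [← h]; exact h'.comp _)

lemma not_isNull_of_comp_eq_id' {f g : a ⟶ b} {α : f ⟶ g} {β : g ⟶ f} (h : α ≫ β = 𝟙 f)
    (hf : ¬ IsNull (𝟙 f)) : ¬ IsNull β := fun h' => hf (by rw [← h]; exact h'.comp_left _)

lemma isNull_of_isNull_comp {f g h : a ⟶ b} {α : f ⟶ g} {β : g ⟶ f} (hα : α ≫ β = 𝟙 f)
    {φ : h ⟶ f} (hφ : IsNull (φ ≫ α)) : IsNull φ := by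
  simpa [hα] using hφ.comp β

end PB

namespace Sl2Data

open PB Bicategory
open ProjObj (Low VanishBelow Retract)

variable {B : Type u} [Bicategory.{w, v} B] [GradedLinearBicategory B] (S : Sl2Data B)

/-! ### The action of the nilpotent endomorphism of `E` -/

/-- An endomorphism of degree `2` of `E` which induces an isomorphism between the two summands
`E^(2)` of `E E`, when acting on the factor `E` which is applied first. -/
structure Dot where
  /-- the endomorphism -/
  X {l m : ℤ} (h : m = l + 2 * ((1 : ℕ) : ℤ)) : S.E 1 h ⟶ S.E 1 h
  deg_X {l m : ℤ} (h : m = l + 2 * ((1 : ℕ) : ℤ)) : deg (X h) = 2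
  exists_decomp {k l m : ℤ} (h : l = k + 2 * ((1 : ℕ) : ℤ)) (h' : m = l + 2 * ((1 : ℕ) : ℤ))
    (h'' : m = k + 2 * ((2 : ℕ) : ℤ)) :
    ∃ D : QDecomp (S.E 1 h ≫ S.E 1 h') 2 (S.E 2 h''),
      (D.j 0 : S.E 2 h'' ⟶ S.E 1 h ≫ S.E 1 h') ≫ X h ▷ S.E 1 h' ≫
        (D.p 1 : S.E 1 h ≫ S.E 1 h' ⟶ S.E 2 h'') = 𝟙 (S.E 2 h'')

variable {S} (X : S.Dot)

namespace Dot

attribute [simp] deg_X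

/-- The `n`-th power of the dot maps the lowest summand of `E^(n) E` to the highest one. -/
lemma j_iter_p (n : ℕ) : ∀ {k l m : ℤ} (h : l = k + 2 * ((1 : ℕ) : ℤ)) (h' : m = l + 2 * (n : ℤ))
    (h'' : m = k + 2 * ((n + 1 : ℕ) : ℤ)) (D : QDecomp (S.E 1 h ≫ S.E n h') (n + 1) (S.E (n + 1) h'')),
      (D.j 0 : S.E (n + 1) h'' ⟶ S.E 1 h ≫ S.E n h') ≫ iter (X.X h) n ▷ S.E n h' ≫
        (D.p (Fin.last n) : S.E 1 h ≫ S.E n h' ⟶ S.E (n + 1) h'') = 𝟙 (S.E (n + 1) h'') := by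
  induction n with
  | zero =>
    intro k l m h h' h'' D
    simp only [iter_zero, id_whiskerRight, Category.id_comp]
    exact decomp_j_p_self D 0
  | succ n ih =>
    intro k l m h h' h'' D
    by_cases hn : IsNull (𝟙 (S.E (n + 2) h''))
    · refine IsNull.eq (isNull_of_isNull_id hn _) hn ?_
      rw [deg_comp, deg_comp, deg_fac_j, deg_fac_p, deg_whiskerRight, deg_iter, X.deg_X, deg_id]
      simp only [Fin.val_zero, Fin.val_last]
      push_cast; ring
    have LE := S.low_E (n + 2) h''
    have h₁ : l + 2 = l + 2 * ((1 : ℕ) : ℤ) := by simp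
    have h₂ : m = l + 2 + 2 * (n : ℤ) := by push_cast at h'; omega
    have h₃ : m - 2 = l + 2 * (n : ℤ) := by push_cast at h'; omega
    have h₄ : m - 2 = k + 2 * ((n + 1 : ℕ) : ℤ) := by push_cast at h'' ⊢; omega
    have h₅ : m = m - 2 + 2 * ((1 : ℕ) : ℤ) := by simp
    have h₆ : l + 2 = k + 2 * ((2 : ℕ) : ℤ) := by push_cast; omega
    -- the decompositions of `E^(n+1)`, of `E E^(n)` and of `E E^(n+1)`
    obtain ⟨D₁⟩ := S.E_pow_E n h h₃ h₄
    obtain ⟨D₂⟩ := S.E_E_pow n h₃ h₅ h'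
    obtain ⟨D₃⟩ := S.E_E_pow (n + 1) h₄ h₅ h''
    obtain ⟨D₄⟩ := S.E_pow_E n h₁ h₂ h'
    obtain ⟨D₅, hD₅⟩ := X.exists_decomp h h₁ h₆
    let j (i) : S.E (n + 2) h'' ⟶ S.E 1 h ≫ S.E (n + 1) h' := D.j i
    let p (i) : S.E 1 h ≫ S.E (n + 1) h' ⟶ S.E (n + 2) h'' := D.p i
    have hjp (i) : j i ≫ p i = 𝟙 _ := decomp_j_p_self D i
    let π : S.E 1 h ≫ S.E (n + 1) h' ⟶ S.E (n + 2) h'' := p (Fin.last (n + 1))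
    let Y (i : ℕ) : S.E 1 h ≫ S.E (n + 1) h' ⟶ S.E 1 h ≫ S.E (n + 1) h' :=
      iter (X.X h) i ▷ S.E (n + 1) h'
    have hdj (i) : deg (j i) = -((n : ℤ) + 1 - 2 * ((i : ℕ) : ℤ)) := by
      refine (deg_fac_j _ _).trans ?_; push_cast; ring
    have hdp (i) : deg (p i) = (n : ℤ) + 1 - 2 * ((i : ℕ) : ℤ) := by
      refine (deg_fac_p _ _).trans ?_; push_cast; ring
    have hπ : deg π = -(n + 1) := by
      rw [hdp]; simp only [Fin.val_last]; push_cast; ring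
    have hY (i : ℕ) : deg (Y i) = 2 * i := by simp [Y]; ring
    -- morphisms of degree `1 - n` can be computed in the first two summands
    have split (φ : S.E (n + 2) h'' ⟶ S.E 1 h ≫ S.E (n + 1) h') (hφ : deg φ = 1 - n) :
        φ ≫ Y n ≫ π = (φ ≫ p 1) ≫ (j 1 ≫ Y n ≫ π) := by
      refine (fac_comp_eq D.toFac φ (Y n ≫ π) 1 fun i hi => ?_).trans (Category.assoc _ _ _).symm
      rcases Nat.lt_or_ge (i : ℕ) 1 with h0 | h1
      · have : IsNull (j i ≫ Y n ≫ π) := isNull_of_low LE (by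
          rw [deg_comp, deg_comp, hY, hπ, hdj]; omega)
        exact (this.comp_left (p i)).comp_left φ
      · have h1' : (i : ℕ) ≠ 1 := fun h => hi (Fin.ext h)
        have : IsNull (φ ≫ p i) := isNull_of_low LE (by
          rw [deg_comp, hdp, hφ]; omega)
        have := this.comp (j i ≫ Y n ≫ π)
        rwa [Category.assoc] at this
    have e₁ : j 0 ≫ Y (n + 1) ≫ π = ((j 0 ≫ Y 1) ≫ p 1) ≫ (j 1 ≫ Y n ≫ π) := by
      rw [← split (j 0 ≫ Y 1) (by rw [deg_comp, hY, hdj]; simp; omega)]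
      simp only [Y, Category.assoc]
      rw [← comp_whiskerRight_assoc, ← PB.iter_add, add_comm 1 n]
    -- the second factor
    have n₂ : ¬ IsNull (j 1 ≫ Y n ≫ π) := by
      let t : S.E (n + 2) h'' ⟶ S.E (n + 1) h₄ ≫ S.E 1 h₅ := D₃.j (Fin.last (n + 1))
      let t' : S.E (n + 1) h₄ ≫ S.E 1 h₅ ⟶ S.E (n + 2) h'' := D₃.p (Fin.last (n + 1))
      have htt' : t ≫ t' = 𝟙 _ := decomp_j_p_self D₃ _
      let ι₁ : S.E (n + 1) h₄ ⟶ S.E 1 h ≫ S.E n h₃ := D₁.j 0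
      let π₁ : S.E 1 h ≫ S.E n h₃ ⟶ S.E (n + 1) h₄ := D₁.p (Fin.last n)
      let ι₁' : S.E (n + 1) h₄ ⟶ S.E 1 h ≫ S.E n h₃ := D₁.j (Fin.last n)
      have hπ₁ : ι₁' ≫ π₁ = 𝟙 _ := decomp_j_p_self D₁ _
      let q : S.E n h₃ ≫ S.E 1 h₅ ⟶ S.E (n + 1) h' := D₂.p (Fin.last n)
      let q' : S.E (n + 1) h' ⟶ S.E n h₃ ≫ S.E 1 h₅ := D₂.j (Fin.last n)
      have hq : q' ≫ q = 𝟙 _ := decomp_j_p_self D₂ _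
      have dt : deg t = n + 1 := by
        refine (deg_fac_j _ _).trans ?_
        simp only [Fin.val_last]; push_cast; ring
      have dt' : deg t' = -(n + 1) := by rw [deg_of_comp_eq_id htt', dt]
      have dι₁ : deg ι₁ = -n := by
        refine (deg_fac_j _ _).trans ?_
        simp
      have dπ₁ : deg π₁ = -n := by
        refine (deg_fac_p _ _).trans ?_
        simp only [Fin.val_last]; push_cast; ring
      have dq : deg q = -n := by
        refine (deg_fac_p _ _).trans ?_
        simp only [Fin.val_last]; push_cast; ring
      have ihn : ι₁ ≫ iter (X.X h) n ▷ S.E n h₃ ≫ π₁ = 𝟙 _ := ih h h₃ h₄ D₁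
      have L : Low (S.E 1 h ≫ S.E n h₃ ≫ S.E 1 h₅) (S.E (n + 2) h'') (-(2 * n + 1)) := by
        refine (decompLeft (S.E 1 h) D₂).low_left (Fin.last n) ?_ ?_
        · refine D.low_left (Fin.last (n + 1)) (LE.mono ?_) fun i hi => LE.1.mono ?_
          · simp only [Fin.val_last]; push_cast; omega
          · have : (i : ℕ) ≠ n + 1 := fun h => hi (Fin.ext h)
            simp only [Fin.val_last]; push_cast; omega
        · intro i hi
          refine D.vanish_left fun i' => LE.1.mono ?_
          have : (i : ℕ) ≠ n := fun h => hi (Fin.ext h)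
          push_cast; omega
      have e₂ : S.E 1 h ◁ q ≫ π = (α_ _ _ _).inv ≫ π₁ ▷ S.E 1 h₅ ≫ t' := by
        refine eq_of_low L ?_ ?_ ?_ ?_
        · rw [deg_comp, deg_whiskerLeft, dq, hπ]; ring
        · rw [deg_comp, deg_comp, deg_whiskerRight, dπ₁, dt', deg_iso_inv, deg_associator_hom]; ring
        · refine not_isNull_of_comp_eq_id' (α := j (Fin.last (n + 1)) ≫ S.E 1 h ◁ q') ?_ hn
          rw [Category.assoc, ← whiskerLeft_comp_assoc, hq, whiskerLeft_id, Category.id_comp]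
          exact hjp _
        · refine not_isNull_of_comp_eq_id' (α := t ≫ ι₁' ▷ S.E 1 h₅ ≫ (α_ _ _ _).hom) ?_ hn
          simp only [Category.assoc, Iso.hom_inv_id_assoc]
          rw [← comp_whiskerRight_assoc, hπ₁, id_whiskerRight, Category.id_comp, htt']
      have e₃ : (t ≫ ι₁ ▷ S.E 1 h₅ ≫ (α_ _ _ _).hom ≫ S.E 1 h ◁ q) ≫ Y n ≫ π = 𝟙 _ := by
        simp only [Category.assoc, Y]
        rw [whisker_exchange_assoc, e₂, whiskerRight_comp]
        simp only [Category.assoc, Iso.hom_inv_id_assoc]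
        rw [← comp_whiskerRight_assoc, ← comp_whiskerRight_assoc, Category.assoc, ihn,
          id_whiskerRight, Category.id_comp, htt']
      rw [split _ (by
        simp only [deg_comp, deg_whiskerRight, deg_whiskerLeft, deg_associator_hom]
        rw [dt, dι₁, dq]; ring)] at e₃
      exact not_isNull_of_comp_eq_id' e₃ hn
    -- the first factor
    have n₁ : ¬ IsNull ((j 0 ≫ Y 1) ≫ p 1) := by
      intro hnull
      have e₂ : j 0 ≫ Y 1 = ((j 0 ≫ Y 1) ≫ p 0) ≫ j 0 := by
        refine (fac_eq_p_j D.toFac (j 0 ≫ Y 1) 0 fun i hi => ?_).trans (Category.assoc _ _ _).symm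
        rcases eq_or_ne (i : ℕ) 1 with h1 | h1
        · obtain rfl : i = 1 := Fin.ext h1
          exact hnull
        · have h0 : (i : ℕ) ≠ 0 := fun h => hi (Fin.ext h)
          refine isNull_of_low LE ?_
          have : deg ((j 0 ≫ Y 1) ≫ p i) < 0 := by
            rw [deg_comp, deg_comp, hdj, hdp, hY]; simp; omega
          exact this
      let ι₄ : S.E (n + 1) h' ⟶ S.E 1 h₁ ≫ S.E n h₂ := D₄.j 0
      have hι₄ : ι₄ ≫ (D₄.p 0 : S.E 1 h₁ ≫ S.E n h₂ ⟶ S.E (n + 1) h') = 𝟙 _ := decomp_j_p_self D₄ 0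
      have dι₄ : deg ι₄ = -n := by
        refine (deg_fac_j _ _).trans ?_
        simp
      let J : S.E (n + 2) h'' ⟶ (S.E 1 h ≫ S.E 1 h₁) ≫ S.E n h₂ :=
        j 0 ≫ S.E 1 h ◁ ι₄ ≫ (α_ _ _ _).inv
      have dJ : deg J = -(2 * n + 1) := by
        simp only [J, deg_comp, hdj, deg_whiskerLeft, dι₄, deg_iso_inv, deg_associator_hom]
        simp; ring
      let f (i : Fin 2) : S.E 1 h ≫ S.E 1 h₁ ⟶ S.E 2 h₆ := D₅.p i
      let g (i : Fin 2) : S.E 2 h₆ ⟶ S.E 1 h ≫ S.E 1 h₁ := D₅.j i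
      have nJ : ¬ IsNull J := by
        refine not_isNull_of_comp_eq_id (β := (α_ _ _ _).hom ≫ S.E 1 h ◁ D₄.p 0 ≫ p 0) ?_ hn
        simp only [J, Category.assoc, Iso.inv_hom_id_assoc]
        rw [← whiskerLeft_comp_assoc, hι₄, whiskerLeft_id, Category.id_comp]
        exact hjp 0
      have df (i : Fin 2) : deg (f i) = 1 - 2 * ((i : ℕ) : ℤ) := by
        refine (deg_fac_p _ _).trans ?_
        push_cast; ring
      have L : Low (S.E (n + 2) h'') (S.E 2 h₆ ≫ S.E n h₂) (-(2 * n)) := by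
        have h₇ : m = k + 2 * ((2 + n : ℕ) : ℤ) := by push_cast at h'' ⊢; omega
        have key : ∀ (n' m' : ℕ) (hn : n' = m') (h : m = k + 2 * (n' : ℤ)) (h' : m = k + 2 * (m' : ℤ)),
            Low (S.E n' h) (S.E m' h') 0 := by
          rintro n' _ rfl h h'; exact S.low_E n' h
        refine (S.low_right_E_E 2 n h₆ h₂ h₇ _ 0 (key _ _ (by omega) h'' h₇)).mono ?_
        simp
      have z₁ : IsNull (J ≫ f 1 ▷ S.E n h₂) := isNull_of_low L (by
        rw [deg_comp, dJ, deg_whiskerRight, df]; simp)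
      have z₂ : J ≫ (X.X h ▷ S.E 1 h₁) ▷ S.E n h₂ ≫ f 1 ▷ S.E n h₂ =
          ((j 0 ≫ Y 1) ≫ p 0) ≫ J ≫ f 1 ▷ S.E n h₂ := by
        have e₃ : J ≫ (X.X h ▷ S.E 1 h₁) ▷ S.E n h₂ = (j 0 ≫ Y 1) ≫ S.E 1 h ◁ ι₄ ≫ (α_ _ _ _).inv := by
          simp only [J, Category.assoc, Y, PB.iter_succ, PB.iter_zero, Category.comp_id]
          rw [← associator_inv_naturality_left, whisker_exchange_assoc]
        rw [← Category.assoc, e₃]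
        conv_lhs => rw [e₂]
        simp only [J, Category.assoc]
      have z₃ : J = (J ≫ f 0 ▷ S.E n h₂) ≫ g 0 ▷ S.E n h₂ := by
        refine (fac_eq_p_j (decompRight D₅ (S.E n h₂)).toFac J 0 fun i hi => ?_).trans
          (Category.assoc _ _ _).symm
        obtain rfl : i = 1 := by
          have := i.2
          have h0 : (i : ℕ) ≠ 0 := fun h => hi (Fin.ext h)
          exact Fin.ext (by simp; omega)
        exact z₁
      have z₄ : IsNull (J ≫ f 0 ▷ S.E n h₂) := by
        have : J ≫ f 0 ▷ S.E n h₂ = J ≫ (X.X h ▷ S.E 1 h₁) ▷ S.E n h₂ ≫ f 1 ▷ S.E n h₂ := by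
          have gen (J' : S.E (n + 2) h'' ⟶ (S.E 1 h ≫ S.E 1 h₁) ≫ S.E n h₂)
              (h' : J' = (J' ≫ f 0 ▷ S.E n h₂) ≫ g 0 ▷ S.E n h₂) :
              J' ≫ f 0 ▷ S.E n h₂ = J' ≫ (X.X h ▷ S.E 1 h₁) ▷ S.E n h₂ ≫ f 1 ▷ S.E n h₂ := by
            have hg : g 0 ≫ X.X h ▷ S.E 1 h₁ ≫ f 1 = 𝟙 _ := hD₅
            conv_rhs => rw [h']
            rw [Category.assoc, ← comp_whiskerRight, ← comp_whiskerRight, hg, id_whiskerRight,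
              Category.comp_id]
          exact gen J z₃
        rw [this, z₂]
        exact z₁.comp_left _
      exact nJ (by rw [z₃]; exact z₄.comp _)
    have d₁ : deg ((j 0 ≫ Y 1) ≫ p 1) = 0 := by
      rw [deg_comp, deg_comp, hdj, hdp, hY]; simp
    have d₂ : deg (j 1 ≫ Y n ≫ π) = 0 := by
      rw [deg_comp, deg_comp, hdj, hπ, hY]; simp; ring
    refine e₁.trans ?_
    rw [eq_id_of_low LE d₁ n₁, eq_id_of_low LE d₂ n₂, Category.id_comp]

end Dot

end Sl2Data

namespace Sl2Data

open PB Bicategory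
open ProjObj (Low VanishBelow Retract)

variable {B : Type u} [Bicategory.{w, v} B] [GradedLinearBicategory B] (S : Sl2Data B)

/-! ### The summands of `E^(a) F^(b) E` -/

section Upper

variable (a b : ℕ) {x y z z' v : ℤ} (hx : x = y + 2 * ((1 : ℕ) : ℤ)) (hb : x = z + 2 * (b : ℤ))
  (ha : v = z + 2 * (a : ℤ)) (hb' : y = z' + 2 * (b : ℤ)) (ha' : v = z' + 2 * ((a + 1 : ℕ) : ℤ))

variable {S} in
/-- The `a`-th power of the dot maps the lowest copy of `E^(a+1) F^(b)` in `E^(a) F^(b) E` to the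
highest one. -/
lemma Dot.exists_upper_retraction (X : S.Dot) (hr : 0 ≤ (b : ℤ) - a - x)
    {w : S.F b hb' ≫ S.E (a + 1) ha' ⟶ S.E 1 hx ≫ S.F b hb ≫ S.E a ha} (dw : deg w = -a)
    (hw : IsNull w → IsNull (𝟙 (S.F b hb' ≫ S.E (a + 1) ha'))) :
    ∃ p : S.E 1 hx ≫ S.F b hb ≫ S.E a ha ⟶ S.F b hb' ≫ S.E (a + 1) ha', deg p = -a ∧
      w ≫ iter (X.X hx) a ▷ (S.F b hb ≫ S.E a ha) ≫ p = 𝟙 _ := by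
  by_cases hn : IsNull (𝟙 (S.F b hb' ≫ S.E (a + 1) ha'))
  · obtain ⟨p, -, hp⟩ := exists_isNull (S.E 1 hx ≫ S.F b hb ≫ S.E a ha)
      (S.F b hb' ≫ S.E (a + 1) ha') (-a)
    exact ⟨p, hp, (isNull_of_isNull_id hn _).eq hn (by simp [dw, hp]; ring)⟩
  replace hw : ¬ IsNull w := fun h => hn (hw h)
  have h₁ : x + 2 * (a : ℤ) = x + 2 * (a : ℤ) := rfl
  have h₂ : x + 2 * (a : ℤ) = v + 2 * (b : ℤ) := by omega
  have h₃ : x + 2 * (a : ℤ) = y + 2 * ((a + 1 : ℕ) : ℤ) := by push_cast; omega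
  obtain ⟨D⟩ := S.E_pow_E a hx h₁ h₃
  have hX := X.j_iter_p a hx h₁ h₃ D
  let ι : S.E (a + 1) h₃ ⟶ S.E 1 hx ≫ S.E a h₁ := D.j 0
  let π : S.E 1 hx ≫ S.E a h₁ ⟶ S.E (a + 1) h₃ := D.p (Fin.last a)
  have hι : ι ≫ (D.p 0 : S.E 1 hx ≫ S.E a h₁ ⟶ S.E (a + 1) h₃) = 𝟙 _ := decomp_j_p_self D 0
  have dι : deg ι = -a := (deg_fac_j _ _).trans (by simp)
  have dπ : deg π = -a := (deg_fac_p _ _).trans (by simp only [Fin.val_last]; push_cast; ring)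
  obtain ⟨α, β, hαβ, dα⟩ := exists_of_retract (S.exists_retract_FE a b hb ha h₁ h₂ hr)
  obtain ⟨α', β', hαβ', dα'⟩ := exists_of_retract
    (S.exists_retract_FE (a + 1) b hb' ha' h₃ h₂ (by push_cast; omega))
  have dβ' := deg_of_comp_eq_id hαβ'
  have L : Low (S.F b hb' ≫ S.E (a + 1) ha') (S.E 1 hx ≫ S.E a h₁ ≫ S.F b h₂) (-a) := by
    have L := S.low_FE_EF (a := a + 1) (b := b) (c := a + 1) (d := b) (N := 0) (add_comm _ _)
      hb' ha' h₃ h₂ (by ring)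
    refine (decompAssoc D (S.F b h₂)).low_right 0 (L.mono (by simp)) fun i hi => L.1.mono ?_
    have : (i : ℕ) ≠ 0 := fun h => hi (Fin.ext h)
    push_cast; omega
  have e : w ≫ S.E 1 hx ◁ α = α' ≫ ι ▷ S.F b h₂ ≫ (α_ _ _ _).hom := by
    refine eq_of_low L (by simp [dw, dα]) (by simp [dα', dι]) ?_ ?_
    · intro h
      refine hw (isNull_of_isNull_comp (α := S.E 1 hx ◁ α) (β := S.E 1 hx ◁ β) ?_ h)
      rw [← whiskerLeft_comp, hαβ, whiskerLeft_id]
    · refine not_isNull_of_comp_eq_id (β := (α_ _ _ _).inv ≫ D.p 0 ▷ S.F b h₂ ≫ β') ?_ hn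
      simp only [Category.assoc, Iso.hom_inv_id_assoc]
      rw [← comp_whiskerRight_assoc, hι, id_whiskerRight, Category.id_comp, hαβ']
  refine ⟨S.E 1 hx ◁ α ≫ (α_ _ _ _).inv ≫ π ▷ S.F b h₂ ≫ β', ?_, ?_⟩
  · simp [dα, dβ', dα', dπ]
  · rw [← whisker_exchange_assoc, reassoc_of% e, associator_inv_naturality_left_assoc,
      Iso.hom_inv_id_assoc, ← comp_whiskerRight_assoc, ← comp_whiskerRight_assoc, Category.assoc]
    erw [hX]
    rw [id_whiskerRight, Category.id_comp, hαβ']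

end Upper

/-! ### The summands of `F^(b+1) E` -/

section Lower

variable (b N : ℕ) {x y z : ℤ} (hx : x = y + 2 * ((1 : ℕ) : ℤ)) (hb : y = z + 2 * (b : ℤ))
  (hb' : x = z + 2 * ((b + 1 : ℕ) : ℤ)) (hN : y = b - 1 - N)

include hN

lemma low_lower : Low (S.F b hb) (S.E 1 hx ≫ S.F (b + 1) hb') (-N) := by
  have h₀ : z = z + 2 * ((0 : ℕ) : ℤ) := by simp
  obtain ⟨e, he⟩ := S.E_zero h₀
  refine low_congr_left (whiskerLeftIso _ e ≪≫ ρ_ _) (by simp [he])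
    (S.low_FE_EF (a := 0) (b := b) (c := 1) (d := b + 1) (by omega) hb h₀ hx hb' ?_)
  push_cast; rw [hN]; ring

lemma low_lower' : Low (S.E 1 hx ≫ S.F (b + 1) hb') (S.F b hb) (-N) := by
  have h₀ : z = z + 2 * ((0 : ℕ) : ℤ) := by simp
  obtain ⟨e, he⟩ := S.E_zero h₀
  refine low_congr_right (whiskerLeftIso _ e ≪≫ ρ_ _) (by simp [he])
    (S.low_EF_FE (a := 0) (b := b) (c := 1) (d := b + 1) (by omega) hb h₀ hx hb' ?_)
  push_cast; rw [hN]; ring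

/-- A nonzero morphism from `F^(b)` to `F^(b+1) E` of the lowest possible degree. -/
lemma exists_lower (hn : ¬ IsNull (𝟙 (S.F b hb))) :
    ∃ u : S.F b hb ⟶ S.E 1 hx ≫ S.F (b + 1) hb', deg u = -N ∧ ¬ IsNull u := by
  have h₁ : z + 2 = z + 2 * ((1 : ℕ) : ℤ) := by simp
  have h₂ : x = z + 2 + 2 * (b : ℤ) := by push_cast at *; omega
  obtain ⟨s, s', hs, ds⟩ := exists_of_retract (S.exists_retract_FE 1 b hb h₁ hx h₂ (by
    push_cast; omega))
  obtain ⟨adj, hadj⟩ := S.adj_right 1 h₁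
  obtain ⟨D⟩ := S.F_F_pow b h₁ h₂ hb'
  let v : S.F b hb ⟶ S.E 1 hx ≫ S.F b h₂ ≫ S.F 1 h₁ :=
    adj.homEquiv₂ s ≫ (α_ _ _ _).hom
  have dv : deg v = y - 2 * b + 1 := by
    simp only [v, deg_comp, deg_homEquiv₂, ds, hadj, deg_associator_hom]
    push_cast; omega
  have hn' : ¬ IsNull (𝟙 (S.F b hb ≫ S.E 1 h₁)) := by
    intro h
    refine hn (S.isNull_of_whiskerRight_E 1 h₁ (by push_cast; omega) _ ?_)
    rwa [id_whiskerRight]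
  have hv : ¬ IsNull v := by
    intro h
    have h' := (isNull_comp_iso _ _).1 h
    have := isNull_homEquiv₂_symm adj h'
    rw [Equiv.symm_apply_apply] at this
    exact not_isNull_of_comp_eq_id hs hn' this
  have L := S.low_lower b N hx hb hb' hN
  have e := fac_eq_p_j (decompLeft (S.E 1 hx) D).toFac v 0 fun i hi => isNull_of_low L (by
    have : (i : ℕ) ≠ 0 := fun h => hi (Fin.ext h)
    rw [deg_comp, dv, deg_fac_p]; push_cast; omega)
  refine ⟨v ≫ (decompLeft (S.E 1 hx) D).p 0, ?_, fun h => hv ?_⟩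
  · rw [deg_comp, dv, deg_fac_p]; simp; omega
  · rw [e, ← Category.assoc]; exact h.comp _

/-- A nonzero morphism from `F^(b+1) E` to `F^(b)` of the lowest possible degree, the mate of the
inclusion of a summand. -/
lemma exists_lower' (hn : ¬ IsNull (𝟙 (S.F b hb))) :
    ∃ ψ : S.E 1 hx ≫ S.F (b + 1) hb' ⟶ S.F b hb, deg ψ = -N ∧ ¬ IsNull ψ := by
  obtain ⟨D⟩ := S.F_pow_F b hb hx hb'
  obtain ⟨adj, hadj⟩ := S.adj_left 1 hx
  have hD : (D.j 0 : S.F (b + 1) hb' ⟶ S.F 1 hx ≫ S.F b hb) ≫ D.p 0 = 𝟙 _ := decomp_j_p_self D 0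
  refine ⟨adj.homEquiv₁ (D.j 0), ?_, fun h => ?_⟩
  · rw [deg_homEquiv₁, deg_fac_j, hadj]; simp; omega
  · have := isNull_homEquiv₁_symm adj h
    rw [Equiv.symm_apply_apply] at this
    have h' : IsNull (𝟙 (S.F (b + 1) hb')) := by rw [← hD]; exact this.comp _
    obtain ⟨k, hk⟩ := S.exists_retract_E_F b hb hx hb' (by omega)
    obtain ⟨α, β, hαβ, -⟩ := exists_of_retract hk
    exact hn (by rw [← hαβ]; exact (isNull_of_isNull_id' (isNull_id_comp_right _ h') α).comp β)

variable {S} in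
/-- The `N`-th power of the dot maps the lowest copy of `F^(b)` in `F^(b+1) E` to the highest
one. -/
lemma Dot.lower_iter_lower' (X : S.Dot) {u : S.F b hb ⟶ S.E 1 hx ≫ S.F (b + 1) hb'}
    (du : deg u = -N) (hu : IsNull u → IsNull (𝟙 (S.F b hb)))
    {ψ : S.E 1 hx ≫ S.F (b + 1) hb' ⟶ S.F b hb} (dψ : deg ψ = -N)
    (hψ : IsNull ψ → IsNull (𝟙 (S.F b hb))) :
    u ≫ iter (X.X hx) N ▷ S.F (b + 1) hb' ≫ ψ = 𝟙 _ := by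
  have d₀ : deg (u ≫ iter (X.X hx) N ▷ S.F (b + 1) hb' ≫ ψ) = 0 := by
    simp [du, dψ]; ring
  by_cases hn : IsNull (𝟙 (S.F b hb))
  · exact (isNull_of_isNull_id hn _).eq hn (by simp [du, dψ]; ring)
  replace hu : ¬ IsNull u := fun h => hn (hu h)
  replace hψ : ¬ IsNull ψ := fun h => hn (hψ h)
  refine eq_id_of_low (S.low_F b hb) d₀ fun h₀ => ?_
  -- after composition with `E^(N)`, the divided powers can be reordered
  obtain ⟨v, hv⟩ : ∃ v, v = z + 2 * (N : ℤ) := ⟨_, rfl⟩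
  have hz : z + N ≤ 0 := by omega
  have hxv : x + 2 * (N : ℤ) = x + 2 * (N : ℤ) := rfl
  have hxv' : x + 2 * (N : ℤ) = v + 2 * ((b + 1 : ℕ) : ℤ) := by push_cast at *; omega
  have hyv : x + 2 * (N : ℤ) = y + 2 * ((N + 1 : ℕ) : ℤ) := by push_cast at *; omega
  obtain ⟨e, he⟩ := S.exists_iso_FE N (b + 1) hb' hv hxv hxv' (by push_cast; omega)
  obtain ⟨D⟩ := S.E_pow_E N hx hxv hyv
  have hX := X.j_iter_p N hx hxv hyv D
  let ι : S.E (N + 1) hyv ⟶ S.E 1 hx ≫ S.E N hxv := D.j 0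
  let π : S.E 1 hx ≫ S.E N hxv ⟶ S.E (N + 1) hyv := D.p (Fin.last N)
  have dι : deg ι = -N := (deg_fac_j _ _).trans (by simp)
  have dπ : deg π = -N := (deg_fac_p _ _).trans (by simp only [Fin.val_last]; push_cast; ring)
  have L₁ : Low (S.F b hb ≫ S.E N hv) (S.E (N + 1) hyv ≫ S.F (b + 1) hxv') 0 :=
    S.low_FE_EF (by omega) hb hv hyv hxv' (by push_cast; rw [hN]; ring)
  have L₂ : Low (S.E (N + 1) hyv ≫ S.F (b + 1) hxv') (S.F b hb ≫ S.E N hv) 0 :=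
    S.low_EF_FE (by omega) hb hv hyv hxv' (by push_cast; rw [hN]; ring)
  have L₀ : Low (S.F b hb ≫ S.E N hv) (S.F b hb ≫ S.E N hv) 0 :=
    S.low_FE_FE (by omega) hb hv hb hv (by omega) (by ring)
  have hn' : ¬ IsNull (𝟙 (S.F b hb ≫ S.E N hv)) := by
    intro h
    exact hn (S.isNull_of_whiskerRight_E N hv hz _ (by rwa [id_whiskerRight]))
  -- `E^(N) F^(b)` is a direct summand of `F^(b+1) E^(N+1)`, without shift
  obtain ⟨α, β, hαβ, dα⟩ : ∃ (α : S.F b hb ≫ S.E N hv ⟶ S.E (N + 1) hyv ≫ S.F (b + 1) hxv')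
      (β : S.E (N + 1) hyv ≫ S.F (b + 1) hxv' ⟶ S.F b hb ≫ S.E N hv), α ≫ β = 𝟙 _ ∧
      deg α = 0 := by
    obtain ⟨k, hk⟩ := S.exists_retract_E_F b hb hx hb' (by omega)
    have H := ((retract_whiskerRight hk (S.E N hv)).trans (retract_iso (α_ _ _ _))).trans
      (retract_iso (whiskerLeftIso (S.E 1 hx) e))
    obtain ⟨i, hi, -⟩ := exists_retract_of_fac L₀ H (decompAssoc D (S.F (b + 1) hxv')).toFac hn'
    obtain ⟨α, β, hαβ, dα⟩ := exists_of_retract hi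
    have dβ := deg_of_comp_eq_id hαβ
    refine ⟨α, β, hαβ, ?_⟩
    have h₁ : 0 ≤ deg α := by
      by_contra! h
      exact not_isNull_of_comp_eq_id hαβ hn' (isNull_of_low L₁ h)
    have h₂ : 0 ≤ deg β := by
      by_contra! h
      exact not_isNull_of_comp_eq_id' hαβ hn' (isNull_of_low L₂ h)
    omega
  have dβ := deg_of_comp_eq_id hαβ
  let A := decompAssoc D (S.F (b + 1) hxv')
  let u' : S.F b hb ≫ S.E N hv ⟶ S.E 1 hx ≫ S.E N hxv ≫ S.F (b + 1) hxv' :=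
    u ▷ S.E N hv ≫ (α_ _ _ _).hom ≫ S.E 1 hx ◁ e.hom
  let ψ' : S.E 1 hx ≫ S.E N hxv ≫ S.F (b + 1) hxv' ⟶ S.F b hb ≫ S.E N hv :=
    S.E 1 hx ◁ e.inv ≫ (α_ _ _ _).inv ≫ ψ ▷ S.E N hv
  have hu' : ¬ IsNull u' := by
    intro h
    have h' : IsNull ((u ▷ S.E N hv ≫ (α_ _ _ _).hom) ≫ (whiskerLeftIso (S.E 1 hx) e).hom) := by
      simpa [u'] using h
    rw [isNull_comp_iso, isNull_comp_iso] at h'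
    exact hu (S.isNull_of_whiskerRight_E N hv hz _ h')
  have hψ' : ¬ IsNull ψ' := by
    intro h
    have h' : IsNull ((whiskerLeftIso (S.E 1 hx) e).inv ≫ (α_ _ _ _).inv ≫ ψ ▷ S.E N hv) := h
    rw [isNull_iso_inv_comp, isNull_iso_inv_comp] at h'
    exact hψ (S.isNull_of_whiskerRight_E N hv hz _ h')
  have du' : deg u' = -N := by simp [u', du, he]
  have dψ' : deg ψ' = -N := by simp [ψ', dψ, he]
  let q (i) : S.E 1 hx ≫ S.E N hxv ≫ S.F (b + 1) hxv' ⟶ S.E (N + 1) hyv ≫ S.F (b + 1) hxv' := A.p i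
  let j (i) : S.E (N + 1) hyv ≫ S.F (b + 1) hxv' ⟶ S.E 1 hx ≫ S.E N hxv ≫ S.F (b + 1) hxv' := A.j i
  have eu : u' = (u' ≫ q 0) ≫ j 0 := by
    refine (fac_eq_p_j A.toFac u' 0 fun i hi => isNull_of_low L₁ ?_).trans
      (Category.assoc _ _ _).symm
    have : (i : ℕ) ≠ 0 := fun h => hi (Fin.ext h)
    rw [deg_comp, du', deg_fac_p]; push_cast; omega
  have eψ : ψ' = q (Fin.last N) ≫ j (Fin.last N) ≫ ψ' := by
    refine fac_eq_p_j' A.toFac ψ' (Fin.last N) fun i hi => isNull_of_low L₂ ?_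
    have : (i : ℕ) ≠ N := fun h => hi (Fin.ext h)
    rw [deg_comp, dψ', deg_fac_j]; push_cast; omega
  have h₁ : u' ≫ q 0 = α := by
    refine eq_of_low L₁ ?_ dα (fun h => hu' (by rw [eu]; exact h.comp _))
      (not_isNull_of_comp_eq_id hαβ hn')
    rw [deg_comp, du', deg_fac_p]; simp
  have h₂ : j (Fin.last N) ≫ ψ' = β := by
    refine eq_of_low L₂ ?_ (by omega) (fun h => hψ' (by rw [eψ]; exact h.comp_left _))
      (not_isNull_of_comp_eq_id' hαβ hn')
    rw [deg_comp, dψ', deg_fac_j]; simp only [Fin.val_last]; push_cast; ring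
  have h₃ : j 0 ≫ iter (X.X hx) N ▷ (S.E N hxv ≫ S.F (b + 1) hxv') ≫ q (Fin.last N) = 𝟙 _ := by
    have e₁ : j 0 = ι ▷ S.F (b + 1) hxv' ≫ (α_ _ _ _).hom := decompAssoc_j _ _ _
    have e₂ : q (Fin.last N) = (α_ _ _ _).inv ≫ π ▷ S.F (b + 1) hxv' := decompAssoc_p _ _ _
    rw [e₁, e₂, Category.assoc, associator_inv_naturality_left_assoc, Iso.hom_inv_id_assoc,
      ← comp_whiskerRight, ← comp_whiskerRight]
    erw [hX]
    rw [id_whiskerRight]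
  have h₄ : u' ≫ iter (X.X hx) N ▷ (S.E N hxv ≫ S.F (b + 1) hxv') ≫ ψ' = 𝟙 _ := by
    rw [eu, eψ, h₁, h₂]
    simp only [Category.assoc]
    rw [reassoc_of% h₃, hαβ]
  have h₅ : u' ≫ iter (X.X hx) N ▷ (S.E N hxv ≫ S.F (b + 1) hxv') ≫ ψ' =
      (u ≫ iter (X.X hx) N ▷ S.F (b + 1) hb' ≫ ψ) ▷ S.E N hv := by
    simp only [u', ψ', Category.assoc]
    rw [whisker_exchange_assoc, ← whiskerLeft_comp_assoc, Iso.hom_inv_id, whiskerLeft_id,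
      Category.id_comp]
    simp
  rw [h₅] at h₄
  exact hn' (by rw [← h₄]; exact h₀.whiskerRight _)

end Lower

end Sl2Data

/-! ### Quantum integers acting on dimension functions -/

/-- The action of the quantum integer `[n]` on functions on the integers. -/
def qsum (n : ℕ) (g : ℤ → ℕ) (m : ℤ) : ℕ := ∑ k : Fin n, g (m + ((n : ℤ) - 1 - 2 * ((k : ℕ) : ℤ)))

@[simp] lemma qsum_zero (g : ℤ → ℕ) (m : ℤ) : qsum 0 g m = 0 := rfl

@[simp] lemma qsum_one (g : ℤ → ℕ) (m : ℤ) : qsum 1 g m = g m := by simp [qsum]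

lemma qsum_add (t s : ℕ) (g : ℤ → ℕ) (m : ℤ) :
    qsum (t + s) g m = qsum t g (m + s) + qsum s g (m - t) := by
  rw [qsum, Fin.sum_univ_add]
  congr 1
  · refine Finset.sum_congr rfl fun k _ => ?_
    congr 1
    simp only [Fin.val_castAdd]; push_cast; ring
  · refine Finset.sum_congr rfl fun k _ => ?_
    congr 1
    simp only [Fin.val_natAdd]; push_cast; ring

lemma qsum_comm (t s : ℕ) (g : ℤ → ℕ) (m : ℤ) : qsum t (qsum s g) m = qsum s (qsum t g) m := by
  simp only [qsum]
  rw [Finset.sum_comm]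
  refine Finset.sum_congr rfl fun k _ => Finset.sum_congr rfl fun l _ => ?_
  congr 1; ring

lemma qsum_add_fun (n : ℕ) (g h : ℤ → ℕ) (m : ℤ) :
    qsum n (fun i => g i + h i) m = qsum n g m + qsum n h m := by
  simp [qsum, Finset.sum_add_distrib]

/-- `[n][s+1] + [s-n] = [n+1][s] + [n-s]`, where `[k] = 0` for negative `k`. -/
lemma qsum_identity (n s : ℕ) (g : ℤ → ℕ) (m : ℤ) :
    qsum n (qsum (s + 1) g) m + qsum (s - n) g m = qsum (n + 1) (qsum s g) m + qsum (n - s) g m := by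
  have h₁ : qsum n (qsum (s + 1) g) m = qsum n (qsum s g) (m + 1) + qsum n g (m - s) := by
    rw [qsum_comm, qsum_add, qsum_one, qsum_comm, Nat.cast_one]
  have h₂ : qsum (n + 1) (qsum s g) m = qsum n (qsum s g) (m + 1) + qsum s g (m - n) := by
    rw [qsum_add, qsum_one, Nat.cast_one]
  rw [h₁, h₂]
  have key (t s : ℕ) : qsum (t + s) g (m - s) = qsum t g m + qsum s g (m - ((t + s : ℕ) : ℤ)) := by
    rw [qsum_add, sub_add_cancel]
    congr 2; push_cast; ring
  rcases le_total n s with h | h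
  · obtain ⟨t, rfl⟩ := Nat.exists_eq_add_of_le h
    rw [Nat.sub_eq_zero_of_le h, qsum_zero, Nat.add_sub_cancel_left, add_comm n t, key t n]
    ring
  · obtain ⟨t, rfl⟩ := Nat.exists_eq_add_of_le h
    rw [Nat.sub_eq_zero_of_le h, qsum_zero, Nat.add_sub_cancel_left, add_comm s t, key t s]
    ring

/-- A quantum integer can be cancelled if an inequality is known. -/
lemma eq_of_qsum_eq {n : ℕ} {g h : ℤ → ℕ} (hle : ∀ m, g m ≤ h m)
    (he : ∀ m, qsum (n + 1) g m = qsum (n + 1) h m) (m : ℤ) : g m = h m := by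
  have := (Finset.sum_eq_sum_iff_of_le fun k _ => hle _).1 (he (m - n)) 0 (Finset.mem_univ _)
  have e : m - (n : ℤ) + (((n + 1 : ℕ) : ℤ) - 1 - 2 * (((0 : Fin (n + 1)) : ℕ) : ℤ)) = m := by
    simp
  rwa [e] at this

section

variable {C : Type u} [Category.{v} C] [Preadditive C] [Linear ℂ C] [HasShift C ℤ]
  [∀ n : ℤ, (shiftFunctor C n).Additive] [∀ n : ℤ, (shiftFunctor C n).Linear ℂ]
  [∀ X Y : C, Module.Finite ℂ (X ⟶ Y)]

open ProjObj ShiftedHom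

variable {M : ProjObj C} {ι : Type} [Fintype ι] {Z : ι → ProjObj C} {d : ι → ℤ}

lemma exists_free_of_triangular (u : ∀ i, Z i ⟶ M) (du : ∀ i, deg (u i) = -d i) (v : ∀ i, M ⟶ Z i)
    (rk : ι → ℕ) (h₁ : ∀ i, u i ≫ v i = 𝟙 (Z i))
    (h₂ : ∀ i j, j ≠ i → rk j ≤ rk i → IsNull (u j ≫ v i)) :
    ∃ u' : ∀ i, ShiftedHom (Z i).obj M.obj (-d i), (∀ i, u i = pcl (u' i)) ∧ Free u' := by
  choose u' hu' using fun i => exists_rep (u i) (du i)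
  refine ⟨u', hu', Free.of_triangular u' v rk (fun i => ?_) fun i j hj hr => ?_⟩
  · have := h₁ i
    rwa [hu' i] at this
  · have := h₂ i j hj hr
    rwa [hu' j] at this

lemma sum_hdim_le_of_triangular (u : ∀ i, Z i ⟶ M) (du : ∀ i, deg (u i) = -d i)
    (v : ∀ i, M ⟶ Z i) (rk : ι → ℕ) (h₁ : ∀ i, u i ≫ v i = 𝟙 (Z i))
    (h₂ : ∀ i j, j ≠ i → rk j ≤ rk i → IsNull (u j ≫ v i)) (T : C) (n : ℤ) :
    ∑ i, hdim T (Z i) (n + d i) ≤ hdim T M n := by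
  obtain ⟨u', -, hu'⟩ := exists_free_of_triangular u du v rk h₁ h₂
  exact hu'.sum_hdim_le T n

lemma nonempty_decomp_of_triangular (u : ∀ i, Z i ⟶ M) (du : ∀ i, deg (u i) = -d i)
    (v : ∀ i, M ⟶ Z i) (rk : ι → ℕ) (h₁ : ∀ i, u i ≫ v i = 𝟙 (Z i))
    (h₂ : ∀ i j, j ≠ i → rk j ≤ rk i → IsNull (u j ≫ v i))
    (hs : ∀ (T : C) (n : ℤ), hdim T M n = ∑ i, hdim T (Z i) (n + d i)) :
    Nonempty (Decomp M Z d) := by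
  obtain ⟨u', -, hu'⟩ := exists_free_of_triangular u du v rk h₁ h₂
  exact ⟨(hu'.exists_decomp hs).choose⟩

lemma hdim_congr_of_piso {M N : ProjObj C} (e : M ≅ N) (he : deg e.hom = 0) (T : C) (n : ℤ) :
    hdim T M n = hdim T N n := by
  obtain ⟨A, -, -⟩ := Decomp.exists_ofPIso e he
  simpa using A.hdim_eq T n

end

namespace PB

open ProjObj (Low VanishBelow Retract)
open Bicategory

variable {B : Type u} [Bicategory.{w, v} B] [GradedLinearBicategory B] {a b c d : PB B}
  [∀ X Y : a.as ⟶ b.as, Module.Finite ℂ (X ⟶ Y)]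

lemma hdim_congr {f g : a ⟶ b} (e : f ≅ g) (he : deg e.hom = 0) (T : a.as ⟶ b.as) (n : ℤ) :
    hdim T f n = hdim T g n := hdim_congr_of_piso e he T n

variable {f g h : a ⟶ b}

lemma hdim_eq_qsum {n : ℕ} (D : QDecomp f n g) (T : a.as ⟶ b.as) (m : ℤ) :
    hdim T f m = qsum n (hdim T g) m := D.hdim_eq T m

lemma hdim_eq_add_qsum {n : ℕ} {Z : Unit ⊕ Fin n → (a ⟶ b)} {k : Unit ⊕ Fin n → ℤ}
    (D : Decomp f Z k) (hg : Z (.inl ()) = g) (hh : ∀ i, Z (.inr i) = h)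
    (hk : k (.inl ()) = 0) (hk' : ∀ i, k (.inr i) = (n : ℤ) - 1 - 2 * ((i : ℕ) : ℤ))
    (T : a.as ⟶ b.as) (m : ℤ) :
    hdim T f m = hdim T g m + qsum n (hdim T h) m := by
  rw [D.hdim_eq T m, Fintype.sum_sum_type]
  simp only [hh, hk', qsum, Finset.univ_unique, Finset.sum_singleton]
  congr 1
  have : (default : Unit) = () := rfl
  rw [this, hg, hk, add_zero]

end PB

namespace Sl2Data

open PB Bicategory
open ProjObj (Low VanishBelow Retract)

variable {B : Type u} [Bicategory.{w, v} B] [GradedLinearBicategory B] {S : Sl2Data B}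

namespace Dot

variable (X : S.Dot)
include X

/-- The summands of `F^(b+1) E`. -/
lemma exists_decomp_E_F (b : ℕ) : ∀ (n : ℕ) {x y z z' : ℤ} (hx : x = y + 2 * ((1 : ℕ) : ℤ))
    (hb : y = z + 2 * (b : ℤ)) (hb' : x = z + 2 * ((b + 1 : ℕ) : ℤ))
    (hz : z = z' + 2 * ((1 : ℕ) : ℤ)) (hb'' : y = z' + 2 * ((b + 1 : ℕ) : ℤ)), y = b - n →
    Nonempty (Decomp (S.E 1 hx ≫ S.F (b + 1) hb')
      (Sum.elim (fun _ : Unit => S.F (b + 1) hb'' ≫ S.E 1 hz) (fun _ : Fin n => S.F b hb))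
      (Sum.elim (fun _ => 0) (fun k => (n : ℤ) - 1 - 2 * ((k : ℕ) : ℤ)))) := by
  have main (b n : ℕ) {x y z z' : ℤ} (hx : x = y + 2 * ((1 : ℕ) : ℤ))
    (hb : y = z + 2 * (b : ℤ)) (hb' : x = z + 2 * ((b + 1 : ℕ) : ℤ))
    (hz : z = z' + 2 * ((1 : ℕ) : ℤ)) (hb'' : y = z' + 2 * ((b + 1 : ℕ) : ℤ)) (hn : y = b - n)
    (hs : ∀ (T : (S.wt y).as ⟶ (S.wt z).as),
      (∀ m, hdim T (S.F (b + 1) hb'' ≫ S.E 1 hz) m + qsum n (hdim T (S.F b hb)) m ≤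
        hdim T (S.E 1 hx ≫ S.F (b + 1) hb') m) → ∀ m,
      hdim T (S.E 1 hx ≫ S.F (b + 1) hb') m =
        hdim T (S.F (b + 1) hb'' ≫ S.E 1 hz) m + qsum n (hdim T (S.F b hb)) m) :
      Nonempty (Decomp (S.E 1 hx ≫ S.F (b + 1) hb')
      (Sum.elim (fun _ : Unit => S.F (b + 1) hb'' ≫ S.E 1 hz) (fun _ : Fin n => S.F b hb))
      (Sum.elim (fun _ => 0) (fun k => (n : ℤ) - 1 - 2 * ((k : ℕ) : ℤ)))) := by
    have := fun X Y : (S.wt y).as ⟶ (S.wt z).as => S.finite_dimensional X Y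
    obtain ⟨s, s', hs', ds⟩ := exists_of_retract (S.exists_retract_FE 1 (b + 1) hb'' hz hx hb' (by
      push_cast; omega))
    have hsum (T : (S.wt y).as ⟶ (S.wt z).as) (m : ℤ) : ∑ i, hdim T
        ((Sum.elim (fun _ : Unit => S.F (b + 1) hb'' ≫ S.E 1 hz) (fun _ : Fin n => S.F b hb)) i)
        (m + (Sum.elim (fun _ : Unit => (0 : ℤ)) (fun k : Fin n =>
          (n : ℤ) - 1 - 2 * ((k : ℕ) : ℤ))) i) =
        hdim T (S.F (b + 1) hb'' ≫ S.E 1 hz) m + qsum n (hdim T (S.F b hb)) m := by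
      rw [Fintype.sum_sum_type]
      simp [qsum]
    -- the basis, and the morphisms which detect it
    obtain ⟨u, v, du, huv, huv', hsv⟩ : ∃ (u : Fin n → (S.F b hb ⟶ S.E 1 hx ≫ S.F (b + 1) hb'))
        (v : Fin n → (S.E 1 hx ≫ S.F (b + 1) hb' ⟶ S.F b hb)),
        (∀ k, deg (u k) = -((n : ℤ) - 1 - 2 * ((k : ℕ) : ℤ))) ∧ (∀ k, u k ≫ v k = 𝟙 _) ∧
        (∀ k l, k < l → IsNull (u k ≫ v l)) ∧ ∀ k, IsNull (s ≫ v k) := by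
      rcases n with _ | N
      · exact ⟨fun k => k.elim0, fun k => k.elim0, fun k => k.elim0, fun k => k.elim0,
          fun k => k.elim0, fun k => k.elim0⟩
      have hN : y = b - 1 - N := by push_cast at hn; omega
      obtain ⟨u, du, hu⟩ : ∃ u : S.F b hb ⟶ S.E 1 hx ≫ S.F (b + 1) hb', deg u = -N ∧
          (IsNull u → IsNull (𝟙 (S.F b hb))) := by
        by_cases h : IsNull (𝟙 (S.F b hb))
        · obtain ⟨u, -, du⟩ := exists_isNull (S.F b hb) (S.E 1 hx ≫ S.F (b + 1) hb') (-N)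
          exact ⟨u, du, fun _ => h⟩
        · obtain ⟨u, du, hu⟩ := S.exists_lower b N hx hb hb' hN h
          exact ⟨u, du, fun h => (hu h).elim⟩
      obtain ⟨ψ, dψ, hψ⟩ : ∃ ψ : S.E 1 hx ≫ S.F (b + 1) hb' ⟶ S.F b hb, deg ψ = -N ∧
          (IsNull ψ → IsNull (𝟙 (S.F b hb))) := by
        by_cases h : IsNull (𝟙 (S.F b hb))
        · obtain ⟨u, -, du⟩ := exists_isNull (S.E 1 hx ≫ S.F (b + 1) hb') (S.F b hb) (-N)
          exact ⟨u, du, fun _ => h⟩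
        · obtain ⟨u, du, hu⟩ := S.exists_lower' b N hx hb hb' hN h
          exact ⟨u, du, fun h => (hu h).elim⟩
      have hX := X.lower_iter_lower' b N hx hb hb' hN du hu dψ hψ
      have comp (k l : ℕ) : iter (X.X hx) k ▷ S.F (b + 1) hb' ≫ iter (X.X hx) l ▷ S.F (b + 1) hb' =
          iter (X.X hx) (k + l) ▷ S.F (b + 1) hb' := by rw [← comp_whiskerRight, ← iter_add]
      refine ⟨fun k => u ≫ iter (X.X hx) k ▷ S.F (b + 1) hb',
        fun k => iter (X.X hx) (N - k) ▷ S.F (b + 1) hb' ≫ ψ, fun k => ?_, fun k => ?_,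
        fun k l hkl => ?_, fun k => ?_⟩
      · simp [du]; ring
      · rw [Category.assoc, reassoc_of% comp, Nat.add_sub_cancel' (Nat.lt_succ_iff.1 k.2), hX]
      · refine isNull_of_low (S.low_F b hb) ?_
        have := k.2; have := l.2
        have : (k : ℕ) < l := hkl
        simp only [deg_comp, du, dψ, deg_whiskerRight, deg_iter, X.deg_X]
        push_cast [Nat.lt_succ_iff.1 l.2]; omega
      · have hz₀ : z = z + 2 * ((0 : ℕ) : ℤ) := by simp
        obtain ⟨e, he⟩ := S.E_zero hz₀
        have L := low_congr_right (whiskerLeftIso _ e ≪≫ ρ_ _) (by simp [he])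
          (S.low_FE_FE (a := 1) (b := b + 1) (c := 0) (d := b) (by omega) hb'' hz hb hz₀
            (by push_cast; omega) rfl)
        refine isNull_of_low L ?_
        simp only [deg_comp, ds, dψ, deg_whiskerRight, deg_iter, X.deg_X]
        have := k.2
        push_cast [Nat.lt_succ_iff.1 k.2]
        have : ((b : ℤ) + 1 - b) * (2 * (b + 1) - 1 - y - b) = b + 1 - y := by ring
        rw [this]; omega
    -- independence gives an inequality of dimensions, and the recursion `hs` turns it into an equality
    have tri := sum_hdim_le_of_triangular (ι := Unit ⊕ Fin n) (M := S.E 1 hx ≫ S.F (b + 1) hb')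
      (Z := Sum.elim (fun _ => S.F (b + 1) hb'' ≫ S.E 1 hz) (fun _ => S.F b hb))
      (d := Sum.elim (fun _ => 0) (fun k => (n : ℤ) - 1 - 2 * ((k : ℕ) : ℤ)))
      (Sum.rec (fun _ => s) u)
      (by rintro (k | k); exacts [ds, du k]) (Sum.rec (fun _ => s') v)
      (Sum.elim (fun _ => 0) fun k => k + 1)
      (by rintro (k | k); exacts [hs', huv k])
      (by
        rintro (k | k) (l | l) hlk hr
        · exact (hlk rfl).elim
        · exact absurd hr (Nat.not_succ_le_zero _)
        · exact hsv k
        · refine huv' l k (lt_of_le_of_ne (by simpa using hr) fun h => hlk (by rw [h])))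
    refine nonempty_decomp_of_triangular (ι := Unit ⊕ Fin n) (M := S.E 1 hx ≫ S.F (b + 1) hb')
      (Z := Sum.elim (fun _ => S.F (b + 1) hb'' ≫ S.E 1 hz) (fun _ => S.F b hb))
      (d := Sum.elim (fun _ => 0) (fun k => (n : ℤ) - 1 - 2 * ((k : ℕ) : ℤ)))
      (Sum.rec (fun _ => s) u)
      (by rintro (k | k); exacts [ds, du k]) (Sum.rec (fun _ => s') v)
      (Sum.elim (fun _ => 0) fun k => k + 1)
      (by rintro (k | k); exacts [hs', huv k])
      (by
        rintro (k | k) (l | l) hlk hr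
        · exact (hlk rfl).elim
        · exact absurd hr (Nat.not_succ_le_zero _)
        · exact hsv k
        · refine huv' l k (lt_of_le_of_ne (by simpa using hr) fun h => hlk (by rw [h]))) ?_
    intro T m
    refine (hs T (fun m => ?_) m).trans (hsum T m).symm
    rw [← hsum T m]
    exact tri T m
  induction b with
  | zero =>
    intro n x y z z' hx hb hb' hz hb'' hn
    obtain rfl : y = z := by simpa using hb
    have := fun X Y : (S.wt y).as ⟶ (S.wt y).as => S.finite_dimensional X Y
    refine main 0 n hx hb hb' hz hb'' hn fun T _ m => ?_
    obtain ⟨D⟩ := S.FE hz hx n (by simpa using hn)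
    obtain ⟨e, he⟩ := S.F_zero hb
    have h₁ := hdim_eq_add_qsum D rfl (fun _ => rfl) rfl (fun _ => rfl) T m
    rw [show hdim T (S.F 0 hb) = hdim T (𝟙 (S.wt y)) from funext (hdim_congr e he T)]
    exact h₁
  | succ c ih =>
    intro n x y z z' hx hb hb' hz hb'' hn
    have := fun X Y : (S.wt y).as ⟶ (S.wt z).as => S.finite_dimensional X Y
    refine main (c + 1) n hx hb hb' hz hb'' hn fun T hle m => ?_
    -- compare the decompositions of `F^(c+1) F E`, whose two outer factors can be exchanged
    refine (eq_of_qsum_eq (n := c + 1) hle (fun m => ?_) m).symm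
    have h₁ : y = (y - 2) + 2 * ((1 : ℕ) : ℤ) := by simp
    have h₂ : y - 2 = z + 2 * (c : ℤ) := by push_cast at hb; omega
    have h₃ : y - 2 = z' + 2 * ((c + 1 : ℕ) : ℤ) := by push_cast at hb''⊢; omega
    obtain ⟨D₀⟩ := ih (n + 1) h₁ h₂ hb hz h₃ (by push_cast at hn ⊢; omega)
    obtain ⟨D₁⟩ := S.F_pow_F (c + 1) hb hx hb'
    obtain ⟨D₂⟩ := S.F_pow_F (c + 1) h₃ h₁ hb''
    obtain ⟨D₃⟩ := S.F_pow_F c h₂ h₁ hb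
    have e₁ := hdim_eq_qsum (decompLeft (S.E 1 hx) D₁) T m
    have e₂ := hdim_eq_add_qsum (g := S.F 1 h₁ ≫ S.F (c + 1) h₃ ≫ S.E 1 hz) (h := S.F 1 h₁ ≫ S.F c h₂)
      (decompLeft (S.F 1 h₁) D₀) rfl (fun _ => rfl) rfl (fun _ => rfl) T m
    have e₃ := hdim_eq_qsum (decompAssoc D₂ (S.E 1 hz)) T m
    have e₄ : hdim T (S.F 1 h₁ ≫ S.F c h₂) = qsum (c + 1) (hdim T (S.F (c + 1) hb)) :=
      funext (hdim_eq_qsum D₃ T)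
    have e₅ : hdim T (S.E 1 hx ≫ S.F 1 hx ≫ S.F (c + 1) hb) m +
        qsum (c + 1 - n) (hdim T (S.F (c + 1) hb)) m =
        hdim T (S.F 1 h₁ ≫ S.E 1 h₁ ≫ S.F (c + 1) hb) m +
        qsum (n - (c + 1)) (hdim T (S.F (c + 1) hb)) m := by
      have e₆ : hdim T (𝟙 _ ≫ S.F (c + 1) hb) = hdim T (S.F (c + 1) hb) :=
        funext (hdim_congr (λ_ _) rfl T)
      rcases le_total y 0 with hy | hy
      · obtain ⟨D⟩ := S.FE h₁ hx (n - (c + 1)) (by push_cast at hn ⊢; omega)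
        have := hdim_eq_add_qsum (h := 𝟙 _ ≫ S.F (c + 1) hb) (decompAssoc D (S.F (c + 1) hb)) rfl (fun _ => rfl) rfl
          (fun _ => rfl) T m
        rw [this, show c + 1 - n = 0 by push_cast at hn; omega, e₆]
        simp only [Sum.elim_inl, qsum_zero, add_zero]
        rw [hdim_congr (α_ _ _ _) rfl]
      · obtain ⟨D⟩ := S.EF h₁ hx (c + 1 - n) (by push_cast at hn ⊢; omega)
        have := hdim_eq_add_qsum (h := 𝟙 _ ≫ S.F (c + 1) hb) (decompAssoc D (S.F (c + 1) hb)) rfl (fun _ => rfl) rfl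
          (fun _ => rfl) T m
        rw [this, show n - (c + 1) = 0 by push_cast at hn; omega, e₆]
        simp only [Sum.elim_inl, qsum_zero, add_zero]
        rw [hdim_congr (α_ _ _ _) rfl]
    have e₆ := qsum_identity n (c + 1) (hdim T (S.F (c + 1) hb)) m
    rw [qsum_add_fun, ← e₁]
    rw [e₄] at e₂
    rw [← e₃]
    rw [e₂] at e₅
    have e₇ := qsum_comm n (c + 1 + 1) (hdim T (S.F (c + 1) hb)) m
    omega

end Dot

end Sl2Data

/-! ### Morphisms of complexes up to scalars -/

section ComplexClasses

variable {C : Type u} [Category.{v} C] [Preadditive C] [Linear ℂ C] [HasShift C ℤ]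
  [∀ n : ℤ, (shiftFunctor C n).Additive] [∀ n : ℤ, (shiftFunctor C n).Linear ℂ]

open ShiftedHom ProjObj

lemma pcl₀_eq_iff {X Y : C} {f g : X ⟶ Y} : pcl₀ f = pcl₀ g ↔ ∃ c : ℂˣ, g = (c : ℂ) • f := by
  rw [pcl₀, pcl₀, pcl_eq_iff]
  refine exists_congr fun c => ⟨fun h => ?_, fun h => by rw [h, mk₀_smul]⟩
  exact mk₀_injective (m₀ := (0 : ℤ)) (hm₀ := rfl) (by rw [h, mk₀_smul])

lemma exists_pcl₀ {X Y : C} (φ : toProj X ⟶ toProj Y) (h : deg φ = 0) :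
    ∃ f : X ⟶ Y, φ = pcl₀ f := by
  obtain ⟨α, rfl⟩ := exists_rep φ h
  exact ⟨(ShiftedHom.homEquiv (0 : ℤ) rfl).symm α, by
    rw [pcl₀]; congr 1; exact ((ShiftedHom.homEquiv (0 : ℤ) rfl).apply_symm_apply α).symm⟩

lemma isIso_of_pcl₀_comp_eq_id {X Y : C} {f : X ⟶ Y} {g : Y ⟶ X} (h : pcl₀ f ≫ pcl₀ g = 𝟙 _)
    (h' : pcl₀ g ≫ pcl₀ f = 𝟙 _) : IsIso f := by
  rw [← pcl₀_comp, ← pcl₀_id, eq_comm, pcl₀_eq_iff] at h h'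
  obtain ⟨c, hc⟩ := h
  obtain ⟨c', hc'⟩ := h'
  have h₁ : f ≫ (((c⁻¹ : ℂˣ) : ℂ) • g) = 𝟙 X := by
    rw [Linear.comp_smul, hc, smul_smul]; simp
  have h₂ : (((c'⁻¹ : ℂˣ) : ℂ) • g) ≫ f = 𝟙 Y := by
    rw [Linear.smul_comp, hc', smul_smul]; simp
  refine ⟨_, h₁, ?_⟩
  have : ((c⁻¹ : ℂˣ) : ℂ) • g = ((c'⁻¹ : ℂˣ) : ℂ) • g := by
    rw [← Category.id_comp (((c⁻¹ : ℂˣ) : ℂ) • g), ← h₂, Category.assoc, h₁, Category.comp_id]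
  rw [this, h₂]

variable {K L : CochainComplex C ℤ}

/-- Classes of morphisms which commute with the differentials up to scalars come from a morphism
of complexes. -/
lemma exists_hom_of_class (φ : ∀ i, toProj (K.X i) ⟶ toProj (L.X i)) (hd : ∀ i, deg (φ i) = 0)
    (hφ : ∀ i, φ i ≫ pcl₀ (L.d i (i + 1)) = pcl₀ (K.d i (i + 1)) ≫ φ (i + 1)) :
    ∃ g : K ⟶ L, ∀ i, pcl₀ (g.f i) = φ i := by
  choose f hf using fun i => exists_pcl₀ (φ i) (hd i)
  obtain ⟨g, c, hg⟩ := exists_rescale f fun i => by rw [← hf, ← hf, hφ]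
  exact ⟨g, fun i => by rw [hf, eq_comm, pcl₀_eq_iff]; exact ⟨c i, hg i⟩⟩

lemma exists_iso_of_class (e : ∀ i, toProj (K.X i) ≅ toProj (L.X i))
    (hd : ∀ i, deg (e i).hom = 0)
    (he : ∀ i, (e i).hom ≫ pcl₀ (L.d i (i + 1)) = pcl₀ (K.d i (i + 1)) ≫ (e (i + 1)).hom) :
    ∃ φ : K ≅ L, ∀ i, pcl₀ (φ.hom.f i) = (e i).hom := by
  obtain ⟨g, hg⟩ := exists_hom_of_class (fun i => (e i).hom) hd he
  have (i : ℤ) : IsIso (g.f i) := by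
    obtain ⟨h, hh⟩ := exists_pcl₀ (e i).inv (by rw [deg_iso_inv, hd, neg_zero])
    exact isIso_of_pcl₀_comp_eq_id (g := h) (by rw [hg, ← hh, (e i).hom_inv_id])
      (by rw [hg, ← hh, (e i).inv_hom_id])
  have : IsIso g := HomologicalComplex.Hom.isIso_of_components g
  exact ⟨asIso g, hg⟩

/-- The homotopy category of complexes. -/
noncomputable abbrev toHtpy (C : Type u) [Category.{v} C] [Preadditive C] :
    CochainComplex C ℤ ⥤ HomotopyCategory C (ComplexShape.up ℤ) :=
  HomotopyCategory.quotient C (ComplexShape.up ℤ)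

/-- If two morphisms of complexes agree up to scalars which may depend on the degree, then their
compositions with suitably rescaled morphisms agree. -/
lemma exists_rescaled_inverse {f f' : K ⟶ L} (h : ∀ i, pcl₀ (f.f i) = pcl₀ (f'.f i)) (g : L ⟶ K) :
    ∃ g' : L ⟶ K, f' ≫ g' = (f ≫ g) ≫ f ≫ g ∧ g' ≫ f' = (g ≫ f) ≫ g ≫ f := by
  choose c hc using fun i => pcl₀_eq_iff.1 (h i)
  -- wherever the scalars change, the composition of `f` with the differential vanishes
  have key (i : ℤ) : (c i : ℂ) • (f.f i ≫ L.d i (i + 1)) =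
      (c (i + 1) : ℂ) • (f.f i ≫ L.d i (i + 1)) := by
    have h₁ := f'.comm i (i + 1)
    rw [hc, hc, Linear.smul_comp, Linear.comp_smul, ← f.comm] at h₁
    exact h₁
  have key' (i : ℤ) : ((c i)⁻¹ : ℂˣ).1 • (f.f i ≫ L.d i (i + 1)) =
      ((c (i + 1))⁻¹ : ℂˣ).1 • (f.f i ≫ L.d i (i + 1)) := by
    have := congrArg (fun z => ((c i)⁻¹ * (c (i + 1))⁻¹ : ℂˣ).1 • z) (key i)
    simp only [smul_smul, ← Units.val_mul] at this
    rw [inv_mul_cancel_right, mul_comm, mul_inv_cancel_left] at this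
    exact this.symm
  refine ⟨{ f := fun i => ((c i)⁻¹ : ℂˣ).1 • (g.f i ≫ f.f i ≫ g.f i), comm' := ?_ }, ?_, ?_⟩
  · rintro i _ rfl
    have := congrArg (fun z => g.f i ≫ z ≫ g.f (i + 1)) (key' i)
    simp only [Linear.smul_comp, Linear.comp_smul, Category.assoc] at this ⊢
    rw [g.comm] at *
    rw [this, f.comm_assoc, g.comm_assoc]
  · ext i
    simp only [HomologicalComplex.comp_f, hc, Linear.smul_comp, Linear.comp_smul, smul_smul,
      Category.assoc]
    simp
  · ext i
    simp only [HomologicalComplex.comp_f, hc, Linear.smul_comp, Linear.comp_smul, smul_smul,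
      Category.assoc]
    simp

lemma isSplitMono_of_class {f f' : K ⟶ L} (h : ∀ i, pcl₀ (f.f i) = pcl₀ (f'.f i))
    (hf : IsSplitMono ((toHtpy C).map f)) : IsSplitMono ((toHtpy C).map f') := by
  obtain ⟨g, hg⟩ := (toHtpy C).map_surjective (retraction ((toHtpy C).map f))
  obtain ⟨g', h₁, -⟩ := exists_rescaled_inverse h g
  refine ⟨⟨⟨(toHtpy C).map g', ?_⟩⟩⟩
  have : (toHtpy C).map (f ≫ g) = 𝟙 _ := by rw [Functor.map_comp, hg, IsSplitMono.id]
  rw [← Functor.map_comp, h₁, Functor.map_comp, this, Category.comp_id]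

lemma isSplitEpi_of_class {f f' : K ⟶ L} (h : ∀ i, pcl₀ (f.f i) = pcl₀ (f'.f i))
    (hf : IsSplitEpi ((toHtpy C).map f)) : IsSplitEpi ((toHtpy C).map f') := by
  obtain ⟨g, hg⟩ := (toHtpy C).map_surjective (section_ ((toHtpy C).map f))
  obtain ⟨g', -, h₁⟩ := exists_rescaled_inverse h g
  refine ⟨⟨⟨(toHtpy C).map g', ?_⟩⟩⟩
  have : (toHtpy C).map (g ≫ f) = 𝟙 _ := by rw [Functor.map_comp, hg, IsSplitEpi.id]
  rw [← Functor.map_comp, h₁, Functor.map_comp, this, Category.comp_id]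

/-- The complex `K⟨k⟩`. -/
noncomputable abbrev intShift (k : ℤ) (K : CochainComplex C ℤ) : CochainComplex C ℤ :=
  ((shiftFunctor C k).mapHomologicalComplex _).obj K

/-- The morphism `f⟨k⟩` of complexes. -/
noncomputable abbrev intShiftMap (k : ℤ) (f : K ⟶ L) : intShift k K ⟶ intShift k L :=
  ((shiftFunctor C k).mapHomologicalComplex _).map f

/-- The isomorphisms of degree `k` between the terms of `K⟨k⟩` and those of `K`. -/
noncomputable def intShiftPIso (K : CochainComplex C ℤ) (k i : ℤ) :
    toProj ((intShift k K).X i) ≅ toProj (K.X i) := shiftPIso (K.X i) k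

@[simp] lemma deg_intShiftPIso_hom (K : CochainComplex C ℤ) (k i : ℤ) :
    deg (intShiftPIso K k i).hom = k := rfl

lemma shiftPIso_naturality {X Y : C} (f : X ⟶ Y) (k : ℤ) :
    pcl₀ (f⟦k⟧') ≫ (shiftPIso Y k).hom = (shiftPIso X k).hom ≫ pcl₀ f := by
  rw [shiftPIso_hom, shiftPIso_hom, ← pcl₀_comp_pcl, ← pcl_comp_pcl₀]
  congr 1
  simp [ofShift]

lemma intShiftPIso_d (K : CochainComplex C ℤ) (k i j : ℤ) :
    (intShiftPIso K k i).hom ≫ pcl₀ (K.d i j) =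
      pcl₀ ((intShift k K).d i j) ≫ (intShiftPIso K k j).hom :=
  (shiftPIso_naturality (K.d i j) k).symm

lemma intShiftPIso_inv_d (K : CochainComplex C ℤ) (k i j : ℤ) :
    (intShiftPIso K k i).inv ≫ pcl₀ ((intShift k K).d i j) =
      pcl₀ (K.d i j) ≫ (intShiftPIso K k j).inv := by
  rw [Iso.inv_comp_eq, ← Category.assoc, intShiftPIso_d, Category.assoc, Iso.hom_inv_id,
    Category.comp_id]

lemma intShiftPIso_map (k : ℤ) (f : K ⟶ L) (i : ℤ) :
    pcl₀ ((intShiftMap k f).f i) ≫ (intShiftPIso L k i).hom =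
      (intShiftPIso K k i).hom ≫ pcl₀ (f.f i) := shiftPIso_naturality (f.f i) k

/-- Classes of degree `k` which commute with the differentials come from a morphism to `L⟨k⟩`. -/
lemma exists_hom_intShift_of_class {k : ℤ} (φ : ∀ i, toProj (K.X i) ⟶ toProj (L.X i))
    (hd : ∀ i, deg (φ i) = k)
    (hφ : ∀ i, φ i ≫ pcl₀ (L.d i (i + 1)) = pcl₀ (K.d i (i + 1)) ≫ φ (i + 1)) :
    ∃ g : K ⟶ intShift k L, ∀ i, pcl₀ (g.f i) ≫ (intShiftPIso L k i).hom = φ i := by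
  obtain ⟨g, hg⟩ := exists_hom_of_class (fun i => φ i ≫ (intShiftPIso L k i).inv)
    (fun i => by simp [hd]) (fun i => by
      rw [Category.assoc, intShiftPIso_inv_d, reassoc_of% (hφ i)])
  exact ⟨g, fun i => by rw [hg, Category.assoc, Iso.inv_hom_id, Category.comp_id]⟩

lemma isSplitMono_of_intShift {f : K ⟶ L} {k : ℤ} (h : IsSplitMono
    ((toHtpy C).map (intShiftMap k f))) :
    IsSplitMono ((toHtpy C).map f) := by
  rw [← ((shiftFunctor C k).mapHomotopyCategory (ComplexShape.up ℤ)).isSplitMono_iff]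
  exact h

lemma isSplitEpi_of_intShift {f : K ⟶ L} {k : ℤ} (h : IsSplitEpi
    ((toHtpy C).map (intShiftMap k f))) :
    IsSplitEpi ((toHtpy C).map f) := by
  rw [← ((shiftFunctor C k).mapHomotopyCategory (ComplexShape.up ℤ)).isSplitEpi_iff]
  exact h

/-- Split monomorphisms up to homotopy only depend on the classes of their components, and these
may be shifted. -/
lemma isSplitMono_of_shifted_class {K' L' : CochainComplex C ℤ} {f : K ⟶ L} {f' : K' ⟶ L'} {k : ℤ}
    (e : ∀ i, toProj (K.X i) ≅ toProj (K'.X i)) (he : ∀ i, deg (e i).hom = k)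
    (hed : ∀ i, (e i).hom ≫ pcl₀ (K'.d i (i + 1)) = pcl₀ (K.d i (i + 1)) ≫ (e (i + 1)).hom)
    (e' : ∀ i, toProj (L.X i) ≅ toProj (L'.X i)) (he' : ∀ i, deg (e' i).hom = k)
    (hed' : ∀ i, (e' i).hom ≫ pcl₀ (L'.d i (i + 1)) = pcl₀ (L.d i (i + 1)) ≫ (e' (i + 1)).hom)
    (h : ∀ i, pcl₀ (f.f i) ≫ (e' i).hom = (e i).hom ≫ pcl₀ (f'.f i)) :
    (IsSplitMono ((toHtpy C).map f) → IsSplitMono ((toHtpy C).map f')) ∧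
    (IsSplitEpi ((toHtpy C).map f) → IsSplitEpi ((toHtpy C).map f')) := by
  have aux {K K' : CochainComplex C ℤ} (e : ∀ i, toProj (K.X i) ≅ toProj (K'.X i))
      (he : ∀ i, deg (e i).hom = k)
      (hed : ∀ i, (e i).hom ≫ pcl₀ (K'.d i (i + 1)) = pcl₀ (K.d i (i + 1)) ≫ (e (i + 1)).hom) :
      ∃ φ : K ≅ intShift k K', ∀ i, pcl₀ (φ.hom.f i) = (e i).hom ≫ (intShiftPIso K' k i).inv :=
    exists_iso_of_class (fun i => e i ≪≫ (intShiftPIso K' k i).symm)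
      (fun i => by simp [he]) fun i => by
        rw [Iso.trans_hom, Iso.symm_hom, Category.assoc, intShiftPIso_inv_d, reassoc_of% (hed i)]
        rfl
  obtain ⟨φ, hφ⟩ := aux e he hed
  obtain ⟨ψ, hψ⟩ := aux e' he' hed'
  have hcl (i : ℤ) : pcl₀ ((φ.inv ≫ f ≫ ψ.hom).f i) = pcl₀ ((intShiftMap k f').f i) := by
    have h₁ : pcl₀ (φ.hom.f i) ≫ pcl₀ ((φ.inv ≫ f ≫ ψ.hom).f i) =
        pcl₀ (φ.hom.f i) ≫ pcl₀ ((intShiftMap k f').f i) := by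
      rw [← pcl₀_comp, ← HomologicalComplex.comp_f, Iso.hom_inv_id_assoc,
        HomologicalComplex.comp_f, pcl₀_comp, hψ, hφ, ← Category.assoc, h, Category.assoc,
        Category.assoc]
      congr 1
      rw [Iso.eq_inv_comp, ← Category.assoc, ← intShiftPIso_map, Category.assoc, Iso.hom_inv_id,
        Category.comp_id]
    have h₂ := congrArg ((intShiftPIso K' k i).hom ≫ ·)
      (congrArg ((e i).inv ≫ ·) h₁)
    simpa [hφ] using h₂
  constructor
  · intro hf
    refine isSplitMono_of_intShift (k := k) (isSplitMono_of_class hcl ?_)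
    rw [Functor.map_comp, Functor.map_comp]
    infer_instance
  · intro hf
    refine isSplitEpi_of_intShift (k := k) (isSplitEpi_of_class hcl ?_)
    rw [Functor.map_comp, Functor.map_comp]
    infer_instance

end ComplexClasses

/-! ### Splitting a complex by a chain map and an endomorphism of degree `2` -/

section Splitting

variable {C : Type u} [Category.{v} C] [Preadditive C] [Linear ℂ C] [HasShift C ℤ]
  [∀ n : ℤ, (shiftFunctor C n).Additive] [∀ n : ℤ, (shiftFunctor C n).Linear ℂ]
  [HasFiniteBiproducts C]

open ShiftedHom ProjObj

instance hasFiniteBiproducts_cochainComplex : HasFiniteBiproducts (CochainComplex C ℤ) :=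
  have : HasFiniteProducts (CochainComplex C ℤ) := ⟨fun n => by
    have : HasLimitsOfShape (Discrete (Fin n)) C := hasLimitsOfShape_discrete C (Fin n)
    exact HomologicalComplex.instHasLimitsOfShape⟩
  HasFiniteBiproducts.of_hasFiniteProducts

/-- The summands of the terms of a direct sum of shifts of a complex. -/
lemma nonempty_decomp_biproduct (D : CochainComplex C ℤ) (n : ℕ) (k : Fin n → ℤ) (i : ℤ) :
    Nonempty (Decomp (toProj ((⨁ fun t => intShift (k t) D).X i))
      (fun _ => toProj (D.X i)) k) :=
  ⟨Decomp.ofIso (Z := fun _ => D.X i) (d := k)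
    ((HomologicalComplex.eval C (ComplexShape.up ℤ) i).mapBiproduct fun t => intShift (k t) D)⟩

variable [∀ X Y : C, Module.Finite ℂ (X ⟶ Y)] {K D : CochainComplex C ℤ}

/-- Let `X` be an endomorphism of degree `2` of a complex `K`, and `Ψ` a morphism from `K` to `D`. If
the terms of `K` have the same size as sums of shifts of the terms of `D`, which are detected by
powers of `X`, then `Ψ, XΨ, …, X^rΨ` form a homotopy equivalence. -/
lemma exists_isIso_toHtpy_biproduct {r : ℕ} (a : ℤ → ℕ)
    (ha : ∀ i, a (i + 1) + 1 = a i ∨ IsNull (𝟙 (toProj (D.X (i + 1)))))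
    (X : ℕ → ∀ i, toProj (K.X i) ⟶ toProj (K.X i)) (dX : ∀ n i, deg (X n i) = 2 * n)
    (X_add : ∀ m n i, X m i ≫ X n i = X (m + n) i)
    (X_d : ∀ n i, X n i ≫ pcl₀ (K.d i (i + 1)) = pcl₀ (K.d i (i + 1)) ≫ X n (i + 1))
    (Ψ : ∀ i, toProj (K.X i) ⟶ toProj (D.X i)) (dΨ : ∀ i, deg (Ψ i) = 0)
    (Ψ_d : ∀ i, Ψ i ≫ pcl₀ (D.d i (i + 1)) = pcl₀ (K.d i (i + 1)) ≫ Ψ (i + 1))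
    (l : ∀ i, toProj (D.X i) ⟶ toProj (K.X i)) (dl : ∀ i, deg (l i) = -2 * (r + a i))
    (p : ∀ i, toProj (K.X (i + 1)) ⟶ toProj (D.X i)) (dp : ∀ i, deg (p i) = 2 * (r + 1))
    (hl : ∀ i, l i ≫ X (r + a i) i ≫ Ψ i = 𝟙 _)
    (hp : ∀ i k, a i = k + 1 → l i ≫ pcl₀ (K.d i (i + 1)) ≫ X k (i + 1) ≫ p i = 𝟙 _)
    (v₀ : ∀ i, VanishBelow (toProj (D.X i)) (toProj (D.X i)) 0)
    (v₁ : ∀ i, VanishBelow (toProj (D.X i)) (toProj (D.X (i + 1))) 0)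
    (v₂ : ∀ i, VanishBelow (toProj (D.X (i + 1))) (toProj (D.X i)) 1)
    (hs : ∀ i T m, hdim T (toProj (K.X (i + 1))) m =
      ∑ j : Fin (a i), hdim T (toProj (D.X i)) (m + 2 * (r + 1 + (j : ℕ))) +
      ∑ j : Fin (r + a (i + 1) + 1), hdim T (toProj (D.X (i + 1))) (m + 2 * (j : ℕ))) :
    ∃ Φ : K ⟶ ⨁ fun t : Fin (r + 1) => intShift (2 * ((t : ℕ) : ℤ)) D,
      IsIso ((toHtpy C).map Φ) ∧ ∀ (t : Fin (r + 1)) (i : ℤ),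
        pcl₀ ((Φ ≫ biproduct.π (fun t : Fin (r + 1) => intShift (2 * ((t : ℕ) : ℤ)) D) t).f i) ≫
          (intShiftPIso D (2 * ((t : ℕ) : ℤ)) i).hom = X t i ≫ Ψ i := by
  choose g hg using fun t : Fin (r + 1) => exists_hom_intShift_of_class (K := K) (L := D)
    (k := 2 * ((t : ℕ) : ℤ)) (fun i => X t i ≫ Ψ i) (fun i => by simp [dX, dΨ])
    (fun i => by rw [Category.assoc, Ψ_d, reassoc_of% X_d t i])
  refine ⟨biproduct.lift g, ?_, fun t i => by rw [biproduct.lift_π, hg]⟩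
  let L := ⨁ fun t : Fin (r + 1) => intShift (2 * ((t : ℕ) : ℤ)) D
  let e (i : ℤ) (j : Fin (r + a i + 1)) : ℤ := 2 * (r + a i) - 2 * (j : ℕ)
  choose x hx using fun i (j : Fin (r + a i + 1)) =>
    exists_rep (l i ≫ X j i) (show deg (l i ≫ X j i) = -e i j by simp [dl, dX, e]; ring)
  let q (i : ℤ) (t : Fin (r + 1)) : toProj (L.X i) ⟶ toProj (D.X i) :=
    pcl₀ ((biproduct.π (fun t : Fin (r + 1) => intShift (2 * ((t : ℕ) : ℤ)) D) t).f i) ≫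
      (intShiftPIso D (2 * ((t : ℕ) : ℤ)) i).hom
  have hq (i : ℤ) (t : Fin (r + 1)) : pcl₀ ((biproduct.lift g).f i) ≫ q i t = X t i ≫ Ψ i := by
    rw [← hg t i, ← Category.assoc, ← pcl₀_comp, ← HomologicalComplex.comp_f, biproduct.lift_π]
  have dq (i : ℤ) (t : Fin (r + 1)) : deg (q i t) = 2 * (t : ℕ) := by simp [q]
  have null (i : ℤ) {φ : toProj (D.X i) ⟶ toProj (D.X i)} (h : deg φ < 0) : IsNull φ := v₀ i φ h
  have X_add' (m n i) {Y} (φ : toProj (K.X i) ⟶ Y) : X m i ≫ X n i ≫ φ = X (m + n) i ≫ φ := by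
    rw [← Category.assoc, X_add]
  have X_d' (n i) {Y} (φ : toProj (K.X (i + 1)) ⟶ Y) : X n i ≫ pcl₀ (K.d i (i + 1)) ≫ φ =
      pcl₀ (K.d i (i + 1)) ≫ X n (i + 1) ≫ φ := by
    rw [← Category.assoc, X_d, Category.assoc]
  have := hasBinaryBiproducts_of_finite_biproducts C
  -- the elements `l X^j` for `j ≤ r + a`; the first `a` of them are detected in the following term
  -- of `K`, after the differential, and the others by the components of the morphism to `L`
  refine isIso_quotient_map_of_triangular (biproduct.lift g) (fun i => r + a i + 1)
    (fun i => D.X i) e x (fun i j => X (r + a i - j) i ≫ Ψ i)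
    (fun i j => X (a i - 1 - j) (i + 1) ≫ p i)
    (fun i j => q i (Fin.ofNat (r + 1) (r + a i - j)))
    (fun i j => (j : ℕ) < a i) ?_ ?_ ?_ ?_ ?_ ?_ ?_ ?_ ?_
  · intro i j
    rw [← hx, Category.assoc, X_add', Nat.add_sub_cancel' (Nat.lt_succ_iff.1 j.2), hl]
  · intro i j k hk
    rw [← hx]
    refine null i ?_
    have : (k : ℕ) < j := hk
    have := j.2
    simp only [deg_comp, dl, dX, dΨ]
    push_cast [Nat.lt_succ_iff.1 j.2]; omega
  · intro i j k hk
    rw [← hx]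
    rcases ha i with h | h
    · refine v₁ i _ ?_
      simp only [deg_comp, dl, dX, dΨ, deg_pcl₀]
      push_cast [Nat.lt_succ_iff.1 j.2]
      have := j.2
      omega
    · exact isNull_of_isNull_id' h _
  · intro i j hj
    rw [← hx, Category.assoc, X_d', X_add']
    have : (j : ℕ) + (a i - 1 - j) + 1 = a i := by omega
    exact hp i _ this.symm
  · intro i j k hj hk
    rw [← hx]
    refine null i ?_
    have : (k : ℕ) < j := hk
    have h₁ : ((a i - 1 - j : ℕ) : ℤ) = a i - 1 - (j : ℕ) := by omega
    simp only [deg_comp, dl, dX, dp, deg_pcl₀, h₁]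
    omega
  · intro i j k hj hk
    rw [← hx]
    rcases ha i with h | h
    · refine v₂ i _ ?_
      have h₁ : ((a i - 1 - j : ℕ) : ℤ) = a i - 1 - (j : ℕ) := by omega
      simp only [deg_comp, dl, dX, dp, h₁]
      omega
    · exact isNull_of_isNull_id h _
  · intro i j hj
    have h₁ : ((Fin.ofNat (r + 1) (r + a i - j) : Fin (r + 1)) : ℕ) = r + a i - j :=
      Nat.mod_eq_of_lt (by omega)
    rw [hq, ← hx, h₁, Category.assoc, X_add', Nat.add_sub_cancel' (Nat.lt_succ_iff.1 j.2), hl]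
  · intro i j k hj hk
    have h₁ : ((Fin.ofNat (r + 1) (r + a i - j) : Fin (r + 1)) : ℕ) = r + a i - j :=
      Nat.mod_eq_of_lt (by omega)
    rw [hq, ← hx]
    refine null i ?_
    have : (k : ℕ) < j := hk
    have := j.2
    simp only [deg_comp, dl, dX, dΨ, h₁]
    push_cast [Nat.lt_succ_iff.1 j.2]; omega
  · intro i T m
    obtain ⟨A⟩ := nonempty_decomp_biproduct D (r + 1) (fun t => 2 * ((t : ℕ) : ℤ)) i
    have h₁ : hdim T (toProj (L.X i)) m =
        ∑ t : Fin (r + 1), hdim T (toProj (D.X i)) (m + 2 * (t : ℕ)) := A.hdim_eq T m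
    refine (congrArg₂ (· + ·) (hs i T m) h₁).trans ?_
    have h₂ (i : ℤ) : ∑ j, hdim T (toProj (D.X i)) (m + e i j) =
        ∑ j : Fin (r + a i + 1), hdim T (toProj (D.X i)) (m + 2 * (j : ℕ)) := by
      rw [← Equiv.sum_comp Fin.revPerm]
      refine Finset.sum_congr rfl fun j _ => ?_
      congr 2
      simp only [e, Fin.revPerm_apply, Fin.val_rev]
      have := j.2
      omega
    rw [h₂, h₂]
    have h₃ : ∑ j : Fin (r + a i + 1), hdim T (toProj (D.X i)) (m + 2 * (j : ℕ)) =
        ∑ j : Fin (r + 1), hdim T (toProj (D.X i)) (m + 2 * (j : ℕ)) +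
        ∑ j : Fin (a i), hdim T (toProj (D.X i)) (m + 2 * (r + 1 + (j : ℕ))) := by
      rw [Fin.sum_univ_eq_sum_range (fun j => hdim T (toProj (D.X i)) (m + 2 * (j : ℤ))),
        Fin.sum_univ_eq_sum_range (fun j => hdim T (toProj (D.X i)) (m + 2 * (j : ℤ))),
        Fin.sum_univ_eq_sum_range (fun j => hdim T (toProj (D.X i)) (m + 2 * (r + 1 + (j : ℤ)))),
        show r + a i + 1 = (r + 1) + a i by ring, Finset.sum_range_add]
      push_cast
      rfl
    rw [h₃]
    ring

end Splitting

/-! ### The differentials of the Rickard complexes -/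

namespace PB

open Bicategory

variable {B : Type u} [Bicategory.{w, v} B] [GradedLinearBicategory B] {a b c d : PB B}

lemma homEquiv₂_whiskerRight_comp {f : a ⟶ b} {g : b ⟶ a} (adj : f ⊣ g) {X : c ⟶ a} {Y : c ⟶ b}
    {W : a ⟶ d} {Z : b ⟶ d} (s : X ≫ f ⟶ Y) (κ : g ≫ W ⟶ Z) :
    adj.homEquiv₂ s ▷ W ≫ (α_ Y g W).hom ≫ Y ◁ κ =
      X ◁ adj.homEquiv₁.symm κ ≫ (α_ X f Z).inv ≫ s ▷ Z := by
  simp only [Adjunction.homEquiv₂, Adjunction.homEquiv₁, Equiv.coe_fn_mk, Equiv.coe_fn_symm_mk,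
    comp_whiskerRight, whiskerLeft_comp, Category.assoc]
  rw [associator_naturality_left_assoc, ← whisker_exchange]
  simp

lemma homEquiv₁_symm_whisker {f : a ⟶ b} {g : b ⟶ a} (adj : f ⊣ g) {X : a ⟶ c} {Y : b ⟶ c}
    {h : c ⟶ d} {X'' : a ⟶ d} (ι : X'' ⟶ X ≫ h) (ψ : g ≫ X ⟶ Y) :
    adj.homEquiv₁.symm (g ◁ ι ≫ (α_ g X h).inv ≫ ψ ▷ h) =
      ι ≫ adj.homEquiv₁.symm ψ ▷ h ≫ (α_ f Y h).hom := by
  simp only [Adjunction.homEquiv₁, Equiv.coe_fn_symm_mk,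
    comp_whiskerRight, whiskerLeft_comp, Category.assoc]
  rw [← associator_naturality_right_assoc, ← whisker_exchange_assoc,
    ← leftUnitor_inv_naturality_assoc]
  simp

end PB

namespace Sl2Data

open PB Bicategory
open ProjObj (Low VanishBelow Retract)

variable {B : Type u} [Bicategory.{w, v} B] [GradedLinearBicategory B] (S : Sl2Data B)

section Inclusions

lemma low_E_pow_E (a : ℕ) {l m k : ℤ} (h : m = l + 2 * ((1 : ℕ) : ℤ)) (h' : k = m + 2 * (a : ℤ))
    (h'' : k = l + 2 * ((a + 1 : ℕ) : ℤ)) :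
    Low (S.E (a + 1) h'') (S.E 1 h ≫ S.E a h') (-a) := by
  obtain ⟨D⟩ := S.E_pow_E a h h' h''
  have L := S.low_E (a + 1) h''
  refine D.low_right 0 (L.mono (by simp)) fun i hi => L.1.mono ?_
  have : (i : ℕ) ≠ 0 := fun h => hi (Fin.ext h)
  push_cast; omega

lemma low_F_F_pow (b : ℕ) {l m k : ℤ} (h : m = l + 2 * ((1 : ℕ) : ℤ)) (h' : k = m + 2 * (b : ℤ))
    (h'' : k = l + 2 * ((b + 1 : ℕ) : ℤ)) :
    Low (S.F (b + 1) h'') (S.F b h' ≫ S.F 1 h) (-b) := by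
  obtain ⟨D⟩ := S.F_F_pow b h h' h''
  have L := S.low_F (b + 1) h''
  refine D.low_right 0 (L.mono (by simp)) fun i hi => L.1.mono ?_
  have : (i : ℕ) ≠ 0 := fun h => hi (Fin.ext h)
  push_cast; omega

lemma low_F_pow_F (b : ℕ) {l m k : ℤ} (h : m = l + 2 * (b : ℤ)) (h' : k = m + 2 * ((1 : ℕ) : ℤ))
    (h'' : k = l + 2 * ((b + 1 : ℕ) : ℤ)) :
    Low (S.F (b + 1) h'') (S.F 1 h' ≫ S.F b h) (-b) := by
  obtain ⟨D⟩ := S.F_pow_F b h h' h''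
  have L := S.low_F (b + 1) h''
  refine D.low_right 0 (L.mono (by simp)) fun i hi => L.1.mono ?_
  have : (i : ℕ) ≠ 0 := fun h => hi (Fin.ext h)
  push_cast; omega

lemma exists_retraction_E_pow_E (a : ℕ) {l m k : ℤ} (h : m = l + 2 * ((1 : ℕ) : ℤ))
    (h' : k = m + 2 * (a : ℤ)) (h'' : k = l + 2 * ((a + 1 : ℕ) : ℤ))
    {ι : S.E (a + 1) h'' ⟶ S.E 1 h ≫ S.E a h'} (dι : deg ι = -a) (hι : ¬ IsNull ι) :
    ∃ π : S.E 1 h ≫ S.E a h' ⟶ S.E (a + 1) h'', ι ≫ π = 𝟙 _ := by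
  obtain ⟨D⟩ := S.E_pow_E a h h' h''
  have hD : (D.j 0 : S.E (a + 1) h'' ⟶ S.E 1 h ≫ S.E a h') ≫ D.p 0 = 𝟙 _ := decomp_j_p_self D 0
  have hn : ¬ IsNull (𝟙 (S.E (a + 1) h'')) := fun h => hι (isNull_of_isNull_id h _)
  refine ⟨D.p 0, ?_⟩
  rw [eq_of_low (S.low_E_pow_E a h h' h'') dι ((deg_fac_j _ _).trans (by simp)) hι
    (not_isNull_of_comp_eq_id hD hn), hD]

lemma exists_retraction_F_F_pow (b : ℕ) {l m k : ℤ} (h : m = l + 2 * ((1 : ℕ) : ℤ))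
    (h' : k = m + 2 * (b : ℤ)) (h'' : k = l + 2 * ((b + 1 : ℕ) : ℤ))
    {ι : S.F (b + 1) h'' ⟶ S.F b h' ≫ S.F 1 h} (dι : deg ι = -b) (hι : ¬ IsNull ι) :
    ∃ π : S.F b h' ≫ S.F 1 h ⟶ S.F (b + 1) h'', ι ≫ π = 𝟙 _ := by
  obtain ⟨D⟩ := S.F_F_pow b h h' h''
  have hD : (D.j 0 : S.F (b + 1) h'' ⟶ S.F b h' ≫ S.F 1 h) ≫ D.p 0 = 𝟙 _ := decomp_j_p_self D 0
  have hn : ¬ IsNull (𝟙 (S.F (b + 1) h'')) := fun h => hι (isNull_of_isNull_id h _)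
  refine ⟨D.p 0, ?_⟩
  rw [eq_of_low (S.low_F_F_pow b h h' h'') dι ((deg_fac_j _ _).trans (by simp)) hι
    (not_isNull_of_comp_eq_id hD hn), hD]

lemma exists_retraction_F_pow_F (b : ℕ) {l m k : ℤ} (h : m = l + 2 * (b : ℤ))
    (h' : k = m + 2 * ((1 : ℕ) : ℤ)) (h'' : k = l + 2 * ((b + 1 : ℕ) : ℤ))
    {ι : S.F (b + 1) h'' ⟶ S.F 1 h' ≫ S.F b h} (dι : deg ι = -b) (hι : ¬ IsNull ι) :
    ∃ π : S.F 1 h' ≫ S.F b h ⟶ S.F (b + 1) h'', ι ≫ π = 𝟙 _ := by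
  obtain ⟨D⟩ := S.F_pow_F b h h' h''
  have hD : (D.j 0 : S.F (b + 1) h'' ⟶ S.F 1 h' ≫ S.F b h) ≫ D.p 0 = 𝟙 _ := decomp_j_p_self D 0
  have hn : ¬ IsNull (𝟙 (S.F (b + 1) h'')) := fun h => hι (isNull_of_isNull_id h _)
  refine ⟨D.p 0, ?_⟩
  rw [eq_of_low (S.low_F_pow_F b h h' h'') dι ((deg_fac_j _ _).trans (by simp)) hι
    (not_isNull_of_comp_eq_id hD hn), hD]

/-- The contraction `E^(a+1) F ⟶ E^(a)` of lowest degree is unique. -/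
lemma low_contraction (a : ℕ) {z z' y : ℤ} (h₁ : z = z' + 2 * ((1 : ℕ) : ℤ))
    (ha : y = z + 2 * (a : ℤ)) (ha' : y = z' + 2 * ((a + 1 : ℕ) : ℤ)) :
    Low (S.F 1 h₁ ≫ S.E (a + 1) ha') (S.E a ha) (1 - z - a) := by
  obtain ⟨adj, hadj⟩ := S.adj_right 1 h₁
  exact low_adj₁ adj (S.low_E_pow_E a h₁ ha ha') (by rw [hadj]; push_cast; omega)

end Inclusions

section Differential

variable (a b : ℕ) {x y z z' : ℤ} (hb' : x = z' + 2 * ((b + 1 : ℕ) : ℤ))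
  (ha' : y = z' + 2 * ((a + 1 : ℕ) : ℤ)) (hb : x = z + 2 * (b : ℤ)) (ha : y = z + 2 * (a : ℤ))

/-- `δ : E^(a+1) F^(b+1) ⟶ E^(a) F^(b)` is the composition of the inclusion
`F^(b+1) ⟶ F F^(b)` and of a contraction `E^(a+1) F ⟶ E^(a)`, both of the lowest degree in which
there are nonzero morphisms. -/
def IsDifferential (δ : S.F (b + 1) hb' ≫ S.E (a + 1) ha' ⟶ S.F b hb ≫ S.E a ha) : Prop :=
  ∃ (h₁ : z = z' + 2 * ((1 : ℕ) : ℤ)) (ι : S.F (b + 1) hb' ⟶ S.F b hb ≫ S.F 1 h₁)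
    (κ : S.F 1 h₁ ≫ S.E (a + 1) ha' ⟶ S.E a ha), deg ι = -b ∧
    (IsNull ι → IsNull (𝟙 (S.F (b + 1) hb'))) ∧ deg κ = 1 - z - a ∧
    (IsNull κ → IsNull (𝟙 (S.E (a + 1) ha'))) ∧
    δ = ι ▷ S.E (a + 1) ha' ≫ (α_ _ _ _).hom ≫ S.F b hb ◁ κ

variable {S a b hb' ha' hb ha}

lemma IsDifferential.deg_eq {δ : S.F (b + 1) hb' ≫ S.E (a + 1) ha' ⟶ S.F b hb ≫ S.E a ha}
    (h : S.IsDifferential a b hb' ha' hb ha δ) : deg δ = 1 - a + b - x := by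
  obtain ⟨h₁, ι, κ, dι, -, dκ, -, rfl⟩ := h
  simp [dι, dκ]; omega

lemma IsDifferential.eq {δ δ' : S.F (b + 1) hb' ≫ S.E (a + 1) ha' ⟶ S.F b hb ≫ S.E a ha}
    (h : S.IsDifferential a b hb' ha' hb ha δ) (h' : S.IsDifferential a b hb' ha' hb ha δ') :
    δ = δ' := by
  have hd := h.deg_eq.trans h'.deg_eq.symm
  by_cases hF : IsNull (𝟙 (S.F (b + 1) hb'))
  · have := isNull_id_comp_left hF (S.E (a + 1) ha')
    exact (isNull_of_isNull_id this δ).eq (isNull_of_isNull_id this δ') hd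
  by_cases hE : IsNull (𝟙 (S.E (a + 1) ha'))
  · have := isNull_id_comp_right (S.F (b + 1) hb') hE
    exact (isNull_of_isNull_id this δ).eq (isNull_of_isNull_id this δ') hd
  obtain ⟨h₁, ι, κ, dι, hι, dκ, hκ, rfl⟩ := h
  obtain ⟨h₁, ι', κ', dι', hι', dκ', hκ', rfl⟩ := h'
  rw [eq_of_low (S.low_F_F_pow b h₁ hb hb') dι dι' (fun h => hF (hι h)) (fun h => hF (hι' h)),
    eq_of_low (S.low_contraction a h₁ ha ha') dκ dκ' (fun h => hE (hκ h)) (fun h => hE (hκ' h))]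

end Differential

section ChainMap

variable {S} {a b N : ℕ} {x y z z' v : ℤ} (hx : x = y + 2 * ((1 : ℕ) : ℤ))
  (h₁ : z = z' + 2 * ((1 : ℕ) : ℤ)) (hb : y = z + 2 * (b : ℤ))
  (hb' : y = z' + 2 * ((b + 1 : ℕ) : ℤ)) (hc : x = z + 2 * ((b + 1 : ℕ) : ℤ))
  (hc' : x = z' + 2 * ((b + 1 + 1 : ℕ) : ℤ)) (hN : y = b - 1 - N)
include hN

/-- The morphisms `F^(b+1) E ⟶ F^(b)` of lowest degree are compatible with the inclusions
`F^(b+1) ⟶ F F^(b)`. -/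
lemma lower_comp_inclusion {ψ : S.E 1 hx ≫ S.F (b + 1) hc ⟶ S.F b hb} (dψ : deg ψ = -N)
    (hψ : IsNull ψ → IsNull (𝟙 (S.F b hb)))
    {ψ' : S.E 1 hx ≫ S.F (b + 1 + 1) hc' ⟶ S.F (b + 1) hb'} (dψ' : deg ψ' = -(N + 1 : ℕ))
    (hψ' : IsNull ψ' → IsNull (𝟙 (S.F (b + 1) hb')))
    {ι : S.F (b + 1 + 1) hc' ⟶ S.F (b + 1) hc ≫ S.F 1 h₁} (dι : deg ι = -(b + 1 : ℕ))
    (hι : IsNull ι → IsNull (𝟙 (S.F (b + 1 + 1) hc')))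
    {ι' : S.F (b + 1) hb' ⟶ S.F b hb ≫ S.F 1 h₁} (dι' : deg ι' = -b)
    (hι' : IsNull ι' → IsNull (𝟙 (S.F (b + 1) hb'))) :
    S.E 1 hx ◁ ι ≫ (α_ _ _ _).inv ≫ ψ ▷ S.F 1 h₁ = ψ' ≫ ι' := by
  have hd : deg (S.E 1 hx ◁ ι ≫ (α_ _ _ _).inv ≫ ψ ▷ S.F 1 h₁) = deg (ψ' ≫ ι') := by
    simp [dι, dψ, dψ', dι']; ring
  by_cases hT : IsNull (𝟙 (S.F b hb ≫ S.F 1 h₁))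
  · exact (isNull_of_isNull_id' hT _).eq (isNull_of_isNull_id' hT _) hd
  by_cases hA : IsNull (𝟙 (S.F (b + 1 + 1) hc'))
  · have := isNull_id_comp_right (S.E 1 hx) hA
    exact (isNull_of_isNull_id this _).eq (isNull_of_isNull_id this _) hd
  have hn : ¬ IsNull (𝟙 (S.F b hb)) := fun h => hT (isNull_id_comp_left h _)
  obtain ⟨D⟩ := S.F_F_pow b h₁ hb hb'
  have hn' : ¬ IsNull (𝟙 (S.F (b + 1) hb')) := fun h => hT (fac_isNull_of_p D.toFac _ fun i =>
    isNull_of_isNull_id' h _)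
  have L : Low (S.E 1 hx ≫ S.F (b + 1 + 1) hc') (S.F b hb ≫ S.F 1 h₁) (-(N + 1 : ℕ) - b) := by
    have L := S.low_lower' (b + 1) (N + 1) hx hb' hc' (by push_cast; omega)
    refine D.low_right 0 (L.mono (by push_cast; simp)) fun i hi => L.1.mono ?_
    have : (i : ℕ) ≠ 0 := fun h => hi (Fin.ext h)
    push_cast; omega
  refine eq_of_low L (by rw [hd]; simp [dψ', dι']; ring) (by simp [dψ', dι']; ring) ?_ ?_
  · intro h
    obtain ⟨adj, hadj⟩ := S.adj_left 1 hx
    have h' := isNull_homEquiv₁_symm adj h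
    rw [homEquiv₁_symm_whisker] at h'
    have hρ : ¬ IsNull (adj.homEquiv₁.symm ψ) := fun h => hn (hψ (by
      simpa using isNull_homEquiv₁ adj h))
    obtain ⟨π, hπ⟩ := S.exists_retraction_F_pow_F b hb hx hc (ι := adj.homEquiv₁.symm ψ) (by
      rw [deg_homEquiv₁_symm, dψ, hadj]; push_cast; omega) hρ
    obtain ⟨π', hπ'⟩ := S.exists_retraction_F_F_pow (b + 1) h₁ hc hc' dι (fun h => hA (hι h))
    refine not_isNull_of_comp_eq_id (β := (α_ _ _ _).inv ≫ π ▷ S.F 1 h₁ ≫ π') ?_ hA h'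
    simp only [Category.assoc, Iso.hom_inv_id_assoc]
    rw [← comp_whiskerRight_assoc, hπ, id_whiskerRight, Category.id_comp, hπ']
  · intro h
    obtain ⟨π, hπ⟩ := S.exists_retraction_F_F_pow b h₁ hb hb' dι' (fun h => hn' (hι' h))
    exact hn' (hψ' (isNull_of_isNull_comp hπ h))

/-- The morphisms `F^(b+1) E ⟶ F^(b)` of lowest degree form a chain map up to scalars. -/
lemma IsDifferential.lower_comp {ha : v = z + 2 * (a : ℤ)} {ha' : v = z' + 2 * ((a + 1 : ℕ) : ℤ)}
    {δ : S.F (b + 1 + 1) hc' ≫ S.E (a + 1) ha' ⟶ S.F (b + 1) hc ≫ S.E a ha}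
    (hδ : S.IsDifferential a (b + 1) hc' ha' hc ha δ)
    {δ' : S.F (b + 1) hb' ≫ S.E (a + 1) ha' ⟶ S.F b hb ≫ S.E a ha}
    (hδ' : S.IsDifferential a b hb' ha' hb ha δ')
    {ψ : S.E 1 hx ≫ S.F (b + 1) hc ⟶ S.F b hb} (dψ : deg ψ = -N)
    (hψ : IsNull ψ → IsNull (𝟙 (S.F b hb)))
    {ψ' : S.E 1 hx ≫ S.F (b + 1 + 1) hc' ⟶ S.F (b + 1) hb'} (dψ' : deg ψ' = -(N + 1 : ℕ))
    (hψ' : IsNull ψ' → IsNull (𝟙 (S.F (b + 1) hb'))) :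
    S.E 1 hx ◁ δ ≫ (α_ _ _ _).inv ≫ ψ ▷ S.E a ha =
      (α_ _ _ _).inv ≫ ψ' ▷ S.E (a + 1) ha' ≫ δ' := by
  have hd : deg (S.E 1 hx ◁ δ ≫ (α_ _ _ _).inv ≫ ψ ▷ S.E a ha) =
      deg ((α_ _ _ _).inv ≫ ψ' ▷ S.E (a + 1) ha' ≫ δ') := by
    simp [hδ.deg_eq, hδ'.deg_eq, dψ, dψ']; omega
  by_cases hE : IsNull (𝟙 (S.E (a + 1) ha'))
  · have := isNull_id_comp_right (S.E 1 hx) (isNull_id_comp_right (S.F (b + 1 + 1) hc') hE)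
    exact (isNull_of_isNull_id this _).eq (isNull_of_isNull_id this _) hd
  obtain ⟨h₁, ι, κ, dι, hι, dκ, hκ, rfl⟩ := hδ
  obtain ⟨h₁, ι', κ', dι', hι', dκ', hκ', rfl⟩ := hδ'
  rw [eq_of_low (S.low_contraction a h₁ ha ha') dκ dκ' (fun h => hE (hκ h)) (fun h => hE (hκ' h))]
  have := congrArg (fun φ => φ ▷ S.E (a + 1) ha')
    (lower_comp_inclusion hx h₁ hb hb' hc hc' hN dψ hψ dψ' hψ' dι hι dι' hι')
  simp only [comp_whiskerRight] at this
  rw [← reassoc_of% this]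
  rw [associator_naturality_left_assoc, ← whisker_exchange]
  simp

/-- The differential maps the lowest copy of `E^(a+1) F^(b)` in `E^(a+1) F^(b+1) E` to the lowest
copy in `E^(a) F^(b) E`. -/
lemma IsDifferential.upper_comp {w : ℤ} {hd : w = z + 2 * ((1 : ℕ) : ℤ)} {hw : x = w + 2 * (b : ℤ)}
    {ha : v = w + 2 * (a : ℤ)} {ha' : v = z + 2 * ((a + 1 : ℕ) : ℤ)}
    {δ : S.F (b + 1) hc ≫ S.E (a + 1) ha' ⟶ S.F b hw ≫ S.E a ha}
    (hδ : S.IsDifferential a b hc ha' hw ha δ)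
    {u : S.F b hb ⟶ S.E 1 hx ≫ S.F (b + 1) hc} (du : deg u = -N)
    (hu : IsNull u → IsNull (𝟙 (S.F b hb)))
    (h₀ : IsNull (u ▷ S.E (a + 1) ha' ≫ (α_ _ _ _).hom ≫ S.E 1 hx ◁ δ)) :
    IsNull (𝟙 (S.F b hb ≫ S.E (a + 1) ha')) := by
  by_contra hn
  obtain ⟨hd', ι, κ, dι, hι, dκ, hκ, rfl⟩ := hδ
  have hnF : ¬ IsNull (𝟙 (S.F b hb)) := fun h => hn (isNull_id_comp_left h _)
  have hnE : ¬ IsNull (𝟙 (S.E (a + 1) ha')) := fun h => hn (isNull_id_comp_right _ h)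
  replace hu : ¬ IsNull u := fun h => hnF (hu h)
  have hnF' : ¬ IsNull (𝟙 (S.F (b + 1) hc)) := fun h => hu
    (isNull_of_isNull_id' (isNull_id_comp_right _ h) _)
  obtain ⟨adj, hadj⟩ := S.adj_right 1 hd
  obtain ⟨π, hπ⟩ := S.exists_retraction_E_pow_E a hd ha ha' (ι := adj.homEquiv₁.symm κ) (by
    rw [deg_homEquiv₁_symm, dκ, hadj]; push_cast; omega) fun h => hnE (hκ (by
      simpa using isNull_homEquiv₁ adj h))
  obtain ⟨s, s', hs, ds⟩ := exists_of_retract (S.exists_retract_FE 1 b hb hd hx hw (by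
    push_cast; omega))
  have key : u ≫ S.E 1 hx ◁ ι ≫ (α_ _ _ _).inv = adj.homEquiv₂ s := by
    obtain ⟨D⟩ := S.F_F_pow b hd hw hc
    have L : Low (S.F b hb) (S.E 1 hx ≫ S.F b hw ≫ S.F 1 hd) (-N - b) := by
      have L := S.low_lower b N hx hb hc hN
      refine (decompLeft (S.E 1 hx) D).low_right 0 (L.mono (by simp)) fun i hi => L.1.mono ?_
      have : (i : ℕ) ≠ 0 := fun h => hi (Fin.ext h)
      push_cast; omega
    refine eq_of_low (low_congr_right (α_ _ _ _).symm (by simp) L) ?_ ?_ ?_ ?_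
    · simp [du, dι]; ring
    · rw [deg_homEquiv₂, ds, hadj]; push_cast; omega
    · intro h
      rw [← Category.assoc, isNull_comp_iso_inv] at h
      obtain ⟨π', hπ'⟩ := S.exists_retraction_F_F_pow b hd hw hc dι fun h => hnF' (hι h)
      refine hu (isNull_of_isNull_comp (β := S.E 1 hx ◁ π') ?_ h)
      rw [← whiskerLeft_comp, hπ', whiskerLeft_id]
    · intro h
      have h' : IsNull s := by simpa using isNull_homEquiv₂_symm adj h
      have h'' : IsNull (𝟙 (S.F b hb ≫ S.E 1 hd)) := by rw [← hs]; exact h'.comp _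
      refine hn ?_
      have : S.F b hb ◁ adj.homEquiv₁.symm κ ≫ S.F b hb ◁ π = 𝟙 _ := by
        rw [← whiskerLeft_comp, hπ, whiskerLeft_id]
      rw [← this]
      have h₃ : IsNull (𝟙 (S.F b hb ≫ S.E 1 hd ≫ S.E a ha)) := by
        have := ((isNull_id_comp_left h'' (S.E a ha)).comp_left (α_ _ _ _).inv).comp
          (α_ _ _ _).hom
        simpa using this
      exact (isNull_of_isNull_id' h₃ _).comp _
  have e : u ▷ S.E (a + 1) ha' ≫ (α_ _ _ _).hom ≫ S.E 1 hx ◁ (ι ▷ S.E (a + 1) ha' ≫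
      (α_ _ _ _).hom ≫ S.F b hw ◁ κ) = S.F b hb ◁ adj.homEquiv₁.symm κ ≫ (α_ _ _ _).inv ≫
        s ▷ S.E a ha ≫ (α_ _ _ _).hom := by
    have h₂ := homEquiv₂_whiskerRight_comp adj s κ
    rw [← key] at h₂
    simp only [← Category.assoc] at h₂ ⊢
    rw [← h₂]
    simp
  rw [e] at h₀
  refine not_isNull_of_comp_eq_id
    (β := (α_ _ _ _).inv ≫ s' ▷ S.E a ha ≫ (α_ _ _ _).hom ≫ S.F b hb ◁ π) ?_ hn h₀
  simp only [Category.assoc, Iso.hom_inv_id_assoc]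
  rw [← comp_whiskerRight_assoc, hs, id_whiskerRight, Category.id_comp, Iso.inv_hom_id_assoc,
    ← whiskerLeft_comp, hπ, whiskerLeft_id]

end ChainMap

end Sl2Data

/-! ### Complexes with the terms of a Rickard complex -/

section Dimensions

variable {C : Type u} [Category.{v} C] [Preadditive C] [Linear ℂ C] [HasShift C ℤ]
  [∀ n : ℤ, (shiftFunctor C n).Additive] [∀ n : ℤ, (shiftFunctor C n).Linear ℂ]
  [∀ X Y : C, Module.Finite ℂ (X ⟶ Y)]

open ProjObj

lemma hdim_of_piso {M N : ProjObj C} (e : M ≅ N) {k : ℤ} (he : deg e.hom = k) (T : C) (n : ℤ) :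
    hdim T M n = hdim T N (n + k) := by
  obtain ⟨A, -, -⟩ := Decomp.exists_ofPIso e he
  simpa using A.hdim_eq T n

lemma hdim_eq_zero {M : ProjObj C} (h : IsNull (𝟙 M)) (T : C) (n : ℤ) : hdim T M n = 0 := by
  have : Subsingleton (ShiftedHom T M.obj n) := ⟨fun α β => by
    have h₁ (α : ShiftedHom T M.obj n) : α = 0 := isNull_pcl.1 (isNull_of_isNull_id' h (pcl α))
    rw [h₁ α, h₁ β]⟩
  exact Module.finrank_zero_of_subsingleton

end Dimensions

lemma qsum_eq_sum_add (n : ℕ) (g : ℤ → ℕ) (m : ℤ) :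
    qsum (n + 1) g m = ∑ j : Fin (n + 1), g (m - n + 2 * ((j : ℕ) : ℤ)) := by
  rw [qsum, ← Equiv.sum_comp Fin.revPerm]
  refine Finset.sum_congr rfl fun j _ => ?_
  congr 1
  simp only [Fin.revPerm_apply, Fin.val_rev]
  have := j.2
  omega

namespace PB

open Bicategory

variable {B : Type u} [Bicategory.{w, v} B] [GradedLinearBicategory B] {a b c : PB B}

/-- The term of degree `i` of a complex of 1-morphisms. -/
def X (C : CochainComplex (a.as ⟶ b.as) ℤ) (i : ℤ) : a ⟶ b := (⟨C.X i⟩ : ProjObj (a.as ⟶ b.as))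

/-- The differential of a complex of 1-morphisms, up to scalars. -/
noncomputable def d (C : CochainComplex (a.as ⟶ b.as) ℤ) (i : ℤ) : X C i ⟶ X C (i + 1) :=
  pcl₀ (C.d i (i + 1))

lemma X_compBefore (C : CochainComplex (b.as ⟶ c.as) ℤ) (f : a ⟶ b) (i : ℤ) :
    X (compBefore C f.obj) i = f ≫ X C i := rfl

lemma d_compBefore (C : CochainComplex (b.as ⟶ c.as) ℤ) (f : a ⟶ b) (i : ℤ) :
    (d (compBefore C f.obj) i : f ≫ X C i ⟶ f ≫ X C (i + 1)) = f ◁ d C i :=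
  pcl₀_whiskerLeft f.obj (C.d i (i + 1))

lemma deg_d (C : CochainComplex (a.as ⟶ b.as) ℤ) (i : ℤ) : deg (d C i) = 0 := rfl

end PB

namespace Sl2Data

open PB Bicategory
open ProjObj (Low VanishBelow Retract)

variable {B : Type u} [Bicategory.{w, v} B] [GradedLinearBicategory B] (S : Sl2Data B)

/-- A complex with terms `E^(α-i) F^(β-i)` up to shifts, where terms with a negative exponent are
zero, and with the differentials of the Rickard complexes up to scalars. The shifts are normalized
by `κ`. -/
structure IsRickard {x v : ℤ} (C : CochainComplex ((S.wt x).as ⟶ (S.wt v).as) ℤ) (α β κ : ℤ) :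
    Prop where
  null (i : ℤ) (h : α < i ∨ β < i) : IsNull (𝟙 (PB.X C i))
  exists_iso : ∃ e : ∀ (i : ℤ) (a b : ℕ) (z : ℤ) (hb : x = z + 2 * (b : ℤ))
      (ha : v = z + 2 * (a : ℤ)), (a : ℤ) = α - i → (b : ℤ) = β - i →
      (PB.X C i ≅ S.F b hb ≫ S.E a ha),
    (∀ i a b z hb ha h h', deg (e i a b z hb ha h h').hom = κ + i * (β - α - x + 1)) ∧
    ∀ (i : ℤ) (a b : ℕ) (z z' : ℤ) (hb' : x = z' + 2 * ((b + 1 : ℕ) : ℤ))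
      (ha' : v = z' + 2 * ((a + 1 : ℕ) : ℤ)) (hb : x = z + 2 * (b : ℤ))
      (ha : v = z + 2 * (a : ℤ)) (h₁ : ((a + 1 : ℕ) : ℤ) = α - i) (h₁' : ((b + 1 : ℕ) : ℤ) = β - i)
      (h₂ : (a : ℤ) = α - (i + 1)) (h₂' : (b : ℤ) = β - (i + 1)),
      ∃ δ, S.IsDifferential a b hb' ha' hb ha δ ∧
        PB.d C i ≫ (e (i + 1) a b z hb ha h₂ h₂').hom = (e i _ _ z' hb' ha' h₁ h₁').hom ≫ δ

variable {S}

lemma IsRickard.low {x v α β κ : ℤ} {C : CochainComplex ((S.wt x).as ⟶ (S.wt v).as) ℤ}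
    (hC : S.IsRickard C α β κ) (hr : 0 ≤ β - α - x) (hv : v = x + 2 * (α - β)) (i j : ℤ) :
    Low (PB.X C i) (PB.X C j) ((j - i) * (j - i - 1)) := by
  by_cases hi : α < i ∨ β < i
  · exact Low.of_isNull_left (hC.null i hi)
  by_cases hj : α < j ∨ β < j
  · exact Low.of_isNull_right (hC.null j hj)
  push Not at hi hj
  obtain ⟨e, he, -⟩ := hC.exists_iso
  obtain ⟨a, ha⟩ := Int.eq_ofNat_of_zero_le (sub_nonneg.2 hi.1)
  obtain ⟨b, hb⟩ := Int.eq_ofNat_of_zero_le (sub_nonneg.2 hi.2)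
  obtain ⟨c, hc⟩ := Int.eq_ofNat_of_zero_le (sub_nonneg.2 hj.1)
  obtain ⟨d, hd⟩ := Int.eq_ofNat_of_zero_le (sub_nonneg.2 hj.2)
  have L := S.low_FE_FE (a := a) (b := b) (c := c) (d := d) (z := x - 2 * b) (z' := x - 2 * d)
    (x := x) (y := v) (by omega) (by omega) (by omega) (by omega) (by omega) (by omega) rfl
  refine Low.of_iso (e i a b _ (by omega) (by omega) ha.symm hb.symm)
    (e j c d _ (by omega) (by omega) hc.symm hd.symm) L ?_
  have h₁ := he i a b (x - 2 * b) (by omega) (by omega) ha.symm hb.symm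
  have h₂ := he j c d (x - 2 * d) (by omega) (by omega) hc.symm hd.symm
  refine Eq.trans ?_ (congrArg₂ (fun s t => (j - i) * (j - i - 1) + s - t) h₂.symm h₁.symm)
  rw [show (b : ℤ) = β - i by omega, show (d : ℤ) = β - j by omega, show (a : ℤ) = α - i by omega]
  ring

section Step

variable {x y v α β κ : ℤ} {C : CochainComplex ((S.wt x).as ⟶ (S.wt v).as) ℤ}
  {D : CochainComplex ((S.wt y).as ⟶ (S.wt v).as) ℤ} {r : ℕ}

/-- The sizes of the terms of the composition of a Rickard complex with `E`. -/
lemma IsRickard.hdim_E_comp (X : S.Dot) (hx : x = y + 2 * ((1 : ℕ) : ℤ))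
    (hv : v = x + 2 * (α - β)) (hr : (r : ℤ) = β - α - x) (hC : S.IsRickard C α β κ)
    (hD : S.IsRickard D α (β - 1) (κ - r - α)) (i : ℤ) (T : (S.wt y).as ⟶ (S.wt v).as) (m : ℤ) :
    have := fun X Y : (S.wt y).as ⟶ (S.wt v).as => S.finite_dimensional X Y
    hdim T (S.E 1 hx ≫ PB.X C (i + 1)) m =
      ∑ j : Fin (α - i).toNat, hdim T (PB.X D i) (m + 2 * (r + 1 + (j : ℕ))) +
      ∑ j : Fin (r + (α - (i + 1)).toNat + 1), hdim T (PB.X D (i + 1)) (m + 2 * (j : ℕ)) := by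
  have := fun X Y : (S.wt y).as ⟶ (S.wt v).as => S.finite_dimensional X Y
  by_cases hi : α < i + 1 ∨ β < i + 1
  · have h₀ : hdim T (S.E 1 hx ≫ PB.X C (i + 1)) m = 0 :=
      hdim_eq_zero (isNull_id_comp_right _ (hC.null _ hi)) T m
    have h₁ (m) : hdim T (PB.X D (i + 1)) m = 0 := hdim_eq_zero (hD.null _ (by omega)) T m
    refine h₀.trans ?_
    simp only [h₁, Finset.sum_const_zero, add_zero]
    rcases hi with hi | hi
    · rw [show (α - i).toNat = 0 by omega]; simp
    · have h₂ (m) : hdim T (PB.X D i) m = 0 := hdim_eq_zero (hD.null _ (by omega)) T m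
      simp [h₂]
  push Not at hi
  obtain ⟨e, he, -⟩ := hC.exists_iso
  obtain ⟨e', he', -⟩ := hD.exists_iso
  obtain ⟨a, ha⟩ := Int.eq_ofNat_of_zero_le (sub_nonneg.2 hi.1)
  obtain ⟨b, hb⟩ := Int.eq_ofNat_of_zero_le (sub_nonneg.2 hi.2)
  rw [show (α - i).toNat = a + 1 by omega, show (α - (i + 1)).toNat = a by omega]
  obtain ⟨z, hz⟩ : ∃ z, x = z + 2 * (b : ℤ) := ⟨x - 2 * b, by ring⟩
  obtain ⟨z', hz'⟩ : ∃ z', z = z' + 2 * ((1 : ℕ) : ℤ) := ⟨z - 2, by simp⟩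
  have hb' : y = z' + 2 * (b : ℤ) := by omega
  have ha₁ : v = z + 2 * (a : ℤ) := by omega
  have ha₂ : v = z' + 2 * ((a + 1 : ℕ) : ℤ) := by push_cast; omega
  obtain ⟨A⟩ := S.E_pow_E a hz' ha₁ ha₂
  have q₁ := he (i + 1) a b z hz ha₁ ha.symm hb.symm
  have q₂ := he' i (a + 1) b z' hb' ha₂ (by push_cast; omega) (by omega)
  have e₁ : hdim T (S.E 1 hx ≫ PB.X C (i + 1)) m =
      hdim T (S.E 1 hx ≫ S.F b hz ≫ S.E a ha₁) (m + (κ + (i + 1) * (r + 1))) :=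
    hdim_of_piso (whiskerLeftIso (S.E 1 hx) (e (i + 1) a b z hz ha₁ ha.symm hb.symm))
      ((deg_whiskerLeft _ _).trans (q₁.trans (by rw [hr]))) T m
  have e₂ (m : ℤ) : hdim T (S.F b hb' ≫ S.E (a + 1) ha₂) m =
      hdim T (PB.X D i) (m - (κ - r - α + i * (r + 2))) := by
    refine ((hdim_of_piso _ q₂ T _).trans ?_).symm
    congr 1
    rw [hr, hx]; push_cast; ring
  have e₃ (m : ℤ) : hdim T (S.F b hb' ≫ S.E 1 hz' ≫ S.E a ha₁) m =
      qsum (a + 1) (hdim T (S.F b hb' ≫ S.E (a + 1) ha₂)) m :=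
    hdim_eq_qsum (decompLeft (S.F b hb') A) T m
  have e₄ : ∑ j : Fin (a + 1), hdim T (PB.X D i) (m + 2 * (r + 1 + (j : ℕ))) =
      hdim T (S.F b hb' ≫ S.E 1 hz' ≫ S.E a ha₁) (m + (κ + (i + 1) * (r + 1))) := by
    rw [e₃, qsum_eq_sum_add]
    refine Finset.sum_congr rfl fun j _ => ?_
    rw [e₂]
    congr 1
    rw [show α = a + i + 1 by omega]; ring
  refine e₁.trans ?_
  rw [e₄]
  rcases b with _ | b
  · have h₁ (m) : hdim T (PB.X D (i + 1)) m = 0 :=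
      hdim_eq_zero (hD.null _ (by push_cast at hb; omega)) T m
    simp only [h₁, Finset.sum_const_zero, add_zero]
    obtain rfl : x = z := by simpa using hz
    obtain rfl : y = z' := by simpa using hb'
    obtain ⟨f, hf⟩ := S.F_zero hz
    obtain ⟨f', hf'⟩ := S.F_zero hb'
    refine hdim_congr (whiskerLeftIso (S.E 1 hx) (whiskerRightIso f (S.E a ha₁) ≪≫ λ_ _) ≪≫
      (λ_ _).symm ≪≫ (whiskerRightIso f' _).symm) ?_ T _
    simp [hf, hf']
  · have hb'' : y = z + 2 * (b : ℤ) := by push_cast at *; omega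
    obtain ⟨A'⟩ := X.exists_decomp_E_F b (r + a + 1) hx hb'' hz hz' hb' (by push_cast at *; omega)
    have q₃ := he' (i + 1) a b z hb'' ha₁ ha.symm (by push_cast at *; omega)
    have e₅ (m : ℤ) : hdim T (S.F b hb'' ≫ S.E a ha₁) m =
        hdim T (PB.X D (i + 1)) (m - (κ - r - α + (i + 1) * (r + 2))) := by
      refine ((hdim_of_piso _ q₃ T _).trans ?_).symm
      congr 1
      rw [hr, hx]; push_cast; ring
    have e₆ := hdim_eq_add_qsum (g := (S.F (b + 1) hb' ≫ S.E 1 hz') ≫ S.E a ha₁)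
      (h := S.F b hb'' ≫ S.E a ha₁) (decompAssoc A' (S.E a ha₁)) rfl (fun _ => rfl) rfl
      (fun _ => rfl) T (m + (κ + (i + 1) * (r + 1)))
    refine e₆.trans (congrArg₂ (· + ·) (hdim_congr (α_ _ _ _) rfl T _) ?_)
    rw [qsum_eq_sum_add]
    refine Finset.sum_congr rfl fun j _ => ?_
    rw [e₅]
    congr 1
    rw [show α = a + i + 1 by omega]; push_cast; ring

end Step

end Sl2Data

namespace Sl2Data

open PB Bicategory
open ProjObj (Low VanishBelow Retract)

variable {B : Type u} [Bicategory.{w, v} B] [GradedLinearBicategory B] {S : Sl2Data B}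

/-! ### Composition of a Rickard complex with `E` -/

section Step

variable {x y v α β κ : ℤ} {C : CochainComplex ((S.wt x).as ⟶ (S.wt v).as) ℤ}
  {D : CochainComplex ((S.wt y).as ⟶ (S.wt v).as) ℤ} {r : ℕ}

/-- The composition of a Rickard complex with `E` is a direct sum of shifts of a Rickard complex,
whose components are detected by powers of the dot. -/
theorem IsRickard.exists_isIso (X : S.Dot) (hx : x = y + 2 * ((1 : ℕ) : ℤ))
    (hv : v = x + 2 * (α - β)) (hr : (r : ℤ) = β - α - x) (hC : S.IsRickard C α β κ)
    (hD : S.IsRickard D α (β - 1) (κ - r - α)) :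
    ∃ (Φ : compBefore C (S.E 1 hx).obj ⟶
        ⨁ fun t : Fin (r + 1) => intShift (2 * ((t : ℕ) : ℤ)) D)
      (Ψ : ∀ i, S.E 1 hx ≫ PB.X C i ⟶ PB.X D i), (∀ i, deg (Ψ i) = 0) ∧
      (∀ i, Ψ i ≫ PB.d D i = S.E 1 hx ◁ PB.d C i ≫ Ψ (i + 1)) ∧
      IsIso ((toHtpy _).map Φ) ∧ ∀ (t : Fin (r + 1)) (i : ℤ),
        pcl₀ ((Φ ≫ biproduct.π (fun t : Fin (r + 1) => intShift (2 * ((t : ℕ) : ℤ)) D) t).f i) ≫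
          (intShiftPIso D (2 * ((t : ℕ) : ℤ)) i).hom =
            (iter (X.X hx) t ▷ PB.X C i ≫ Ψ i : S.E 1 hx ≫ PB.X C i ⟶ PB.X D i) := by
  have hfd := fun X Y : (S.wt y).as ⟶ (S.wt v).as => S.finite_dimensional X Y
  obtain ⟨e, he, hd⟩ := hC.exists_iso
  obtain ⟨e', he', hd'⟩ := hD.exists_iso
  have hN {a b : ℕ} {z i : ℤ} (hb : y = z + 2 * (b : ℤ)) (ha : v = z + 2 * (a : ℤ))
      (h₁ : (a : ℤ) = α - i) (h₂ : ((b + 1 : ℕ) : ℤ) = β - i) : y = b - 1 - ((r + a : ℕ) : ℤ) := by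
    push_cast at *; omega
  -- the chain map
  have hΨ (i : ℤ) : ∃ Ψ : S.E 1 hx ≫ PB.X C i ⟶ PB.X D i, deg Ψ = 0 ∧
      ∀ (a b : ℕ) (z : ℤ) (hb : y = z + 2 * (b : ℤ)) (hc : x = z + 2 * ((b + 1 : ℕ) : ℤ))
        (ha : v = z + 2 * (a : ℤ)) (h₁ : (a : ℤ) = α - i) (h₂ : ((b + 1 : ℕ) : ℤ) = β - i)
        (h₃ : (b : ℤ) = β - 1 - i), ∃ ψ : S.E 1 hx ≫ S.F (b + 1) hc ⟶ S.F b hb,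
          deg ψ = -(r + a : ℕ) ∧ (IsNull ψ → IsNull (𝟙 (S.F b hb))) ∧
          Ψ = S.E 1 hx ◁ (e i a (b + 1) z hc ha h₁ h₂).hom ≫ (α_ _ _ _).inv ≫ ψ ▷ S.E a ha ≫
            (e' i a b z hb ha h₁ h₃).inv := by
    by_cases hi : i ≤ α ∧ i ≤ β - 1
    · obtain ⟨a, h₁⟩ := Int.eq_ofNat_of_zero_le (sub_nonneg.2 hi.1)
      obtain ⟨b, h₃⟩ := Int.eq_ofNat_of_zero_le (sub_nonneg.2 hi.2)
      have h₂ : ((b + 1 : ℕ) : ℤ) = β - i := by push_cast; omega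
      obtain ⟨z, hb⟩ : ∃ z, y = z + 2 * (b : ℤ) := ⟨y - 2 * b, by ring⟩
      have hc : x = z + 2 * ((b + 1 : ℕ) : ℤ) := by push_cast at *; omega
      have ha : v = z + 2 * (a : ℤ) := by omega
      obtain ⟨ψ, dψ, hψ⟩ : ∃ ψ : S.E 1 hx ≫ S.F (b + 1) hc ⟶ S.F b hb, deg ψ = -(r + a : ℕ) ∧
          (IsNull ψ → IsNull (𝟙 (S.F b hb))) := by
        by_cases h : IsNull (𝟙 (S.F b hb))
        · obtain ⟨ψ, -, dψ⟩ := exists_isNull (S.E 1 hx ≫ S.F (b + 1) hc) (S.F b hb) (-(r + a : ℕ))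
          exact ⟨ψ, dψ, fun _ => h⟩
        · obtain ⟨ψ, dψ, hψ⟩ := S.exists_lower' b (r + a) hx hb hc (hN hb ha h₁.symm h₂) h
          exact ⟨ψ, dψ, fun h => (hψ h).elim⟩
      refine ⟨S.E 1 hx ◁ (e i a (b + 1) z hc ha h₁.symm h₂).hom ≫ (α_ _ _ _).inv ≫
        ψ ▷ S.E a ha ≫ (e' i a b z hb ha h₁.symm h₃.symm).inv, ?_, ?_⟩
      · simp only [deg_comp, deg_whiskerLeft, deg_whiskerRight, deg_iso_inv, deg_associator_hom,
          he, he', dψ]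
        rw [← hr, show β - 1 - α - y = r + 1 by omega]
        push_cast
        rw [show α = a + i by omega]; ring
      · intro a' b' z' hb' hc' ha' h₁' h₂' h₃'
        obtain rfl : a' = a := by omega
        obtain rfl : b' = b := by omega
        obtain rfl : z' = z := by omega
        exact ⟨ψ, dψ, hψ, rfl⟩
    · obtain ⟨Ψ, -, dΨ⟩ := exists_isNull (S.E 1 hx ≫ PB.X C i) (PB.X D i) 0
      exact ⟨Ψ, dΨ, fun a b z hb hc ha h₁ h₂ h₃ => (hi (by omega)).elim⟩
  choose Ψ dΨ hΨ using hΨ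
  -- the inclusions of the summands of lowest degree
  have hl (i : ℤ) : ∃ l : PB.X D i ⟶ S.E 1 hx ≫ PB.X C i, deg l = -2 * (r + (α - i).toNat) ∧
      ∀ (a b : ℕ) (z : ℤ) (hb : y = z + 2 * (b : ℤ)) (hc : x = z + 2 * ((b + 1 : ℕ) : ℤ))
        (ha : v = z + 2 * (a : ℤ)) (h₁ : (a : ℤ) = α - i) (h₂ : ((b + 1 : ℕ) : ℤ) = β - i)
        (h₃ : (b : ℤ) = β - 1 - i), ∃ u : S.F b hb ⟶ S.E 1 hx ≫ S.F (b + 1) hc,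
          deg u = -(r + a : ℕ) ∧ (IsNull u → IsNull (𝟙 (S.F b hb))) ∧
          l = (e' i a b z hb ha h₁ h₃).hom ≫ u ▷ S.E a ha ≫ (α_ _ _ _).hom ≫
            S.E 1 hx ◁ (e i a (b + 1) z hc ha h₁ h₂).inv := by
    by_cases hi : i ≤ α ∧ i ≤ β - 1
    · obtain ⟨a, h₁⟩ := Int.eq_ofNat_of_zero_le (sub_nonneg.2 hi.1)
      obtain ⟨b, h₃⟩ := Int.eq_ofNat_of_zero_le (sub_nonneg.2 hi.2)
      have h₂ : ((b + 1 : ℕ) : ℤ) = β - i := by push_cast; omega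
      obtain ⟨z, hb⟩ : ∃ z, y = z + 2 * (b : ℤ) := ⟨y - 2 * b, by ring⟩
      have hc : x = z + 2 * ((b + 1 : ℕ) : ℤ) := by push_cast at *; omega
      have ha : v = z + 2 * (a : ℤ) := by omega
      obtain ⟨u, du, hu⟩ : ∃ u : S.F b hb ⟶ S.E 1 hx ≫ S.F (b + 1) hc, deg u = -(r + a : ℕ) ∧
          (IsNull u → IsNull (𝟙 (S.F b hb))) := by
        by_cases h : IsNull (𝟙 (S.F b hb))
        · obtain ⟨ψ, -, dψ⟩ := exists_isNull (S.F b hb) (S.E 1 hx ≫ S.F (b + 1) hc) (-(r + a : ℕ))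
          exact ⟨ψ, dψ, fun _ => h⟩
        · obtain ⟨ψ, dψ, hψ⟩ := S.exists_lower b (r + a) hx hb hc (hN hb ha h₁.symm h₂) h
          exact ⟨ψ, dψ, fun h => (hψ h).elim⟩
      refine ⟨(e' i a b z hb ha h₁.symm h₃.symm).hom ≫ u ▷ S.E a ha ≫ (α_ _ _ _).hom ≫
        S.E 1 hx ◁ (e i a (b + 1) z hc ha h₁.symm h₂).inv, ?_, ?_⟩
      · simp only [deg_comp, deg_whiskerLeft, deg_whiskerRight, deg_iso_inv, deg_associator_hom,
          he, he', du]
        rw [← hr, show β - 1 - α - y = r + 1 by omega, show (α - i).toNat = a by omega]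
        push_cast
        rw [show α = a + i by omega]; ring
      · intro a' b' z' hb' hc' ha' h₁' h₂' h₃'
        obtain rfl : a' = a := by omega
        obtain rfl : b' = b := by omega
        obtain rfl : z' = z := by omega
        exact ⟨u, du, hu, rfl⟩
    · obtain ⟨l, -, dl⟩ := exists_isNull (PB.X D i) (S.E 1 hx ≫ PB.X C i)
        (-2 * (r + (α - i).toNat))
      exact ⟨l, dl, fun a b z hb hc ha h₁ h₂ h₃ => (hi (by omega)).elim⟩
  choose l dl hl using hl
  have Ψ_d (i : ℤ) : Ψ i ≫ PB.d D i = S.E 1 hx ◁ PB.d C i ≫ Ψ (i + 1) := by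
    have hdeg : deg (Ψ i ≫ PB.d D i) = deg (S.E 1 hx ◁ PB.d C i ≫ Ψ (i + 1)) := by
      simp [dΨ, PB.deg_d]
    by_cases hi : i + 1 ≤ α ∧ i + 1 ≤ β - 1
    · obtain ⟨a, h₁⟩ := Int.eq_ofNat_of_zero_le (sub_nonneg.2 hi.1)
      obtain ⟨b, h₃⟩ := Int.eq_ofNat_of_zero_le (sub_nonneg.2 hi.2)
      obtain ⟨z, hb⟩ : ∃ z, y = z + 2 * (b : ℤ) := ⟨y - 2 * b, by ring⟩
      obtain ⟨z', hz⟩ : ∃ z', z = z' + 2 * ((1 : ℕ) : ℤ) := ⟨z - 2, by simp⟩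
      have ha : v = z + 2 * (a : ℤ) := by omega
      have hc : x = z + 2 * ((b + 1 : ℕ) : ℤ) := by push_cast at *; omega
      have ha' : v = z' + 2 * ((a + 1 : ℕ) : ℤ) := by push_cast at *; omega
      have hb' : y = z' + 2 * ((b + 1 : ℕ) : ℤ) := by push_cast at *; omega
      have hc' : x = z' + 2 * ((b + 1 + 1 : ℕ) : ℤ) := by push_cast at *; omega
      have k₁ : ((b + 1 : ℕ) : ℤ) = β - (i + 1) := by push_cast; omega
      have k₂ : ((a + 1 : ℕ) : ℤ) = α - i := by push_cast; omega
      have k₃ : ((b + 1 + 1 : ℕ) : ℤ) = β - i := by push_cast; omega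
      have k₄ : ((b + 1 : ℕ) : ℤ) = β - 1 - i := by push_cast; omega
      obtain ⟨ψ, dψ, hψ, eψ⟩ := hΨ (i + 1) a b z hb hc ha h₁.symm k₁ h₃.symm
      obtain ⟨ψ', dψ', hψ', eψ'⟩ := hΨ i (a + 1) (b + 1) z' hb' hc' ha' k₂ k₃ k₄
      obtain ⟨δ, hδ, eδ⟩ := hd i a (b + 1) z z' hc' ha' hc ha k₂ k₃ h₁.symm k₁
      obtain ⟨δ', hδ', eδ'⟩ := hd' i a b z z' hb' ha' hb ha k₂ k₄ h₁.symm h₃.symm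
      have key := IsDifferential.lower_comp hx hb hb' hc hc' (hN hb ha h₁.symm k₁) hδ hδ' dψ hψ
        (by rw [dψ']; push_cast; ring) hψ'
      rw [eψ, ← whiskerLeft_comp_assoc, eδ, whiskerLeft_comp_assoc, ← Category.assoc (S.E 1 hx ◁ δ),
        ← Category.assoc (S.E 1 hx ◁ δ ≫ _), Category.assoc (S.E 1 hx ◁ δ), key, eψ']
      simp only [Category.assoc]
      rw [← Iso.inv_comp_eq] at eδ'
      rw [← eδ']
      simp only [Category.assoc, Iso.hom_inv_id, Category.comp_id]
    · by_cases hi' : α < i + 1 ∨ β - 1 < i + 1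
      · have := hD.null (i + 1) hi'
        exact (isNull_of_isNull_id' this _).eq (isNull_of_isNull_id' this _) hdeg
      · omega
  have X_add (m n : ℕ) (i : ℤ) : iter (X.X hx) m ▷ PB.X C i ≫ iter (X.X hx) n ▷ PB.X C i =
      iter (X.X hx) (m + n) ▷ PB.X C i := by rw [iter_add, comp_whiskerRight]
  -- the differential of the lowest summand generates the other summands
  have hp (i : ℤ) : ∃ p : S.E 1 hx ≫ PB.X C (i + 1) ⟶ PB.X D i, deg p = 2 * (r + 1) ∧
      ∀ k, (α - i).toNat = k + 1 → l i ≫ S.E 1 hx ◁ PB.d C i ≫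
        iter (X.X hx) k ▷ PB.X C (i + 1) ≫ p = 𝟙 _ := by
    by_cases hi : i + 1 ≤ α
    swap
    · obtain ⟨p, -, dp⟩ := exists_isNull (S.E 1 hx ≫ PB.X C (i + 1)) (PB.X D i) (2 * (r + 1))
      exact ⟨p, dp, fun k hk => (hi (by omega)).elim⟩
    by_cases hi' : i + 1 ≤ β
    swap
    · obtain ⟨p, -, dp⟩ := exists_isNull (S.E 1 hx ≫ PB.X C (i + 1)) (PB.X D i) (2 * (r + 1))
      refine ⟨p, dp, fun k hk => ?_⟩
      have := hD.null i (by omega)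
      refine (isNull_of_isNull_id this _).eq this ?_
      simp only [deg_comp, dl, deg_whiskerLeft, PB.deg_d, deg_whiskerRight, deg_iter, X.deg_X, dp,
        hk, deg_id]
      push_cast; ring
    obtain ⟨a, h₁⟩ := Int.eq_ofNat_of_zero_le (sub_nonneg.2 hi)
    obtain ⟨b, h₂⟩ := Int.eq_ofNat_of_zero_le (sub_nonneg.2 hi')
    obtain ⟨z, hb⟩ : ∃ z, y = z + 2 * (b : ℤ) := ⟨y - 2 * b, by ring⟩
    obtain ⟨z', hz⟩ : ∃ z', z' = z + 2 * ((1 : ℕ) : ℤ) := ⟨z + 2, by simp⟩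
    have ha : v = z' + 2 * (a : ℤ) := by omega
    have hc : x = z + 2 * ((b + 1 : ℕ) : ℤ) := by push_cast at *; omega
    have hc' : x = z' + 2 * (b : ℤ) := by push_cast at *; omega
    have ha' : v = z + 2 * ((a + 1 : ℕ) : ℤ) := by push_cast at *; omega
    have k₂ : ((a + 1 : ℕ) : ℤ) = α - i := by push_cast; omega
    have k₃ : ((b + 1 : ℕ) : ℤ) = β - i := by push_cast; omega
    have k₄ : (b : ℤ) = β - 1 - i := by omega
    obtain ⟨u, du, hu, eu⟩ := hl i (a + 1) b z hb hc ha' k₂ k₃ k₄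
    obtain ⟨δ, hδ, eδ⟩ := hd i a b z' z hc ha' hc' ha k₂ k₃ h₁.symm h₂.symm
    have hw := fun h => IsDifferential.upper_comp (hd := hz) hx hb hc (hN hb ha' k₂ k₃) hδ du hu h
    obtain ⟨p, dp, hp⟩ := X.exists_upper_retraction a b hx hc' ha hb ha' (by omega)
      (by simp [du, hδ.deg_eq]; omega) hw
    refine ⟨S.E 1 hx ◁ (e (i + 1) a b z' hc' ha h₁.symm h₂.symm).hom ≫ p ≫
      (e' i (a + 1) b z hb ha' k₂ k₄).inv, ?_, ?_⟩
    · simp only [deg_comp, deg_whiskerLeft, deg_iso_inv, he, he', dp]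
      rw [← hr, show β - 1 - α - y = r + 1 by omega, show α = a + i + 1 by omega]
      push_cast; ring
    · intro k hk
      obtain rfl : k = a := by omega
      rw [← Iso.inv_comp_eq] at eδ
      have h₅ := congrArg (S.E 1 hx ◁ ·) eδ
      simp only [whiskerLeft_comp] at h₅
      rw [eu, ← whisker_exchange_assoc]
      simp only [Category.assoc] at hp ⊢
      rw [reassoc_of% h₅, reassoc_of% hp, Iso.hom_inv_id]
  choose p dp hp using hp
  have hr' : 0 ≤ β - 1 - α - y := by omega
  have hv' : v = y + 2 * (α - (β - 1)) := by push_cast at hx; omega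
  have hlX (i : ℤ) : l i ≫ iter (X.X hx) (r + (α - i).toNat) ▷ PB.X C i ≫ Ψ i = 𝟙 _ := by
    have hdeg : deg (l i ≫ iter (X.X hx) (r + (α - i).toNat) ▷ PB.X C i ≫ Ψ i) = 0 := by
      simp [dl, dΨ]; ring
    by_cases hi : i ≤ α ∧ i ≤ β - 1
    · obtain ⟨a, h₁⟩ := Int.eq_ofNat_of_zero_le (sub_nonneg.2 hi.1)
      obtain ⟨b, h₃⟩ := Int.eq_ofNat_of_zero_le (sub_nonneg.2 hi.2)
      have h₂ : ((b + 1 : ℕ) : ℤ) = β - i := by push_cast; omega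
      obtain ⟨z, hb⟩ : ∃ z, y = z + 2 * (b : ℤ) := ⟨y - 2 * b, by ring⟩
      have hc : x = z + 2 * ((b + 1 : ℕ) : ℤ) := by push_cast at *; omega
      have ha : v = z + 2 * (a : ℤ) := by omega
      obtain ⟨ψ, dψ, hψ, eψ⟩ := hΨ i a b z hb hc ha h₁.symm h₂ h₃.symm
      obtain ⟨u, du, hu, eu⟩ := hl i a b z hb hc ha h₁.symm h₂ h₃.symm
      have hX := X.lower_iter_lower' b (r + a) hx hb hc (hN hb ha h₁.symm h₂) du hu dψ hψ
      rw [show (α - i).toNat = a by omega, eψ, eu]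
      simp only [Category.assoc]
      rw [← whisker_exchange_assoc, ← whiskerLeft_comp_assoc, Iso.inv_hom_id, whiskerLeft_id,
        Category.id_comp, associator_inv_naturality_left_assoc, Iso.hom_inv_id_assoc,
        ← comp_whiskerRight_assoc, ← comp_whiskerRight_assoc, Category.assoc, hX, id_whiskerRight,
        Category.id_comp, Iso.hom_inv_id]
    · have := hD.null i (by omega)
      exact PB.IsNull.eq (isNull_of_isNull_id this _) this hdeg
  obtain ⟨Φ, hΦ, hΦ'⟩ := exists_isIso_toHtpy_biproduct (K := compBefore C (S.E 1 hx).obj) (D := D)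
    (r := r) (fun i => (α - i).toNat) (fun i => by
      by_cases hi : i + 1 ≤ α
      · exact Or.inl (by omega)
      · exact Or.inr (hD.null (i + 1) (by omega)))
    (fun n i => iter (X.X hx) n ▷ PB.X C i)
    (fun n i => (deg_whiskerRight _ _).trans ((deg_iter _ _).trans (by rw [X.deg_X]; ring))) X_add
    (fun n i => (congrArg (iter (X.X hx) n ▷ PB.X C i ≫ ·) (d_compBefore C (S.E 1 hx) i)).trans
      ((whisker_exchange _ _).symm.trans
      (congrArg (· ≫ iter (X.X hx) n ▷ PB.X C (i + 1)) (d_compBefore C (S.E 1 hx) i)).symm)) Ψ dΨ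
    (fun i => (Ψ_d i).trans (congrArg (· ≫ Ψ (i + 1)) (d_compBefore C (S.E 1 hx) i)).symm) l dl p dp
    hlX
    (fun i k hk => (congrArg (l i ≫ ·) (congrArg (· ≫ iter (X.X hx) k ▷ PB.X C (i + 1) ≫ p i)
      (d_compBefore C (S.E 1 hx) i))).trans (hp i k hk))
    (fun i => (hD.low hr' hv' i i).1.mono (by simp))
    (fun i => (hD.low hr' hv' i (i + 1)).1.mono (by simp))
    (fun i => (hD.low hr' hv' (i + 1) i).1.mono (by ring_nf; simp))
    (fun i T m => hC.hdim_E_comp X hx hv hr hD i T m)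
  exact ⟨Φ, Ψ, dΨ, Ψ_d, hΦ, hΦ'⟩

end Step

end Sl2Data

/-! ### Summands of a complex in the homotopy category -/

section AntiTriangular

/-- An isomorphism between two direct sums whose matrix vanishes above the antidiagonal has a split
monomorphism and a split epimorphism in the corners of the antidiagonal. -/
lemma isSplitMono_isSplitEpi_of_antitriangular {H : Type u} [Category.{v} H] [Preadditive H] {q : ℕ}
    {M L : H} {A D : Fin (q + 1) → H} (J : ∀ i, A i ⟶ M) (P : ∀ i, M ⟶ A i) (hJ : J 0 ≫ P 0 = 𝟙 _)
    (hP : ∑ i, P i ≫ J i = 𝟙 M) (ι : ∀ t, D t ⟶ L) (π : ∀ t, L ⟶ D t) (hι : ι 0 ≫ π 0 = 𝟙 _)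
    (hπ : ∑ t, π t ≫ ι t = 𝟙 L) (Φ : M ⟶ L) [IsIso Φ]
    (h₀ : ∀ i t : Fin (q + 1), (i : ℕ) + t < q → J i ≫ Φ ≫ π t = 0) :
    IsSplitMono (J 0 ≫ Φ ≫ π (Fin.last q)) ∧ IsSplitEpi (J (Fin.last q) ≫ Φ ≫ π 0) := by
  have h₁ : (J 0 ≫ Φ ≫ π (Fin.last q)) ≫ ι (Fin.last q) = J 0 ≫ Φ := by
    have := congrArg (fun φ => (J 0 ≫ Φ) ≫ φ) hπ
    simp only [Preadditive.comp_sum, Category.comp_id] at this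
    rw [← this, Finset.sum_eq_single (Fin.last q) (fun t _ ht => ?_) (by simp)]
    · simp
    · have := h₀ 0 t (by have := Fin.val_lt_last ht; simpa using this)
      simp only [Category.assoc]
      rw [reassoc_of% this, zero_comp]
  have h₂ : (ι 0 ≫ inv Φ ≫ P (Fin.last q)) ≫ J (Fin.last q) ≫ Φ ≫ π 0 = 𝟙 _ := by
    have := congrArg (fun φ => (ι 0 ≫ inv Φ) ≫ φ ≫ Φ ≫ π 0) hP
    simp only [Preadditive.sum_comp, Preadditive.comp_sum] at this
    rw [Finset.sum_eq_single (Fin.last q) (fun t _ ht => ?_) (by simp)] at this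
    · simpa [hι] using this
    · have := h₀ t 0 (by have := Fin.val_lt_last ht; simpa using this)
      simp [this]
  exact ⟨⟨⟨⟨ι (Fin.last q) ≫ inv Φ ≫ P 0, by
    rw [← Category.assoc, h₁]; simp [hJ]⟩⟩⟩, ⟨⟨⟨_, h₂⟩⟩⟩⟩

variable {C : Type u} [Category.{v} C] [Preadditive C] [Linear ℂ C] [HasShift C ℤ]
  [∀ n : ℤ, (shiftFunctor C n).Additive] [∀ n : ℤ, (shiftFunctor C n).Linear ℂ]

open ShiftedHom ProjObj

/-- A decomposition, with the summands replaced by their shifts. -/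
lemma Decomp.exists_shift {M : C} {ι : Type} [Fintype ι] {Z : ι → C} {d : ι → ℤ}
    (A : Decomp (toProj M) (fun i => toProj (Z i)) d) :
    ∃ (j : ∀ i, (Z i)⟦d i⟧ ⟶ M) (p : ∀ i, M ⟶ (Z i)⟦d i⟧),
      (∀ i, pcl₀ (j i) = (shiftPIso (Z i) (d i)).hom ≫ A.j i) ∧ (∀ i, j i ≫ p i = 𝟙 _) ∧
      ∑ i, p i ≫ j i = 𝟙 M := by
  let j (i : ι) : (Z i)⟦d i⟧ ⟶ M :=
    (homEquiv (0 : ℤ) rfl).symm ((ofShift (Z i) (d i)).comp (A.inj i) (neg_add_cancel (d i)))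
  have hj (i : ι) : mk₀ (0 : ℤ) rfl (j i) =
      (ofShift (Z i) (d i)).comp (A.inj i) (neg_add_cancel (d i)) :=
    (homEquiv (0 : ℤ) rfl).apply_symm_apply _
  let p (i : ι) : M ⟶ (Z i)⟦d i⟧ := A.proj i
  have hp (i : ι) : (mk₀ 0 rfl (p i)).comp (ofShift (Z i) (d i)) (add_zero (d i)) = A.proj i :=
    mk₀_comp_ofShift _
  refine ⟨j, p, fun i => ?_, fun i => ?_, ?_⟩
  · rw [pcl₀, hj, shiftPIso_hom]
    exact pcl_comp (ofShift (Z i) (d i)) (A.inj i) (neg_add_cancel (d i))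
  · have h₁ : (mk₀ 0 rfl (j i ≫ p i)).comp (ofShift (Z i) (d i)) (add_zero (d i)) =
        ofShift (Z i) (d i) := by
      rw [← mk₀_comp_mk₀ _ _ (add_zero 0) rfl rfl, hj,
        comp_assoc _ _ _ (show 0 + 0 = (0 : ℤ) from rfl) (add_zero (d i)) (by omega), hp,
        comp_assoc _ _ _ (neg_add_cancel (d i)) (add_neg_cancel (d i)) (by omega),
        A.inj_proj_self, comp_mk₀_id]
    exact (mk₀_comp_ofShift (j i ≫ p i)).symm.trans h₁
  · have := A.sum_proj_inj
    refine mk₀_injective (m₀ := (0 : ℤ)) (hm₀ := rfl) (Eq.trans ?_ this)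
    refine (map_sum (AddMonoidHom.mk' (fun f : M ⟶ M => mk₀ (0 : ℤ) rfl f)
      fun _ _ => mk₀_add _ _ _ _) _ _).trans (Finset.sum_congr rfl fun i _ => ?_)
    simp only [AddMonoidHom.mk'_apply]
    rw [← mk₀_comp_mk₀ _ _ (add_zero 0) rfl rfl, hj,
      ← comp_assoc _ _ _ (add_zero (d i)) (neg_add_cancel (d i)) (by omega), hp]

end AntiTriangular

section CompBefore

open Bicategory

variable {B : Type u} [Bicategory.{w, v} B] [GradedLinearBicategory B] {a b c : B}

/-- The morphism `C ∘ τ` of complexes. -/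
noncomputable def compBeforeMap (C : CochainComplex (b ⟶ c) ℤ) {f f' : a ⟶ b} (τ : f ⟶ f') :
    compBefore C f ⟶ compBefore C f' where
  f i := τ ▷ C.X i
  comm' i j _ := (whisker_exchange τ (C.d i j)).symm

/-- The associativity of the composition of a complex with 1-morphisms. -/
noncomputable def compBeforeAssoc (C : CochainComplex (b ⟶ c) ℤ) {d : B} (g : d ⟶ a) (f : a ⟶ b) :
    compBefore C (g ≫ f) ≅ compBefore (compBefore C f) g :=
  HomologicalComplex.Hom.isoOfComponents (fun i => α_ g f (C.X i)) fun i j _ => by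
    exact (associator_naturality_right g f (C.d i j)).symm

lemma compBeforeMap_id (C : CochainComplex (b ⟶ c) ℤ) (f : a ⟶ b) :
    compBeforeMap C (𝟙 f) = 𝟙 _ := by
  ext i; exact id_whiskerRight f (C.X i)

lemma compBeforeMap_comp (C : CochainComplex (b ⟶ c) ℤ) {f g h : a ⟶ b} (τ : f ⟶ g) (σ : g ⟶ h) :
    compBeforeMap C (τ ≫ σ) = compBeforeMap C τ ≫ compBeforeMap C σ := by
  ext i; exact comp_whiskerRight τ σ (C.X i)

lemma compBeforeMap_sum (C : CochainComplex (b ⟶ c) ℤ) {f g : a ⟶ b} {ι : Type} (s : Finset ι)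
    (τ : ι → (f ⟶ g)) : compBeforeMap C (∑ i ∈ s, τ i) = ∑ i ∈ s, compBeforeMap C (τ i) :=
  map_sum (AddMonoidHom.mk' (fun τ : f ⟶ g => compBeforeMap C τ) fun τ σ => by
    ext i; exact AdditiveLinearBicategory.add_whiskerRight τ σ (C.X i)) τ s

end CompBefore

/-! ### Composition of a Rickard complex with divided powers -/

namespace Sl2Data

open PB Bicategory
open ProjObj (Low VanishBelow Retract)

variable {B : Type u} [Bicategory.{w, v} B] [GradedLinearBicategory B] {S : Sl2Data B}

/-- The powers of the dot span the inclusions of the summands `E^(q+1)` into `E^(q) E`. -/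
lemma Dot.exists_decomp_iter (X : S.Dot) (q : ℕ) {k l m : ℤ} (h : l = k + 2 * ((1 : ℕ) : ℤ))
    (h' : m = l + 2 * (q : ℤ)) (h'' : m = k + 2 * ((q + 1 : ℕ) : ℤ)) :
    ∃ (A : QDecomp (S.E 1 h ≫ S.E q h') (q + 1) (S.E (q + 1) h''))
      (j : S.E (q + 1) h'' ⟶ S.E 1 h ≫ S.E q h'), deg j = -q ∧
      ∀ i, A.j i = j ≫ iter (X.X h) i ▷ S.E q h' := by
  have := fun X Y : (S.wt k).as ⟶ (S.wt m).as => S.finite_dimensional X Y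
  obtain ⟨D⟩ := S.E_pow_E q h h' h''
  let j : S.E (q + 1) h'' ⟶ S.E 1 h ≫ S.E q h' := D.j 0
  have hj : deg j = -q := (deg_fac_j _ _).trans (by push_cast; simp)
  let p : S.E 1 h ≫ S.E q h' ⟶ S.E (q + 1) h'' := D.p (Fin.last q)
  have hp : deg p = -q := (deg_fac_p _ _).trans (by simp only [Fin.val_last]; push_cast; ring)
  obtain ⟨u, hu, hu'⟩ := exists_free_of_triangular (M := S.E 1 h ≫ S.E q h')
    (Z := fun _ : Fin (q + 1) => S.E (q + 1) h'')
    (d := fun i => ((q + 1 : ℕ) : ℤ) - 1 - 2 * ((i : ℕ) : ℤ))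
    (fun i => j ≫ iter (X.X h) i ▷ S.E q h')
    (fun i => (deg_comp _ _).trans (by simp [hj]; ring))
    (fun i => iter (X.X h) (q - i) ▷ S.E q h' ≫ p) (fun i => (i : ℕ))
    (fun i => by
      have := X.j_iter_p q h h' h'' D
      show (j ≫ iter (X.X h) i ▷ S.E q h') ≫ iter (X.X h) (q - i) ▷ S.E q h' ≫ p = 𝟙 _
      rw [Category.assoc, ← comp_whiskerRight_assoc, ← PB.iter_add,
        Nat.add_sub_cancel' (Nat.lt_succ_iff.1 i.2)]
      exact this)
    (fun i i' hi hr => by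
      have : (i' : ℕ) ≠ i := fun h => hi (Fin.ext h)
      have := i.2
      refine isNull_of_low (S.low_E (q + 1) h'')
        (φ := (j ≫ iter (X.X h) i' ▷ S.E q h') ≫ iter (X.X h) (q - i) ▷ S.E q h' ≫ p) ?_
      simp [hj, hp]
      omega)
  obtain ⟨A, hA⟩ := hu'.exists_decomp fun T n => D.hdim_eq T n
  refine ⟨A, j, hj, fun i => ?_⟩
  rw [hu i, ← hA]; rfl

/-- The morphisms from `E^(a) F^(b) E^(q)` to `E^(a) F^(b-q)` of lowest degree are unique. -/
lemma low_E_FE_FE {a d q : ℕ} {x y z v : ℤ} (hq : x = y + 2 * (q : ℤ))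
    (hb : x = z + 2 * ((q + d : ℕ) : ℤ)) (ha : v = z + 2 * (a : ℤ)) (hd : y = z + 2 * (d : ℤ))
    (hx : x = (q + d : ℕ) - a) :
    Low (S.E q hq ≫ S.F (q + d) hb ≫ S.E a ha) (S.F d hd ≫ S.E a ha) (-(a * q)) := by
  obtain ⟨adj, hadj⟩ := S.adj_left a ha
  obtain ⟨adj', hadj'⟩ := S.adj_left q hq
  have L := S.low_FE_FE (a := a) (b := q + d) (c := a) (d := q + d) (by omega) hb ha hb ha
    (by omega) rfl
  have L₁ := low_adj₂ adj L (N := (q + d : ℕ) - (q + d : ℕ) - deg adj.unit) (by push_cast; ring)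
  have L₂ : Low ((S.F (q + d) hb ≫ S.E a ha) ≫ S.F a ha) (S.F q hq ≫ S.F d hd)
      (-deg adj.unit - q * d) := by
    obtain ⟨x, rfl⟩ : ∃ x', x = -x' := ⟨-x, by simp⟩
    obtain ⟨y, rfl⟩ : ∃ y', y = -y' := ⟨-y, by simp⟩
    obtain ⟨z, rfl⟩ : ∃ z', z = -z' := ⟨-z, by simp⟩
    refine S.chev.low_right_E_E q d (x := x) (y := y) (z := z) (by omega) (by omega) (by omega)
      ((S.F (q + d) hb ≫ S.E a ha) ≫ S.F a ha) _ (L₁.mono (by simp))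
  have L₃ := low_congr_right (α_ _ _ _) rfl (low_adj₂' adj L₂ rfl)
  refine low_adj₁ adj' L₃ ?_
  rw [hadj']
  push_cast at *
  rw [show y = d - q - a by omega]
  ring

section Unique

variable {x v α β κ : ℤ} {C C' : CochainComplex ((S.wt x).as ⟶ (S.wt v).as) ℤ}

lemma IsRickard.shift (k : ℤ) (hC : S.IsRickard C α β κ) :
    S.IsRickard (intShift k C) α β (κ + k) where
  null i h := by
    let e : PB.X (intShift k C) i ≅ PB.X C i := intShiftPIso C k i
    have := ((hC.null i h).comp_left e.hom).comp e.inv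
    simpa using this
  exists_iso := by
    obtain ⟨e, he, hd⟩ := hC.exists_iso
    refine ⟨fun i a b z hb ha h h' => intShiftPIso C k i ≪≫ e i a b z hb ha h h',
      fun i a b z hb ha h h' => ?_, fun i a b z z' hb' ha' hb ha h₁ h₁' h₂ h₂' => ?_⟩
    · refine (deg_comp _ _).trans ((congrArg₂ (· + ·) rfl (he i a b z hb ha h h')).trans ?_)
      show k + _ = _
      ring
    · obtain ⟨δ, hδ, h⟩ := hd i a b z z' hb' ha' hb ha h₁ h₁' h₂ h₂'
      refine ⟨δ, hδ, ?_⟩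
      have h₃ := intShiftPIso_d C k i (i + 1)
      refine Eq.trans (Category.assoc _ _ _).symm ?_
      refine (congrArg (· ≫ (e (i + 1) a b z hb ha h₂ h₂').hom) h₃.symm).trans ?_
      refine (Category.assoc _ _ _).trans ((congrArg _ h).trans (Category.assoc _ _ _).symm)

/-- Rickard complexes are unique up to scalars. -/
lemma IsRickard.exists_iso_of_isRickard (hv : v = x + 2 * (α - β)) (hC : S.IsRickard C α β κ)
    (hC' : S.IsRickard C' α β κ) :
    ∃ e : ∀ i, PB.X C i ≅ PB.X C' i, (∀ i, deg (e i).hom = 0) ∧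
      ∀ i, (e i).hom ≫ PB.d C' i = PB.d C i ≫ (e (i + 1)).hom := by
  obtain ⟨e, he, hd⟩ := hC.exists_iso
  obtain ⟨e', he', hd'⟩ := hC'.exists_iso
  have key (i : ℤ) : ∃ φ : PB.X C i ≅ PB.X C' i, deg φ.hom = 0 ∧
      ∀ (a b : ℕ) (z : ℤ) (hb : x = z + 2 * (b : ℤ)) (ha : v = z + 2 * (a : ℤ))
        (h : (a : ℤ) = α - i) (h' : (b : ℤ) = β - i),
        φ.hom = (e i a b z hb ha h h').hom ≫ (e' i a b z hb ha h h').inv := by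
    by_cases hi : α < i ∨ β < i
    · obtain ⟨φ, hφ, dφ⟩ := exists_isNull (PB.X C i) (PB.X C' i) 0
      obtain ⟨ψ, hψ, dψ⟩ := exists_isNull (PB.X C' i) (PB.X C i) 0
      refine ⟨⟨φ, ψ, (hφ.comp ψ).eq (hC.null i hi) (by simp [dφ, dψ]),
        (hψ.comp φ).eq (hC'.null i hi) (by simp [dφ, dψ])⟩, dφ, fun a b z hb ha h h' => by omega⟩
    · obtain ⟨a, h⟩ := Int.eq_ofNat_of_zero_le (show 0 ≤ α - i by omega)
      obtain ⟨b, h'⟩ := Int.eq_ofNat_of_zero_le (show 0 ≤ β - i by omega)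
      refine ⟨e i a b (x - 2 * b) (by omega) (by omega) h.symm h'.symm ≪≫
        (e' i a b (x - 2 * b) (by omega) (by omega) h.symm h'.symm).symm, by simp [he, he'], ?_⟩
      intro a' b' z' hb ha h₁ h₁'
      obtain rfl : a' = a := by omega
      obtain rfl : b' = b := by omega
      obtain rfl : z' = x - 2 * b' := by omega
      rfl
  choose φ dφ hφ using key
  refine ⟨φ, dφ, fun i => ?_⟩
  by_cases hi : α < i + 1 ∨ β < i + 1
  · have := hC'.null _ hi
    exact (isNull_of_isNull_id' this _).eq (isNull_of_isNull_id' this _) (by simp [dφ, deg_d])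
  obtain ⟨a, h⟩ := Int.eq_ofNat_of_zero_le (show 0 ≤ α - (i + 1) by omega)
  obtain ⟨b, h'⟩ := Int.eq_ofNat_of_zero_le (show 0 ≤ β - (i + 1) by omega)
  obtain ⟨z, hb⟩ : ∃ z, x = z + 2 * (b : ℤ) := ⟨x - 2 * b, by ring⟩
  have h₁ : x = z - 2 + 2 * ((b + 1 : ℕ) : ℤ) := by push_cast; omega
  have h₂ : v = z - 2 + 2 * ((a + 1 : ℕ) : ℤ) := by push_cast; omega
  have h₃ : ((a + 1 : ℕ) : ℤ) = α - i := by push_cast; omega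
  have h₄ : ((b + 1 : ℕ) : ℤ) = β - i := by push_cast; omega
  obtain ⟨δ, hδ, eδ⟩ := hd i a b z _ h₁ h₂ hb (by omega) h₃ h₄ h.symm h'.symm
  obtain ⟨δ', hδ', eδ'⟩ := hd' i a b z _ h₁ h₂ hb (by omega) h₃ h₄ h.symm h'.symm
  rw [hφ i _ _ _ h₁ h₂ h₃ h₄, hφ (i + 1) a b z hb (by omega) h.symm h'.symm, reassoc_of% eδ,
    hδ.eq hδ', Category.assoc]
  congr 1
  rw [Iso.inv_comp_eq, ← reassoc_of% eδ', Iso.hom_inv_id, Category.comp_id]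

end Unique

section DividedPowers

variable {v α β κ : ℤ}

/-- The composition of a Rickard complex of the middle weight with `E^(p)` is a Rickard complex. -/
theorem IsRickard.exists_isIso_E_pow (X : S.Dot) {x : ℤ} (hv : v = x + 2 * (α - β))
    (hx : x = β - α) {C : CochainComplex ((S.wt x).as ⟶ (S.wt v).as) ℤ} (hC : S.IsRickard C α β κ)
    (p : ℕ) (hex : ∀ q ≤ p, ∀ y, x = y + 2 * (q : ℤ) →
      ∃ (D : CochainComplex ((S.wt y).as ⟶ (S.wt v).as) ℤ) (κ' : ℤ), S.IsRickard D α (β - q) κ')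
    {y : ℤ} (h : x = y + 2 * (p : ℤ)) {D : CochainComplex ((S.wt y).as ⟶ (S.wt v).as) ℤ}
    (hD : S.IsRickard D α (β - p) (κ - α * p)) :
    ∃ g : compBefore C (S.E p h).obj ⟶ D, IsIso ((toHtpy _).map g) := by
  induction p generalizing y with
  | zero =>
    obtain rfl : x = y := by simpa using h
    simp only [Nat.cast_zero, sub_zero, mul_zero] at hD
    obtain ⟨e, he, hd⟩ := hC.exists_iso_of_isRickard hv hD
    obtain ⟨ε₀, hε⟩ := S.E_zero h
    obtain ⟨φ, -⟩ := exists_iso_of_class (K := compBefore C (S.E 0 h).obj) (L := D)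
      (fun i => whiskerRightIso ε₀ (PB.X C i) ≪≫ λ_ (PB.X C i) ≪≫ e i)
      (fun i => (by simp [hε, he] :
        deg (ε₀.hom ▷ PB.X C i ≫ (λ_ (PB.X C i)).hom ≫ (e i).hom) = 0))
      fun i => by
        refine Eq.trans ?_ (congrArg (· ≫ ε₀.hom ▷ PB.X C (i + 1) ≫ (λ_ (PB.X C (i + 1))).hom ≫
          (e (i + 1)).hom) (d_compBefore C (S.E 0 h) i)).symm
        show (ε₀.hom ▷ PB.X C i ≫ (λ_ (PB.X C i)).hom ≫ (e i).hom) ≫ PB.d D i =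
          S.E 0 h ◁ PB.d C i ≫ ε₀.hom ▷ PB.X C (i + 1) ≫ (λ_ (PB.X C (i + 1))).hom ≫
          (e (i + 1)).hom
        simp only [Category.assoc, hd]
        rw [whisker_exchange_assoc]
        simp
    exact ⟨φ.hom, inferInstance⟩
  | succ p ih =>
    obtain ⟨y', hy'⟩ : ∃ y', x = y' + 2 * (p : ℤ) := ⟨x - 2 * p, by ring⟩
    have h₁ : y' = y + 2 * ((1 : ℕ) : ℤ) := by push_cast at *; omega
    obtain ⟨C', κ', hC'⟩ := hex p (by omega) y' hy'
    replace hC' := hC'.shift (κ - α * p - κ')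
    rw [add_sub_cancel] at hC'
    generalize intShift (κ - α * p - κ') C' = C'' at hC'
    obtain ⟨f, hf⟩ := ih (fun q hq => hex q (by omega)) hy' hC'
    let D' := intShift (-(p : ℤ)) D
    have hD' : S.IsRickard D' α (β - p - 1) (κ - α * p - p - α) := by
      have := hD.shift (-(p : ℤ))
      push_cast at this
      rw [show β - p - 1 = β - (p + 1) by ring,
        show κ - α * p - p - α = κ - α * (p + 1) + -p by ring]
      exact this
    obtain ⟨Φ, Ψ, dΨ, Ψ_d, hΦ, hΦ'⟩ := hC'.exists_isIso X h₁ (by omega) (r := p)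
      (by push_cast at h₁; omega) hD'
    obtain ⟨A, j, dj, hA⟩ := X.exists_decomp_iter p h₁ hy' h
    obtain ⟨J, P, hJ, hJP, hPJ⟩ := Decomp.exists_shift (M := (S.E 1 h₁).obj ≫ (S.E p hy').obj)
      (Z := fun _ => (S.E (p + 1) h).obj) A
    let fcl (n : ℤ) : S.E p hy' ≫ PB.X C n ⟶ PB.X C'' n := pcl₀ (f.f n)
    let m (s : ℕ) (n : ℤ) : S.E (p + 1) h ≫ PB.X C n ⟶ PB.X D' n :=
      (j ≫ iter (X.X h₁) s ▷ S.E p hy') ▷ PB.X C n ≫ (α_ _ _ _).hom ≫ S.E 1 h₁ ◁ fcl n ≫ Ψ n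
    have dfcl (n : ℤ) : deg (fcl n) = 0 := rfl
    have dm (s : ℕ) (n : ℤ) : deg (m s n) = -p + 2 * s := by simp [m, dj, dΨ, dfcl]; ring
    let M := compBefore (compBefore C (S.E p hy').obj) (S.E 1 h₁).obj
    let F := (Bicategory.precomp (S.wt v).as (S.E 1 h₁).obj)
    let f' : M ⟶ compBefore C'' (S.E 1 h₁).obj := (F.mapHomologicalComplex _).map f
    have hf' : IsIso ((toHtpy _).map f') := by
      have : IsIso ((F.mapHomotopyCategory (ComplexShape.up ℤ)).map ((toHtpy _).map f)) :=
        inferInstance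
      exact this
    let G (i : Fin (p + 1)) : (S.wt y).as ⟶ (S.wt x).as :=
      (S.E (p + 1) h).obj⟦((p + 1 : ℕ) : ℤ) - 1 - 2 * ((i : ℕ) : ℤ)⟧
    let Js (i : Fin (p + 1)) : compBefore C (G i) ⟶ M :=
      compBeforeMap C (J i) ≫ (compBeforeAssoc C _ _).hom
    let Ps (i : Fin (p + 1)) : M ⟶ compBefore C (G i) :=
      (compBeforeAssoc C _ _).inv ≫ compBeforeMap C (P i)
    let σ (i : Fin (p + 1)) : toPB (G i) ≅ S.E (p + 1) h := shiftPIso (S.E (p + 1) h).obj _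
    let D₂ (t : Fin (p + 1)) := intShift (2 * ((t : ℕ) : ℤ)) D'
    let τ (t : Fin (p + 1)) (n : ℤ) : PB.X (D₂ t) n ≅ PB.X D' n :=
      intShiftPIso D' (2 * ((t : ℕ) : ℤ)) n
    let ω (n : ℤ) : PB.X D' n ≅ PB.X D n := intShiftPIso D (-(p : ℤ)) n
    let φ (t : Fin (p + 1)) (n : ℤ) : S.E 1 h₁ ≫ PB.X C'' n ⟶ PB.X (D₂ t) n :=
      pcl₀ ((Φ ≫ biproduct.π D₂ t).f n)
    let J' (i : Fin (p + 1)) : toPB (G i) ⟶ S.E 1 h₁ ≫ S.E p hy' := pcl₀ (J i)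
    let Θ (i t : Fin (p + 1)) : compBefore C (G i) ⟶ D₂ t := Js i ≫ (f' ≫ Φ) ≫ biproduct.π D₂ t
    let Θ' (i t : Fin (p + 1)) (n : ℤ) : toPB (G i) ≫ PB.X C n ⟶ PB.X (D₂ t) n := pcl₀ ((Θ i t).f n)
    have key (i t : Fin (p + 1)) (n : ℤ) :
        Θ' i t n ≫ (τ t n).hom = (σ i).hom ▷ PB.X C n ≫ m (i + t) n := by
      have e₁ : Θ' i t n = J' i ▷ PB.X C n ≫ (α_ _ _ _).hom ≫ S.E 1 h₁ ◁ fcl n ≫ φ t n := by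
        refine (congrArg pcl₀ (show (Js i ≫ (f' ≫ Φ) ≫ biproduct.π D₂ t).f n =
          J i ▷ C.X n ≫ (α_ _ _ _).hom ≫ (S.E 1 h₁).obj ◁ f.f n ≫
            (Φ ≫ biproduct.π D₂ t).f n by simp [Js]; rfl)).trans ?_
        exact (pcl₀_comp _ _).trans (congrArg₂ (· ≫ ·) (pcl₀_whiskerRight _ _)
          ((pcl₀_comp _ _).trans (congrArg₂ (· ≫ ·) rfl ((pcl₀_comp _ _).trans
            (congrArg₂ (· ≫ ·) (pcl₀_whiskerLeft _ _) rfl)))))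
      have e₂ : J' i = (σ i).hom ≫ j ≫ iter (X.X h₁) i ▷ S.E p hy' :=
        (hJ i).trans (congrArg _ (hA i))
      have e₃ : φ t n ≫ (τ t n).hom = iter (X.X h₁) t ▷ PB.X C'' n ≫ Ψ n := hΦ' t n
      rw [e₁, e₂]
      simp only [Category.assoc, e₃, m, PB.iter_add, comp_whiskerRight]
      rw [whisker_exchange_assoc]
      simp
    -- the entries above the antidiagonal vanish for degree reasons
    have hnull (n : ℤ) : VanishBelow (S.E (p + 1) h ≫ PB.X C n) (PB.X D' n) p := by
      by_cases hn : α < n ∨ β < n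
      · exact VanishBelow.of_isNull_left (isNull_id_comp_right _ (hC.null n hn))
      by_cases hn' : β - p - 1 < n
      · exact (Low.of_isNull_right (hD'.null n (Or.inr hn'))).1
      obtain ⟨e, he, -⟩ := hC.exists_iso
      obtain ⟨e', he', -⟩ := hD'.exists_iso
      obtain ⟨a, ha⟩ := Int.eq_ofNat_of_zero_le (show 0 ≤ α - n by omega)
      obtain ⟨d, hd⟩ := Int.eq_ofNat_of_zero_le (show 0 ≤ β - p - 1 - n by omega)
      have hb : x = y - 2 * d + 2 * ((p + 1 + d : ℕ) : ℤ) := by push_cast at *; omega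
      have ha' : v = y - 2 * d + 2 * (a : ℤ) := by push_cast at *; omega
      have hd' : y = y - 2 * d + 2 * (d : ℤ) := by ring
      have hb' : ((p + 1 + d : ℕ) : ℤ) = β - n := by push_cast; omega
      have q₁ := he n a (p + 1 + d) _ hb ha' ha.symm hb'
      have q₂ := he' n a d _ hd' ha' ha.symm hd.symm
      refine VanishBelow.of_iso (whiskerLeftIso (S.E (p + 1) h) (e n a (p + 1 + d) _ hb ha' ha.symm hb'))
        (e' n a d _ hd' ha' ha.symm hd.symm) (low_E_FE_FE h hb ha' hd' (by omega)).1 ?_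
      refine Eq.trans ?_ (congrArg₂ (fun s t => (p : ℤ) + s - t) q₂.symm
        ((deg_whiskerLeft _ _).trans q₁).symm)
      push_cast at *
      rw [show β = x + α by omega, show y = x - 2 * (p + 1) by omega, ← ha]
      ring
    have hzero (i t : Fin (p + 1)) (hit : (i : ℕ) + t < p) : Θ i t = 0 := by
      ext n
      refine ProjObj.isNull_pcl₀.1 ?_
      have h₂ : PB.IsNull (Θ' i t n ≫ (τ t n).hom) := by
        rw [key]
        exact (isNull_of_vanish (hnull n) (by rw [dm]; push_cast; omega)).comp_left _
      have h₃ := h₂.comp (τ t n).inv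
      rwa [Category.assoc, Iso.hom_inv_id, Category.comp_id] at h₃
    -- the entries on the antidiagonal agree up to scalars and shifts
    obtain ⟨g, hg⟩ := exists_hom_of_class (K := compBefore C (S.E (p + 1) h).obj) (L := D)
      (fun n => m p n ≫ (ω n).hom)
      (fun n => (deg_comp _ _).trans ((congrArg₂ (· + ·) (dm p n)
        (deg_intShiftPIso_hom D (-(p : ℤ)) n)).trans (by ring)))
      (fun n => by
        have h₂ : (ω n).hom ≫ PB.d D n = PB.d D' n ≫ (ω (n + 1)).hom := intShiftPIso_d D _ n (n + 1)
        have h₃ : fcl n ≫ PB.d C'' n = S.E p hy' ◁ PB.d C n ≫ fcl (n + 1) := by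
          have := congrArg pcl₀ (f.comm n (n + 1))
          exact (pcl₀_comp _ _).symm.trans (this.trans ((pcl₀_comp _ _).trans
            (congrArg (· ≫ fcl (n + 1)) (d_compBefore C (S.E p hy') n))))
        refine Eq.trans ?_ (congrArg (· ≫ m p (n + 1) ≫ (ω (n + 1)).hom)
          (d_compBefore C (S.E (p + 1) h) n)).symm
        show (m p n ≫ (ω n).hom) ≫ PB.d D n =
          S.E (p + 1) h ◁ PB.d C n ≫ m p (n + 1) ≫ (ω (n + 1)).hom
        simp only [Category.assoc, h₂, m]
        rw [reassoc_of% Ψ_d n, ← whiskerLeft_comp_assoc, h₃, whiskerLeft_comp_assoc,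
          ← associator_naturality_right_assoc, ← whisker_exchange_assoc])
    have entry (i t : Fin (p + 1)) (hit : (i : ℕ) + t = p) :=
      isSplitMono_of_shifted_class (f := Θ i t) (f' := g) (k := (p : ℤ) - 2 * (i : ℕ))
        (fun n => whiskerRightIso (σ i) (PB.X C n))
        (fun n => (deg_whiskerRight _ _).trans (show _ - 1 - _ = _ by push_cast; ring))
        (fun n => by
          refine (congrArg ((σ i).hom ▷ PB.X C n ≫ ·) (d_compBefore C (S.E (p + 1) h) n)).trans
            (Eq.trans ?_ (congrArg (· ≫ (σ i).hom ▷ PB.X C (n + 1))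
              (d_compBefore C (toPB (G i)) n)).symm)
          exact (whisker_exchange _ _).symm)
        (fun n => τ t n ≪≫ ω n)
        (fun n => (deg_comp _ _).trans (show 2 * ((t : ℕ) : ℤ) + -(p : ℤ) = _ by omega))
        (fun n => by
          have h₂ : (ω n).hom ≫ PB.d D n = PB.d D' n ≫ (ω (n + 1)).hom :=
            intShiftPIso_d D _ n (n + 1)
          have h₃ : (τ t n).hom ≫ PB.d D' n = PB.d (D₂ t) n ≫ (τ t (n + 1)).hom :=
            intShiftPIso_d D' _ n (n + 1)
          show ((τ t n).hom ≫ (ω n).hom) ≫ PB.d D n =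
            PB.d (D₂ t) n ≫ (τ t (n + 1)).hom ≫ (ω (n + 1)).hom
          rw [Category.assoc, h₂, reassoc_of% h₃])
        (fun n => by
          refine Eq.trans ?_ (congrArg ((σ i).hom ▷ PB.X C n ≫ ·) (hg n)).symm
          show Θ' i t n ≫ (τ t n).hom ≫ (ω n).hom = (σ i).hom ▷ PB.X C n ≫ m p n ≫ (ω n).hom
          rw [reassoc_of% key i t n, hit])
    obtain ⟨h₂, h₃⟩ := isSplitMono_isSplitEpi_of_antitriangular (q := p)
      (A := fun i => (toHtpy _).obj (compBefore C (G i))) (D := fun t => (toHtpy _).obj (D₂ t))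
      (fun i => (toHtpy _).map (Js i)) (fun i => (toHtpy _).map (Ps i))
      (by
        rw [← Functor.map_comp, ← CategoryTheory.Functor.map_id]
        congr 1
        simp only [Js, Ps, Category.assoc, Iso.hom_inv_id_assoc]
        rw [← compBeforeMap_comp, hJP, compBeforeMap_id])
      (by
        simp only [← Functor.map_comp]
        rw [← Functor.map_sum, ← CategoryTheory.Functor.map_id]
        congr 1
        have h₂ (i) : Ps i ≫ Js i = (compBeforeAssoc C _ _).inv ≫ compBeforeMap C (P i ≫ J i) ≫
            (compBeforeAssoc C _ _).hom := by simp [Js, Ps, compBeforeMap_comp]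
        simp only [h₂]
        rw [← Preadditive.comp_sum, ← Preadditive.sum_comp, ← compBeforeMap_sum, hPJ,
          compBeforeMap_id, Category.id_comp, Iso.inv_hom_id])
      (fun t => (toHtpy _).map (biproduct.ι D₂ t)) (fun t => (toHtpy _).map (biproduct.π D₂ t))
      (by rw [← Functor.map_comp, biproduct.ι_π_self, CategoryTheory.Functor.map_id])
      (by
        simp only [← Functor.map_comp]
        rw [← Functor.map_sum, biproduct.total, CategoryTheory.Functor.map_id])
      ((toHtpy _).map f' ≫ (toHtpy _).map Φ)
      (fun i t hit => by
        simp only [← Functor.map_comp]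
        exact (congrArg _ (hzero i t hit)).trans (Functor.map_zero _ _ _))
    simp only [← Functor.map_comp] at h₂ h₃
    have := (entry 0 (Fin.last p) (by simp)).1 h₂
    have := (entry (Fin.last p) 0 (by simp)).2 h₃
    exact ⟨g, isIso_of_epi_of_isSplitMono _⟩

end DividedPowers

end Sl2Data

/-! ### Dots for the exchanged and the reversed action -/

namespace Sl2Data

open PB Bicategory
open ProjObj (Low VanishBelow Retract)

variable {B : Type u} [Bicategory.{w, v} B] [GradedLinearBicategory B] (S : Sl2Data B)

/-- The action on the opposite bicategory which exchanges `E` and `F`. -/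
noncomputable def rev : Sl2Data (BOp B) where
  wt l := ⟨⟨(S.wt l).as⟩⟩
  E r _ _ h := S.F r h
  F r _ _ h := S.E r h
  finite_dimensional := S.finite_dimensional
  integrable := S.integrable
  low_id := S.low_id
  E_zero h := S.F_zero h
  F_zero h := S.E_zero h
  adj_right r _ _ h := by
    obtain ⟨adj, h'⟩ := S.adj_right r h
    exact ⟨Adjunction.toOp adj, h'⟩
  adj_left r _ _ h := by
    obtain ⟨adj, h'⟩ := S.adj_left r h
    exact ⟨Adjunction.toOp adj, h'⟩
  FE := S.FE
  EF := S.EF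
  E_E_pow := S.F_pow_F
  E_pow_E := S.F_F_pow
  F_F_pow := S.E_pow_E
  F_pow_F := S.E_E_pow

/-- An endomorphism of degree `2` of `E E` which is nonzero between the copies of `E^(2)` of
extreme degrees. -/
lemma exists_decomp_of_not_isNull {k l m : ℤ} (h : l = k + 2 * ((1 : ℕ) : ℤ))
    (h' : m = l + 2 * ((1 : ℕ) : ℤ)) (h'' : m = k + 2 * ((2 : ℕ) : ℤ))
    {φ : S.E 1 h ≫ S.E 1 h' ⟶ S.E 1 h ≫ S.E 1 h'} (dφ : deg φ = 2)
    (H : ¬ IsNull (𝟙 (S.E 2 h'')) → ∃ (α : S.E 2 h'' ⟶ S.E 1 h ≫ S.E 1 h')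
      (β : S.E 1 h ≫ S.E 1 h' ⟶ S.E 2 h''), deg α = -1 ∧ deg β = -1 ∧ ¬ IsNull (α ≫ φ ≫ β)) :
    ∃ D : QDecomp (S.E 1 h ≫ S.E 1 h') 2 (S.E 2 h''),
      (D.j 0 : S.E 2 h'' ⟶ S.E 1 h ≫ S.E 1 h') ≫ φ ≫
        (D.p 1 : S.E 1 h ≫ S.E 1 h' ⟶ S.E 2 h'') = 𝟙 (S.E 2 h'') := by
  obtain ⟨D⟩ := S.E_pow_E 1 h h' h''
  let j : S.E 2 h'' ⟶ S.E 1 h ≫ S.E 1 h' := D.j 0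
  let p : S.E 1 h ≫ S.E 1 h' ⟶ S.E 2 h'' := D.p 1
  have dj : deg j = -1 := (deg_fac_j _ _).trans (by simp)
  have dp : deg p = -1 := (deg_fac_p _ _).trans (by simp)
  refine ⟨D, ?_⟩
  show j ≫ φ ≫ p = 𝟙 _
  by_cases hn : IsNull (𝟙 (S.E 2 h''))
  · exact (isNull_of_isNull_id hn _).eq hn (by simp [dj, dp, dφ])
  obtain ⟨α, β, dα, dβ, h₀⟩ := H hn
  have hjp : j ≫ D.p 0 = 𝟙 _ := decomp_j_p_self D 0
  have hpj : (D.j 1 : S.E 2 h'' ⟶ S.E 1 h ≫ S.E 1 h') ≫ p = 𝟙 _ := decomp_j_p_self D 1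
  have L := S.low_left_E_E 1 1 h h' h'' _ _ (S.low_E 2 h'')
  rw [← eq_of_low (S.low_E_pow_E 1 h h' h'') (by simpa using dα) (by simpa using dj)
    (fun h => h₀ (h.comp _)) (not_isNull_of_comp_eq_id hjp hn),
    ← eq_of_low L (by simpa using dβ) (by simpa using dp)
    (fun h => h₀ ((h.comp_left _).comp_left _)) (not_isNull_of_comp_eq_id' hpj hn)]
  exact eq_id_of_low (S.low_E 2 h'') (by simp [dα, dβ, dφ]) h₀

/-- A dot which acts on the second factor of `E E`. -/
structure LeftDot where
  /-- the endomorphism -/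
  X {l m : ℤ} (h : m = l + 2 * ((1 : ℕ) : ℤ)) : S.E 1 h ⟶ S.E 1 h
  deg_X {l m : ℤ} (h : m = l + 2 * ((1 : ℕ) : ℤ)) : deg (X h) = 2
  exists_decomp {k l m : ℤ} (h : l = k + 2 * ((1 : ℕ) : ℤ)) (h' : m = l + 2 * ((1 : ℕ) : ℤ))
    (h'' : m = k + 2 * ((2 : ℕ) : ℤ)) :
    ∃ D : QDecomp (S.E 1 h ≫ S.E 1 h') 2 (S.E 2 h''),
      (D.j 0 : S.E 2 h'' ⟶ S.E 1 h ≫ S.E 1 h') ≫ S.E 1 h ◁ X h' ≫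
        (D.p 1 : S.E 1 h ≫ S.E 1 h' ⟶ S.E 2 h'') = 𝟙 (S.E 2 h'')

section Conjugate

variable {a b : PB B} {l₁ l₂ l₃ : a ⟶ b} {r₁ r₂ r₃ : b ⟶ a}

lemma deg_conjugateEquiv (adj₁ : l₁ ⊣ r₁) (adj₂ : l₂ ⊣ r₂) (φ : l₂ ⟶ l₁) :
    deg (conjugateEquiv adj₁ adj₂ φ) = deg φ + deg adj₂.unit - deg adj₁.unit := by
  rw [conjugateEquiv_apply']
  simp [deg_counit]
  ring

lemma isNull_of_isNull_conjugateEquiv (adj₁ : l₁ ⊣ r₁) (adj₂ : l₂ ⊣ r₂) {φ : l₂ ⟶ l₁}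
    (h : IsNull (conjugateEquiv adj₁ adj₂ φ)) : IsNull φ := by
  rw [← (conjugateEquiv adj₁ adj₂).symm_apply_apply φ, conjugateEquiv_symm_apply']
  exact (((((h.whiskerRight l₂).whiskerLeft l₁).comp _).comp_left _).comp_left _).comp_left _

lemma deg_unit_comp {c : PB B} {l : b ⟶ c} {r : c ⟶ b} (adj₁ : l₁ ⊣ r₁) (adj : l ⊣ r) :
    deg (adj₁.comp adj).unit = deg adj₁.unit + deg adj.unit := by
  simp [Bicategory.Adjunction.comp, Bicategory.Adjunction.compUnit, bicategoricalComp]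

/-- Conjugation preserves nonzero composites. -/
lemma not_isNull_conjugateEquiv (adj₁ : l₁ ⊣ r₁) (adj₂ : l₂ ⊣ r₂) {α : l₂ ⟶ l₁} {φ : l₁ ⟶ l₁}
    {β : l₁ ⟶ l₂} (h : ¬ IsNull (α ≫ φ ≫ β)) :
    ¬ IsNull (conjugateEquiv adj₂ adj₁ β ≫ conjugateEquiv adj₁ adj₁ φ ≫
      conjugateEquiv adj₁ adj₂ α) := by
  rw [Bicategory.conjugateEquiv_comp, Bicategory.conjugateEquiv_comp, Category.assoc]
  exact fun h' => h (isNull_of_isNull_conjugateEquiv _ _ h')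

end Conjugate

variable {S}

/-- The adjunctions chosen for the conjugation of dots. -/
noncomputable def adjE (S : Sl2Data B) {l m : ℤ} (h : m = l + 2 * ((1 : ℕ) : ℤ)) :
    S.E 1 h ⊣ S.F 1 h :=
  (S.adj_right 1 h).choose

lemma deg_unit_adjE (S : Sl2Data B) {l m : ℤ} (h : m = l + 2 * ((1 : ℕ) : ℤ)) :
    deg (S.adjE h).unit = ((1 : ℕ) : ℤ) * (l + ((1 : ℕ) : ℤ)) :=
  (S.adj_right 1 h).choose_spec

/-- An endomorphism of `E E` which maps the lowest summand `E^(2)` isomorphically to the highest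
one has a mate on `F F` with the same property, by uniqueness up to scalars. -/
lemma exists_conjugate {k l m : ℤ} (h : l = k + 2 * ((1 : ℕ) : ℤ))
    (h' : m = l + 2 * ((1 : ℕ) : ℤ)) (h'' : m = k + 2 * ((2 : ℕ) : ℤ))
    {φ : S.E 1 h ≫ S.E 1 h' ⟶ S.E 1 h ≫ S.E 1 h'}
    (H : ∃ D : QDecomp (S.E 1 h ≫ S.E 1 h') 2 (S.E 2 h''),
      (D.j 0 : S.E 2 h'' ⟶ S.E 1 h ≫ S.E 1 h') ≫ φ ≫
        (D.p 1 : S.E 1 h ≫ S.E 1 h' ⟶ S.E 2 h'') = 𝟙 (S.E 2 h''))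
    (hn : ¬ IsNull (𝟙 (S.F 2 h''))) :
    ∃ (α : S.F 2 h'' ⟶ S.F 1 h' ≫ S.F 1 h) (β : S.F 1 h' ≫ S.F 1 h ⟶ S.F 2 h''),
      deg α = -1 ∧ deg β = -1 ∧ ¬ IsNull (α ≫ conjugateEquiv ((S.adjE h).comp (S.adjE h'))
        ((S.adjE h).comp (S.adjE h')) φ ≫ β) := by
  obtain ⟨D, hD⟩ := H
  obtain ⟨adj₂, h₂⟩ := S.adj_right 2 h''
  have hd : deg ((S.adjE h).comp (S.adjE h')).unit = deg adj₂.unit := by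
    rw [deg_unit_comp, h₂, S.deg_unit_adjE, S.deg_unit_adjE]
    push_cast; omega
  let j : S.E 2 h'' ⟶ S.E 1 h ≫ S.E 1 h' := D.j 0
  let p : S.E 1 h ≫ S.E 1 h' ⟶ S.E 2 h'' := D.p 1
  have dj : deg j = -1 := (deg_fac_j _ _).trans (by simp)
  have dp : deg p = -1 := (deg_fac_p _ _).trans (by simp)
  refine ⟨Bicategory.conjugateEquiv adj₂ ((S.adjE h).comp (S.adjE h')) p,
    Bicategory.conjugateEquiv ((S.adjE h).comp (S.adjE h')) adj₂ j, ?_, ?_, ?_⟩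
  · rw [deg_conjugateEquiv, hd, dp]; ring
  · rw [deg_conjugateEquiv, hd, dj]; ring
  · refine not_isNull_conjugateEquiv _ _ fun h₀ => hn ?_
    have h₁ : IsNull (𝟙 (S.E 2 h'')) := hD ▸ h₀
    rw [← Bicategory.conjugateEquiv_id adj₂]
    rw [Bicategory.conjugateEquiv_apply']
    exact ((((h₁.whiskerRight _).whiskerLeft _).comp _).comp_left _).comp_left _

/-- The conjugate of a dot. -/
noncomputable def Dot.rev (X : S.Dot) : S.rev.Dot where
  X {l m} h := conjugateEquiv (S.adjE h) (S.adjE h) (X.X h)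
  deg_X h := by
    refine (deg_conjugateEquiv _ _ (X.X h)).trans ?_
    rw [add_sub_cancel_right]
    exact X.deg_X h
  exists_decomp {k l m} h h' h'' := by
    let φ : S.F 1 h' ≫ S.F 1 h ⟶ S.F 1 h' ≫ S.F 1 h :=
      S.F 1 h' ◁ conjugateEquiv (S.adjE h) (S.adjE h) (X.X h)
    have hφ : conjugateEquiv ((S.adjE h).comp (S.adjE h')) ((S.adjE h).comp (S.adjE h'))
        (X.X h ▷ S.E 1 h') = φ := conjugateEquiv_whiskerRight _ _ _ _
    have dφ : deg φ = 2 := by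
      simp only [φ, PB.deg_whiskerLeft, deg_conjugateEquiv, add_sub_cancel_right, X.deg_X]
    refine S.rev.exists_decomp_of_not_isNull h h' h'' (φ := φ) dφ fun hn => ?_
    have := exists_conjugate h h' h'' (X.exists_decomp h h' h'') hn
    rw [hφ] at this
    exact this

/-- The conjugate of a dot. -/
noncomputable def LeftDot.chev (X : S.LeftDot) : S.chev.Dot where
  X {l m} h := conjugateEquiv (S.adjE (l := -m) (m := -l) (by omega))
    (S.adjE (l := -m) (m := -l) (by omega)) (X.X (l := -m) (m := -l) (by omega))
  deg_X h := by
    refine (deg_conjugateEquiv _ _ (X.X _)).trans ?_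
    rw [add_sub_cancel_right]
    exact X.deg_X _
  exists_decomp {k l m} h h' h'' := by
    have g : -k = -l + 2 * ((1 : ℕ) : ℤ) := by omega
    have g' : -l = -m + 2 * ((1 : ℕ) : ℤ) := by omega
    have g'' : -k = -m + 2 * ((2 : ℕ) : ℤ) := by omega
    let φ : S.F 1 g ≫ S.F 1 g' ⟶ S.F 1 g ≫ S.F 1 g' :=
      conjugateEquiv (S.adjE g) (S.adjE g) (X.X g) ▷ S.F 1 g'
    have hφ : conjugateEquiv ((S.adjE g').comp (S.adjE g)) ((S.adjE g').comp (S.adjE g))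
        (S.E 1 g' ◁ X.X g) = φ := conjugateEquiv_whiskerLeft _ _ _ _
    have dφ : deg φ = 2 := by
      simp only [φ, PB.deg_whiskerRight, deg_conjugateEquiv, add_sub_cancel_right, X.deg_X]
    refine S.chev.exists_decomp_of_not_isNull h h' h'' (φ := φ) dφ fun hn => ?_
    have := exists_conjugate g' g g'' (X.exists_decomp g' g g'') hn
    rw [hφ] at this
    exact this

end Sl2Data

/-! ### The dots of a categorical 2-representation -/

namespace CategoricalSl2Rep

open PB Bicategory ShiftedHom

variable {B : Type u} [Bicategory.{w, v} B] [GradedLinearBicategory B] (R : CategoricalSl2Rep B)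

/-- The class of `θ`. -/
noncomputable def thetaClass (l : ℤ) : 𝟙 (R.toSl2Data.wt l) ⟶ 𝟙 (R.toSl2Data.wt l) :=
  pcl (X := 𝟙 (R.wt l)) (Y := 𝟙 (R.wt l)) (k := (2 : ℤ)) (R.θ l)

lemma deg_thetaClass (l : ℤ) : deg (R.thetaClass l) = 2 := rfl

/-- The condition on `θ`, in terms of classes up to scalars. -/
lemma exists_not_isNull_theta {k l m : ℤ} (h : l = k + 2 * ((1 : ℕ) : ℤ))
    (h' : m = l + 2 * ((1 : ℕ) : ℤ)) (h'' : m = k + 2 * ((2 : ℕ) : ℤ))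
    (hn : ¬ IsNull (𝟙 (R.toSl2Data.E 2 h''))) :
    ∃ (α : R.toSl2Data.E 2 h'' ⟶ R.toSl2Data.E 1 h ≫ R.toSl2Data.E 1 h')
      (β : R.toSl2Data.E 1 h ≫ R.toSl2Data.E 1 h' ⟶ R.toSl2Data.E 2 h''), deg α = -1 ∧
      deg β = -1 ∧ ¬ IsNull (α ≫ R.toSl2Data.E 1 h ◁ ((λ_ (R.toSl2Data.E 1 h')).inv ≫
        R.thetaClass l ▷ R.toSl2Data.E 1 h' ≫ (λ_ (R.toSl2Data.E 1 h')).hom) ≫ β) := by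
  obtain ⟨φ, hφ⟩ := R.θ_iso h h' h''
  let Z (j : Fin 2) := (R.E 2 h'')⟦((2 : ℕ) : ℤ) - 1 - 2 * ((j : ℕ) : ℤ)⟧
  let f : Z 0 ⟶ R.E 1 h ≫ R.E 1 h' := biproduct.ι Z 0 ≫ φ.inv
  let g : R.E 1 h ≫ R.E 1 h' ⟶ Z 1 := φ.hom ≫ biproduct.π Z 1
  let W : ShiftedHom (R.E 1 h ≫ 𝟙 _ ≫ R.E 1 h') (R.E 1 h ≫ 𝟙 _ ≫ R.E 1 h') (2 : ℤ) :=
    gradedWhiskerLeft (R.E 1 h) (gradedWhiskerRight (R.θ l) (R.E 1 h'))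
  let Φ : ShiftedHom (Z 0) (Z 1) (2 : ℤ) := f ≫ R.E 1 h ◁ (λ_ (R.E 1 h')).inv ≫ W ≫
    (R.E 1 h ◁ (λ_ (R.E 1 h')).hom)⟦(2 : ℤ)⟧' ≫ g⟦(2 : ℤ)⟧'
  replace hφ : IsIso (X := Z 0) (Y := (Z 1)⟦(2 : ℤ)⟧) Φ := by
    have e : Φ = _ := Category.assoc _ _ _
    rw [e]
    exact hφ
  let a := pcl₀ (R.E 1 h ◁ (λ_ (R.E 1 h')).inv)
  let c := pcl₀ (R.E 1 h ◁ (λ_ (R.E 1 h')).hom)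
  have hΦ : pcl Φ = pcl₀ f ≫ a ≫ pcl W ≫ c ≫ pcl₀ g := by
    simp only [a, c]
    rw [← pcl₀_comp (R.E 1 h ◁ (λ_ (R.E 1 h')).hom), ← pcl_comp_pcl₀, ← pcl₀_comp_pcl,
      ← pcl₀_comp_pcl]
    simp only [Φ, CategoryTheory.Functor.map_comp]
  have hz : ¬ IsZero (R.E 2 h'') := fun h => hn (ProjObj.isNull_id_iff.2 h)
  let s := shiftPIso (C := R.wt k ⟶ R.wt m) (R.E 2 h'') (((2 : ℕ) : ℤ) - 1 - 2 * (((0 : Fin 2) : ℕ) : ℤ))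
  let t := shiftPIso (C := R.wt k ⟶ R.wt m) (R.E 2 h'') (((2 : ℕ) : ℤ) - 1 - 2 * (((1 : Fin 2) : ℕ) : ℤ))
  have hW : (R.toSl2Data.E 1 h ◁ ((λ_ (R.toSl2Data.E 1 h')).inv ≫
        R.thetaClass l ▷ R.toSl2Data.E 1 h' ≫ (λ_ (R.toSl2Data.E 1 h')).hom)) =
      a ≫ pcl W ≫ c := by
    rw [Bicategory.whiskerLeft_comp, Bicategory.whiskerLeft_comp]
    exact congrArg₂ (· ≫ ·) (pcl₀_whiskerLeft (R.E 1 h) (λ_ (R.E 1 h')).inv).symm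
      (congrArg₂ (· ≫ ·) rfl (pcl₀_whiskerLeft (R.E 1 h) (λ_ (R.E 1 h')).hom).symm)
  let α := s.inv ≫ pcl₀ f
  let β := pcl₀ g ≫ t.hom
  refine ⟨α, β, rfl, rfl, fun h₀ => hz ?_⟩
  have h₁ : ProjObj.IsNull (s.inv ≫ pcl Φ ≫ t.hom) := by
    rw [hΦ]
    have : α ≫ (a ≫ pcl W ≫ c) ≫ β = s.inv ≫ (pcl₀ f ≫ a ≫ pcl W ≫ c ≫ pcl₀ g) ≫ t.hom := by
      simp only [α, β, Category.assoc]
    rw [hW] at h₀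
    rw [← this]
    exact h₀
  have h₂ := (h₁.comp_left s.hom).comp t.inv
  simp only [Category.assoc, Iso.hom_inv_id, Iso.hom_inv_id_assoc, Category.comp_id] at h₂
  have h₃ : Φ = 0 := ProjObj.isNull_pcl.1 h₂
  have h₄ : IsZero (Z 0) := by
    rw [h₃] at hφ
    rw [IsZero.iff_id_eq_zero, ← IsIso.hom_inv_id (0 : Z 0 ⟶ (Z 1)⟦(2 : ℤ)⟧), Limits.zero_comp]
  have h₅ := (shiftFunctor (R.wt k ⟶ R.wt m) (-(((2 : ℕ) : ℤ) - 1 -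
    2 * (((0 : Fin 2) : ℕ) : ℤ)))).map_isZero h₄
  exact h₅.of_iso ((shiftFunctorCompIsoId (R.wt k ⟶ R.wt m) _ _ (add_neg_cancel _)).app _).symm

/-- The dot given by `θ` between the factors of `E E`, as an endomorphism of the first factor. -/
noncomputable def dot : R.toSl2Data.Dot where
  X {l m} h := (ρ_ (R.toSl2Data.E 1 h)).inv ≫ R.toSl2Data.E 1 h ◁ R.thetaClass m ≫
    (ρ_ (R.toSl2Data.E 1 h)).hom
  deg_X h := by simp [deg_thetaClass]
  exists_decomp h h' h'' := by
    refine R.toSl2Data.exists_decomp_of_not_isNull h h' h'' (by simp [deg_thetaClass]) fun hn => ?_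
    convert R.exists_not_isNull_theta h h' h'' hn using 7
    simp

/-- The dot given by `θ` between the factors of `E E`, as an endomorphism of the second factor. -/
noncomputable def leftDot : R.toSl2Data.LeftDot where
  X {l m} h := (λ_ (R.toSl2Data.E 1 h)).inv ≫ R.thetaClass l ▷ R.toSl2Data.E 1 h ≫
    (λ_ (R.toSl2Data.E 1 h)).hom
  deg_X h := by simp [deg_thetaClass]
  exists_decomp h h' h'' :=
    R.toSl2Data.exists_decomp_of_not_isNull h h' h'' (by simp [deg_thetaClass])
      fun hn => R.exists_not_isNull_theta h h' h'' hn

end CategoricalSl2Rep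

/-! ### Symmetries of the differentials -/

namespace PB

open Bicategory

variable {B : Type u} [Bicategory.{w, v} B] [GradedLinearBicategory B] {a b c d : PB B}

/-- The two ways of contracting with the counit of an adjunction agree. -/
lemma whisker_homEquiv₁_eq {f : a ⟶ b} {g : b ⟶ a} (adj : f ⊣ g) {X' : c ⟶ a} {X : c ⟶ b}
    {Y' : a ⟶ d} {Y : b ⟶ d} (ι : X' ⟶ X ≫ g) (ι' : Y' ⟶ f ≫ Y) :
    ι ▷ Y' ≫ (α_ X g Y').hom ≫ X ◁ adj.homEquiv₁ ι' =
      X' ◁ ι' ≫ (α_ X' f Y).inv ≫ adj.homEquiv₂.symm ι ▷ Y := by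
  simp only [Adjunction.homEquiv₂, Adjunction.homEquiv₁, Equiv.coe_fn_mk, Equiv.coe_fn_symm_mk,
    comp_whiskerRight, whiskerLeft_comp]
  rw [← associator_inv_naturality_left_assoc, whisker_exchange_assoc]
  simp

end PB

namespace Sl2Data

open PB Bicategory
open ProjObj (Low VanishBelow Retract)

variable {B : Type u} [Bicategory.{w, v} B] [GradedLinearBicategory B] {S : Sl2Data B}

section Differential

variable {a b : ℕ} {x y z z' : ℤ} {hb' : x = z' + 2 * ((b + 1 : ℕ) : ℤ)}
  {ha' : y = z' + 2 * ((a + 1 : ℕ) : ℤ)} {hb : x = z + 2 * (b : ℤ)} {ha : y = z + 2 * (a : ℤ)}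

/-- A composition of lowest degree inclusions and of a counit is a differential, also for the
reversed action. -/
lemma isDifferential_of_adjunction (h₁ : z = z' + 2 * ((1 : ℕ) : ℤ))
    {ι : S.F (b + 1) hb' ⟶ S.F b hb ≫ S.F 1 h₁} (dι : deg ι = -b)
    (hι : IsNull ι → IsNull (𝟙 (S.F (b + 1) hb')))
    {ι' : S.E (a + 1) ha' ⟶ S.E 1 h₁ ≫ S.E a ha} (dι' : deg ι' = -a)
    (hι' : IsNull ι' → IsNull (𝟙 (S.E (a + 1) ha')))
    (adj : S.E 1 h₁ ⊣ S.F 1 h₁) (hadj : deg adj.unit = z' + 1)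
    {δ : S.F (b + 1) hb' ≫ S.E (a + 1) ha' ⟶ S.F b hb ≫ S.E a ha}
    (hδ : δ = ι ▷ S.E (a + 1) ha' ≫ (α_ _ _ _).hom ≫ S.F b hb ◁ adj.homEquiv₁ ι') :
    S.IsDifferential a b hb' ha' hb ha δ ∧ S.rev.IsDifferential b a ha' hb' ha hb δ := by
  have h₂ : IsNull (adj.homEquiv₂.symm ι) → IsNull (𝟙 (S.F (b + 1) hb')) := fun h =>
    hι (by simpa using isNull_homEquiv₂ adj h)
  have h₃ : deg (adj.homEquiv₂.symm ι) = 1 - z - b := by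
    rw [deg_homEquiv₂_symm, dι, hadj]; omega
  refine ⟨⟨h₁, ι, adj.homEquiv₁ ι', dι, hι, ?_, fun h => hι' ?_, hδ⟩,
    h₁, ι', adj.homEquiv₂.symm ι, dι', hι', h₃, h₂, ?_⟩
  · rw [deg_homEquiv₁, dι', hadj]; omega
  · simpa using isNull_homEquiv₁_symm adj h
  · rw [hδ, whisker_homEquiv₁_eq]
    rfl

variable (S hb' ha' hb ha) in
lemma exists_isDifferential : ∃ δ, S.IsDifferential a b hb' ha' hb ha δ ∧
    S.rev.IsDifferential b a ha' hb' ha hb δ := by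
  have h₁ : z = z' + 2 * ((1 : ℕ) : ℤ) := by push_cast at *; omega
  obtain ⟨D⟩ := S.F_F_pow b h₁ hb hb'
  obtain ⟨D'⟩ := S.E_pow_E a h₁ ha ha'
  obtain ⟨adj, hadj⟩ := S.adj_right 1 h₁
  have h₂ : (D.j 0 : S.F (b + 1) hb' ⟶ S.F b hb ≫ S.F 1 h₁) ≫ D.p 0 = 𝟙 _ := decomp_j_p_self D 0
  have h₃ : (D'.j 0 : S.E (a + 1) ha' ⟶ S.E 1 h₁ ≫ S.E a ha) ≫ D'.p 0 = 𝟙 _ :=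
    decomp_j_p_self D' 0
  exact ⟨_, isDifferential_of_adjunction h₁ (ι := D.j 0) (ι' := D'.j 0) ((deg_fac_j _ _).trans (by simp))
    (fun h => by rw [← h₂]; exact h.comp _) ((deg_fac_j _ _).trans (by simp))
    (fun h => by rw [← h₃]; exact h.comp _) adj (by rw [hadj]; simp) rfl⟩

lemma IsDifferential.rev {δ : S.F (b + 1) hb' ≫ S.E (a + 1) ha' ⟶ S.F b hb ≫ S.E a ha}
    (hδ : S.IsDifferential a b hb' ha' hb ha δ) : S.rev.IsDifferential b a ha' hb' ha hb δ := by
  obtain ⟨δ', h, h'⟩ := S.exists_isDifferential hb' ha' hb ha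
  rw [hδ.eq h]
  exact h'

/-- The differentials do not vanish at `x = b - a`. -/
lemma IsDifferential.isNull_id (hx : x = b - a)
    {δ : S.F (b + 1) hb' ≫ S.E (a + 1) ha' ⟶ S.F b hb ≫ S.E a ha}
    (hδ : S.IsDifferential a b hb' ha' hb ha δ) (h₀ : IsNull δ) :
    IsNull (𝟙 (S.F (b + 1) hb' ≫ S.E (a + 1) ha')) := by
  obtain ⟨w, hw⟩ : ∃ w, x = w + 2 * ((1 : ℕ) : ℤ) := ⟨x - 2, by simp⟩
  have hb₂ : w = z' + 2 * (b : ℤ) := by push_cast at *; omega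
  have hN : w = b - 1 - (a + 1 : ℕ) := by push_cast at *; omega
  suffices h : IsNull (𝟙 (S.F b hb₂ ≫ S.E (a + 1) ha')) by
    obtain ⟨D⟩ := S.F_pow_F b hb₂ hw hb'
    have h₂ : (D.j 0 : S.F (b + 1) hb' ⟶ S.F 1 hw ≫ S.F b hb₂) ≫ D.p 0 = 𝟙 _ :=
      decomp_j_p_self D 0
    have h₃ : IsNull (𝟙 ((S.F 1 hw ≫ S.F b hb₂) ≫ S.E (a + 1) ha')) := by
      have := ((isNull_id_comp_right (S.F 1 hw) h).comp_left (α_ _ _ _).hom).comp (α_ _ _ _).inv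
      simpa using this
    rw [← id_whiskerRight, ← h₂, comp_whiskerRight]
    exact (isNull_of_isNull_id' h₃ _).comp _
  by_cases hn : IsNull (𝟙 (S.F b hb₂))
  · exact isNull_id_comp_left hn _
  obtain ⟨u, du, hu⟩ := S.exists_lower b (a + 1) hw hb₂ hb' hN hn
  exact hδ.upper_comp (hd := by push_cast at *; omega) hw hb₂ hb' hN du (fun h => (hu h).elim)
    (((h₀.whiskerLeft _).comp_left _).comp_left _)

end Differential

/-- For `x = b - a` the isomorphisms `E^(a) F^(b) ≅ F^(b) E^(a)` are compatible with the
differentials. -/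
lemma iso_comp_isDifferential {a b : ℕ} {x y z z' w w' : ℤ} {hb' : -x = z' + 2 * ((b + 1 : ℕ) : ℤ)}
    {ha' : -y = z' + 2 * ((a + 1 : ℕ) : ℤ)} {hb : -x = z + 2 * (b : ℤ)} {ha : -y = z + 2 * (a : ℤ)}
    {ga' : -w' = -x + 2 * ((a + 1 : ℕ) : ℤ)} {gb' : -w' = -y + 2 * ((b + 1 : ℕ) : ℤ)}
    {ga : -w = -x + 2 * (a : ℤ)} {gb : -w = -y + 2 * (b : ℤ)} (hx : x = a - b)
    {δ : S.F (b + 1) hb' ≫ S.E (a + 1) ha' ⟶ S.F b hb ≫ S.E a ha}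
    (hδ : S.IsDifferential a b hb' ha' hb ha δ)
    {δ' : S.E (a + 1) ga' ≫ S.F (b + 1) gb' ⟶ S.E a ga ≫ S.F b gb}
    (hδ' : S.chev.IsDifferential b a (x := x) (y := y) (z := w) (z' := w') (by omega) (by omega)
      (by omega) (by omega) δ')
    {e' : S.F (b + 1) hb' ≫ S.E (a + 1) ha' ≅ S.E (a + 1) ga' ≫ S.F (b + 1) gb'}
    (de' : deg e'.hom = 0) {e : S.F b hb ≫ S.E a ha ≅ S.E a ga ≫ S.F b gb}
    (de : deg e.hom = 0) : δ ≫ e.hom = e'.hom ≫ δ' := by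
  have dδ : deg δ = 1 := by rw [hδ.deg_eq]; omega
  have dδ' : deg δ' = 1 := hδ'.deg_eq.trans (by omega)
  by_cases hn : IsNull (𝟙 (S.F (b + 1) hb' ≫ S.E (a + 1) ha'))
  · exact (isNull_of_isNull_id hn _).eq (isNull_of_isNull_id hn _) (by simp [dδ, dδ', de, de'])
  rw [← Iso.eq_comp_inv, Category.assoc]
  have L := S.low_FE_FE (a := a + 1) (b := b + 1) (c := a) (d := b) (by omega) hb' ha' hb ha
    (by push_cast; omega) rfl
  have hN : (((b + 1 : ℕ) : ℤ) - b) * (2 * ((b + 1 : ℕ) : ℤ) - ((a + 1 : ℕ) : ℤ) - -x - b) = 1 := by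
    rw [hx]; push_cast; ring
  rw [hN] at L
  refine eq_of_low L dδ (by simp [dδ', de, de']) (fun h => hn (hδ.isNull_id (by omega) h))
    fun h => hn ?_
  have h₁ : IsNull δ' := by
    have := (h.comp_left e'.inv).comp e.hom
    simpa using this
  have h₂ : IsNull (𝟙 (S.E (a + 1) ga' ≫ S.F (b + 1) gb')) := hδ'.isNull_id hx h₁
  have := (h₂.comp_left e'.hom).comp e'.inv
  simpa using this

end Sl2Data

/-! ### Symmetries of the Rickard complexes -/

section

variable {C : Type u} [Category.{v} C] [Preadditive C] [Linear ℂ C] [HasShift C ℤ]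
  [∀ n : ℤ, (shiftFunctor C n).Additive] [∀ n : ℤ, (shiftFunctor C n).Linear ℂ]

lemma pcl₀_units_smul {X Y : C} (s : ℤˣ) (f : X ⟶ Y) : pcl₀ (s • f) = pcl₀ f := by
  rcases Int.units_eq_one_or s with rfl | rfl
  · rw [one_smul]
  · rw [Units.neg_smul, one_smul, pcl₀_neg]

lemma pcl₀_shiftedMap {X Y : C} {n : ℤ} (δ : ShiftedHom X Y n) (i j : ℤ) (h : n + i = j) :
    pcl₀ (ShiftedHom.shiftedMap δ i j h) ≫ (shiftPIso Y j).hom = (shiftPIso X i).hom ≫ pcl δ := by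
  rw [shiftPIso_hom, shiftPIso_hom, ← pcl₀_comp_pcl, ← pcl_comp _ _ h]
  congr 1
  simp only [ShiftedHom.ofShift, ShiftedHom.comp, ShiftedHom.shiftedMap]
  exact (Category.comp_id _).trans (Category.id_comp _).symm

end

namespace Sl2Data

open PB Bicategory
open ProjObj (Low VanishBelow Retract)

variable {B : Type u} [Bicategory.{w, v} B] [GradedLinearBicategory B] {S : Sl2Data B}
  {x v α β κ : ℤ} {C : CochainComplex ((S.wt x).as ⟶ (S.wt v).as) ℤ}

lemma IsRickard.rev (hv : v = x + 2 * (α - β)) (hC : S.IsRickard C α β κ) :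
    S.rev.IsRickard (x := v) (v := x) C β α κ where
  null i h := hC.null i h.symm
  exists_iso := by
    obtain ⟨e, he, hd⟩ := hC.exists_iso
    refine ⟨fun i a b z hb ha h h' => e i b a z ha hb h' h, fun i a b z hb ha h h' =>
      (he i b a z ha hb h' h).trans (by rw [hv]; ring), fun i a b z z' hb' ha' hb ha h₁ h₁' h₂ h₂' =>
      ?_⟩
    obtain ⟨δ, hδ, h⟩ := hd i b a z z' ha' hb' ha hb h₁' h₁ h₂' h₂
    exact ⟨δ, hδ.rev, h⟩

lemma IsRickard.translate (p : ℤ) (hC : S.IsRickard C α β κ) :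
    S.IsRickard (C⟦p⟧) (α - p) (β - p) (κ + p * (β - α - x + 1)) where
  null i h := hC.null (i + p) (by omega)
  exists_iso := by
    obtain ⟨e, he, hd⟩ := hC.exists_iso
    refine ⟨fun i a b z hb ha h h' => e (i + p) a b z hb ha (by omega) (by omega),
      fun i a b z hb ha h h' => (he (i + p) a b z hb ha _ _).trans (by ring),
      fun i a b z z' hb' ha' hb ha h₁ h₁' h₂ h₂' => ?_⟩
    obtain ⟨δ, hδ, h⟩ := hd (i + p) a b z z' hb' ha' hb ha (by omega) (by omega) (by omega)
      (by omega)
    refine ⟨δ, hδ, ?_⟩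
    have key (j : ℤ) (hj : j = i + p + 1) : pcl₀ (p.negOnePow • C.d (i + p) j) ≫
        (e j a b z hb ha (by omega) (by omega)).hom =
          (e (i + p) (a + 1) (b + 1) z' hb' ha' (by omega) (by omega)).hom ≫ δ := by
      subst hj
      rw [pcl₀_units_smul]
      exact h
    exact key (i + 1 + p) (by ring)

lemma IsRickard.bishift (k p : ℤ) (hC : S.IsRickard C α β κ) :
    S.IsRickard (bishift C k p) (α - p) (β - p) (κ + k + p * (β - α - x + 1)) :=
  (hC.shift k).translate p

/-- For `x = β - α` a Rickard complex with terms `E^(a) F^(b)` also has the terms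
`F^(b) E^(a)`. -/
lemma isRickard_chev_iff {x v α β κ : ℤ} {C : CochainComplex ((S.wt (-x)).as ⟶ (S.wt (-v)).as) ℤ}
    (hx : x = α - β) (hv : v = x + 2 * (β - α)) :
    S.chev.IsRickard (x := x) (v := v) C β α κ ↔ S.IsRickard (x := -x) (v := -v) C α β κ := by
  have iso (a b : ℕ) (z w : ℤ) (hb : -x = z + 2 * (b : ℤ)) (ha : -v = z + 2 * (a : ℤ))
      (ga : -w = -x + 2 * (a : ℤ)) (gb : -w = -v + 2 * (b : ℤ)) (h : (b : ℤ) - a = β - α) :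
      ∃ e : S.F b hb ≫ S.E a ha ≅ S.E a ga ≫ S.F b gb, deg e.hom = 0 :=
    S.exists_iso_FE a b hb ha ga gb (by omega)
  choose f hf using iso
  have key (a b : ℕ) (z z' w w' : ℤ) (hb' : -x = z' + 2 * ((b + 1 : ℕ) : ℤ))
      (ha' : -v = z' + 2 * ((a + 1 : ℕ) : ℤ)) (hb : -x = z + 2 * (b : ℤ))
      (ha : -v = z + 2 * (a : ℤ)) (ga' : -w' = -x + 2 * ((a + 1 : ℕ) : ℤ))
      (gb' : -w' = -v + 2 * ((b + 1 : ℕ) : ℤ)) (ga : -w = -x + 2 * (a : ℤ))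
      (gb : -w = -v + 2 * (b : ℤ)) (h : (b : ℤ) - a = β - α)
      (h' : ((b + 1 : ℕ) : ℤ) - ((a + 1 : ℕ) : ℤ) = β - α)
      (δ : S.F (b + 1) hb' ≫ S.E (a + 1) ha' ⟶ S.F b hb ≫ S.E a ha)
      (hδ : S.IsDifferential a b hb' ha' hb ha δ)
      (δ' : S.E (a + 1) ga' ≫ S.F (b + 1) gb' ⟶ S.E a ga ≫ S.F b gb)
      (hδ' : S.chev.IsDifferential b a (x := x) (y := v) (z := w) (z' := w') (by omega) (by omega)
        (by omega) (by omega) δ') :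
      δ ≫ (f a b z w hb ha ga gb h).hom = (f (a + 1) (b + 1) z' w' hb' ha' ga' gb' h').hom ≫ δ' :=
    iso_comp_isDifferential (by omega) hδ hδ' (hf _ _ _ _ _ _ _ _ _) (hf _ _ _ _ _ _ _ _ _)
  constructor <;> intro hC
  · refine ⟨fun i h => hC.null i h.symm, ?_⟩
    obtain ⟨e, he, hd⟩ := hC.exists_iso
    let e' (i : ℤ) (a b : ℕ) (w : ℤ) (ga : -w = -x + 2 * (a : ℤ)) (gb : -w = -v + 2 * (b : ℤ))
      (h : (a : ℤ) = α - i) (h' : (b : ℤ) = β - i) :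
      PB.X C i ≅ S.E a ga ≫ S.F b gb := e i b a w (by omega) (by omega) h' h
    have he' (i a b w ga gb h h') : deg (e' i a b w ga gb h h').hom = κ + i :=
      (he i b a w (by omega) (by omega) h' h).trans (by rw [hx]; ring)
    refine ⟨fun i a b z hb ha h h' => e' i a b (x - 2 * (a : ℤ)) (by ring) (by omega) h h' ≪≫
      (f a b z _ hb ha _ _ (by omega)).symm, fun i a b z hb ha h h' => by
        simp [he', hf, hx], fun i a b z z' hb' ha' hb ha h₁ h₁' h₂ h₂' => ?_⟩
    obtain ⟨δ', hδ', h⟩ := hd i b a (x - 2 * (a : ℤ)) (x - 2 * ((a + 1 : ℕ) : ℤ)) (by omega)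
      (by omega) (by omega) (by omega) h₁' h₁ h₂' h₂
    obtain ⟨δ, hδ, -⟩ := S.exists_isDifferential hb' ha' hb ha
    have q := key a b z z' _ _ hb' ha' hb ha (by ring) (by omega) (by ring) (by omega) (by omega)
      (by push_cast; omega) δ hδ δ' hδ'
    refine ⟨δ, hδ, ?_⟩
    rw [Iso.trans_hom, Iso.trans_hom, Iso.symm_hom, Iso.symm_hom, Category.assoc,
      ← Category.assoc, Iso.comp_inv_eq, Category.assoc, Category.assoc, q]
    exact h.trans (congrArg _ (Iso.inv_hom_id_assoc _ _).symm)
  · refine ⟨fun i h => hC.null i h.symm, ?_⟩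
    obtain ⟨e, he, hd⟩ := hC.exists_iso
    let e' (i : ℤ) (b a : ℕ) (w : ℤ) (ga : -w = -x + 2 * (a : ℤ)) (gb : -w = -v + 2 * (b : ℤ))
        (h' : (b : ℤ) = β - i) (h : (a : ℤ) = α - i) : PB.X C i ≅ S.E a ga ≫ S.F b gb :=
      e i a b (-x - 2 * (b : ℤ)) (by ring) (by omega) h h' ≪≫ f a b _ w _ _ ga gb (by omega)
    refine ⟨fun i b a w ga gb h' h => e' i b a w (by omega) (by omega) h' h,
      fun i b a w ga gb h' h => ?_, fun i b a w w' ga' gb' ga gb h₁' h₁ h₂' h₂ => ?_⟩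
    · have : deg (e' i b a w (by omega) (by omega) h' h).hom = κ + i * (α - β - x + 1) := by
        simp [e', he, hf, hx]
      exact this
    · obtain ⟨δ, hδ, h⟩ := hd i a b (-x - 2 * (b : ℤ)) (-x - 2 * ((b + 1 : ℕ) : ℤ)) (by ring)
        (by omega) (by ring) (by omega) h₁ h₁' h₂ h₂'
      obtain ⟨δ', hδ'⟩ : ∃ δ' : S.E (a + 1) (l := -x) (m := -w') (by omega) ≫
          S.F (b + 1) (l := -v) (by omega) ⟶ S.E a (m := -w) (by omega) ≫ S.F b (by omega),
          S.chev.IsDifferential b a ga' gb' ga gb δ' :=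
        (S.chev.exists_isDifferential ga' gb' ga gb).imp fun _ h => h.1
      refine ⟨δ', hδ', ?_⟩
      have q := key a b _ _ w w' _ _ _ _ (by omega) (by omega) (by omega) (by omega) (by omega)
        (by push_cast; omega) δ hδ δ' hδ'
      have h₃ : PB.d C i ≫ (e (i + 1) a b (-x - 2 * (b : ℤ)) (by ring) (by omega) h₂ h₂').hom ≫
          (f a b _ w _ _ (by omega) (by omega) (by omega)).hom =
          ((e i (a + 1) (b + 1) (-x - 2 * ((b + 1 : ℕ) : ℤ)) (by ring) (by omega) h₁ h₁').hom ≫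
          (f (a + 1) (b + 1) _ w' _ _ (by omega) (by omega) (by push_cast; omega)).hom) ≫ δ' := by
        rw [Category.assoc, ← q, reassoc_of% h]
      exact h₃

/-- Complexes whose terms and differentials have the required form. -/
lemma isRickard_of_nat (a b : ℕ) (hab : a = 0 ∨ b = 0) (z : ℕ → ℤ)
    (hb : ∀ s, x = z s + 2 * ((b + s : ℕ) : ℤ)) (ha : ∀ s, v = z s + 2 * ((a + s : ℕ) : ℤ))
    {c : ℤ} (hc : c = 1 - a + b - x) (h₀ : ∀ i : ℤ, 0 < i → IsZero (C.X i))
    (e : ∀ s : ℕ, C.X (-(s : ℤ)) ≅ (S.F (b + s) (hb s) ≫ S.E (a + s) (ha s)).obj⟦-((s : ℤ) * c)⟧)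
    (hd : ∀ s : ℕ, ∃ δ : ShiftedHom (S.F (b + (s + 1)) (hb (s + 1)) ≫
        S.E (a + (s + 1)) (ha (s + 1))).obj (S.F (b + s) (hb s) ≫ S.E (a + s) (ha s)).obj c,
      S.IsDifferential (a + s) (b + s) (hb (s + 1)) (ha (s + 1)) (hb s) (ha s) (pcl δ) ∧
      C.d (-((s + 1 : ℕ) : ℤ)) (-(s : ℤ)) ≫ (e s).hom =
        (e (s + 1)).hom ≫ ShiftedHom.shiftedMap δ (-(((s + 1 : ℕ) : ℤ) * c)) (-((s : ℤ) * c))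
          (by push_cast; ring)) : S.IsRickard C a b 0 := by
  obtain ⟨e₁, de₁, he₁⟩ : ∃ e₁ : ∀ (i : ℤ) (s : ℕ) (_ : i = -(s : ℤ)) (a' b' : ℕ) (y : ℤ)
      (hb' : x = y + 2 * (b' : ℤ)) (ha' : v = y + 2 * (a' : ℤ)) (_ : a' = a + s) (_ : b' = b + s),
      (PB.X C i ≅ S.F b' hb' ≫ S.E a' ha'),
      (∀ i s hs a' b' y hb' ha' h h', deg (e₁ i s hs a' b' y hb' ha' h h').hom = i * c) ∧
      ∀ (i j : ℤ) (s a' b' : ℕ) (y y' : ℤ) (hb' : x = y' + 2 * ((b' + 1 : ℕ) : ℤ))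
      (ha' : v = y' + 2 * ((a' + 1 : ℕ) : ℤ)) (hb : x = y + 2 * (b' : ℤ))
      (ha : v = y + 2 * (a' : ℤ)) (hs : i = -((s + 1 : ℕ) : ℤ)) (hs' : j = -(s : ℤ))
      (h : a' = a + s) (h' : b' = b + s), ∃ δ, S.IsDifferential a' b' hb' ha' hb ha δ ∧
      (pcl₀ (C.d i j) : PB.X C i ⟶ PB.X C j) ≫ (e₁ j s hs' a' b' y hb ha h h').hom =
        (e₁ i (s + 1) hs (a' + 1) (b' + 1) y' hb' ha' (by omega) (by omega)).hom ≫ δ := by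
    refine ⟨fun i s hs a' b' y hb' ha' h h' => by
      subst hs h h'
      obtain rfl : z s = y := by have := hb s; omega
      exact pisoOfIso (e s) ≪≫ shiftPIso _ _, ?_, ?_⟩
    · intro i s hs a' b' y hb' ha' h h'
      subst hs h h'
      obtain rfl : z s = y := by have := hb s; omega
      exact (deg_comp _ _).trans ((zero_add _).trans (neg_mul _ _).symm)
    · intro i j s a' b' y y' hb' ha' hb₁ ha₁ hs hs' h h'
      subst hs hs' h h'
      obtain rfl : z s = y := by have := hb s; omega
      obtain rfl : z (s + 1) = y' := by have := hb (s + 1); push_cast at *; omega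
      obtain ⟨δ, hδ, h⟩ := hd s
      refine ⟨pcl δ, hδ, ?_⟩
      have h₁ := congrArg (· ≫ (shiftPIso _ (-((s : ℤ) * c))).hom) (congrArg pcl₀ h)
      simp only [pcl₀_comp, Category.assoc] at h₁
      rw [pcl₀_shiftedMap, ← Category.assoc (pcl₀ (e (s + 1)).hom)] at h₁
      exact h₁
  refine ⟨fun i hi => ?_, fun i a' b' y hb' ha' h h' =>
    e₁ i (-i).toNat (by omega) a' b' y hb' ha' (by omega) (by omega), fun i a' b' y hb' ha' h h' => by
      rw [de₁, hc]; ring, fun i a' b' y y' hb' ha' hb ha h₁ h₁' h₂ h₂' => ?_⟩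
  · exact ProjObj.isNull_id_iff.2 (h₀ i (by omega))
  · have hi : (-i).toNat = (-(i + 1)).toNat + 1 := by omega
    simp only [hi]
    exact he₁ i (i + 1) (-(i + 1)).toNat a' b' y y' hb' ha' hb ha (by omega) (by omega) (by omega)
      (by omega)

end Sl2Data

/-! ### Existence of the Rickard complexes -/

section

variable {C : Type u} [Category.{v} C] [Preadditive C] [HasFiniteBiproducts C] [Linear ℂ C]
  [HasShift C ℤ] [∀ n : ℤ, (shiftFunctor C n).Additive] [∀ n : ℤ, (shiftFunctor C n).Linear ℂ]

open ProjObj ShiftedHom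

/-- A sequence of morphisms of degree `c` whose consecutive compositions vanish gives a complex. -/
lemma exists_cochainComplex (X : ℕ → C) (c : ℤ) (δ : ∀ s, ShiftedHom (X (s + 1)) (X s) c)
    (hδ : ∀ s, IsNull (pcl (δ (s + 1)) ≫ pcl (δ s))) :
    ∃ K : CochainComplex C ℤ, (∀ i : ℤ, 0 < i → IsZero (K.X i)) ∧
      ∃ e : ∀ s : ℕ, K.X (-(s : ℤ)) ≅ (X s)⟦-((s : ℤ) * c)⟧, ∀ s : ℕ,
        K.d (-((s + 1 : ℕ) : ℤ)) (-(s : ℤ)) ≫ (e s).hom = (e (s + 1)).hom ≫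
          shiftedMap (δ s) (-(((s + 1 : ℕ) : ℤ) * c)) (-((s : ℤ) * c)) (by push_cast; ring) := by
  have := hasZeroObject_of_hasFiniteBiproducts C
  let Y (s : ℕ) : C := (X s)⟦-((s : ℤ) * c)⟧
  let d (s : ℕ) : Y (s + 1) ⟶ Y s :=
    shiftedMap (δ s) (-(((s + 1 : ℕ) : ℤ) * c)) (-((s : ℤ) * c)) (by push_cast; ring)
  have hd (s : ℕ) : d (s + 1) ≫ d s = 0 := by
    rw [← isNull_pcl₀, ← isNull_comp_iso _ (shiftPIso (X s) (-((s : ℤ) * c))), pcl₀_comp,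
      Category.assoc, pcl₀_shiftedMap, ← Category.assoc, pcl₀_shiftedMap, Category.assoc,
      isNull_iso_comp]
    exact hδ s
  let L := ChainComplex.of Y d hd
  let E := ComplexShape.embeddingDownNat
  have hE (s : ℕ) : E.f s = -(s : ℤ) := rfl
  refine ⟨L.extend E, fun i hi => L.isZero_extend_X E i fun s hs => ?_,
    fun s => L.extendXIso E (hE s), fun s => ?_⟩
  · have : -(s : ℤ) = i := hs
    omega
  · have hL : L.d (s + 1) s = d s := ChainComplex.of_d Y d s
    rw [L.extend_d_eq E (hE (s + 1)) (hE s), hL, Category.assoc, Category.assoc]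
    exact congrArg _ ((congrArg _ (Iso.inv_hom_id _)).trans (Category.comp_id _))

end

namespace Sl2Data

open PB Bicategory ShiftedHom
open ProjObj (Low VanishBelow Retract exists_rep)

variable {B : Type u} [Bicategory.{w, v} B] [GradedLinearBicategory B] (S : Sl2Data B)

/-- For degree reasons, the square of the differential of a Rickard complex vanishes. -/
lemma isNull_comp_FE {a b : ℕ} {x y z z' : ℤ} (hb : x = z + 2 * ((b + 2 : ℕ) : ℤ))
    (ha : y = z + 2 * ((a + 2 : ℕ) : ℤ)) (hb' : x = z' + 2 * (b : ℤ)) (ha' : y = z' + 2 * (a : ℤ))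
    (hr : 0 ≤ (b : ℤ) - a - x) {φ : S.F (b + 2) hb ≫ S.E (a + 2) ha ⟶ S.F b hb' ≫ S.E a ha'}
    (hφ : deg φ = (1 - a + b - x) + (1 - a + b - x)) : IsNull φ := by
  refine isNull_of_low (S.low_FE_FE (by omega) hb ha hb' ha' (by push_cast; omega) rfl) ?_
  rw [hφ]
  have : (((b + 2 : ℕ) : ℤ) - b) = 2 := by push_cast; ring
  rw [this]; push_cast; omega

lemma isNull_comp_EF {a b : ℕ} {x y z z' : ℤ} (ha : z = x + 2 * ((a + 2 : ℕ) : ℤ))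
    (hb : z = y + 2 * ((b + 2 : ℕ) : ℤ)) (ha' : z' = x + 2 * (a : ℤ)) (hb' : z' = y + 2 * (b : ℤ))
    (hr : 0 ≤ (a : ℤ) - b + x) {φ : S.E (a + 2) ha ≫ S.F (b + 2) hb ⟶ S.E a ha' ≫ S.F b hb'}
    (hφ : deg φ = (1 + a - b + x) + (1 + a - b + x)) : IsNull φ := by
  obtain ⟨x, rfl⟩ : ∃ k, x = -k := ⟨-x, by simp⟩
  obtain ⟨y, rfl⟩ : ∃ k, y = -k := ⟨-y, by simp⟩
  obtain ⟨z, rfl⟩ : ∃ k, z = -k := ⟨-z, by simp⟩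
  obtain ⟨z', rfl⟩ : ∃ k, z' = -k := ⟨-z', by simp⟩
  exact S.chev.isNull_comp_FE (a := b) (b := a) (x := x) (y := y) (z := z) (z' := z') (by omega)
    (by omega) (by omega) (by omega) (by omega) (φ := φ) (hφ.trans (by ring))

lemma exists_isRickard_nat (a b : ℕ) (hab : a = 0 ∨ b = 0) {x v : ℤ} (hr : 0 ≤ (b : ℤ) - a - x)
    (hv : v = x + 2 * ((a : ℤ) - b)) :
    ∃ C : CochainComplex ((S.wt x).as ⟶ (S.wt v).as) ℤ, S.IsRickard C a b 0 := by
  let z (s : ℕ) : ℤ := x - 2 * ((b + s : ℕ) : ℤ)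
  have hb (s) : x = z s + 2 * ((b + s : ℕ) : ℤ) := by simp [z]
  have ha (s) : v = z s + 2 * ((a + s : ℕ) : ℤ) := by simp [z]; omega
  have key (s : ℕ) : ∃ δ : ShiftedHom (S.F (b + (s + 1)) (hb (s + 1)) ≫
      S.E (a + (s + 1)) (ha (s + 1))).obj (S.F (b + s) (hb s) ≫ S.E (a + s) (ha s)).obj
        (1 - a + b - x),
      S.IsDifferential (a + s) (b + s) (hb (s + 1)) (ha (s + 1)) (hb s) (ha s) (pcl δ) := by
    obtain ⟨φ, hφ, -⟩ := S.exists_isDifferential (a := a + s) (b := b + s) (hb (s + 1))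
      (ha (s + 1)) (hb s) (ha s)
    obtain ⟨δ, rfl⟩ := exists_rep φ (hφ.deg_eq.trans
      (show _ = 1 - (a : ℤ) + b - x by push_cast; ring))
    exact ⟨δ, hφ⟩
  choose δ hδ using key
  obtain ⟨C, h₀, e, he⟩ := exists_cochainComplex
    (fun s => (S.F (b + s) (hb s) ≫ S.E (a + s) (ha s)).obj) _ δ fun s => S.isNull_comp_FE (a := a + s)
    (b := b + s) (hb (s + 2)) (ha (s + 2)) (hb s) (ha s) (by push_cast; omega)
    (φ := pcl (δ (s + 1)) ≫ pcl (δ s)) ((deg_comp _ _).trans (by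
      show (1 - (a : ℤ) + b - x) + (1 - (a : ℤ) + b - x) = _
      push_cast; ring))
  exact ⟨C, isRickard_of_nat a b hab z hb ha rfl h₀ e fun s => ⟨δ s, hδ s, he s⟩⟩

/-- Rickard complexes with arbitrary exponents are shifts of those with `α = 0` or `β = 0`. -/
lemma exists_isRickard (α β κ : ℤ) {x v : ℤ} (hr : 0 ≤ β - α - x) (hv : v = x + 2 * (α - β)) :
    ∃ C : CochainComplex ((S.wt x).as ⟶ (S.wt v).as) ℤ, S.IsRickard C α β κ := by
  obtain ⟨a, b, q, hab, ha, hb⟩ : ∃ (a b : ℕ) (q : ℤ), (a = 0 ∨ b = 0) ∧ (a : ℤ) = α + q ∧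
      (b : ℤ) = β + q :=
    ⟨(α - min α β).toNat, (β - min α β).toNat, -min α β, by omega, by omega, by omega⟩
  obtain ⟨C, hC⟩ := S.exists_isRickard_nat a b hab (x := x) (v := v) (by omega) (by omega)
  have := hC.bishift (κ - q * (β - α - x + 1)) q
  rw [ha, hb, add_sub_cancel_right, add_sub_cancel_right] at this
  rw [show 0 + (κ - q * (β - α - x + 1)) + q * (β + q - (α + q) - x + 1) = κ by ring] at this
  exact ⟨_, this⟩

end Sl2Data

lemma PB.whisker_homEquiv₁ {B : Type u} [Bicategory.{w, v} B] {p q r m : B} {X' : p ⟶ q}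
    {X : p ⟶ m} {x : m ⟶ q} {Y' : q ⟶ r} {y : q ⟶ m} {Y : m ⟶ r} (adj : y ⊣ x)
    (ι₁ : X' ⟶ X ≫ x) (ι₂ : Y' ⟶ y ≫ Y) :
    ι₁ ▷ Y' ≫ (α_ _ _ _).hom ≫ X ◁ adj.homEquiv₁ ι₂ =
      (ι₁ ▷ Y' ≫ (X ≫ x) ◁ ι₂) ≫ ((α_ X x (y ≫ Y)).hom ≫ X ◁ (α_ x y Y).inv) ≫
        X ◁ adj.counit ▷ Y ≫ X ◁ (λ_ Y).hom := by
  simp [Bicategory.Adjunction.homEquiv₁]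

namespace CategoricalSl2Rep

open PB Bicategory ShiftedHom

variable {B : Type u} [Bicategory.{w, v} B] [GradedLinearBicategory B] (R : CategoricalSl2Rep B)

/-- The class of the explicit differential is expressed by the adjunction of `E` and `F`. -/
lemma pcl_splitAndContract {p q r m : B} {X' : p ⟶ q} {X : p ⟶ m} {x : m ⟶ q}
    {Y' : q ⟶ r} {y : q ⟶ m} {Y : m ⟶ r} {i j k n : ℤ}
    (ι₁ : ShiftedHom X' (X ≫ x) i) (ι₂ : ShiftedHom Y' (y ≫ Y) j)
    (κ : ShiftedHom (x ≫ y) (𝟙 m) k) (h : k + (j + i) = n) (adj : toPB y ⊣ toPB x)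
    (hκ : adj.counit = pcl κ) :
    (pcl (splitAndContract ι₁ ι₂ κ h) : toPB X' ≫ toPB Y' ⟶ toPB X ≫ toPB Y) =
      (pcl ι₁ : toPB X' ⟶ toPB X ≫ toPB x) ▷ toPB Y' ≫ (α_ _ _ _).hom ≫
        toPB X ◁ adj.homEquiv₁ (pcl ι₂ : toPB Y' ⟶ toPB y ≫ toPB Y) := by
  have h₁ : pcl (splitAndContract ι₁ ι₂ κ h) = (pcl (gradedWhiskerRight ι₁ Y') ≫
      pcl (gradedWhiskerLeft (X ≫ x) ι₂)) ≫ (pcl₀ (α_ X x (y ≫ Y)).hom ≫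
        pcl₀ (X ◁ (α_ x y Y).inv)) ≫ pcl (gradedWhiskerLeft X (gradedWhiskerRight κ Y)) ≫
          pcl₀ (X ◁ (λ_ Y).hom) := by
    rw [splitAndContract, pcl_comp, pcl_comp, pcl₀_comp_pcl, pcl_comp_pcl₀, pcl₀_comp]
  rw [pcl₀_whiskerLeft, pcl₀_whiskerLeft] at h₁
  have h₂ := whisker_homEquiv₁ adj (X := toPB X) (X' := toPB X') (Y := toPB Y) (Y' := toPB Y')
    (pcl ι₁) (pcl ι₂)
  rw [hκ] at h₂
  exact h₁.trans h₂.symm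

end CategoricalSl2Rep

/-! ### The Rickard complexes of a categorical 2-representation -/

namespace CategoricalSl2Rep

open PB Bicategory ShiftedHom
open ProjObj (exists_rep)

variable {B : Type u} [Bicategory.{w, v} B] [GradedLinearBicategory B]
  {R : CategoricalSl2Rep B}

lemma isNull_of_isLowestInclusion {a b : B} {m : ℕ} {X Y : a ⟶ b} {ι : ShiftedHom X Y (-(m : ℤ))}
    (h : IsLowestInclusion m ι) (h₀ : IsNull (pcl ι : toPB X ⟶ toPB Y)) :
    IsNull (𝟙 (toPB X)) := by
  obtain ⟨D, hD⟩ := h.exists_decomp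
  have : (D.j 0 : toPB X ⟶ toPB Y) ≫ D.p 0 = 𝟙 _ := decomp_j_p_self D 0
  rw [← this]
  rw [← hD] at h₀
  exact h₀.comp _

lemma IsEFDifferential.isDifferential {a b : ℕ} {x y : ℤ}
    {hy : y = x + 2 * (a : ℤ) - 2 * (b : ℤ)}
    {hy' : y = x + 2 * ((a + 1 : ℕ) : ℤ) - 2 * ((b + 1 : ℕ) : ℤ)}
    {c : ℤ} {hc : c = 1 - (a : ℤ) + (b : ℤ) - x}
    {δ : ShiftedHom (R.EF (a + 1) (b + 1) hy') (R.EF a b hy) c}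
    (h : R.IsEFDifferential a b hy hy' hc δ) :
    R.toSl2Data.IsDifferential a b (x := x) (y := y) (z := x - 2 * (b : ℤ))
      (z' := x - 2 * ((b + 1 : ℕ) : ℤ)) (by omega) (by omega) (by omega) (by omega) (pcl δ) := by
  obtain ⟨ιF, ιE, adj, hF, hE, rfl⟩ := h
  exact (Sl2Data.isDifferential_of_adjunction (S := R.toSl2Data) (by push_cast; omega)
    (ι := (pcl ιF : toPB (R.F (b + 1) _) ⟶ toPB (_ ≫ _))) rfl (isNull_of_isLowestInclusion hF)
    (ι' := (pcl ιE : toPB (R.E (a + 1) _) ⟶ toPB (_ ≫ _))) rfl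
    (isNull_of_isLowestInclusion hE) (Adjunction.ofRightShift adj)
    ((Adjunction.deg_unit_ofRightShift adj).trans (by push_cast; ring))
    (pcl_splitAndContract ιF ιE _ _ _ (pcl_counitOfRightShift adj).symm)).1

lemma isDifferential_chev {a b : ℕ} {x y z z' : ℤ}
    {h₁ : -z' = -x + 2 * ((a + 1 : ℕ) : ℤ)} {h₂ : -z' = -y + 2 * ((b + 1 : ℕ) : ℤ)}
    {h₃ : -z = -x + 2 * (a : ℤ)} {h₄ : -z = -y + 2 * (b : ℤ)} {h₅ : -z' = -z + 2 * ((1 : ℕ) : ℤ)}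
    {c : ℤ} {ιE : ShiftedHom (R.E (a + 1) h₁) (R.E a h₃ ≫ R.E 1 h₅) (-(a : ℤ))}
    {ιF : ShiftedHom (R.F (b + 1) h₂) (R.F 1 h₅ ≫ R.F b h₄) (-(b : ℤ))}
    (adj : (R.F 1 h₅)⟦-(((1 : ℕ) : ℤ) * (-z + ((1 : ℕ) : ℤ)))⟧ ⊣ R.E 1 h₅)
    (hE : IsLowestInclusion a ιE) (hF : IsLowestInclusion b ιF)
    (hc : -(-(((1 : ℕ) : ℤ) * (-z + ((1 : ℕ) : ℤ)))) + (-(b : ℤ) + -(a : ℤ)) = c) :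
    R.toSl2Data.chev.IsDifferential b a (x := x) (y := y) (z := z) (z' := z') (by omega) (by omega)
      (by omega) (by omega) (pcl (splitAndContract ιE ιF (counitOfLeftShift adj) hc)) :=
  (Sl2Data.isDifferential_of_adjunction (S := R.toSl2Data.chev) (x := x) (y := y) (z := z)
    (z' := z') (by push_cast at *; omega)
    (ι := (pcl ιE : toPB (R.E (a + 1) _) ⟶ toPB (_ ≫ _))) rfl (isNull_of_isLowestInclusion hE)
    (ι' := (pcl ιF : toPB (R.F (b + 1) _) ⟶ toPB (_ ≫ _))) rfl
    (isNull_of_isLowestInclusion hF) (Adjunction.ofLeftShift adj)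
    ((Adjunction.deg_unit_ofLeftShift adj).trans (by push_cast at *; omega))
    (pcl_splitAndContract ιE ιF _ _ _ (pcl_counitOfLeftShift adj).symm)).1

lemma IsEFComplex.isRickard {a b : ℕ} (hab : a = 0 ∨ b = 0) {c x y : ℤ}
    {hy : y = x + 2 * (a : ℤ) - 2 * (b : ℤ)} {hc : c = 1 - (a : ℤ) + (b : ℤ) - x}
    {C : CochainComplex (R.wt x ⟶ R.wt y) ℤ} (h : R.IsEFComplex a b c hy hc C) :
    R.toSl2Data.IsRickard (x := x) (v := y) C a b 0 := by
  obtain ⟨h₀, e, he⟩ := h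
  refine Sl2Data.isRickard_of_nat (S := R.toSl2Data) a b hab (fun s => x - 2 * ((b + s : ℕ) : ℤ))
    (fun s => by omega) (fun s => by push_cast; omega) hc h₀ e fun s => ?_
  obtain ⟨δ, hδ, hd⟩ := he s
  exact ⟨δ, hδ.isDifferential, hd⟩

lemma IsFEComplex.isRickard_chev {a b : ℕ} (hab : a = 0 ∨ b = 0) {c x y : ℤ}
    {hy : -y = -x + 2 * (a : ℤ) - 2 * (b : ℤ)} {hc : c = 1 + (a : ℤ) - (b : ℤ) + -x}
    {C : CochainComplex (R.wt (-x) ⟶ R.wt (-y)) ℤ} (h : R.IsFEComplex a b c hy hc C) :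
    R.toSl2Data.chev.IsRickard (x := x) (v := y) C b a 0 := by
  -- the intermediate weights become variables, since they have to be rewritten as negatives
  have key (w : ℕ → ℤ) (hw : ∀ s, w s = -x + 2 * ((a + s : ℕ) : ℤ)) :
      ∃ e : ∀ s : ℕ, C.X (-(s : ℤ)) ≅
        (R.E (a + s) (hw s) ≫ R.F (b + s) (l := -y) (m := w s)
          (by have := hw s; push_cast at *; omega))⟦-((s : ℤ) * c)⟧,
      ∀ s : ℕ, ∃ (ιE : ShiftedHom (R.E (a + s + 1) (hw (s + 1))) (R.E (a + s) (hw s) ≫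
          R.E 1 (l := w s) (m := w (s + 1)) (by simp only [hw]; push_cast; ring)) (-((a + s : ℕ) : ℤ)))
        (ιF : ShiftedHom (R.F (b + s + 1) (l := -y) (m := w (s + 1))
          (by have := hw (s + 1); push_cast at *; omega)) (R.F 1 (l := w s) (m := w (s + 1))
            (by simp only [hw]; push_cast; ring) ≫ R.F (b + s) (l := -y) (m := w s)
              (by have := hw s; push_cast at *; omega)) (-((b + s : ℕ) : ℤ)))
        (adj : (R.F 1 (l := w s) (m := w (s + 1)) (by simp only [hw]; push_cast; ring))⟦
          -(((1 : ℕ) : ℤ) * (w s + ((1 : ℕ) : ℤ)))⟧ ⊣ R.E 1 (by simp only [hw]; push_cast; ring)),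
        IsLowestInclusion (a + s) ιE ∧ IsLowestInclusion (b + s) ιF ∧
        C.d (-((s + 1 : ℕ) : ℤ)) (-(s : ℤ)) ≫ (e s).hom = (e (s + 1)).hom ≫
          shiftedMap (splitAndContract ιE ιF (counitOfLeftShift adj)
            (n := c) (by simp only [hw]; push_cast; omega)) (-(((s + 1 : ℕ) : ℤ) * c))
              (-((s : ℤ) * c)) (by push_cast; ring) := by
    obtain rfl := funext hw
    obtain ⟨e, he⟩ := h.2
    refine ⟨e, fun s => ?_⟩
    obtain ⟨δ, ⟨ιE, ιF, adj, hE, hF, rfl⟩, hd⟩ := he s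
    exact ⟨ιE, ιF, adj, hE, hF, hd⟩
  let z (s : ℕ) : ℤ := x - 2 * ((a + s : ℕ) : ℤ)
  have hz (s : ℕ) : -z s = -x + 2 * ((a + s : ℕ) : ℤ) := by simp only [z]; ring
  obtain ⟨e, he⟩ := key (fun s => -z s) hz
  refine Sl2Data.isRickard_of_nat (S := R.toSl2Data.chev) b a hab.symm z (fun s => by simp [z])
    (fun s => by simp only [z]; push_cast; omega) (by omega) h.1 e fun s => ?_
  obtain ⟨ιE, ιF, adj, hE, hF, hd⟩ := he s
  exact ⟨_, isDifferential_chev adj hE hF _, hd⟩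

end CategoricalSl2Rep

/-! ### Homotopy equivalences of shifted complexes -/

section

variable {B : Type u} [Bicategory.{w, v} B] [GradedLinearBicategory B]

lemma HtpyIso.of_isIso {a b : B} {K L : CochainComplex (a ⟶ b) ℤ} (g : K ⟶ L)
    [IsIso ((HomotopyCategory.quotient _ _).map g)] : HtpyIso K L :=
  ⟨HomotopyCategory.homotopyEquivOfIso (asIso ((HomotopyCategory.quotient _ _).map g))⟩

lemma HtpyIso.symm {a b : B} {K L : CochainComplex (a ⟶ b) ℤ} (h : HtpyIso K L) : HtpyIso L K :=
  h.map HomotopyEquiv.symm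

lemma HtpyIso.trans {a b : B} {K L M : CochainComplex (a ⟶ b) ℤ} (h : HtpyIso K L)
    (h' : HtpyIso L M) : HtpyIso K M := by
  obtain ⟨h⟩ := h
  exact h'.map h.trans

lemma HtpyIso.bishift {a b : B} {K L : CochainComplex (a ⟶ b) ℤ} (h : HtpyIso K L) (k p : ℤ) :
    HtpyIso (bishift K k p) (bishift L k p) := by
  obtain ⟨h⟩ := h
  exact ⟨HomotopyCategory.homotopyEquivOfIso <|
    ((HomotopyCategory.quotient _ _).commShiftIso p).app _ ≪≫
      (shiftFunctor _ p).mapIso (HomotopyCategory.isoOfHomotopyEquiv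
        ((shiftFunctor (a ⟶ b) k).mapHomotopyEquiv h)) ≪≫
          (((HomotopyCategory.quotient _ _).commShiftIso p).app _).symm⟩

namespace Sl2Data

variable {S : Sl2Data B} {x y v α β κ : ℤ}

lemma IsRickard.htpyIso_compBefore (X : S.Dot) (hx : x = β - α) (hv : v = x + 2 * (α - β))
    {p : ℕ} (h : x = y + 2 * (p : ℤ)) {C : CochainComplex ((S.wt x).as ⟶ (S.wt v).as) ℤ}
    (hC : S.IsRickard C α β κ) {D : CochainComplex ((S.wt y).as ⟶ (S.wt v).as) ℤ}
    (hD : S.IsRickard D α (β - p) (κ - α * p)) : HtpyIso (compBefore C (S.E p h).obj) D := by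
  obtain ⟨g, hg⟩ := hC.exists_isIso_E_pow X hv hx p (fun q _ y' hy' => by
    obtain ⟨D', hD'⟩ := S.exists_isRickard α (β - q) 0 (x := y') (v := v) (by omega) (by omega)
    exact ⟨D', 0, hD'⟩) h hD
  exact HtpyIso.of_isIso g

lemma IsRickard.htpyIso_compAfter (X : S.Dot) (hx : x = β - α) (hv : v = x + 2 * (α - β))
    {p : ℕ} (h : v = y + 2 * (p : ℤ)) {C : CochainComplex ((S.wt x).as ⟶ (S.wt v).as) ℤ}
    (hC : S.IsRickard C α β κ) {D : CochainComplex ((S.wt x).as ⟶ (S.wt y).as) ℤ}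
    (hD : S.IsRickard D (α - p) β (κ - β * p)) : HtpyIso (compAfter (S.F p h).obj C) D :=
  IsRickard.htpyIso_compBefore (S := S.rev) X.rev (x := v) (v := x) (by omega) (by omega) h
    (hC.rev hv) (hD.rev (by omega))

end Sl2Data

namespace CategoricalSl2Rep

open ShiftedHom Bicategory PB
open ProjObj (exists_rep)

variable (R : CategoricalSl2Rep B) {x y v α β κ : ℤ}

/-- `C` has terms `E^(α-i) F^(β-i)` up to shifts, see `Sl2Data.IsRickard`. -/
def IsEFRickard (C : CochainComplex (R.wt x ⟶ R.wt v) ℤ) (α β κ : ℤ) : Prop :=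
  R.toSl2Data.IsRickard (x := x) (v := v) C α β κ

/-- `C` has terms `F^(α-i) E^(β-i)` up to shifts. This is `Sl2Data.IsRickard` for the action which
exchanges `E` and `F`, whose weights are the negatives of the original ones; the weights of `C` are
identified with such negatives. -/
def IsFERickard (C : CochainComplex (R.wt x ⟶ R.wt v) ℤ) (α β κ : ℤ) : Prop :=
  ∀ (x' v' : ℤ) (hx : x = -x') (hv : v = -v'), by
    subst hx hv
    exact R.toSl2Data.chev.IsRickard (x := x') (v := v') C α β κ

variable {R}

lemma isFERickard_neg_iff {C : CochainComplex (R.wt (-x) ⟶ R.wt (-v)) ℤ} :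
    R.IsFERickard C α β κ ↔ R.toSl2Data.chev.IsRickard (x := x) (v := v) C α β κ := by
  refine ⟨fun h => h x v rfl rfl, fun h x' v' hx hv => ?_⟩
  obtain rfl : x = x' := by omega
  obtain rfl : v = v' := by omega
  exact h

lemma isFERickard_iff {C : CochainComplex (R.wt x ⟶ R.wt v) ℤ} (hx : x = α - β)
    (hv : v = x + 2 * (β - α)) : R.IsFERickard C α β κ ↔ R.IsEFRickard C β α κ := by
  obtain ⟨x, rfl⟩ : ∃ k, x = -k := ⟨-x, by simp⟩
  obtain ⟨v, rfl⟩ : ∃ k, v = -k := ⟨-v, by simp⟩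
  exact isFERickard_neg_iff.trans (Sl2Data.isRickard_chev_iff (by omega) (by omega))

lemma IsEFComplex.isEFRickard {a b : ℕ} (hab : a = 0 ∨ b = 0) {c : ℤ}
    {hy : y = x + 2 * (a : ℤ) - 2 * (b : ℤ)} {hc : c = 1 - (a : ℤ) + (b : ℤ) - x}
    {C : CochainComplex (R.wt x ⟶ R.wt y) ℤ} (h : R.IsEFComplex a b c hy hc C) :
    R.IsEFRickard C a b 0 := h.isRickard hab

lemma IsFEComplex.isFERickard {a b : ℕ} (hab : a = 0 ∨ b = 0) {c : ℤ}
    {hy : y = x + 2 * (a : ℤ) - 2 * (b : ℤ)} {hc : c = 1 + (a : ℤ) - (b : ℤ) + x}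
    {C : CochainComplex (R.wt x ⟶ R.wt y) ℤ} (h : R.IsFEComplex a b c hy hc C) :
    R.IsFERickard C b a 0 := by
  intro x' v' hx hv
  subst hx hv
  exact h.isRickard_chev hab

lemma IsEFRickard.bishift {C : CochainComplex (R.wt x ⟶ R.wt v) ℤ} (hC : R.IsEFRickard C α β κ)
    (k p : ℤ) : R.IsEFRickard (bishift C k p) (α - p) (β - p) (κ + k + p * (β - α - x + 1)) :=
  Sl2Data.IsRickard.bishift k p hC

lemma IsFERickard.bishift {C : CochainComplex (R.wt x ⟶ R.wt v) ℤ} (hC : R.IsFERickard C α β κ)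
    (k p : ℤ) : R.IsFERickard (bishift C k p) (α - p) (β - p) (κ + k + p * (β - α + x + 1)) := by
  obtain ⟨x, rfl⟩ : ∃ k, x = -k := ⟨-x, by simp⟩
  obtain ⟨v, rfl⟩ : ∃ k, v = -k := ⟨-v, by simp⟩
  rw [isFERickard_neg_iff] at hC ⊢
  exact Sl2Data.IsRickard.bishift k p hC

lemma IsEFRickard.htpyIso_E (hx : x = β - α) (hv : v = x + 2 * (α - β))
    {p : ℕ} (h : x = y + 2 * (p : ℤ)) {C : CochainComplex (R.wt x ⟶ R.wt v) ℤ}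
    (hC : R.IsEFRickard C α β κ) {D : CochainComplex (R.wt y ⟶ R.wt v) ℤ}
    (hD : R.IsEFRickard D α (β - p) (κ - α * p)) : HtpyIso (compBefore C (R.E p h)) D :=
  Sl2Data.IsRickard.htpyIso_compBefore R.dot hx hv h hC hD

lemma IsEFRickard.htpyIso_F (hx : x = β - α) (hv : v = x + 2 * (α - β))
    {p : ℕ} (h : v = y + 2 * (p : ℤ)) {C : CochainComplex (R.wt x ⟶ R.wt v) ℤ}
    (hC : R.IsEFRickard C α β κ) {D : CochainComplex (R.wt x ⟶ R.wt y) ℤ}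
    (hD : R.IsEFRickard D (α - p) β (κ - β * p)) : HtpyIso (compAfter (R.F p h) C) D :=
  Sl2Data.IsRickard.htpyIso_compAfter R.dot hx hv h hC hD

lemma IsFERickard.htpyIso_F (hx : x = α - β) (hv : v = x + 2 * (β - α))
    {p : ℕ} (h : y = x + 2 * (p : ℤ)) {C : CochainComplex (R.wt x ⟶ R.wt v) ℤ}
    (hC : R.IsFERickard C α β κ) {D : CochainComplex (R.wt y ⟶ R.wt v) ℤ}
    (hD : R.IsFERickard D α (β - p) (κ - α * p)) : HtpyIso (compBefore C (R.F p h)) D := by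
  obtain ⟨x, rfl⟩ : ∃ k, x = -k := ⟨-x, by simp⟩
  obtain ⟨v, rfl⟩ : ∃ k, v = -k := ⟨-v, by simp⟩
  obtain ⟨y, rfl⟩ : ∃ k, y = -k := ⟨-y, by simp⟩
  rw [isFERickard_neg_iff] at hC hD
  exact Sl2Data.IsRickard.htpyIso_compBefore R.leftDot.chev (by omega) (by omega) (by omega) hC hD

lemma IsFERickard.htpyIso_E (hx : x = α - β) (hv : v = x + 2 * (β - α))
    {p : ℕ} (h : y = v + 2 * (p : ℤ)) {C : CochainComplex (R.wt x ⟶ R.wt v) ℤ}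
    (hC : R.IsFERickard C α β κ) {D : CochainComplex (R.wt x ⟶ R.wt y) ℤ}
    (hD : R.IsFERickard D (α - p) β (κ - β * p)) : HtpyIso (compAfter (R.E p h) C) D := by
  obtain ⟨x, rfl⟩ : ∃ k, x = -k := ⟨-x, by simp⟩
  obtain ⟨v, rfl⟩ : ∃ k, v = -k := ⟨-v, by simp⟩
  obtain ⟨y, rfl⟩ : ∃ k, y = -k := ⟨-y, by simp⟩
  rw [isFERickard_neg_iff] at hC hD
  exact Sl2Data.IsRickard.htpyIso_compAfter R.leftDot.chev (by omega) (by omega) (by omega) hC hD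

variable (R) in
lemma exists_isEFRickard (α β κ : ℤ) {x v : ℤ} (hr : 0 ≤ β - α - x) (hv : v = x + 2 * (α - β)) :
    ∃ C : CochainComplex (R.wt x ⟶ R.wt v) ℤ, R.IsEFRickard C α β κ :=
  R.toSl2Data.exists_isRickard α β κ hr hv

variable (R) in
lemma exists_isFERickard (α β κ : ℤ) {x v : ℤ} (hr : 0 ≤ β - α + x) (hv : v = x + 2 * (β - α)) :
    ∃ C : CochainComplex (R.wt x ⟶ R.wt v) ℤ, R.IsFERickard C α β κ := by
  obtain ⟨x, rfl⟩ : ∃ k, x = -k := ⟨-x, by simp⟩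
  obtain ⟨v, rfl⟩ : ∃ k, v = -k := ⟨-v, by simp⟩
  obtain ⟨C, hC⟩ := R.toSl2Data.chev.exists_isRickard α β κ (x := x) (v := v) (by omega) (by omega)
  exact ⟨C, isFERickard_neg_iff.2 hC⟩

variable (R) in
lemma exists_isEFComplex (a b : ℕ) {x y : ℤ} (c : ℤ) (hy : y = x + 2 * (a : ℤ) - 2 * (b : ℤ))
    (hc : c = 1 - (a : ℤ) + (b : ℤ) - x) (hc' : 1 ≤ c) :
    ∃ C : CochainComplex (R.wt x ⟶ R.wt y) ℤ, R.IsEFComplex a b c hy hc C := by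
  have key (s : ℕ) : ∃ δ : ShiftedHom (R.EF (a + s + 1) (b + s + 1) (x := x) (y := y) (by omega))
      (R.EF (a + s) (b + s) (by omega)) c,
      R.IsEFDifferential (a + s) (b + s) (by omega) (by omega) (by omega) δ := by
    obtain ⟨φ⟩ := R.F_F_pow (b + s) (l := x - 2 * ((b + s + 1 : ℕ) : ℤ))
      (m := x - 2 * ((b + s : ℕ) : ℤ)) (k := x) (by push_cast; ring) (by omega) (by omega)
    obtain ⟨ψ⟩ := R.E_pow_E (a + s) (l := x - 2 * ((b + s + 1 : ℕ) : ℤ))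
      (m := x - 2 * ((b + s : ℕ) : ℤ)) (k := y) (by push_cast; ring) (by push_cast; omega)
      (by push_cast; omega)
    obtain ⟨adj⟩ := R.adj_right 1 (l := x - 2 * ((b + s + 1 : ℕ) : ℤ))
      (m := x - 2 * ((b + s : ℕ) : ℤ)) (by push_cast; ring)
    exact ⟨_, _, _, adj, ⟨φ, rfl⟩, ⟨ψ, rfl⟩, rfl⟩
  choose δ hδ using key
  have hN (s : ℕ) : IsNull ((pcl (δ (s + 1)) : toPB _ ⟶ toPB _) ≫ (pcl (δ s) : toPB _ ⟶ toPB _)) :=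
    R.toSl2Data.isNull_comp_FE (a := a + s) (b := b + s) (x := x) (y := y)
        (z := x - 2 * ((b + (s + 2) : ℕ) : ℤ)) (z' := x - 2 * ((b + s : ℕ) : ℤ))
        (by push_cast; ring) (by push_cast; omega) (by omega) (by omega) (by omega)
        ((deg_comp _ _).trans (by
          show c + c = _
          push_cast; omega))
  obtain ⟨C, h₀, e, he⟩ := exists_cochainComplex
    (fun s => R.EF (a + s) (b + s) (x := x) (y := y) (by omega)) c δ hN
  exact ⟨C, h₀, e, fun s => ⟨δ s, hδ s, he s⟩⟩

variable (R) in
lemma exists_isFEComplex (a b : ℕ) {x y : ℤ} (c : ℤ) (hy : y = x + 2 * (a : ℤ) - 2 * (b : ℤ))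
    (hc : c = 1 + (a : ℤ) - (b : ℤ) + x) (hc' : 1 ≤ c) :
    ∃ C : CochainComplex (R.wt x ⟶ R.wt y) ℤ, R.IsFEComplex a b c hy hc C := by
  have key (s : ℕ) : ∃ δ : ShiftedHom (R.FE (a + s + 1) (b + s + 1) (x := x) (y := y) (by omega))
      (R.FE (a + s) (b + s) (by omega)) c,
      R.IsFEDifferential (a + s) (b + s) (by omega) (by omega) (by omega) δ := by
    obtain ⟨φ⟩ := R.F_pow_F (b + s) (k := x + 2 * ((a + s + 1 : ℕ) : ℤ))
      (m := x + 2 * ((a + s : ℕ) : ℤ)) (l := y) (by push_cast; omega) (by push_cast; ring)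
      (by push_cast; omega)
    obtain ⟨ψ⟩ := R.E_E_pow (a + s) (k := x + 2 * ((a + s + 1 : ℕ) : ℤ))
      (m := x + 2 * ((a + s : ℕ) : ℤ)) (l := x) (by omega) (by push_cast; ring) (by omega)
    obtain ⟨adj⟩ := R.adj_left 1 (l := x + 2 * ((a + s : ℕ) : ℤ))
      (m := x + 2 * ((a + s + 1 : ℕ) : ℤ)) (by push_cast; ring)
    exact ⟨_, _, _, adj, ⟨ψ, rfl⟩, ⟨φ, rfl⟩, rfl⟩
  choose δ hδ using key
  have hN (s : ℕ) : IsNull ((pcl (δ (s + 1)) : toPB _ ⟶ toPB _) ≫ (pcl (δ s) : toPB _ ⟶ toPB _)) :=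
    R.toSl2Data.isNull_comp_EF (a := a + s) (b := b + s) (x := x) (y := y)
        (z := x + 2 * ((a + (s + 2) : ℕ) : ℤ)) (z' := x + 2 * ((a + s : ℕ) : ℤ))
        (by push_cast; ring) (by push_cast; omega) (by omega) (by push_cast; omega)
        (by push_cast; omega)
        ((deg_comp _ _).trans (by
          show c + c = _
          push_cast; omega))
  obtain ⟨C, h₀, e, he⟩ := exists_cochainComplex
    (fun s => R.FE (a + s) (b + s) (x := x) (y := y) (by omega)) c δ hN
  exact ⟨C, h₀, e, fun s => ⟨δ s, hδ s, he s⟩⟩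

end CategoricalSl2Rep

end

/-! ### Rickard complexes of the middle weight composed with divided powers -/

namespace CategoricalSl2Rep

variable {B : Type u} [Bicategory.{w, v} B] [GradedLinearBicategory B] {R : CategoricalSl2Rep B}
  {x y l r : ℤ} {n : ℕ} {hn : (n : ℤ) = l + r} {C : CochainComplex (R.wt x ⟶ R.wt y) ℤ}

lemma IsEFRickard.of_eq {α β κ α' β' κ' : ℤ} (h : R.IsEFRickard C α β κ) (hα : α = α' := by omega)
    (hβ : β = β' := by omega) (hκ : κ = κ' := by ring) : R.IsEFRickard C α' β' κ' := by
  rwa [← hα, ← hβ, ← hκ]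

lemma IsFERickard.of_eq {α β κ α' β' κ' : ℤ} (h : R.IsFERickard C α β κ) (hα : α = α' := by omega)
    (hβ : β = β' := by omega) (hκ : κ = κ' := by ring) : R.IsFERickard C α' β' κ' := by
  rwa [← hα, ← hβ, ← hκ]

lemma IsTau.isEFRickard {hx : x = -l - 2 * r} {hy : y = l} (h : R.IsTau l r n hn hx hy C)
    (hr : 0 ≤ r) : R.IsEFRickard C n 0 0 := by
  obtain ⟨-, h⟩ | ⟨hr', h⟩ := h
  · exact h.isEFRickard (Or.inr rfl)
  · exact (isFERickard_iff (by omega) (by omega)).1 (h.isFERickard (Or.inr rfl))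

lemma IsTau.isFERickard {hx : x = -l - 2 * r} {hy : y = l} (h : R.IsTau l r n hn hx hy C)
    (hr : r ≤ 0) : R.IsFERickard C 0 n 0 := by
  obtain ⟨hr', h⟩ | ⟨-, h⟩ := h
  · exact (isFERickard_iff (by omega) (by omega)).2 (h.isEFRickard (Or.inr rfl))
  · exact h.isFERickard (Or.inr rfl)

lemma IsTau'.isFERickard {hx : x = l + 2 * r} {hy : y = -l} (h : R.IsTau' l r n hn hx hy C)
    (hr : 0 ≤ r) : R.IsFERickard C n 0 0 := by
  obtain ⟨-, h⟩ | ⟨hr', h⟩ := h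
  · exact h.isFERickard (Or.inl rfl)
  · exact (isFERickard_iff (by omega) (by omega)).2 (h.isEFRickard (Or.inl rfl))

lemma IsTau'.isEFRickard {hx : x = l + 2 * r} {hy : y = -l} (h : R.IsTau' l r n hn hx hy C)
    (hr : r ≤ 0) : R.IsEFRickard C 0 n 0 := by
  obtain ⟨hr', h⟩ | ⟨-, h⟩ := h
  · exact (isFERickard_iff (by omega) (by omega)).1 (h.isFERickard (Or.inl rfl))
  · exact h.isEFRickard (Or.inl rfl)

lemma IsT.isEFRickard {hx : x = l} {hy : y = -l} (h : R.IsT l hx hy C) (hl : l ≤ 0) :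
    R.IsEFRickard C (-l) 0 0 := by
  obtain ⟨_, h⟩ | ⟨hl', h⟩ := h
  · exact (h.isEFRickard (Or.inr rfl)).of_eq
  · exact ((isFERickard_iff (by omega) (by omega)).1 (h.isFERickard (Or.inl rfl))).of_eq

lemma IsT.isFERickard {hx : x = l} {hy : y = -l} (h : R.IsT l hx hy C) (hl : 0 ≤ l) :
    R.IsFERickard C l 0 0 := by
  obtain ⟨hl', h⟩ | ⟨_, h⟩ := h
  · exact ((isFERickard_iff (by omega) (by omega)).2 (h.isEFRickard (Or.inr rfl))).of_eq
  · exact (h.isFERickard (Or.inl rfl)).of_eq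

end CategoricalSl2Rep

theorem proposition4p4 {B : Type u} [Bicategory.{w, v} B] [GradedLinearBicategory B]
    (R : CategoricalSl2Rep B) :
    -- the Rickard complexes exist
    (∀ (l r : ℤ) (n : ℕ) (hn : (n : ℤ) = l + r),
      (0 ≤ r → ∃ C : CochainComplex (R.wt (-l - 2 * r) ⟶ R.wt l) ℤ,
        R.IsEFComplex n 0 (r + 1) (by omega) (by omega) C) ∧
      (r ≤ 0 → ∃ C : CochainComplex (R.wt (-l - 2 * r) ⟶ R.wt l) ℤ,
        R.IsFEComplex n 0 (1 - r) (by omega) (by omega) C) ∧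
      (0 ≤ r → ∃ C : CochainComplex (R.wt (l + 2 * r) ⟶ R.wt (-l)) ℤ,
        R.IsFEComplex 0 n (r + 1) (by omega) (by omega) C) ∧
      (r ≤ 0 → ∃ C : CochainComplex (R.wt (l + 2 * r) ⟶ R.wt (-l)) ℤ,
        R.IsEFComplex 0 n (1 - r) (by omega) (by omega) C)) ∧
    -- `τ_l 1_{-l} E^(p) ≅ τ_{l+p} 1_{-l-2p} ⟨-p(l+p+1)⟩ [p]`
    (∀ (l p : ℕ) (C : CochainComplex (R.wt (-l) ⟶ R.wt l) ℤ)
      (C' : CochainComplex (R.wt (-l - 2 * p) ⟶ R.wt l) ℤ),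
      R.IsTau l 0 l (by omega) (by omega) rfl C →
      R.IsTau l p (l + p) (by omega) (by omega) rfl C' →
      HtpyIso (compBefore C (R.E p (l := -l - 2 * p) (by omega)))
        (bishift C' (-(p * (l + p + 1))) p)) ∧
    -- `τ_l 1_{-l} F^(p) ≅ τ_{l-p} 1_{-l+2p}` if `l - p ≥ 0`
    (∀ (l p : ℕ) (_ : p ≤ l) (C : CochainComplex (R.wt (-l) ⟶ R.wt l) ℤ)
      (C' : CochainComplex (R.wt (-l + 2 * p) ⟶ R.wt l) ℤ),
      R.IsTau l 0 l (by omega) (by omega) rfl C →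
      R.IsTau l (-p) (l - p) (by omega) (by omega) rfl C' →
      HtpyIso (compBefore C (R.F p (m := -l + 2 * p) (by omega))) C') ∧
    -- `E^(p) τ_l 1_{-l} ≅ τ_{l+p} 1_{-l} ⟨-p(l+p+1)⟩ [p]`
    (∀ (l p : ℕ) (C : CochainComplex (R.wt (-l) ⟶ R.wt l) ℤ)
      (C' : CochainComplex (R.wt (-l) ⟶ R.wt (l + 2 * p)) ℤ),
      R.IsTau l 0 l (by omega) (by omega) rfl C →
      R.IsTau (l + 2 * p) (-p) (l + p) (by omega) (by omega) rfl C' →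
      HtpyIso (compAfter (R.E p (m := l + 2 * p) (by omega)) C)
        (bishift C' (-(p * (l + p + 1))) p)) ∧
    -- `F^(p) τ_l 1_{-l} ≅ τ_{l-p} 1_{-l}` if `l - p ≥ 0`
    (∀ (l p : ℕ) (_ : p ≤ l) (C : CochainComplex (R.wt (-l) ⟶ R.wt l) ℤ)
      (C' : CochainComplex (R.wt (-l) ⟶ R.wt (l - 2 * p)) ℤ),
      R.IsTau l 0 l (by omega) (by omega) rfl C →
      R.IsTau (l - 2 * p) p (l - p) (by omega) (by omega) rfl C' →
      HtpyIso (compAfter (R.F p (l := l - 2 * p) (by omega)) C) C') ∧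
    -- `τ'_l 1_l E^(p) ≅ τ'_{l-p} 1_{l-2p}` if `l - p ≥ 0`
    (∀ (l p : ℕ) (_ : p ≤ l) (C : CochainComplex (R.wt l ⟶ R.wt (-l)) ℤ)
      (C' : CochainComplex (R.wt (l - 2 * p) ⟶ R.wt (-l)) ℤ),
      R.IsTau' l 0 l (by omega) (by omega) rfl C →
      R.IsTau' l (-p) (l - p) (by omega) (by omega) rfl C' →
      HtpyIso (compBefore C (R.E p (l := l - 2 * p) (by omega))) C') ∧
    -- `τ'_l 1_l F^(p) ≅ τ'_{l+p} 1_{l+2p} ⟨-p(l+p+1)⟩ [p]`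
    (∀ (l p : ℕ) (C : CochainComplex (R.wt l ⟶ R.wt (-l)) ℤ)
      (C' : CochainComplex (R.wt (l + 2 * p) ⟶ R.wt (-l)) ℤ),
      R.IsTau' l 0 l (by omega) (by omega) rfl C →
      R.IsTau' l p (l + p) (by omega) (by omega) rfl C' →
      HtpyIso (compBefore C (R.F p (m := l + 2 * p) (by omega)))
        (bishift C' (-(p * (l + p + 1))) p)) ∧
    -- `E^(p) τ'_l 1_l ≅ τ'_{l-p} 1_l` if `l - p ≥ 0`
    (∀ (l p : ℕ) (_ : p ≤ l) (C : CochainComplex (R.wt l ⟶ R.wt (-l)) ℤ)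
      (C' : CochainComplex (R.wt l ⟶ R.wt (-l + 2 * p)) ℤ),
      R.IsTau' l 0 l (by omega) (by omega) rfl C →
      R.IsTau' (l - 2 * p) p (l - p) (by omega) (by omega) (by omega) C' →
      HtpyIso (compAfter (R.E p (m := -l + 2 * p) (by omega)) C) C') ∧
    -- `F^(p) τ'_l 1_l ≅ τ'_{l+p} 1_l ⟨-p(l+p+1)⟩ [p]`
    (∀ (l p : ℕ) (C : CochainComplex (R.wt l ⟶ R.wt (-l)) ℤ)
      (C' : CochainComplex (R.wt l ⟶ R.wt (-l - 2 * p)) ℤ),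
      R.IsTau' l 0 l (by omega) (by omega) rfl C →
      R.IsTau' (l + 2 * p) (-p) (l + p) (by omega) (by omega) (by omega) C' →
      HtpyIso (compAfter (R.F p (l := -l - 2 * p) (by omega)) C)
        (bishift C' (-(p * (l + p + 1))) p)) ∧
    -- `T 1_l F^(p) ≅ 1_{-l} E^(p) T ⟨-p(l+p+1)⟩ [p]` if `l ≥ 0`
    (∀ (l : ℤ) (p : ℕ) (_ : 0 ≤ l) (C : CochainComplex (R.wt l ⟶ R.wt (-l)) ℤ)
      (C' : CochainComplex (R.wt (l + 2 * p) ⟶ R.wt (-l - 2 * p)) ℤ),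
      R.IsT l rfl rfl C → R.IsT (l + 2 * p) rfl (by omega) C' →
      HtpyIso (compBefore C (R.F p (m := l + 2 * p) (by omega)))
        (bishift (compAfter (R.E p (m := -l) (by omega)) C') (-(p * (l + p + 1))) p)) ∧
    -- `T 1_l E^(p) ≅ 1_{-l} F^(p) T ⟨-p(-l+p+1)⟩ [p]` if `l ≤ 0`
    (∀ (l : ℤ) (p : ℕ) (_ : l ≤ 0) (C : CochainComplex (R.wt l ⟶ R.wt (-l)) ℤ)
      (C' : CochainComplex (R.wt (l - 2 * p) ⟶ R.wt (-l + 2 * p)) ℤ),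
      R.IsT l rfl rfl C → R.IsT (l - 2 * p) rfl (by omega) C' →
      HtpyIso (compBefore C (R.E p (l := l - 2 * p) (by omega)))
        (bishift (compAfter (R.F p (l := -l) (by omega)) C') (-(p * (-l + p + 1))) p)) ∧
    -- `T 1_l E^(l) ≅ 1_{-l} F^(l) T` if `l ≥ 0`
    (∀ (l : ℕ) (C : CochainComplex (R.wt l ⟶ R.wt (-l)) ℤ)
      (C' : CochainComplex (R.wt (-l) ⟶ R.wt l) ℤ),
      R.IsT l rfl rfl C → R.IsT (-l) rfl (by omega) C' →
      HtpyIso (compBefore C (R.E l (l := -l) (by omega)))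
        (compAfter (R.F l (l := -l) (by omega)) C')) ∧
    -- `T 1_{-l} F^(l) ≅ 1_l E^(l) T` if `-l ≤ 0`
    (∀ (l : ℕ) (C : CochainComplex (R.wt (-l) ⟶ R.wt l) ℤ)
      (C' : CochainComplex (R.wt l ⟶ R.wt (-l)) ℤ),
      R.IsT (-l) rfl (by omega) C → R.IsT l rfl rfl C' →
      HtpyIso (compBefore C (R.F l (l := -l) (by omega)))
        (compAfter (R.E l (l := -l) (by omega)) C')) := by
  refine ⟨fun l r n hn => ⟨fun hr => R.exists_isEFComplex _ _ _ _ _ (by omega),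
    fun hr => R.exists_isFEComplex _ _ _ _ _ (by omega),
    fun hr => R.exists_isFEComplex _ _ _ _ _ (by omega),
    fun hr => R.exists_isEFComplex _ _ _ _ _ (by omega)⟩, ?_, ?_, ?_, ?_, ?_, ?_, ?_, ?_, ?_, ?_,
    ?_, ?_⟩
  · intro l p C C' hC hC'
    exact (hC.isEFRickard le_rfl).htpyIso_E (by omega) (by omega) _
      (((hC'.isEFRickard (by omega)).bishift _ p).of_eq (hκ := by push_cast; ring))
  · intro l p hp C C' hC hC'
    exact (hC.isFERickard le_rfl).htpyIso_F (by omega) (by omega) _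
      (hC'.isFERickard (by omega)).of_eq
  · intro l p C C' hC hC'
    exact (hC.isFERickard le_rfl).htpyIso_E (by omega) (by omega) _
      (((hC'.isFERickard (by omega)).bishift _ p).of_eq (hκ := by push_cast; ring))
  · intro l p hp C C' hC hC'
    exact (hC.isEFRickard le_rfl).htpyIso_F (by omega) (by omega) _
      (hC'.isEFRickard (by omega)).of_eq
  · intro l p hp C C' hC hC'
    exact (hC.isEFRickard le_rfl).htpyIso_E (by omega) (by omega) _
      (hC'.isEFRickard (by omega)).of_eq
  · intro l p C C' hC hC'
    exact (hC.isFERickard le_rfl).htpyIso_F (by omega) (by omega) _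
      (((hC'.isFERickard (by omega)).bishift _ p).of_eq (hκ := by push_cast; ring))
  · intro l p hp C C' hC hC'
    exact (hC.isFERickard le_rfl).htpyIso_E (by omega) (by omega) _
      (hC'.isFERickard (by omega)).of_eq
  · intro l p C C' hC hC'
    exact (hC.isEFRickard le_rfl).htpyIso_F (by omega) (by omega) _
      (((hC'.isEFRickard (by omega)).bishift _ p).of_eq (hκ := by push_cast; ring))
  · intro l p hl C C' hC hC'
    obtain ⟨D, hD⟩ := R.exists_isFERickard (l + p) 0 0 (x := l + 2 * p) (v := -l) (by omega)
      (by omega)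
    have h := (hC'.isFERickard (by omega)).htpyIso_E (by omega) (by omega) (by omega)
      (hD.of_eq (α' := l + 2 * p - p) (κ' := 0 - 0 * p))
    exact ((hC.isFERickard hl).htpyIso_F (by omega) (by omega) _
      ((hD.bishift _ p).of_eq)).trans (h.symm.bishift _ _)
  · intro l p hl C C' hC hC'
    obtain ⟨D, hD⟩ := R.exists_isEFRickard (-l + p) 0 0 (x := l - 2 * p) (v := -l) (by omega)
      (by omega)
    have h := (hC'.isEFRickard (by omega)).htpyIso_F (by omega) (by omega) (by omega)
      (hD.of_eq (α' := -(l - 2 * p) - p) (κ' := 0 - 0 * p))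
    exact ((hC.isEFRickard hl).htpyIso_E (by omega) (by omega) _
      ((hD.bishift _ p).of_eq)).trans (h.symm.bishift _ _)
  · intro l C C' hC hC'
    obtain ⟨D, hD⟩ := R.exists_isEFRickard 0 0 0 (x := -l) (v := -l) (by omega) (by omega)
    have h := (CategoricalSl2Rep.isFERickard_iff (by omega) (by omega)).1 (hC.isFERickard (by omega))
    exact (h.htpyIso_E (by omega) (by omega) _ hD.of_eq).trans
      ((hC'.isEFRickard (by omega)).htpyIso_F (by omega) (by omega) _ hD.of_eq).symm
  · intro l C C' hC hC'
    obtain ⟨D, hD⟩ := R.exists_isFERickard 0 0 0 (x := l) (v := l) (by omega) (by omega)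
    have h := (CategoricalSl2Rep.isFERickard_iff (by omega) (by omega)).2 (hC.isEFRickard (by omega))
    exact (h.htpyIso_F (by omega) (by omega) _ hD.of_eq).trans
      ((hC'.isFERickard (by omega)).htpyIso_E (by omega) (by omega) _ hD.of_eq).symm
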